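/- **Setting.** Let $n\ge 2$. Let $\mathcal K\subset\{|x|<R\}\subset\mathbb R^n$ be a compact set (possibly empty) with smooth boundary, $\Omega=\mathbb R^n\setminus\mathcal K$, and let $\mathrm g$ be a smooth time-independent Riemannian metric on $\overline\Omega$ with $\mathrm g_{jk}=\delta_{jk}$ for $|x|\ge R$; write $dV=\sqrt{\det \mathrm g}\,dx$ and $L^2(\Omega)=L^2(\Omega,dV)$. Let $B$ be the Dirichlet or the Neumann boundary condition, and let $H^1_B(\Omega)$ be $H^1_0(\Omega)$ or $H^1(\Omega)$, respectively. For an interval $I\ni 0$ and $F\in L^1_{loc}(I;L^2(\Omega))$ a solution of $$(\partial_t^2-\Delta_{\mathrm g})u=F \ \text{ in } I\times\Omega,\qquad u(0)=f,\quad \partial_tu(0)=g,\qquad Bu=0 \ \text{ on } I\times\partial\Omega \tag{1}$$ means a finite energy weak solution, $u\in C(I;H^1_B(\Omega))\cap C^1(I;L^2(\Omega))$. *Hypothesis B*: for every $R_0>0$ there is a constant $C$ such that $$\int_0^\infty\Bigl(\|u(t)\|_{H^1(|x|<R_0)}^2+\|\partial_tu(t)\|^2_{L^2(|x|<R_0)}\Bigr)dt\le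 C\Bigl(\|f\|_{H^1}^2+\|g\|_{L^2}^2+\int_0^\infty\|F(s)\|_{L^2}^2\,ds\Bigr)$$ for all solutions $u$ of (1) on $[0,\infty)$ for which $f,g,F$ vanish for $|x|>R_0$. *Sobolev norms.* Fix a smooth $\beta$ with $\operatorname{supp}\beta\subset\{|x|<2R\}$ and $\operatorname{supp}(1-\beta)\subset\{|x|>R\}$, and let $\Omega'$ be the torus $(\mathbb R/4R\mathbb Z)^n$ with $\mathcal K$ removed. For $|s|<n/2$ let $$\|f\|_{\dot H^s_B(\Omega)}=\|\beta f\|_{H^s_B(\Omega')}+\|(1-\beta)f\|_{\dot H^s(\mathbb R^n)},$$ where $H^s_B(\Omega')$ is defined by the spectral decomposition of $-\Delta_{\mathrm g}$ on $\Omega'$ with boundary condition $B$, i.e. $\|h\|^2_{H^s_B(\Omega')}=\sum_\lambda(1+\lambda)^s\|P_\lambda h\|^2_{L^2}$ over the eigenvalues $\lambda$ of $-\Delta_{\mathrm g}$, with $P_\lambda$ the orthogonal projections onto the eigenspaces. *Spaces.* $X$ stands for a pair of normed function spaces $X(\mathbb R^n)$, $X(\Omega)$. The dual norms are $\|v\|_{X'}=\sup\{|\int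 u\bar v| : u\in L^2,\ \|u\|_X\le1\}$ for $v\in L^2$, and it is assumed that $\|u\|_X=\sup\{|\int u\bar v| : v\in L^2,\ \|v\|_{X'}\le 1\}$ for $u\in L^2$; the integrals are taken with respect to $dx$ on $\mathbb R^n$ and $dV$ on $\Omega$. The spaces are localizable, $\|f\|_X\approx\|\chi f\|_X+\|(1-\chi)f\|_X$ for $\chi\in C_0^\infty(\mathbb R^n)$, where $\chi=1$ near $\mathcal K$ in case of $X(\Omega)$, and $\|(1-\chi)f\|_{X(\Omega)}\approx\|(1-\chi)f\|_{X(\mathbb R^n)}$ for such $\chi$ with $\chi=1$ near $\mathcal K$ (implied constants may depend on $\chi$, not on $f$). Put $\|u\|_{L^q_tX(I\times\Omega)}=\bigl\|\,\|u(t)\|_{X(\Omega)}\bigr\|_{L^q(I)}$, and similarly with $\mathbb R^n$ in place of $\Omega$ and with $X'$ in place of $X$. For $2\le q\le\infty$, $(X,\gamma,q)$ is an *admissible triple* if, with constants independent of the solution, $$\|v\|_{L^q_tX(\mathbb R\times\mathbb R^n)}\lesssim\|v(0)\|_{\dot H^\gamma(\mathbb R^n)}+\|\partial_tv(0)\|_{\dot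 H^{\gamma-1}(\mathbb R^n)}$$ for all finite energy solutions of $(\partial_t^2-\Delta)v=0$ on $\mathbb R\times\mathbb R^n$, and $$\|u\|_{L^q_tX([0,1]\times\Omega)}\lesssim\|f\|_{\dot H^\gamma_B(\Omega)}+\|g\|_{\dot H^{\gamma-1}_B(\Omega)}$$ for all solutions of (1) on $[0,1]$ with $F=0$. The *global estimate* holds for $(X,\gamma,q)$ if $$\|u\|_{L^q_tX(\mathbb R\times\Omega)}\lesssim\|f\|_{\dot H^\gamma_B(\Omega)}+\|g\|_{\dot H^{\gamma-1}_B(\Omega)} \tag{1.13}$$ for all solutions of (1) on $\mathbb R$ with $F=0$. **Corollary 1.4.** Assume Hypothesis B. Let $0\le\gamma\le1$ with $\gamma<n/2$ and $1-\gamma<n/2$ (so $0<\gamma<1$ if $n=2$), let $(X,\gamma,q)$ and $(Y,1-\gamma,r)$ be admissible triples for both of which the global estimate (1.13) holds, let $r'$ be the exponent conjugate to $r$, and suppose that $q>r'$ (that is, $q$ and $r$ are not both equal to $2$). Then there is a constant $C$ such that for every $F\in L^1_{loc}([0,\infty);L^2(\Omega))$ and every solution $u$ of (1) on $[0,\infty)$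 $$\|u\|_{L^q_tX([0,\infty)\times\Omega)}\le C\Bigl(\|f\|_{\dot H^\gamma_B(\Omega)}+\|g\|_{\dot H^{\gamma-1}_B(\Omega)}+\|F\|_{L^{r'}_tY'([0,\infty)\times\Omega)}\Bigr).$$ -/

import Mathlib

open MeasureTheory Set Filter Topology
open scoped ENNReal NNReal ContDiff FourierTransform ComplexConjugate

noncomputable section

namespace AbstractStrichartz

abbrev Eu (n : ℕ) := EuclideanSpace ℝ (Fin n)

/-- Complex gradients. -/
abbrev CVec (n : ℕ) := EuclideanSpace ℂ (Fin n)

/-- The boundary operator: the identity (Dirichlet) or the normal derivative (Neumann). -/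
inductive BC
  | dirichlet
  | neumann

/-- The geometric setting: `Ω` is the complement of the compact obstacle `K ⊆ {|x| < R}`
(possibly empty) with smooth boundary, and `g` is a smooth Riemannian metric, Euclidean for
`|x| ≥ R`.  Only the values of `g` on the closure of `Ω` matter; a smooth metric there
extends to a smooth metric on the whole space. -/
structure Exterior (n : ℕ) where
  K : Set (Eu n)
  g : Eu n → Matrix (Fin n) (Fin n) ℝ
  R : ℝ
  R_pos : 0 < R
  isCompact_K : IsCompact K
  K_subset : K ⊆ Metric.ball 0 R
  smooth_boundary : ∀ p ∈ frontier K, ∃ ρ : Eu n → ℝ, ContDiff ℝ ∞ ρ ∧ fderiv ℝ ρ p ≠ 0 ∧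
    ∀ᶠ x in 𝓝 p, (x ∈ K ↔ ρ x ≤ 0)
  smooth_g : ∀ i j, ContDiff ℝ ∞ (fun x => g x i j)
  posDef_g : ∀ x, (g x).PosDef
  g_eq_one : ∀ x, R ≤ ‖x‖ → g x = 1

/-- Minkowski space: no obstacle and the Euclidean metric. -/
def Exterior.flat (n : ℕ) : Exterior n where
  K := ∅
  g := fun _ => 1
  R := 1
  R_pos := one_pos
  isCompact_K := isCompact_empty
  K_subset := empty_subset _
  smooth_boundary := by simp
  smooth_g := fun _ _ => contDiff_const
  posDef_g := fun _ => Matrix.PosDef.one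
  g_eq_one := fun _ _ => rfl

/-- The Riemannian volume `√(det g) dx` on a set `D`. -/
def gvol {n : ℕ} (g : Eu n → Matrix (Fin n) (Fin n) ℝ) (D : Set (Eu n)) : Measure (Eu n) :=
  (volume.restrict D).withDensity fun x => ENNReal.ofReal (√(g x).det)

/-- The Euclidean gradient `(∂₁φ, …, ∂ₙφ)` of a smooth function. -/
def grad {n : ℕ} (φ : Eu n → ℂ) (x : Eu n) : CVec n :=
  WithLp.toLp 2 fun j => fderiv ℝ φ x (EuclideanSpace.single j 1)

/-- `u` belongs to the form domain of `Δ_g` on `D` with the boundary condition `B`, and `U` is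
its weak gradient; `𝒯` is the class of smooth test functions on `D`.  For Neumann this is `H¹(D)`,
defined through weak derivatives; for Dirichlet it is `H¹₀(D)`, the closure of `𝒯` in `H¹`. -/
def IsH1 {n : ℕ} (B : BC) (g : Eu n → Matrix (Fin n) (Fin n) ℝ) (D : Set (Eu n))
    (𝒯 : Set (Eu n → ℂ)) (u : Eu n → ℂ) (U : Eu n → CVec n) : Prop :=
  MemLp u 2 (gvol g D) ∧ MemLp U 2 (gvol g D) ∧
  match B with
  | .neumann => ∀ φ ∈ 𝒯, ∀ j, ∫ x in D, u x * grad φ x j = -∫ x in D, U x j * φ x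
  | .dirichlet => ∃ φ : ℕ → Eu n → ℂ, (∀ k, φ k ∈ 𝒯) ∧
      Tendsto (fun k => eLpNorm (fun x => φ k x - u x) 2 (gvol g D)) atTop (𝓝 0) ∧
      Tendsto (fun k => eLpNorm (fun x => grad (φ k) x - U x) 2 (gvol g D)) atTop (𝓝 0)

/-- The form `∫_D ⟨U, Φ⟩_g dvol = ∫_D ∑ g^{jk} U_j conj(Φ_k) √(det g) dx` of `-Δ_g`,
in terms of the gradients. -/
def form {n : ℕ} (g : Eu n → Matrix (Fin n) (Fin n) ℝ) (D : Set (Eu n))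
    (U Φ : Eu n → CVec n) : ℂ :=
  ∫ x, ∑ j, ∑ k, (((g x)⁻¹ j k : ℝ) : ℂ) * U x j * conj (Φ x k) ∂(gvol g D)

namespace Exterior

variable {n : ℕ} (M : Exterior n)

/-- The exterior domain. -/
def Ω : Set (Eu n) := M.Kᶜ

/-- The Riemannian volume on `Ω`. -/
def vol : Measure (Eu n) := gvol M.g M.Ω

/-- Test functions on `Ω`: `C_c^∞(Ω)`. -/
def testΩ : Set (Eu n → ℂ) :=
  {φ | ContDiff ℝ ∞ φ ∧ HasCompactSupport φ ∧ tsupport φ ⊆ M.Ω}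

abbrev L2 := Lp ℂ 2 M.vol

abbrev L2Vec := Lp (CVec n) 2 M.vol

/-! ### The compact manifold `Ω'`

The torus `(ℝ/4Rℤ)ⁿ` with `K` removed.  Functions on it are functions on the cube
`[-2R, 2R)ⁿ` minus `K`, and smooth functions on the torus are smooth periodic functions. -/

/-- The fundamental cube with the obstacle removed. -/
def cube : Set (Eu n) := {x | ∀ i, x i ∈ Ico (-2 * M.R) (2 * M.R)} \ M.K

/-- Test functions on `Ω'`: smooth periodic functions which vanish near `K`. -/
def testTorus : Set (Eu n → ℂ) :=
  {φ | ContDiff ℝ ∞ φ ∧ (∀ i x, φ (x + EuclideanSpace.single i (4 * M.R)) = φ x) ∧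
    Disjoint (tsupport φ) M.K}

/-- `-Δ_g e = l e` on `Ω'` with boundary condition `B`, in the weak form. -/
def IsEigenfunction (B : BC) (l : ℝ) (e : Eu n → ℂ) : Prop :=
  ∃ U, IsH1 B M.g M.cube M.testTorus e U ∧
    ∀ φ Φ, IsH1 B M.g M.cube M.testTorus φ Φ →
      form M.g M.cube U Φ = l * ∫ x, e x * conj (φ x) ∂(gvol M.g M.cube)

/-- The norm of `H^s_B(Ω')` on square integrable functions, by spectral decomposition:
`‖f‖² = ∑_l (1 + l)^s ‖P_l f‖²`, where `P_l` is the orthogonal projection onto the eigenspace of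
`-Δ_g` for the eigenvalue `l`.  Here `‖P_l f‖` is written as the supremum of `|⟨f, e⟩|` over `e` in
the closed unit ball of that eigenspace (it is `0` when `l` is no eigenvalue). -/
def sobTorus (B : BC) (s : ℝ) (f : Eu n → ℂ) : ℝ≥0∞ :=
  (∑' l : ℝ≥0, ENNReal.ofReal ((1 + (l : ℝ)) ^ s) *
    (⨆ (e : Eu n → ℂ) (_ : M.IsEigenfunction B l e ∧ eLpNorm e 2 (gvol M.g M.cube) ≤ 1),
      ‖∫ x, f x * conj (e x) ∂(gvol M.g M.cube)‖ₑ) ^ 2) ^ (1 / 2 : ℝ)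

/-- Cutoffs `β` with `β` and `1 - β` supported where `|x| < 2R` and `|x| > R`, respectively. -/
structure IsCutoff (β : Eu n → ℝ) : Prop where
  smooth : ContDiff ℝ ∞ β
  supp : tsupport β ⊆ {x | ‖x‖ < 2 * M.R}
  supp' : tsupport (fun x => 1 - β x) ⊆ {x | M.R < ‖x‖}

end Exterior

open Classical in
/-- The norm of the homogeneous Sobolev space `Ḣ^s(ℝⁿ)` on square integrable functions,
`‖f‖² = ∫ |2πξ|^{2s} |𝓕 f(ξ)|² dξ` with `𝓕 f(ξ) = ∫ e^{-2πi x·ξ} f(x) dx`. -/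
def homSob {n : ℕ} (s : ℝ) (f : Eu n → ℂ) : ℝ≥0∞ :=
  if hf : MemLp f 2 (volume : Measure (Eu n)) then
    (∫⁻ ξ, ENNReal.ofReal ((2 * Real.pi * ‖ξ‖) ^ (2 * s)) *
      ‖(𝓕 (hf.toLp f) : Lp ℂ 2 (volume : Measure (Eu n))) ξ‖ₑ ^ 2) ^ (1 / 2 : ℝ)
  else ⊤

/-- The norm of `Ḣ^s_B(Ω)`:
`‖β f‖_{H^s_B(Ω')} + ‖(1 - β) f‖_{Ḣ^s(ℝⁿ)}`. -/
def Exterior.homSobB {n : ℕ} (M : Exterior n) (B : BC) (β : Eu n → ℝ) (s : ℝ)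
    (f : Eu n → ℂ) : ℝ≥0∞ :=
  M.sobTorus B s (fun x => (β x : ℂ) * f x) + homSob s (fun x => ((1 - β x : ℝ) : ℂ) * f x)

/-- Finite energy (weak) solutions of
`(∂_t² - Δ_g) u = F` on `I × Ω`, `B u = 0` on `I × ∂Ω`, on a time interval `I` containing `0`:
`u ∈ C(I; H¹_B(Ω)) ∩ C¹(I; L²(Ω))`.  Here `ut = ∂_t u`, `gradu = ∇_x u`, and the Cauchy data are
`(u 0, ut 0)`.  The Neumann condition is the natural boundary condition of the weak form. -/
structure Solution {n : ℕ} (M : Exterior n) (B : BC) (I : Set ℝ) (F : ℝ → M.L2) where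
  u : ℝ → M.L2
  ut : ℝ → M.L2
  gradu : ℝ → M.L2Vec
  mem_H1 : ∀ t ∈ I, IsH1 B M.g M.Ω M.testΩ (u t) (gradu t)
  continuousOn_gradu : ContinuousOn gradu I
  hasDeriv : ∀ t ∈ I, HasDerivWithinAt u (ut t) I t
  continuousOn_ut : ContinuousOn ut I
  weak : ∀ φ Φ, IsH1 B M.g M.Ω M.testΩ φ Φ → ∀ t ∈ I,
    (∫ x, ut t x * conj (φ x) ∂M.vol) - ∫ x, ut 0 x * conj (φ x) ∂M.vol =
      ∫ s in (0 : ℝ)..t,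
        ((∫ x, F s x * conj (φ x) ∂M.vol) - form M.g M.Ω (gradu s) Φ)

/-- The local energy decay hypothesis (Hypothesis B). -/
def HypothesisB {n : ℕ} (M : Exterior n) (B : BC) : Prop :=
  ∀ R₀ : ℝ, 0 < R₀ → ∃ C : ℝ≥0, ∀ F : ℝ → M.L2, LocallyIntegrableOn F (Ici 0) →
    ∀ w : Solution M B (Ici 0) F,
      (∀ᵐ x ∂M.vol, R₀ < ‖x‖ → w.u 0 x = 0) →
      (∀ᵐ x ∂M.vol, R₀ < ‖x‖ → w.ut 0 x = 0) →
      (∀ᵐ t ∂(volume.restrict (Ici (0 : ℝ))), ∀ᵐ x ∂M.vol, R₀ < ‖x‖ → F t x = 0) →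
      ∫⁻ t in Ici (0 : ℝ), ∫⁻ x in M.Ω ∩ Metric.ball 0 R₀,
          (‖w.u t x‖ₑ ^ 2 + ‖w.gradu t x‖ₑ ^ 2 + ‖w.ut t x‖ₑ ^ 2) ≤
        C * ((∫⁻ x in M.Ω, (‖w.u 0 x‖ₑ ^ 2 + ‖w.gradu 0 x‖ₑ ^ 2)) +
          (∫⁻ x in M.Ω, ‖w.ut 0 x‖ₑ ^ 2) +
          ∫⁻ t in Ici (0 : ℝ), ∫⁻ x in M.Ω, ‖F t x‖ₑ ^ 2)

/-- The dual norm `‖v‖_{X'} = sup |∫ u v̄ dμ|` over `u ∈ L²` with `‖u‖_X ≤ 1`, for `v ∈ L²`. -/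
def dualNorm {n : ℕ} (μ : Measure (Eu n)) (N : (Eu n → ℂ) → ℝ≥0∞) (v : Eu n → ℂ) : ℝ≥0∞ :=
  ⨆ (u : Eu n → ℂ) (_ : MemLp u 2 μ ∧ N u ≤ 1), ‖∫ x, u x * conj (v x) ∂μ‖ₑ

/-- A normed function space with respect to the measure `μ`, given by its norm
(`∞` off the space), which is recovered from the dual norm:
`‖u‖_X = sup_{‖v‖_{X'} ≤ 1} |∫ u v̄ dμ|`. -/
structure FunSpace {n : ℕ} (μ : Measure (Eu n)) where
  N : (Eu n → ℂ) → ℝ≥0∞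
  congr_ae : ∀ f h, f =ᵐ[μ] h → N f = N h
  eq_zero_iff : ∀ f, AEStronglyMeasurable f μ → (N f = 0 ↔ f =ᵐ[μ] 0)
  add_le : ∀ f h, AEStronglyMeasurable f μ → AEStronglyMeasurable h μ →
    N (fun x => f x + h x) ≤ N f + N h
  smul_eq : ∀ (c : ℂ) f, AEStronglyMeasurable f μ → N (fun x => c * f x) = ‖c‖ₑ * N f
  dual : ∀ u, MemLp u 2 μ →
    N u = ⨆ (v : Eu n → ℂ) (_ : MemLp v 2 μ ∧ dualNorm μ N v ≤ 1), ‖∫ x, u x * conj (v x) ∂μ‖ₑ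

/-- A pair of normed function spaces `X(ℝⁿ)`, `X(Ω)`, both localizable and compatible away from
the obstacle. -/
structure SpacePair {n : ℕ} (M : Exterior n) where
  free : FunSpace (Exterior.flat n).vol
  ext : FunSpace M.vol
  loc_free : ∀ β : Eu n → ℝ, ContDiff ℝ ∞ β → HasCompactSupport β →
    ∃ C : ℝ≥0, ∀ f : Eu n → ℂ, AEStronglyMeasurable f volume →
      free.N f ≤ C * (free.N (fun x => (β x : ℂ) * f x) +
        free.N (fun x => ((1 - β x : ℝ) : ℂ) * f x)) ∧
      free.N (fun x => (β x : ℂ) * f x) + free.N (fun x => ((1 - β x : ℝ) : ℂ) * f x) ≤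
        C * free.N f
  loc_ext : ∀ β : Eu n → ℝ, ContDiff ℝ ∞ β → HasCompactSupport β → (∀ᶠ x in 𝓝ˢ M.K, β x = 1) →
    ∃ C : ℝ≥0, ∀ f : Eu n → ℂ, AEStronglyMeasurable f volume →
      ext.N f ≤ C * (ext.N (fun x => (β x : ℂ) * f x) +
        ext.N (fun x => ((1 - β x : ℝ) : ℂ) * f x)) ∧
      ext.N (fun x => (β x : ℂ) * f x) + ext.N (fun x => ((1 - β x : ℝ) : ℂ) * f x) ≤
        C * ext.N f
  compat : ∀ β : Eu n → ℝ, ContDiff ℝ ∞ β → HasCompactSupport β → (∀ᶠ x in 𝓝ˢ M.K, β x = 1) →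
    ∃ C : ℝ≥0, ∀ f : Eu n → ℂ, AEStronglyMeasurable f volume →
      ext.N (fun x => ((1 - β x : ℝ) : ℂ) * f x) ≤
        C * free.N (fun x => ((1 - β x : ℝ) : ℂ) * f x) ∧
      free.N (fun x => ((1 - β x : ℝ) : ℂ) * f x) ≤
        C * ext.N (fun x => ((1 - β x : ℝ) : ℂ) * f x)

/-- The mixed norm `‖u‖_{L^q_t X(I × Ω)}`. -/
def mixedNorm {n : ℕ} {μ : Measure (Eu n)} (N : (Eu n → ℂ) → ℝ≥0∞) (q : ℝ≥0∞) (I : Set ℝ)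
    (u : ℝ → Lp ℂ 2 μ) : ℝ≥0∞ :=
  eLpNorm (fun t => N (u t)) q (volume.restrict I)

variable {n : ℕ} {M : Exterior n}

/-- `(X, γ, q)` is an admissible triple: `q ≥ 2`, the global Strichartz estimate holds for the free
wave equation on `ℝ × ℝⁿ`, and the local one holds on `[0,1] × Ω`.  (Without a boundary the
boundary condition plays no role.) -/
structure IsAdmissible (B : BC) (β : Eu n → ℝ) (X : SpacePair M) (γ : ℝ) (q : ℝ≥0∞) : Prop where
  two_le : 2 ≤ q
  free : ∃ C : ℝ≥0, ∀ w : Solution (Exterior.flat n) B univ 0,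
    mixedNorm X.free.N q univ w.u ≤ C * (homSob γ (w.u 0) + homSob (γ - 1) (w.ut 0))
  loc : ∃ C : ℝ≥0, ∀ w : Solution M B (Icc 0 1) 0,
    mixedNorm X.ext.N q (Icc 0 1) w.u ≤
      C * (M.homSobB B β γ (w.u 0) + M.homSobB B β (γ - 1) (w.ut 0))

/-- The global abstract Strichartz estimate for homogeneous solutions on `ℝ × Ω`. -/
def GlobalStrichartz (B : BC) (β : Eu n → ℝ) (X : SpacePair M) (γ : ℝ) (q : ℝ≥0∞) : Prop :=
  ∃ C : ℝ≥0, ∀ w : Solution M B univ 0,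
    mixedNorm X.ext.N q univ w.u ≤
      C * (M.homSobB B β γ (w.u 0) + M.homSobB B β (γ - 1) (w.ut 0))

end AbstractStrichartz

end

open MeasureTheory Set Filter Topology
open scoped ENNReal NNReal ContDiff FourierTransform ComplexConjugate

/-! Let A be the self-adjoint operator defined by the Dirichlet form of the metric on `H1`, and put
C(t) = cos(t√A), S(t) = sin(t√A)/√A. A finite energy solution is u(t) = C(t)f + S(t)g + ∫₀ᵗ
S(t-s)F(s) ds (`WaveBase.duhamel`), and the global estimate for X covers the first two terms. The
point is the Duhamel term.

Forget at first that the integral stops at s = t. For a fixed measurable set E of times, S(t-s) =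
S(t)C(s) - C(t)S(s) exhibits ∫_E S(t-s)F(s) ds as the homogeneous solution with data -∫_E S(s)F(s)
ds and ∫_E C(s)F(s) ds (`WaveBase.sol_eq_setIntegral`). The global estimate for X bounds it by the
norms of order γ and γ-1 of these data. Those norms are bounded by duality
(`GlobalStrichartz.exists_homSobB_setIntegral_le`): paired with a test function h, the data become
∫_E ⟨S(s)h, F(s)⟩ ds and ∫_E ⟨C(s)h, F(s)⟩ ds, where S(s)h and C(s)h are homogeneous solutions with
data (0, h) and (h, 0). The global estimate for Y at level 1-γ and Hölder in time give the bound by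
the L^{r'}Y' norm of F over E, with a constant independent of E. Since r' < q, the Christ–Kiselev
lemma (`exists_eLpNorm_setIntegral_Iic_le`) replaces E by (-∞, t].

The analytic core is the duality between the norms of order s and -s on Ω
(`Exterior.IsCutoff.exists_homSobB_le_of_forall`). The norm is glued from a spectral norm on the
torus and a Fourier norm on ℝⁿ, so the test functions suited to one piece, namely combinations of
eigenfunctions and Schwartz functions, have to be multiplied by β or 1-β, and their full norm of
order -s must then be controlled. This comes down to boundedness of multiplication by β², β(1-β) and
(1-β)² within and between the two scales. For the cutoffs supported in the core, orders in [0, 1]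
follow by interpolating the L² and H¹ bounds (`lintegral_rpow_le_of_forall_parallel`), and negative
orders by transposition. The restriction to orders below n/2 in absolute value enters because a
homogeneous norm controls the inhomogeneous norm of a localized function only below n/2
(`exists_sobolev_schwartzMul_le`). On the torus only Bessel's inequality for eigenfunctions is used,
never completeness of the eigenfunctions.

The propagators are built from the bounded operator D = (1+A)^{-1/2}, obtained from the form by a
Riesz argument and a square root (`exists_base`). Functions of A become functions of x ∈ (0, 1], the
spectral variable of D, that need only be bounded and continuous there (`bcalc`). Unbounded
operators thereby never occur: powers of A appear as factorizations through D, and derivatives in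
time are taken on the range of D. -/

noncomputable section
namespace AbstractStrichartz

/-! ### Functional calculus for symbols that may oscillate at 0 -/

section Calculus

variable {H : Type*} [NormedAddCommGroup H] [InnerProductSpace ℂ H] [CompleteSpace H]

/-- A positive injective contraction; think of `(1 + A)^{-1/2}`. -/
structure IsBase (D : H →L[ℂ] H) : Prop where
  nonneg : 0 ≤ D
  norm_le : ‖D‖ ≤ 1
  inj : Function.Injective D

/-- A bounded continuous symbol on `(0, 1]`. -/
structure IsSymbol (φ : ℝ → ℝ) (M : ℝ) : Prop where
  cont : ContinuousOn φ (Ioc 0 1)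
  bound : ∀ x ∈ Ioc (0 : ℝ) 1, |φ x| ≤ M

theorem IsSymbol.nonneg {φ : ℝ → ℝ} {M : ℝ} (h : IsSymbol φ M) : 0 ≤ M :=
  (abs_nonneg _).trans (h.bound 1 (by simp))

theorem IsSymbol.mul {φ ψ : ℝ → ℝ} {M M' : ℝ} (h : IsSymbol φ M) (h' : IsSymbol ψ M') :
    IsSymbol (fun x => φ x * ψ x) (M * M') :=
  ⟨h.cont.mul h'.cont, fun x hx => by
    rw [abs_mul]
    exact mul_le_mul (h.bound x hx) (h'.bound x hx) (abs_nonneg _) h.nonneg⟩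

theorem IsSymbol.add {φ ψ : ℝ → ℝ} {M M' : ℝ} (h : IsSymbol φ M) (h' : IsSymbol ψ M') :
    IsSymbol (fun x => φ x + ψ x) (M + M') :=
  ⟨h.cont.add h'.cont, fun x hx => (abs_add_le _ _).trans
    (add_le_add (h.bound x hx) (h'.bound x hx))⟩

theorem IsSymbol.const_mul {φ : ℝ → ℝ} {M : ℝ} (h : IsSymbol φ M) (c : ℝ) :
    IsSymbol (fun x => c * φ x) (|c| * M) :=
  ⟨h.cont.const_mul c, fun x hx => by
    rw [abs_mul]; exact mul_le_mul_of_nonneg_left (h.bound x hx) (abs_nonneg _)⟩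

theorem IsSymbol.sub {φ ψ : ℝ → ℝ} {M M' : ℝ} (h : IsSymbol φ M) (h' : IsSymbol ψ M') :
    IsSymbol (fun x => φ x - ψ x) (M + M') :=
  ⟨h.cont.sub h'.cont, fun x hx => (abs_sub _ _).trans
    (add_le_add (h.bound x hx) (h'.bound x hx))⟩

theorem IsSymbol.id : IsSymbol (fun x => x) 1 :=
  ⟨continuousOn_id, fun x hx => by rw [abs_of_pos hx.1]; exact hx.2⟩

theorem IsSymbol.one : IsSymbol (fun _ => 1) 1 := ⟨continuousOn_const, fun x _ => by simp⟩

/-- A bounded symbol such as cos(t√(1-x²)/x) has no limit at 0, but the factor x damps the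
oscillation. This is what brings symbols within reach of the continuous functional calculus. -/
theorem IsSymbol.continuousOn_mul {φ : ℝ → ℝ} {M : ℝ} (h' : IsSymbol φ M) :
    ContinuousOn (fun x => x * φ x) (Icc 0 1) := by
  intro x hx
  rcases eq_or_lt_of_le hx.1 with h0 | h0
  · subst h0
    have h1 : Tendsto (fun x : ℝ => M * |x|) (𝓝[Icc 0 1] 0) (𝓝 0) := by
      have : ContinuousAt (fun x : ℝ => M * |x|) 0 := by fun_prop
      simpa using this.continuousWithinAt (s := Icc (0 : ℝ) 1) |>.tendsto
    have h2 : Tendsto (fun x => x * φ x) (𝓝[Icc 0 1] 0) (𝓝 0) := by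
      refine squeeze_zero_norm' ?_ h1
      filter_upwards [self_mem_nhdsWithin] with y hy
      rcases eq_or_lt_of_le hy.1 with h | h
      · simp [← h]
      · rw [norm_mul, Real.norm_eq_abs, Real.norm_eq_abs, mul_comm]
        exact mul_le_mul_of_nonneg_right (h'.bound y ⟨h, hy.2⟩) (abs_nonneg y)
    simpa [ContinuousWithinAt] using h2
  · have h3 : ContinuousWithinAt φ (Ioc 0 1) x := h'.cont x ⟨h0, hx.2⟩
    have h4 : 𝓝[Icc 0 1] x ≤ 𝓝[Ioc 0 1] x := by
      rw [← nhdsWithin_inter_of_mem (s := Ioi (0 : ℝ)) (t := Icc (0 : ℝ) 1)]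
      · exact nhdsWithin_mono _ fun y hy => ⟨hy.1, hy.2.2⟩
      · exact mem_nhdsWithin_of_mem_nhds (Ioi_mem_nhds h0)
    exact continuousWithinAt_id.mul (h3.mono_left h4)

namespace IsBase

variable {D : H →L[ℂ] H} (hD : IsBase D)
include hD

theorem isSelfAdjoint : IsSelfAdjoint D := hD.nonneg.isSelfAdjoint

theorem spectrum_subset : spectrum ℝ D ⊆ Icc 0 1 := fun x hx =>
  ⟨spectrum_nonneg_of_nonneg hD.nonneg hx, by
    have h1 := spectrum.norm_le_norm_mul_of_mem hx
    have h2 : ‖(1 : H →L[ℂ] H)‖ ≤ 1 := ContinuousLinearMap.norm_id_le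
    have : ‖x‖ ≤ 1 := h1.trans (mul_le_one₀ hD.norm_le (norm_nonneg _) h2)
    exact (le_abs_self x).trans this⟩

theorem inner_left (x y : H) : inner ℂ (D x) y = inner ℂ x (D y) := by
  conv_lhs => rw [← hD.isSelfAdjoint.adjoint_eq]
  rw [ContinuousLinearMap.adjoint_inner_left]

/-- The orthogonal complement of the range of a self-adjoint operator is its kernel, which is
trivial here. -/
theorem denseRange : DenseRange D := by
  have h : (LinearMap.range D.toLinearMap)ᗮ = ⊥ := by
    rw [Submodule.eq_bot_iff]
    intro x hx
    apply hD.inj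
    rw [map_zero, ← inner_self_eq_zero (𝕜 := ℂ), hD.inner_left]
    rw [Submodule.mem_orthogonal'] at hx
    exact hx _ ⟨D x, rfl⟩
  have h2 := (Submodule.topologicalClosure_eq_top_iff).2 h
  exact Submodule.dense_iff_topologicalClosure_eq_top.2 h2

/-- Since ‖k(D)y‖² = ⟨k²(D)y, y⟩, monotonicity of the calculus applied to f² ≤ g² compares the norms
vector by vector. An operator norm bound would not suffice to extend operators from the range of D.
-/
theorem norm_cfc_apply_le {f g : ℝ → ℝ} (hf : ContinuousOn f (Icc 0 1))
    (hg : ContinuousOn g (Icc 0 1)) (hfg : ∀ x ∈ Icc (0 : ℝ) 1, |f x| ≤ |g x|) (y : H) :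
    ‖cfc f D y‖ ≤ ‖cfc g D y‖ := by
  have hf' := hf.mono hD.spectrum_subset
  have hg' := hg.mono hD.spectrum_subset
  have key : ∀ k : ℝ → ℝ, ContinuousOn k (spectrum ℝ D) →
      (‖cfc k D y‖ ^ 2 : ℝ) = RCLike.re (inner ℂ (cfc (fun x => k x * k x) D y) y) := by
    intro k hk
    have hsa : IsSelfAdjoint (cfc k D) := cfc_predicate k D
    rw [cfc_mul k k D hk hk, mul_apply_eq_comp]
    conv_rhs => rw [← hsa.adjoint_eq, ContinuousLinearMap.adjoint_inner_left, hsa.adjoint_eq]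
    rw [inner_self_eq_norm_sq]
  have hle : cfc (fun x => f x * f x) D ≤ cfc (fun x => g x * g x) D := by
    refine cfc_mono (fun x hx => ?_) (hf'.mul hf') (hg'.mul hg')
    have := hfg x (hD.spectrum_subset hx)
    nlinarith [abs_nonneg (f x), abs_mul_abs_self (f x), abs_mul_abs_self (g x)]
  have hpos := (ContinuousLinearMap.le_def _ _).1 hle
  have h3 := hpos.re_inner_nonneg_left y
  rw [_root_.sub_apply, inner_sub_left, map_sub, ← key f hf', ← key g hg'] at h3
  exact (sq_le_sq₀ (norm_nonneg _) (norm_nonneg _)).1 (by linarith)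

end IsBase

/-- The functional calculus for bounded continuous symbols on `(0, 1]`. -/
def bcalc (D : H →L[ℂ] H) (φ : ℝ → ℝ) : H →L[ℂ] H :=
  (cfc (fun x => x * φ x) D).toLinearMap.extendOfNorm D.toLinearMap

namespace IsBase

variable {D : H →L[ℂ] H} (hD : IsBase D) {φ ψ : ℝ → ℝ} {M M' : ℝ}
include hD

theorem cfc_base : cfc (fun x : ℝ => x) D = D := cfc_id' (R := ℝ) D (ha := hD.isSelfAdjoint)

theorem norm_cfc_mul_le (hφ : IsSymbol φ M) (y : H) :
    ‖cfc (fun x => x * φ x) D y‖ ≤ M * ‖D y‖ := by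
  have h := hD.norm_cfc_apply_le (f := fun x => x * φ x) (g := fun x => M * x)
    hφ.continuousOn_mul (by fun_prop) (fun x hx => by
      rw [abs_mul, abs_mul, abs_of_nonneg hφ.nonneg, mul_comm]
      rcases eq_or_lt_of_le hx.1 with h | h
      · simp [← h]
      · exact mul_le_mul_of_nonneg_right (hφ.bound x ⟨h, hx.2⟩) (abs_nonneg _)) y
  refine h.trans_eq ?_
  rw [cfc_const_mul M (fun x => x) D (by fun_prop), hD.cfc_base, _root_.smul_apply,
    norm_smul, Real.norm_of_nonneg hφ.nonneg]

theorem bcalc_apply (hφ : IsSymbol φ M) (y : H) :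
    bcalc D φ (D y) = cfc (fun x => x * φ x) D y :=
  LinearMap.extendOfNorm_eq (f := (cfc (fun x => x * φ x) D).toLinearMap) (e := D.toLinearMap)
    hD.denseRange ⟨M, hD.norm_cfc_mul_le hφ⟩ y

theorem norm_bcalc_le (hφ : IsSymbol φ M) (y : H) : ‖bcalc D φ y‖ ≤ M * ‖y‖ :=
  LinearMap.norm_extendOfNorm_apply_le (f := (cfc (fun x => x * φ x) D).toLinearMap)
    (e := D.toLinearMap) hD.denseRange M (hD.norm_cfc_mul_le hφ) y

theorem ext_dense {T₁ T₂ : H →L[ℂ] H} (h : ∀ y, T₁ (D y) = T₂ (D y)) : T₁ = T₂ :=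
  DFunLike.coe_injective <| hD.denseRange.equalizer T₁.continuous T₂.continuous (funext h)

theorem bcalc_congr (h : ∀ x ∈ Ioc (0 : ℝ) 1, φ x = ψ x) : bcalc D φ = bcalc D ψ := by
  unfold bcalc
  congr 2
  refine cfc_congr fun x hx => ?_
  rcases eq_or_lt_of_le (hD.spectrum_subset hx).1 with h0 | h0
  · simp [← h0]
  · simp [h x ⟨h0, (hD.spectrum_subset hx).2⟩]

theorem cfc_mul_comp (hφ : IsSymbol φ M) :
    cfc (fun x => x * (x * φ x)) D = cfc (fun x => x * φ x) D * D := by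
  have h1 := hφ.continuousOn_mul.mono hD.spectrum_subset
  have h2 := cfc_mul (fun x => x * φ x) (fun x => x) D h1 (by fun_prop)
  rw [hD.cfc_base] at h2
  rw [← h2]
  exact cfc_congr fun x _ => by ring

theorem cfc_mul_comp' (hφ : IsSymbol φ M) :
    cfc (fun x => x * (x * φ x)) D = D * cfc (fun x => x * φ x) D := by
  have h1 := hφ.continuousOn_mul.mono hD.spectrum_subset
  rw [cfc_mul (fun x => x) (fun x => x * φ x) D (by fun_prop) h1, hD.cfc_base]

theorem bcalc_comm_base (hφ : IsSymbol φ M) (y : H) : bcalc D φ (D y) = D (bcalc D φ y) := by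
  have : bcalc D φ * D = D * bcalc D φ := by
    refine hD.ext_dense fun y => ?_
    simp only [mul_apply_eq_comp]
    rw [hD.bcalc_apply hφ, hD.bcalc_apply hφ, ← mul_apply_eq_comp,
      ← mul_apply_eq_comp, ← hD.cfc_mul_comp hφ, ← hD.cfc_mul_comp' hφ]
  exact congrArg (fun T : H →L[ℂ] H => T y) this

theorem bcalc_mul (hφ : IsSymbol φ M) (hψ : IsSymbol ψ M') (y : H) :
    bcalc D φ (bcalc D ψ y) = bcalc D (fun x => φ x * ψ x) y := by
  have : bcalc D φ * bcalc D ψ = bcalc D (fun x => φ x * ψ x) := by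
    refine hD.ext_dense fun y => ?_
    -- Each of φ and ψ consumes one factor D, so the identity is verified on the range of D² and
    -- density is invoked twice.
    have : bcalc D φ * bcalc D ψ * D = bcalc D (fun x => φ x * ψ x) * D := by
      refine hD.ext_dense fun z => ?_
      simp only [mul_apply_eq_comp]
      rw [hD.bcalc_comm_base hψ, hD.bcalc_apply hφ, hD.bcalc_apply hψ,
        hD.bcalc_apply (hφ.mul hψ), ← mul_apply_eq_comp,
        ← cfc_mul _ _ D (hφ.continuousOn_mul.mono hD.spectrum_subset)
          (hψ.continuousOn_mul.mono hD.spectrum_subset), ← mul_apply_eq_comp,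
        ← hD.cfc_mul_comp (hφ.mul hψ)]
      congr 1
      exact cfc_congr fun x _ => by ring
    exact congrArg (fun T : H →L[ℂ] H => T y) this
  exact congrArg (fun T : H →L[ℂ] H => T y) this

theorem bcalc_add (hφ : IsSymbol φ M) (hψ : IsSymbol ψ M') (y : H) :
    bcalc D (fun x => φ x + ψ x) y = bcalc D φ y + bcalc D ψ y := by
  have : bcalc D (fun x => φ x + ψ x) = bcalc D φ + bcalc D ψ := by
    refine hD.ext_dense fun y => ?_
    rw [_root_.add_apply, hD.bcalc_apply hφ, hD.bcalc_apply hψ,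
      hD.bcalc_apply (hφ.add hψ), ← _root_.add_apply,
      ← cfc_add D _ _ (hφ.continuousOn_mul.mono hD.spectrum_subset)
          (hψ.continuousOn_mul.mono hD.spectrum_subset)]
    congr 1
    exact cfc_congr fun x _ => by ring
  rw [this]; rfl

theorem bcalc_const_mul (hφ : IsSymbol φ M) (c : ℝ) (y : H) :
    bcalc D (fun x => c * φ x) y = (c : ℂ) • bcalc D φ y := by
  have : bcalc D (fun x => c * φ x) = (c : ℂ) • bcalc D φ := by
    refine hD.ext_dense fun y => ?_
    rw [_root_.smul_apply, hD.bcalc_apply hφ, hD.bcalc_apply (hφ.const_mul c)]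
    have h1 : cfc (fun x => x * (c * φ x)) D = c • cfc (fun x => x * φ x) D := by
      rw [← cfc_const_mul c _ D (hφ.continuousOn_mul.mono hD.spectrum_subset)]
      exact cfc_congr fun x _ => by ring
    rw [h1, _root_.smul_apply, Complex.coe_smul]
  rw [this]; rfl

theorem bcalc_sub (hφ : IsSymbol φ M) (hψ : IsSymbol ψ M') (y : H) :
    bcalc D (fun x => φ x - ψ x) y = bcalc D φ y - bcalc D ψ y := by
  have h1 := hD.bcalc_add hφ (hψ.const_mul (-1)) y
  rw [hD.bcalc_const_mul hψ] at h1
  simpa [sub_eq_add_neg] using h1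

theorem bcalc_id : bcalc D (fun x => x) = D := by
  refine hD.ext_dense fun y => ?_
  rw [hD.bcalc_apply IsSymbol.id, cfc_mul _ _ D (by fun_prop) (by fun_prop), hD.cfc_base]
  rfl

theorem bcalc_one : bcalc D (fun _ => 1) = 1 := by
  refine hD.ext_dense fun y => ?_
  rw [hD.bcalc_apply IsSymbol.one]
  simp [hD.cfc_base]

theorem bcalc_inner (hφ : IsSymbol φ M) (y z : H) :
    inner ℂ (bcalc D φ y) z = inner ℂ y (bcalc D φ z) := by
  have hsa : IsSelfAdjoint (cfc (fun x => x * φ x) D) := cfc_predicate _ D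
  have : bcalc D φ = ContinuousLinearMap.adjoint (bcalc D φ) := by
    refine hD.ext_dense fun y => ?_
    refine ext_inner_right ℂ fun z => ?_
    rw [ContinuousLinearMap.adjoint_inner_left, hD.bcalc_apply hφ, hD.inner_left,
      ← hD.bcalc_comm_base hφ, hD.bcalc_apply hφ, ← ContinuousLinearMap.adjoint_inner_right,
      hsa.adjoint_eq]
  conv_lhs => rw [this]
  rw [ContinuousLinearMap.adjoint_inner_left]

end IsBase

end Calculus

end AbstractStrichartz

end

noncomputable section
namespace AbstractStrichartz

/-! ### The operator (1 + A)^{-1/2} of a closed form -/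

section FormBase

variable {H V : Type*} [NormedAddCommGroup H] [InnerProductSpace ℂ H] [CompleteSpace H]
  [NormedAddCommGroup V] [InnerProductSpace ℂ V] [CompleteSpace V]

/-- Lax–Milgram in the self-adjoint case: coercivity says E ≥ c > 0 in the order of bounded
operators, and an element above a positive scalar is invertible. -/
theorem isUnit_of_coercive {E : V →L[ℂ] V} (hE : IsSelfAdjoint E) {c : ℝ} (hc : 0 < c)
    (hEc : ∀ v, c * ‖v‖ ^ 2 ≤ RCLike.re (inner ℂ (E v) v)) : IsUnit E := by
  have h1 : (algebraMap ℝ (V →L[ℂ] V) c) ≤ E := by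
    rw [ContinuousLinearMap.le_def, ContinuousLinearMap.isPositive_def]
    refine ⟨(hE.sub (IsSelfAdjoint.algebraMap _ (.all c))).isSymmetric, fun v => ?_⟩
    have h2 : (algebraMap ℝ (V →L[ℂ] V) c) v = (c : ℂ) • v := by
      rw [Algebra.algebraMap_eq_smul_one]
      simp
    rw [ContinuousLinearMap.reApplyInnerSelf, _root_.sub_apply, inner_sub_left, map_sub, h2,
      inner_smul_left, Complex.conj_ofReal]
    have h3 : RCLike.re ((c : ℂ) * inner ℂ v v) = c * ‖v‖ ^ 2 :=
      (Complex.re_ofReal_mul c _).trans (congrArg _ (inner_self_eq_norm_sq (𝕜 := ℂ) v))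
    have := hEc v
    linarith
  refine CStarAlgebra.isUnit_of_le _ h1 (isStrictlyPositive_algebraMap hc)

/-- The operator `(1 + A)^{-1/2}` of a closed form, given by `E` on the form domain `V` which is
included in `H` by `ι`, together with the factorizations `ι W = D` and `D Z = ι`. -/
theorem exists_base (ι : V →L[ℂ] H) (E : V →L[ℂ] V) (hE : IsSelfAdjoint E) {c : ℝ} (hc : 0 < c)
    (hEc : ∀ v, c * ‖v‖ ^ 2 ≤ RCLike.re (inner ℂ (E v) v)) (hι : DenseRange ι)
    (hle : ∀ v, ‖ι v‖ ^ 2 ≤ RCLike.re (inner ℂ (E v) v)) :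
    ∃ (D : H →L[ℂ] H) (W : H →L[ℂ] V) (Z : V →L[ℂ] H), IsBase D ∧ (∀ y, ι (W y) = D y) ∧
      (∀ v, D (Z v) = ι v) ∧ (∀ y, Z (W y) = y) ∧
      ∀ y v, inner ℂ (E v) (W y) = inner ℂ (Z v) y := by
  obtain ⟨U, hU⟩ := isUnit_of_coercive hE hc hEc
  set E' : V →L[ℂ] V := ↑U⁻¹ with hE'
  have hEE' : ∀ v, E (E' v) = v := fun v => by
    have : E * E' = 1 := by rw [← hU, hE']; exact U.mul_inv
    exact congrArg (fun T : V →L[ℂ] V => T v) this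
  have hE'E : ∀ v, E' (E v) = v := fun v => by
    have : E' * E = 1 := by rw [← hU, hE']; exact U.inv_mul
    exact congrArg (fun T : V →L[ℂ] V => T v) this
  have hEs : ∀ v w, inner ℂ (E v) w = inner ℂ v (E w) := fun v w => by
    conv_lhs => rw [← hE.adjoint_eq]
    rw [ContinuousLinearMap.adjoint_inner_left]
  -- T is (1 + A)^{-1} with values in the form domain: it solves ⟨E v, T y⟩ = ⟨ι v, y⟩ for all v.
  set T : H →L[ℂ] V := E' ∘L (ContinuousLinearMap.adjoint ι) with hT
  have hTe : ∀ y v, inner ℂ (E v) (T y) = inner ℂ (ι v) y := fun y v => by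
    rw [hEs, hT, ContinuousLinearMap.comp_apply, hEE', ContinuousLinearMap.adjoint_inner_right]
  have hTe' : ∀ y v, inner ℂ (T y) (E v) = inner ℂ y (ι v) := fun y v => by
    rw [← inner_conj_symm, hTe, inner_conj_symm]
  set B : H →L[ℂ] H := ι ∘L T with hB
  have hBT : ∀ y z, inner ℂ (B y) z = inner ℂ (E (T y)) (T z) := fun y z => by
    rw [hTe]; rfl
  have hBpos : 0 ≤ B := by
    rw [ContinuousLinearMap.nonneg_iff_isPositive, ContinuousLinearMap.isPositive_def]
    refine ⟨fun y z => ?_, fun y => ?_⟩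
    · change inner ℂ (B y) z = inner ℂ y (B z)
      rw [hBT, hEs, hTe']; rfl
    · rw [ContinuousLinearMap.reApplyInnerSelf, hBT]
      exact le_trans (by positivity) (hEc (T y))
  -- B = ι T is (1 + A)^{-1} as a bounded positive operator on H, so its square root is the operator
  -- sought.
  set D : H →L[ℂ] H := CFC.sqrt B with hDdef
  have hDD : ∀ y, D (D y) = B y := fun y => by
    have : D * D = B := CFC.sqrt_mul_sqrt_self B hBpos
    exact congrArg (fun T : H →L[ℂ] H => T y) this
  have hD0 : 0 ≤ D := CFC.sqrt_nonneg B
  have hDsa : IsSelfAdjoint D := hD0.isSelfAdjoint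
  have hDs : ∀ v w, inner ℂ (D v) w = inner ℂ v (D w) := fun v w => by
    conv_lhs => rw [← hDsa.adjoint_eq]
    rw [ContinuousLinearMap.adjoint_inner_left]
  have hDn : ∀ y, ‖D y‖ ^ 2 = RCLike.re (inner ℂ (E (T y)) (T y)) := fun y => by
    rw [← hBT, ← hDD, hDs, inner_self_eq_norm_sq]
  have hinj : Function.Injective D := by
    refine (injective_iff_map_eq_zero D).2 fun y hy => ?_
    have h1 : T y = 0 := by
      have h2 := hDn y
      have h3 := hEc (T y)
      rw [hy] at h2
      have h4 : c * ‖T y‖ ^ 2 ≤ 0 := by rw [norm_zero] at h2; linarith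
      have h5 : ‖T y‖ ^ 2 ≤ 0 := by
        by_contra h; push Not at h; nlinarith
      have h6 : ‖T y‖ = 0 := by nlinarith [norm_nonneg (T y)]
      exact norm_eq_zero.1 h6
    have h2 : ∀ v, inner ℂ (ι v) y = 0 := fun v => by rw [← hTe, h1, inner_zero_right]
    have h3 : ∀ x : H, inner ℂ x y = 0 := fun x =>
      congrFun (DenseRange.equalizer hι (g := fun x : H => inner ℂ x y) (h := fun _ => (0 : ℂ))
        (by fun_prop) (by fun_prop) (funext h2)) x
    exact inner_self_eq_zero.1 (h3 y)
  -- By `hle`, ‖B y‖ ≤ ‖D y‖, while ‖D y‖² = ⟨B y, y⟩ ≤ ‖B y‖ ‖y‖; together these give the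
  -- contraction property.
  have hDle : ∀ y, ‖D y‖ ≤ ‖y‖ := by
    intro y
    have h1 : ‖B y‖ ^ 2 ≤ ‖D y‖ ^ 2 := by rw [hDn]; exact hle (T y)
    have h2 : ‖D y‖ ^ 2 ≤ ‖B y‖ * ‖y‖ := by
      rw [hDn, ← hBT]
      exact (Complex.re_le_norm _).trans (norm_inner_le_norm _ _)
    have h3 : ‖B y‖ ≤ ‖D y‖ := (sq_le_sq₀ (norm_nonneg _) (norm_nonneg _)).1 h1
    have h4 : ‖D y‖ * ‖D y‖ ≤ ‖D y‖ * ‖y‖ := by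
      nlinarith [norm_nonneg y, norm_nonneg (D y)]
    rcases (norm_nonneg (D y)).eq_or_lt with h | h
    · rw [← h]; positivity
    · exact le_of_mul_le_mul_left h4 h
  have hDbase : IsBase D :=
    ⟨hD0, D.opNorm_le_bound zero_le_one (fun y => by simpa using hDle y), hinj⟩
  -- Coercivity bounds T y by D y in the norm of V, so D y ↦ T y extends to a bounded operator W
  -- from H to V. It is D regarded as a map into the form domain.
  have hTD : ∀ y, ‖T.toLinearMap y‖ ≤ √(c⁻¹) * ‖D.toLinearMap y‖ := fun y => by
    have h1 : ‖T y‖ ^ 2 ≤ c⁻¹ * ‖D y‖ ^ 2 := by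
      rw [inv_mul_eq_div, le_div_iff₀ hc, mul_comm, hDn]
      exact hEc _
    have := Real.sqrt_le_sqrt h1
    rwa [Real.sqrt_sq (norm_nonneg _), Real.sqrt_mul (by positivity),
      Real.sqrt_sq (norm_nonneg _)] at this
  set W : H →L[ℂ] V := T.toLinearMap.extendOfNorm D.toLinearMap with hW
  have hWD : ∀ y, W (D y) = T y := fun y =>
    LinearMap.extendOfNorm_eq (f := T.toLinearMap) (e := D.toLinearMap)
      hDbase.denseRange ⟨_, hTD⟩ y
  -- The adjoint of W for the form E plays the part of (1 + A)^{1/2} on the form domain.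
  set Z : V →L[ℂ] H := ContinuousLinearMap.adjoint W ∘L E with hZ
  have hιW : ∀ y, ι (W y) = D y := fun y => by
    have : ι ∘L W = D := hDbase.ext_dense fun y => by
      rw [ContinuousLinearMap.comp_apply, hWD, hDD]; rfl
    exact congrArg (fun T : H →L[ℂ] H => T y) this
  have hDZ : ∀ v, D (Z v) = ι v := fun v => by
    refine ext_inner_right ℂ fun y => ?_
    rw [hDs, hZ, ContinuousLinearMap.comp_apply, ContinuousLinearMap.adjoint_inner_left, hWD, hTe]
  refine ⟨D, W, Z, hDbase, hιW, hDZ, fun y => hinj ?_, fun y v => ?_⟩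
  · rw [hDZ, hιW]
  · rw [hZ, ContinuousLinearMap.comp_apply, ContinuousLinearMap.adjoint_inner_left]

end FormBase

/-! ### Strong continuity and differentiability of operator families -/

section Families

variable {H : Type*} [NormedAddCommGroup H] [InnerProductSpace ℂ H] [CompleteSpace H]

/-- The Taylor remainder of the symbol is quadratic in s - t only after multiplication by x, which
settles vectors in the range of D. The Lipschitz bound keeps the difference quotients uniformly
bounded, so density extends the derivative to every h. -/
theorem IsBase.hasDerivAt_bcalc [NormedSpace ℝ H] [IsScalarTower ℝ ℂ H] {D : H →L[ℂ] H} (hD : IsBase D) {φ φ' : ℝ → ℝ → ℝ}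
    {B B' : ℝ → ℝ} {M : ℝ} (hφ : ∀ t, IsSymbol (φ t) (B t)) (hφ' : ∀ t, IsSymbol (φ' t) (B' t))
    (hlip : ∀ s t, ∀ x ∈ Ioc (0 : ℝ) 1, |φ s x - φ t x| ≤ M * |s - t|)
    (hder : ∀ s t, ∀ x ∈ Ioc (0 : ℝ) 1,
      |(φ s x - φ t x - (s - t) * φ' t x) * x| ≤ M * (s - t) ^ 2) (h : H) (t : ℝ) :
    HasDerivAt (fun t => bcalc D (φ t) h) (bcalc D (φ' t) h) t := by
  have hM : 0 ≤ M := by simpa using (abs_nonneg _).trans (hlip 1 0 1 (by simp))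
  set M' := M + B' t with hM'
  have hM'0 : 0 ≤ M' := add_nonneg hM (hφ' t).nonneg
  set R : ℝ → ℝ → ℝ := fun s x => φ s x - φ t x - (s - t) * φ' t x with hR
  have hRs : ∀ s, IsSymbol (R s) (M' * |s - t|) := fun s =>
    ⟨(((hφ s).cont.sub (hφ t).cont).sub ((hφ' t).cont.const_mul _)), fun x hx => by
      refine (abs_sub _ _).trans ?_
      rw [abs_mul]
      have h1 := hlip s t x hx
      have h2 := mul_le_mul_of_nonneg_left ((hφ' t).bound x hx) (abs_nonneg (s - t))
      rw [hM']; linarith⟩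
  have hReq : ∀ s, bcalc D (R s) h =
      bcalc D (φ s) h - bcalc D (φ t) h - (s - t) • bcalc D (φ' t) h := fun s => by
    rw [hR]
    simp only
    rw [hD.bcalc_sub ((hφ s).sub (hφ t)) ((hφ' t).const_mul _), hD.bcalc_sub (hφ s) (hφ t),
      hD.bcalc_const_mul (hφ' t)]
    congr 1
    exact algebraMap_smul ℂ (s - t) _
  rw [hasDerivAt_iff_isLittleO]
  simp_rw [← hReq]
  rw [Asymptotics.isLittleO_iff]
  intro ε hε
  -- The approximation D y of h is fixed first; afterwards |s - t| is taken small depending on y.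
  obtain ⟨y, hy⟩ : ∃ y, M' * ‖h - D y‖ < ε / 2 := by
    have h1 : 0 < ε / 2 / (M' + 1) := by positivity
    obtain ⟨y, hy⟩ := hD.denseRange.exists_dist_lt h h1
    refine ⟨y, ?_⟩
    rw [dist_eq_norm, lt_div_iff₀ (by positivity)] at hy
    nlinarith [norm_nonneg (h - D y)]
  have hev : ∀ᶠ s in 𝓝 t, M * |s - t| * ‖y‖ < ε / 2 := by
    have : ContinuousAt (fun s => M * |s - t| * ‖y‖) t := by fun_prop
    refine this.eventually_lt continuousAt_const ?_
    simp; positivity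
  filter_upwards [hev] with s hs
  have h1 : ‖bcalc D (R s) (D y)‖ ≤ M * (s - t) ^ 2 * ‖y‖ := by
    have h2 : IsSymbol (fun x => R s x * x) (M * (s - t) ^ 2) :=
      ⟨(hRs s).cont.mul continuousOn_id, hder s t⟩
    have h3 := hD.bcalc_mul (hRs s) IsSymbol.id y
    rw [hD.bcalc_id] at h3
    rw [h3]
    exact hD.norm_bcalc_le h2 y
  have h2 : ‖bcalc D (R s) (h - D y)‖ ≤ M' * |s - t| * ‖h - D y‖ := hD.norm_bcalc_le (hRs s) _
  have h3 : bcalc D (R s) h = bcalc D (R s) (D y) + bcalc D (R s) (h - D y) := by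
    rw [← map_add]; congr 1; abel
  rw [h3, Real.norm_eq_abs]
  refine (norm_add_le _ _).trans ?_
  have h4 : (s - t) ^ 2 = |s - t| * |s - t| := by rw [← sq, sq_abs]
  rw [h4] at h1
  nlinarith [abs_nonneg (s - t)]

/-- Joint continuity by the same approximation: the Lipschitz bound with the factor x serves vectors
D y, and the locally bounded norms B absorb the error of the approximation and the change of the
vector. -/
theorem IsBase.continuous_bcalc {D : H →L[ℂ] H} (hD : IsBase D) {φ : ℝ → ℝ → ℝ}
    {B : ℝ → ℝ} (hB : Continuous B) {M : ℝ} (hφ : ∀ t, IsSymbol (φ t) (B t))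
    (hlip : ∀ s t, ∀ x ∈ Ioc (0 : ℝ) 1, |(φ s x - φ t x) * x| ≤ M * |s - t|) :
    Continuous fun p : ℝ × H => bcalc D (φ p.1) p.2 := by
  rw [continuous_iff_continuousAt]
  rintro ⟨t, h⟩
  have hBt : 0 ≤ B t := (hφ t).nonneg
  rw [Metric.continuousAt_iff']
  intro ε hε
  obtain ⟨y, hy⟩ : ∃ y, (B t + B t) * ‖h - D y‖ < ε := by
    have h1 : 0 < ε / (B t + B t + 1) := by positivity
    obtain ⟨y, hy⟩ := hD.denseRange.exists_dist_lt h h1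
    refine ⟨y, ?_⟩
    rw [dist_eq_norm, lt_div_iff₀ (by positivity)] at hy
    nlinarith [norm_nonneg (h - D y)]
  have hev : ∀ᶠ p : ℝ × H in 𝓝 (t, h),
      B p.1 * ‖p.2 - h‖ + (B p.1 + B t) * ‖h - D y‖ + M * |p.1 - t| * ‖y‖ < ε := by
    have : ContinuousAt (fun p : ℝ × H =>
      B p.1 * ‖p.2 - h‖ + (B p.1 + B t) * ‖h - D y‖ + M * |p.1 - t| * ‖y‖) (t, h) := by fun_prop
    refine this.eventually_lt continuousAt_const ?_
    simpa using hy
  filter_upwards [hev] with p hp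
  obtain ⟨s, k⟩ := p
  refine lt_of_le_of_lt ?_ hp
  have hsub : ∀ z, bcalc D (fun x => φ s x - φ t x) z = bcalc D (φ s) z - bcalc D (φ t) z :=
    fun z => hD.bcalc_sub (hφ s) (hφ t) z
  have h1 : ‖bcalc D (fun x => φ s x - φ t x) (D y)‖ ≤ M * |s - t| * ‖y‖ := by
    have h2 : IsSymbol (fun x => (φ s x - φ t x) * x) (M * |s - t|) :=
      ⟨((hφ s).cont.sub (hφ t).cont).mul continuousOn_id, hlip s t⟩
    have h3 := hD.bcalc_mul ((hφ s).sub (hφ t)) IsSymbol.id y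
    rw [hD.bcalc_id] at h3
    rw [h3]
    exact hD.norm_bcalc_le h2 y
  have h2 : ‖bcalc D (fun x => φ s x - φ t x) (h - D y)‖ ≤ (B s + B t) * ‖h - D y‖ :=
    hD.norm_bcalc_le ((hφ s).sub (hφ t)) _
  have h3 : ‖bcalc D (φ s) (k - h)‖ ≤ B s * ‖k - h‖ := hD.norm_bcalc_le (hφ s) _
  have h4 : bcalc D (φ s) k - bcalc D (φ t) h = bcalc D (φ s) (k - h) +
      bcalc D (fun x => φ s x - φ t x) (h - D y) + bcalc D (fun x => φ s x - φ t x) (D y) := by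
    rw [add_assoc, ← map_add, hsub]
    simp
  rw [dist_eq_norm, h4]
  exact (norm_add₃_le).trans (by linarith)

end Families

/-! ### The symbols of the wave propagators -/

section Symbols

/-- `√(1 - x²)`. -/
def symν (x : ℝ) : ℝ := √(1 - x ^ 2)

/-- The frequency `√A` in terms of the spectral variable `x` of `(1 + A)^{-1/2}`. -/
def symμ (x : ℝ) : ℝ := symν x / x

def symC (t x : ℝ) : ℝ := Real.cos (t * symμ x)

/-- Writing sin(tμ)/μ through `Real.sinc` gives it the value t at μ = 0, that is at x = 1, and keeps
it continuous there. -/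
def symS (t x : ℝ) : ℝ := t * Real.sinc (t * symμ x)

/-- The extra 1/x stands for (1 + A)^{1/2}: the decay of sin(tμ)/μ for large μ compensates it, which
is the gain of one derivative of S(t). -/
def symK (t x : ℝ) : ℝ := symS t x / x

def symL (t x : ℝ) : ℝ := symν x * Real.sin (t * symμ x)

theorem symν_nonneg (x : ℝ) : 0 ≤ symν x := Real.sqrt_nonneg _

theorem symν_le_one (x : ℝ) : symν x ≤ 1 := by
  rw [symν, Real.sqrt_le_one]; nlinarith [sq_nonneg x]

theorem symν_sq {x : ℝ} (hx : x ∈ Ioc (0 : ℝ) 1) : symν x ^ 2 = 1 - x ^ 2 :=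
  Real.sq_sqrt (by nlinarith [hx.1, hx.2])

theorem symμ_mul {x : ℝ} (hx : x ∈ Ioc (0 : ℝ) 1) : symμ x * x = symν x :=
  div_mul_cancel₀ _ hx.1.ne'

theorem symμ_nonneg {x : ℝ} (hx : x ∈ Ioc (0 : ℝ) 1) : 0 ≤ symμ x :=
  div_nonneg (symν_nonneg x) hx.1.le

theorem continuousOn_symν : ContinuousOn symν (Ioc 0 1) := by
  unfold symν; fun_prop

theorem continuousOn_symμ : ContinuousOn symμ (Ioc 0 1) :=
  continuousOn_symν.div continuousOn_id fun _ hx => hx.1.ne'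

theorem symS_mul_symμ (t x : ℝ) : symS t x * symμ x = Real.sin (t * symμ x) := by
  rw [symS]
  by_cases h : t * symμ x = 0
  · rw [h, mul_assoc, mul_comm, mul_assoc, mul_comm (symμ x), h]; simp
  · rw [Real.sinc_of_ne_zero h, mul_right_comm]
    exact mul_div_cancel₀ _ h

theorem symS_of_symμ_eq_zero {t x : ℝ} (h : symμ x = 0) : symS t x = t := by
  simp [symS, h]

theorem abs_symS_le (t x : ℝ) : |symS t x| ≤ |t| := by
  rw [symS, abs_mul]
  exact mul_le_of_le_one_right (abs_nonneg _) (Real.abs_sinc_le_one _)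

theorem abs_sin_sub_sin_le (a b : ℝ) : |Real.sin a - Real.sin b| ≤ |a - b| := by
  have := Real.lipschitzWith_sin.dist_le_mul a b
  simpa [Real.dist_eq] using this

theorem abs_cos_sub_cos_le (a b : ℝ) : |Real.cos a - Real.cos b| ≤ |a - b| := by
  have := Real.lipschitzWith_cos.dist_le_mul a b
  simpa [Real.dist_eq] using this

theorem abs_cos_sub_one_le (h : ℝ) : |Real.cos h - 1| ≤ h ^ 2 := by
  rw [abs_le]
  constructor <;> nlinarith [Real.one_sub_sq_div_two_le_cos (x := h), Real.cos_le_one h, sq_nonneg h]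

theorem abs_sin_sub_self_le (h : ℝ) : |Real.sin h - h| ≤ 2 * h ^ 2 := by
  rcases le_total |h| 1 with h1 | h1
  · have h2 := Real.sin_bound h1
    have h3 : |h| ^ 5 ≤ h ^ 2 := by
      rw [← sq_abs h]; exact pow_le_pow_of_le_one (abs_nonneg h) h1 (by norm_num)
    have h4 : |h ^ 3 / 6| ≤ h ^ 2 := by
      rw [abs_div, abs_pow, ← sq_abs h]
      rw [abs_of_pos (by norm_num : (0 : ℝ) < 6)]
      nlinarith [abs_nonneg h, sq_nonneg |h|]
    have h5 : Real.sin h - h = (Real.sin h - (h - h ^ 3 / 6)) - h ^ 3 / 6 := by ring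
    rw [h5]
    refine (abs_sub _ _).trans ?_
    nlinarith [sq_nonneg h]
  · refine (abs_sub _ _).trans ?_
    have := Real.abs_sin_le_one h
    rw [← sq_abs h]
    nlinarith

theorem abs_sin_taylor_le (a b : ℝ) :
    |Real.sin b - Real.sin a - (b - a) * Real.cos a| ≤ 3 * (b - a) ^ 2 := by
  have h1 : Real.sin b - Real.sin a - (b - a) * Real.cos a =
      Real.sin a * (Real.cos (b - a) - 1) + Real.cos a * (Real.sin (b - a) - (b - a)) := by
    have : Real.sin b = Real.sin (a + (b - a)) := by congr 1; ring
    rw [this, Real.sin_add]; ring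
  rw [h1]
  refine (abs_add_le _ _).trans ?_
  rw [abs_mul, abs_mul]
  have h2 := mul_le_mul (Real.abs_sin_le_one a) (abs_cos_sub_one_le (b - a)) (abs_nonneg _)
    zero_le_one
  have h3 := mul_le_mul (Real.abs_cos_le_one a) (abs_sin_sub_self_le (b - a)) (abs_nonneg _)
    zero_le_one
  linarith

theorem abs_cos_taylor_le (a b : ℝ) :
    |Real.cos b - Real.cos a + (b - a) * Real.sin a| ≤ 3 * (b - a) ^ 2 := by
  have h1 : Real.cos b - Real.cos a + (b - a) * Real.sin a =
      Real.cos a * (Real.cos (b - a) - 1) - Real.sin a * (Real.sin (b - a) - (b - a)) := by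
    have : Real.cos b = Real.cos (a + (b - a)) := by congr 1; ring
    rw [this, Real.cos_add]; ring
  rw [h1]
  refine (abs_sub _ _).trans ?_
  rw [abs_mul, abs_mul]
  have h2 := mul_le_mul (Real.abs_cos_le_one a) (abs_cos_sub_one_le (b - a)) (abs_nonneg _)
    zero_le_one
  have h3 := mul_le_mul (Real.abs_sin_le_one a) (abs_sin_sub_self_le (b - a)) (abs_nonneg _)
    zero_le_one
  linarith

theorem isSymbol_symC (t : ℝ) : IsSymbol (symC t) 1 :=
  ⟨Real.continuous_cos.comp_continuousOn (continuousOn_symμ.const_mul t),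
    fun _ _ => Real.abs_cos_le_one _⟩

theorem isSymbol_symS (t : ℝ) : IsSymbol (symS t) |t| :=
  ⟨(Real.continuous_sinc.comp_continuousOn (continuousOn_symμ.const_mul t)).const_mul t,
    fun _ _ => abs_symS_le _ _⟩

theorem isSymbol_symL (t : ℝ) : IsSymbol (symL t) 1 :=
  ⟨continuousOn_symν.mul (Real.continuous_sin.comp_continuousOn (continuousOn_symμ.const_mul t)),
    fun x _ => by
      rw [symL, abs_mul, abs_of_nonneg (symν_nonneg x)]
      exact mul_le_one₀ (symν_le_one x) (abs_nonneg _) (Real.abs_sin_le_one _)⟩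

theorem symS_mul_symν (t : ℝ) {x : ℝ} (hx : x ∈ Ioc (0 : ℝ) 1) :
    symS t x * symν x = x * Real.sin (t * symμ x) := by
  rw [← symμ_mul hx, ← mul_assoc, symS_mul_symμ, mul_comm]

/-- For x ≥ 1/2, division by x costs a factor 2 on |S| ≤ |t|. For x ≤ 1/2 one has ν ≥ 1/2, and S ν =
x sin(tμ) gives |S| ≤ 2x. The constant is the sum of the two bounds. -/
theorem isSymbol_symK (t : ℝ) : IsSymbol (symK t) (2 * |t| + 2) :=
  ⟨(isSymbol_symS t).cont.div continuousOn_id fun _ hx => hx.1.ne', fun x hx => by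
    rw [symK, abs_div, abs_of_pos hx.1, div_le_iff₀ hx.1]
    rcases le_total (1 / 2) x with h | h
    · nlinarith [abs_symS_le t x, abs_nonneg t]
    · have h1 : 1 / 2 ≤ symν x := by
        rw [symν]; apply Real.le_sqrt_of_sq_le; nlinarith [hx.1]
      have h2 : |symS t x| * symν x ≤ x := by
        rw [← abs_of_nonneg (symν_nonneg x), ← abs_mul, symS_mul_symν t hx, abs_mul,
          abs_of_pos hx.1]
        exact mul_le_of_le_one_right hx.1.le (Real.abs_sin_le_one _)
      nlinarith [abs_nonneg t, abs_nonneg (symS t x), mul_nonneg (abs_nonneg t) hx.1.le]⟩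

theorem symK_mul (t : ℝ) {x : ℝ} (hx : x ∈ Ioc (0 : ℝ) 1) : symK t x * x = symS t x :=
  div_mul_cancel₀ _ hx.1.ne'

theorem symL_mul (t : ℝ) {x : ℝ} (hx : x ∈ Ioc (0 : ℝ) 1) :
    symL t x * x = (1 - x * x) * symS t x := by
  have h := symν_sq hx
  rw [symL, mul_assoc, mul_comm _ x, ← symS_mul_symν t hx]
  linear_combination symS t x * h

theorem symL_eq (t : ℝ) {x : ℝ} (hx : x ∈ Ioc (0 : ℝ) 1) :
    symL t x = (1 - x * x) * symK t x := by
  rw [symK, ← mul_div_assoc, ← symL_mul t hx, mul_div_cancel_right₀ _ hx.1.ne']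

/-- The subtraction formula for the sine; it separates the variables t and s in the Duhamel kernel.
-/
theorem symS_sub (s t x : ℝ) :
    symS (t - s) x = symS t x * symC s x - symC t x * symS s x := by
  by_cases h : symμ x = 0
  · simp [symC, h, symS_of_symμ_eq_zero h]
  · apply mul_right_cancel₀ h
    rw [symS_mul_symμ, sub_mul, sub_mul, Real.sin_sub, symC, symC]
    linear_combination -Real.cos (s * symμ x) * symS_mul_symμ t x +
      Real.cos (t * symμ x) * symS_mul_symμ s x

theorem abs_symS_sub_le (s t : ℝ) {x : ℝ} (hx : x ∈ Ioc (0 : ℝ) 1) :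
    |symS s x - symS t x| ≤ |s - t| := by
  rcases (symμ_nonneg hx).eq_or_lt with h | h
  · simp [symS_of_symμ_eq_zero h.symm]
  · refine le_of_mul_le_mul_right ?_ h
    have h1 := abs_sin_sub_sin_le (s * symμ x) (t * symμ x)
    rw [← symS_mul_symμ, ← symS_mul_symμ, ← sub_mul, ← sub_mul, abs_mul, abs_mul,
      abs_of_pos h] at h1
    exact h1

theorem abs_symC_sub_mul_le (s t : ℝ) {x : ℝ} (hx : x ∈ Ioc (0 : ℝ) 1) :
    |(symC s x - symC t x) * x| ≤ |s - t| := by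
  have h1 := abs_cos_sub_cos_le (s * symμ x) (t * symμ x)
  rw [← sub_mul, abs_mul, abs_of_nonneg (symμ_nonneg hx)] at h1
  rw [abs_mul, abs_of_pos hx.1, symC, symC]
  calc _ ≤ |s - t| * symμ x * x := mul_le_mul_of_nonneg_right h1 hx.1.le
    _ = |s - t| * symν x := by rw [mul_assoc, symμ_mul hx]
    _ ≤ |s - t| := mul_le_of_le_one_right (abs_nonneg _) (symν_le_one x)

theorem abs_symL_sub_mul_le (s t : ℝ) {x : ℝ} (hx : x ∈ Ioc (0 : ℝ) 1) :
    |(symL s x - symL t x) * x| ≤ |s - t| := by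
  rw [sub_mul, symL_mul s hx, symL_mul t hx, ← mul_sub, abs_mul,
    abs_of_nonneg (by nlinarith [hx.1, hx.2] : 0 ≤ 1 - x * x)]
  exact (mul_le_of_le_one_left (abs_nonneg _) (by nlinarith [hx.1])).trans (abs_symS_sub_le s t hx)

/-- The Taylor error of the sine is (s - t)²μ² up to a constant; dividing by μ leaves one μ, and xμ
= ν ≤ 1. -/
theorem abs_symS_taylor_le (s t : ℝ) {x : ℝ} (hx : x ∈ Ioc (0 : ℝ) 1) :
    |(symS s x - symS t x - (s - t) * symC t x) * x| ≤ 3 * (s - t) ^ 2 := by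
  rcases (symμ_nonneg hx).eq_or_lt with h | h
  · simp [symS_of_symμ_eq_zero h.symm, symC, ← h]; positivity
  · refine le_of_mul_le_mul_right ?_ h
    have h1 := abs_sin_taylor_le (t * symμ x) (s * symμ x)
    have h2 : (symS s x - symS t x - (s - t) * symC t x) * x * symμ x =
        (Real.sin (s * symμ x) - Real.sin (t * symμ x) -
          (s * symμ x - t * symμ x) * Real.cos (t * symμ x)) * x := by
      rw [← symS_mul_symμ, ← symS_mul_symμ, symC]; ring
    have h3 := mul_le_mul_of_nonneg_right h1 hx.1.le
    rw [← abs_of_pos hx.1, ← abs_mul, abs_of_pos hx.1, ← h2, abs_mul _ (symμ x),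
      abs_of_pos h] at h3
    refine h3.trans ?_
    have h4 : 3 * (s * symμ x - t * symμ x) ^ 2 * x =
        3 * (s - t) ^ 2 * symμ x * (symμ x * x) := by ring
    rw [h4, symμ_mul hx]
    exact mul_le_of_le_one_right (by positivity) (symν_le_one x)

/-- The cosine costs μ², hence two factors x: one is part of the symbol, because the vector lies in
the range of D, and the other is the one granted by the remainder condition in
`IsBase.hasDerivAt_bcalc`. -/
theorem abs_symC_taylor_le (s t : ℝ) {x : ℝ} (hx : x ∈ Ioc (0 : ℝ) 1) :
    |(symC s x * x - symC t x * x - (s - t) * -symL t x) * x| ≤ 3 * (s - t) ^ 2 := by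
  have h1 := abs_cos_taylor_le (t * symμ x) (s * symμ x)
  have h2 : (symC s x * x - symC t x * x - (s - t) * -symL t x) * x =
      (Real.cos (s * symμ x) - Real.cos (t * symμ x) +
          (s * symμ x - t * symμ x) * Real.sin (t * symμ x)) * x ^ 2 := by
    rw [symL, ← symμ_mul hx, symC, symC]; ring
  rw [h2, abs_mul, abs_of_nonneg (sq_nonneg x)]
  refine (mul_le_mul_of_nonneg_right h1 (sq_nonneg x)).trans ?_
  have h4 : 3 * (s * symμ x - t * symμ x) ^ 2 * x ^ 2 =
        3 * (s - t) ^ 2 * (symμ x * x) ^ 2 := by ring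
  rw [h4, symμ_mul hx]
  exact mul_le_of_le_one_right (by positivity) (by nlinarith [symν_nonneg x, symν_le_one x])

theorem abs_symL_taylor_le (s t : ℝ) {x : ℝ} (hx : x ∈ Ioc (0 : ℝ) 1) :
    |(symL s x * x - symL t x * x - (s - t) * ((1 - x * x) * symC t x)) * x| ≤
      3 * (s - t) ^ 2 := by
  rw [symL_mul s hx, symL_mul t hx]
  have h1 : ((1 - x * x) * symS s x - (1 - x * x) * symS t x - (s - t) * ((1 - x * x) * symC t x))
      * x = (1 - x * x) * ((symS s x - symS t x - (s - t) * symC t x) * x) := by ring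
  rw [h1, abs_mul, abs_of_nonneg (by nlinarith [hx.1, hx.2] : 0 ≤ 1 - x * x)]
  exact (mul_le_of_le_one_left (abs_nonneg _) (by nlinarith [hx.1])).trans
    (abs_symS_taylor_le s t hx)

theorem isSymbol_one_sub_sq : IsSymbol (fun x => 1 - x * x) 1 :=
  ⟨by fun_prop, fun x hx => by rw [abs_le]; constructor <;> nlinarith [hx.1, hx.2]⟩

end Symbols

/-! ### The wave propagators and their derivatives -/

section Waves

variable {H : Type*} [NormedAddCommGroup H] [InnerProductSpace ℂ H] [CompleteSpace H]

/-- `cos (t √A)`. -/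
def opC (D : H →L[ℂ] H) (t : ℝ) : H →L[ℂ] H := bcalc D (symC t)

/-- `sin (t √A) / √A`. -/
def opS (D : H →L[ℂ] H) (t : ℝ) : H →L[ℂ] H := bcalc D (symS t)

/-- `(1 + A)^{1/2} sin (t √A) / √A`. -/
def opK (D : H →L[ℂ] H) (t : ℝ) : H →L[ℂ] H := bcalc D (symK t)

/-- `(1 + A)^{-1/2} √A sin (t √A)`. -/
def opL (D : H →L[ℂ] H) (t : ℝ) : H →L[ℂ] H := bcalc D (symL t)

namespace IsBase

variable {D : H →L[ℂ] H} (hD : IsBase D)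
include hD

theorem inner_opC (t : ℝ) (x y : H) : inner ℂ (opC D t x) y = inner ℂ x (opC D t y) :=
  hD.bcalc_inner (isSymbol_symC t) x y

theorem inner_opS (t : ℝ) (x y : H) : inner ℂ (opS D t x) y = inner ℂ x (opS D t y) :=
  hD.bcalc_inner (isSymbol_symS t) x y

theorem opC_base (t : ℝ) (y : H) : opC D t (D y) = D (opC D t y) :=
  hD.bcalc_comm_base (isSymbol_symC t) y

theorem opS_base (t : ℝ) (y : H) : opS D t (D y) = D (opS D t y) :=
  hD.bcalc_comm_base (isSymbol_symS t) y

theorem base_opK (t : ℝ) (y : H) : D (opK D t y) = opS D t y := by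
  rw [opK, ← hD.bcalc_comm_base (isSymbol_symK t)]
  have h := hD.bcalc_mul (isSymbol_symK t) IsSymbol.id y
  rw [hD.bcalc_id] at h
  rw [h, opS]
  rw [hD.bcalc_congr fun x hx => symK_mul t hx]

theorem bcalc_one_sub_sq (y : H) : bcalc D (fun x => 1 - x * x) y = y - D (D y) := by
  rw [hD.bcalc_sub IsSymbol.one (IsSymbol.id.mul IsSymbol.id), hD.bcalc_one,
    ← hD.bcalc_mul IsSymbol.id IsSymbol.id, hD.bcalc_id]
  rfl

theorem opL_eq (t : ℝ) (y : H) : opL D t y = opK D t y - D (D (opK D t y)) := by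
  rw [← hD.bcalc_one_sub_sq, opK, hD.bcalc_mul isSymbol_one_sub_sq (isSymbol_symK t), opL,
    hD.bcalc_congr fun x hx => symL_eq t hx]

theorem opL_base (t : ℝ) (y : H) : opL D t (D y) = D (opL D t y) :=
  hD.bcalc_comm_base (isSymbol_symL t) y

theorem base_opL (t : ℝ) (y : H) : D (opL D t y) = opS D t y - D (D (opS D t y)) := by
  rw [hD.opL_eq, map_sub, hD.base_opK]

theorem opS_sub (s t : ℝ) (y : H) :
    opS D (t - s) y = opS D t (opC D s y) - opC D t (opS D s y) := by
  rw [opS, opS, opC, opC, opS, hD.bcalc_mul (isSymbol_symS t) (isSymbol_symC s),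
    hD.bcalc_mul (isSymbol_symC t) (isSymbol_symS s),
    ← hD.bcalc_sub ((isSymbol_symS t).mul (isSymbol_symC s))
      ((isSymbol_symC t).mul (isSymbol_symS s)), hD.bcalc_congr fun x _ => symS_sub s t x]

theorem opC_zero (y : H) : opC D 0 y = y := by
  rw [opC, hD.bcalc_congr (ψ := fun _ => 1) (fun x _ => by simp [symC]), hD.bcalc_one]; rfl

theorem opS_zero (y : H) : opS D 0 y = 0 := by
  have := hD.norm_bcalc_le (isSymbol_symS 0) y
  simpa [opS] using this

theorem opL_zero (y : H) : opL D 0 y = 0 := by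
  have h0 : IsSymbol (symL 0) 0 := ⟨(isSymbol_symL 0).cont, fun x _ => by simp [symL]⟩
  simpa [opL] using hD.norm_bcalc_le h0 y

theorem norm_opC_le (t : ℝ) (y : H) : ‖opC D t y‖ ≤ ‖y‖ := by
  simpa [opC] using hD.norm_bcalc_le (isSymbol_symC t) y

theorem norm_opS_le (t : ℝ) (y : H) : ‖opS D t y‖ ≤ |t| * ‖y‖ :=
  hD.norm_bcalc_le (isSymbol_symS t) y

theorem norm_opK_le (t : ℝ) (y : H) : ‖opK D t y‖ ≤ (2 * |t| + 2) * ‖y‖ :=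
  hD.norm_bcalc_le (isSymbol_symK t) y

theorem continuous_opC : Continuous fun p : ℝ × H => opC D p.1 p.2 :=
  hD.continuous_bcalc (B := fun _ => 1) continuous_const (M := 1) isSymbol_symC
    (fun s t x hx => by simpa using abs_symC_sub_mul_le s t hx)

theorem continuous_opS : Continuous fun p : ℝ × H => opS D p.1 p.2 :=
  hD.continuous_bcalc (B := fun t => |t|) continuous_abs (M := 1) isSymbol_symS
    (fun s t x hx => by
      rw [abs_mul, abs_of_pos hx.1, one_mul]
      exact (mul_le_of_le_one_right (abs_nonneg _) hx.2).trans (abs_symS_sub_le s t hx))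

theorem continuous_opK : Continuous fun p : ℝ × H => opK D p.1 p.2 :=
  hD.continuous_bcalc (B := fun t => 2 * |t| + 2) (by fun_prop) (M := 1) isSymbol_symK
    (fun s t x hx => by
      rw [sub_mul, symK_mul s hx, symK_mul t hx, one_mul]
      exact abs_symS_sub_le s t hx)

theorem continuous_opL : Continuous fun p : ℝ × H => opL D p.1 p.2 :=
  hD.continuous_bcalc (B := fun _ => 1) continuous_const (M := 1) isSymbol_symL
    (fun s t x hx => by simpa using abs_symL_sub_mul_le s t hx)

theorem hasDerivAt_opS [NormedSpace ℝ H] [IsScalarTower ℝ ℂ H] (y : H) (t : ℝ) : HasDerivAt (fun t => opS D t y) (opC D t y) t :=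
  hD.hasDerivAt_bcalc (M := 3) isSymbol_symS isSymbol_symC
    (fun s t x hx => by
      have := abs_symS_sub_le s t hx
      nlinarith [abs_nonneg (s - t)])
    (fun s t x hx => abs_symS_taylor_le s t hx) y t

/-- The derivative -√A sin(t√A) is unbounded on H, so the cosine is differentiated on the range of
D, where the factor D turns it into the bounded operator `opL`. -/
theorem hasDerivAt_opC [NormedSpace ℝ H] [IsScalarTower ℝ ℂ H] (y : H) (t : ℝ) :
    HasDerivAt (fun t => opC D t (D y)) (-opL D t y) t := by
  have h := hD.hasDerivAt_bcalc (M := 3) (φ := fun t x => symC t x * x)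
    (φ' := fun t x => -symL t x) (B := fun _ => 1 * 1) (B' := fun _ => 1)
    (fun t => (isSymbol_symC t).mul IsSymbol.id)
    (fun t => ⟨(isSymbol_symL t).cont.neg, fun x hx => by
      rw [abs_neg]; exact (isSymbol_symL t).bound x hx⟩)
    (fun s t x hx => by
      rw [← sub_mul]
      have := abs_symC_sub_mul_le s t hx
      nlinarith [abs_nonneg (s - t)])
    (fun s t x hx => abs_symC_taylor_le s t hx) y t
  have h1 : ∀ t, bcalc D (fun x => symC t x * x) y = opC D t (D y) := fun t => by
    rw [← hD.bcalc_mul (isSymbol_symC t) IsSymbol.id, hD.bcalc_id]; rfl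
  have h2 : bcalc D (fun x => -symL t x) y = -opL D t y := by
    rw [hD.bcalc_congr (ψ := fun x => (-1 : ℝ) * symL t x) (fun x _ => by ring),
      hD.bcalc_const_mul (isSymbol_symL t)]
    simp [opL]
  simp only [h1, h2] at h
  exact h

theorem hasDerivAt_opL [NormedSpace ℝ H] [IsScalarTower ℝ ℂ H] (y : H) (t : ℝ) :
    HasDerivAt (fun t => opL D t (D y)) (opC D t y - D (D (opC D t y))) t := by
  have h := hD.hasDerivAt_bcalc (M := 3) (φ := fun t x => symL t x * x)
    (φ' := fun t x => (1 - x * x) * symC t x) (B := fun _ => 1 * 1) (B' := fun _ => 1 * 1)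
    (fun t => (isSymbol_symL t).mul IsSymbol.id)
    (fun t => isSymbol_one_sub_sq.mul (isSymbol_symC t))
    (fun s t x hx => by
      rw [← sub_mul]
      have := abs_symL_sub_mul_le s t hx
      nlinarith [abs_nonneg (s - t)])
    (fun s t x hx => abs_symL_taylor_le s t hx) y t
  have h1 : ∀ t, bcalc D (fun x => symL t x * x) y = opL D t (D y) := fun t => by
    rw [← hD.bcalc_mul (isSymbol_symL t) IsSymbol.id, hD.bcalc_id]; rfl
  have h2 : bcalc D (fun x => (1 - x * x) * symC t x) y = opC D t y - D (D (opC D t y)) := by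
    rw [← hD.bcalc_mul isSymbol_one_sub_sq (isSymbol_symC t), hD.bcalc_one_sub_sq]; rfl
  simp only [h1, h2] at h
  exact h

end IsBase

end Waves

end AbstractStrichartz

end

/-! ### The metric, its volume and the bounded operator of its form -/

noncomputable section
namespace AbstractStrichartz

/-- The volume density `√(det g)`. -/
def Exterior.density {n : ℕ} (M : Exterior n) (x : Eu n) : ℝ := √(M.g x).det

/-- The inverse metric, acting on complex gradients. -/
def Exterior.cometric {n : ℕ} (M : Exterior n) (x : Eu n) : CVec n →L[ℂ] CVec n :=
  Matrix.toEuclideanCLM (𝕜 := ℂ) (((M.g x)⁻¹).map (fun a : ℝ => (a : ℂ)))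

namespace Exterior

variable {n : ℕ} (M : Exterior n)

theorem continuous_g : Continuous M.g :=
  continuous_matrix fun i j => (M.smooth_g i j).continuous

theorem det_pos (x : Eu n) : 0 < (M.g x).det := (M.posDef_g x).det_pos

theorem density_pos (x : Eu n) : 0 < M.density x := Real.sqrt_pos.2 (M.det_pos x)

theorem continuous_density : Continuous M.density := (M.continuous_g.matrix_det).sqrt

theorem continuous_g_inv : Continuous fun x => (M.g x)⁻¹ := by
  have : (fun x => (M.g x)⁻¹) = fun x => (M.g x).det⁻¹ • (M.g x).adjugate := by
    ext1 x
    rw [Matrix.inv_def, Ring.inverse_eq_inv']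
  rw [this]
  exact (M.continuous_g.matrix_det.inv₀ fun x => (M.det_pos x).ne').smul
    M.continuous_g.matrix_adjugate

theorem continuous_cometric : Continuous M.cometric := by
  have h1 : Continuous fun A : Matrix (Fin n) (Fin n) ℂ =>
      (Matrix.toEuclideanCLM (𝕜 := ℂ) A : CVec n →L[ℂ] CVec n) :=
    LinearMap.continuous_of_finiteDimensional
      (Matrix.toEuclideanCLM (n := Fin n) (𝕜 := ℂ)).toAlgEquiv.toLinearMap
  exact h1.comp (M.continuous_g_inv.matrix_map Complex.continuous_ofReal)

theorem density_eq_one {x : Eu n} (hx : M.R ≤ ‖x‖) : M.density x = 1 := by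
  simp [density, M.g_eq_one x hx]

theorem cometric_eq_one {x : Eu n} (hx : M.R ≤ ‖x‖) : M.cometric x = 1 := by
  rw [cometric, M.g_eq_one x hx, inv_one, Matrix.map_one _ (by simp) (by simp), map_one]

/-- The density is continuous and positive on the compact ball of radius R, and equal to 1 outside.
-/
theorem exists_density_bounds : ∃ c C : ℝ≥0, 0 < c ∧
    ∀ x, (c : ℝ) ≤ M.density x ∧ M.density x ≤ C := by
  have hK := isCompact_closedBall (0 : Eu n) M.R
  obtain ⟨c, hc, hc'⟩ := hK.exists_forall_le' M.continuous_density.continuousOn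
    (a := 0) (fun x _ => M.density_pos x)
  obtain ⟨C, hC⟩ := hK.exists_bound_of_continuousOn M.continuous_density.continuousOn
  refine ⟨(min c 1).toNNReal, (max C 1).toNNReal, by simpa using hc, fun x => ?_⟩
  rw [Real.coe_toNNReal _ (by positivity), Real.coe_toNNReal _ (by positivity)]
  rcases le_total ‖x‖ M.R with h | h
  · have hx : x ∈ Metric.closedBall (0 : Eu n) M.R := by simpa using h
    exact ⟨(min_le_left _ _).trans (hc' x hx),
      ((le_abs_self _).trans (hC x hx)).trans (le_max_left _ _)⟩
  · rw [M.density_eq_one h]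
    exact ⟨min_le_right _ _, le_max_right _ _⟩

theorem inner_cometric (x : Eu n) (ξ η : CVec n) :
    inner ℂ η (M.cometric x ξ) =
      ∑ j, ∑ k, (((M.g x)⁻¹ j k : ℝ) : ℂ) * ξ j * conj (η k) := by
  have hsymm : ∀ j k, (M.g x)⁻¹ j k = (M.g x)⁻¹ k j := fun j k => by
    have h := (M.posDef_g x).inv.isHermitian.apply k j
    simpa using h
  rw [Finset.sum_comm, PiLp.inner_apply]
  refine Finset.sum_congr rfl fun k _ => ?_
  have h1 : (M.cometric x ξ) k = ∑ j, (((M.g x)⁻¹ k j : ℝ) : ℂ) * ξ j := by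
    have := congrFun (Matrix.ofLp_toEuclideanCLM (𝕜 := ℂ)
      (((M.g x)⁻¹).map (fun a : ℝ => (a : ℂ))) ξ) k
    exact this
  rw [h1]
  simp only [RCLike.inner_apply]
  rw [Finset.sum_mul]
  refine Finset.sum_congr rfl fun j _ => ?_
  rw [hsymm j k]

theorem inner_cometric_comm (x : Eu n) (ξ η : CVec n) :
    inner ℂ (M.cometric x ξ) η = inner ℂ ξ (M.cometric x η) := by
  have hsymm : ∀ j k, (M.g x)⁻¹ j k = (M.g x)⁻¹ k j := fun j k => by
    have h := (M.posDef_g x).inv.isHermitian.apply k j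
    simpa using h
  rw [← inner_conj_symm, inner_cometric, inner_cometric, map_sum, Finset.sum_comm]
  rw [Finset.sum_comm]
  conv_rhs => rw [Finset.sum_comm]
  refine Finset.sum_congr rfl fun j _ => ?_
  rw [map_sum]
  refine Finset.sum_congr rfl fun k _ => ?_
  simp only [map_mul, Complex.conj_ofReal, Complex.conj_conj]
  rw [hsymm j k]; ring

theorem inner_cometric_pos (x : Eu n) {ξ : CVec n} (hξ : ξ ≠ 0) :
    0 < (inner ℂ ξ (M.cometric x ξ)).re := by
  have hP := (M.posDef_g x).inv
  have key : (inner ℂ ξ (M.cometric x ξ)).re =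
      (star fun j => (ξ j).re) ⬝ᵥ ((M.g x)⁻¹.mulVec fun j => (ξ j).re) +
      (star fun j => (ξ j).im) ⬝ᵥ ((M.g x)⁻¹.mulVec fun j => (ξ j).im) := by
    rw [inner_cometric, Complex.re_sum]
    simp only [dotProduct, Matrix.mulVec, Finset.mul_sum, Complex.re_sum, ← Finset.sum_add_distrib,
      Pi.star_apply, star_trivial]
    refine Finset.sum_congr rfl fun j _ => Finset.sum_congr rfl fun k _ => ?_
    simp [Complex.mul_re, Complex.mul_im]
    ring
  rw [key]
  have hnn : ∀ v : Fin n → ℝ, 0 ≤ star v ⬝ᵥ (M.g x)⁻¹.mulVec v := fun v =>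
    hP.posSemidef.dotProduct_mulVec_nonneg v
  by_cases h : (fun j => (ξ j).re) = 0
  · have h2 : (fun j => (ξ j).im) ≠ 0 := fun h2 => hξ <| by
      ext j
      exact Complex.ext (congrFun h j) (congrFun h2 j)
    exact add_pos_of_nonneg_of_pos (hnn _) (hP.dotProduct_mulVec_pos h2)
  · exact add_pos_of_pos_of_nonneg (hP.dotProduct_mulVec_pos h) (hnn _)

/-- Compactness of the ball of radius R times the unit sphere gives the lower bound for unit
covectors, homogeneity extends it to all covectors, and beyond R the cometric is the identity. -/
theorem exists_cometric_bounds : ∃ c C : ℝ, 0 < c ∧ 0 ≤ C ∧ ∀ x,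
    ‖M.cometric x‖ ≤ C ∧ ∀ ξ, c * ‖ξ‖ ^ 2 ≤ (inner ℂ ξ (M.cometric x ξ)).re := by
  have hK := isCompact_closedBall (0 : Eu n) M.R
  have hS := isCompact_sphere (0 : CVec n) 1
  obtain ⟨C, hC⟩ := hK.exists_bound_of_continuousOn M.continuous_cometric.continuousOn
  have hcont : Continuous fun p : Eu n × CVec n => (inner ℂ p.2 (M.cometric p.1 p.2)).re :=
    Complex.continuous_re.comp (continuous_snd.inner
      ((M.continuous_cometric.comp continuous_fst).clm_apply continuous_snd))
  obtain ⟨c, hc, hc'⟩ := (hK.prod hS).exists_forall_le' hcont.continuousOn (a := 0)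
    (fun p hp => M.inner_cometric_pos p.1 (by
      have : ‖p.2‖ = 1 := by simpa using hp.2
      intro h0; rw [h0] at this; simp at this))
  refine ⟨min c 1, max C 1, by positivity, by positivity, fun x => ?_⟩
  rcases le_total ‖x‖ M.R with h | h
  · have hx : x ∈ Metric.closedBall (0 : Eu n) M.R := by simpa using h
    refine ⟨(hC x hx).trans (le_max_left _ _), fun ξ => ?_⟩
    rcases eq_or_ne ξ 0 with h0 | h0
    · simp [h0]
    · have hn : 0 < ‖ξ‖ := norm_pos_iff.2 h0
      set e : CVec n := ((‖ξ‖⁻¹ : ℝ) : ℂ) • ξ with he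
      have h1 : ξ = ((‖ξ‖ : ℝ) : ℂ) • e := by
        rw [he, smul_smul, ← Complex.ofReal_mul, mul_inv_cancel₀ hn.ne']; simp
      have h2 : ‖e‖ = 1 := by
        rw [he, norm_smul, Complex.norm_real, norm_inv, norm_norm, inv_mul_cancel₀ hn.ne']
      have h3 := hc' (x, e) ⟨hx, by simpa using h2⟩
      have h4 : (inner ℂ ξ (M.cometric x ξ)).re = ‖ξ‖ ^ 2 * (inner ℂ e (M.cometric x e)).re := by
        conv_lhs => rw [h1]
        rw [map_smul, inner_smul_left, inner_smul_right, Complex.conj_ofReal, Complex.re_ofReal_mul,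
          Complex.re_ofReal_mul]
        ring
      rw [h4, mul_comm]
      have h5 : min c 1 ≤ (inner ℂ e (M.cometric x e)).re := (min_le_left _ _).trans h3
      nlinarith [sq_nonneg ‖ξ‖]
  · rw [M.cometric_eq_one h]
    refine ⟨ContinuousLinearMap.norm_id_le.trans (le_max_right _ _), fun ξ => ?_⟩
    have : (inner ℂ ξ ((1 : CVec n →L[ℂ] CVec n) ξ)).re = ‖ξ‖ ^ 2 :=
      inner_self_eq_norm_sq (𝕜 := ℂ) ξ
    rw [this]
    nlinarith [min_le_right c 1, sq_nonneg ‖ξ‖]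

/-! ### The volume measure -/

variable {D : Set (Eu n)}

theorem gvol_eq (D : Set (Eu n)) :
    gvol M.g D = (volume.restrict D).withDensity fun x => ENNReal.ofReal (M.density x) := rfl

theorem gvol_le : ∃ C : ℝ≥0, ∀ D, gvol M.g D ≤ (C : ℝ≥0∞) • volume.restrict D := by
  obtain ⟨c, C, hc, h⟩ := M.exists_density_bounds
  refine ⟨C, fun D => ?_⟩
  rw [gvol_eq, ← withDensity_const]
  refine withDensity_mono (ae_of_all _ fun x => ?_)
  rw [ENNReal.ofReal_le_iff_le_toReal (by simp)]
  exact (h x).2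

theorem le_gvol : ∃ C : ℝ≥0, ∀ D, volume.restrict D ≤ (C : ℝ≥0∞) • gvol M.g D := by
  obtain ⟨c, C, hc, h⟩ := M.exists_density_bounds
  refine ⟨c⁻¹, fun D => ?_⟩
  have h1 : (c : ℝ≥0∞) • volume.restrict D ≤ gvol M.g D := by
    rw [gvol_eq, ← withDensity_const]
    refine withDensity_mono (ae_of_all _ fun x => ?_)
    rw [ENNReal.le_ofReal_iff_toReal_le (by simp) (M.density_pos x).le]
    exact (h x).1
  calc volume.restrict D = (c⁻¹ : ℝ≥0) • (c • volume.restrict D) := by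
        rw [smul_smul, inv_mul_cancel₀ hc.ne', one_smul]
    _ ≤ _ := by
        rw [ENNReal.smul_def, ENNReal.smul_def]
        gcongr

/-- The density lies between two positive constants, so integrability may be tested with either
measure. -/
theorem memLp_gvol_iff {E : Type*} [NormedAddCommGroup E] {f : Eu n → E} {p : ℝ≥0∞} :
    MemLp f p (gvol M.g D) ↔ MemLp f p (volume.restrict D) := by
  obtain ⟨C, hC⟩ := M.gvol_le
  obtain ⟨C', hC'⟩ := M.le_gvol
  exact ⟨fun h => h.of_measure_le_smul (by simp) (hC' D),
    fun h => h.of_measure_le_smul (by simp) (hC D)⟩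

theorem gvol_ac : gvol M.g D ≪ volume.restrict D := withDensity_absolutelyContinuous _ _

theorem ac_gvol : volume.restrict D ≪ gvol M.g D :=
  withDensity_absolutelyContinuous' (by
    exact (M.continuous_density.measurable.ennreal_ofReal).aemeasurable)
    (ae_of_all _ fun x => (ENNReal.ofReal_pos.2 (M.density_pos x)).ne')

theorem integral_gvol {E : Type*} [NormedAddCommGroup E] [NormedSpace ℝ E] (f : Eu n → E) :
    ∫ x, f x ∂(gvol M.g D) = ∫ x in D, M.density x • f x := by
  rw [gvol_eq, integral_withDensity_eq_integral_toReal_smul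
    M.continuous_density.measurable.ennreal_ofReal (by simp)]
  simp only [ENNReal.toReal_ofReal (M.density_pos _).le]

theorem integral_eq_gvol (f : Eu n → ℂ) :
    ∫ x in D, f x = ∫ x, ((M.density x)⁻¹ : ℝ) * f x ∂(gvol M.g D) := by
  rw [integral_gvol]
  congr 1
  ext1 x
  rw [Complex.real_smul, ← mul_assoc, ← Complex.ofReal_mul, mul_inv_cancel₀ (M.density_pos x).ne']
  simp

theorem isOpen_Ω : IsOpen M.Ω := M.isCompact_K.isClosed.isOpen_compl

theorem measurableSet_Ω : MeasurableSet M.Ω := M.isOpen_Ω.measurableSet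

/-! ### The form as a bounded operator -/

theorem memLp_cometric (μ : Measure (Eu n)) : MemLp M.cometric ∞ μ := by
  obtain ⟨c, C, -, -, h⟩ := M.exists_cometric_bounds
  exact memLp_top_of_bound M.continuous_cometric.aestronglyMeasurable C
    (ae_of_all _ fun x => (h x).1)

/-- Multiplication of complex vector fields by the inverse metric. -/
def cometricOp (μ : Measure (Eu n)) : Lp (CVec n) 2 μ →L[ℂ] Lp (CVec n) 2 μ :=
  (ContinuousLinearMap.id ℂ (CVec n →L[ℂ] CVec n)).holderL μ ∞ 2 2
    ((M.memLp_cometric μ).toLp M.cometric)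

theorem coeFn_cometricOp (μ : Measure (Eu n)) (U : Lp (CVec n) 2 μ) :
    M.cometricOp μ U =ᵐ[μ] fun x => M.cometric x (U x) := by
  have h1 := ContinuousLinearMap.coeFn_holder (r := 2) (ContinuousLinearMap.id ℂ (CVec n →L[ℂ] CVec n))
    ((M.memLp_cometric μ).toLp M.cometric) U
  filter_upwards [h1, (M.memLp_cometric μ).coeFn_toLp] with x h1 h2
  rw [h2] at h1
  exact h1

theorem form_eq_integral (D : Set (Eu n)) (U Φ : Eu n → CVec n) :
    form M.g D U Φ = ∫ x, inner ℂ (Φ x) (M.cometric x (U x)) ∂(gvol M.g D) := by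
  simp only [form, inner_cometric]

theorem form_eq_inner (D : Set (Eu n)) {U Φ : Eu n → CVec n} (hU : MemLp U 2 (gvol M.g D))
    (hΦ : MemLp Φ 2 (gvol M.g D)) :
    form M.g D U Φ = inner ℂ (hΦ.toLp Φ) (M.cometricOp _ (hU.toLp U)) := by
  rw [form_eq_integral, L2.inner_def]
  refine integral_congr_ae ?_
  filter_upwards [hU.coeFn_toLp, hΦ.coeFn_toLp, M.coeFn_cometricOp _ (hU.toLp U)] with x h1 h2 h3
  rw [h2, h3, h1]

theorem form_Lp_eq_inner (D : Set (Eu n)) (U Φ : Lp (CVec n) 2 (gvol M.g D)) :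
    form M.g D U Φ = inner ℂ Φ (M.cometricOp _ U) := by
  rw [M.form_eq_inner D (Lp.memLp U) (Lp.memLp Φ), Lp.toLp_coeFn, Lp.toLp_coeFn]

theorem cometricOp_inner (μ : Measure (Eu n)) (U V : Lp (CVec n) 2 μ) :
    inner ℂ (M.cometricOp μ U) V = inner ℂ U (M.cometricOp μ V) := by
  rw [L2.inner_def, L2.inner_def]
  refine integral_congr_ae ?_
  filter_upwards [M.coeFn_cometricOp _ U, M.coeFn_cometricOp _ V] with x h1 h2
  rw [h1, h2, inner_cometric_comm]

theorem exists_cometricOp_coercive : ∃ c : ℝ, 0 < c ∧ ∀ (μ : Measure (Eu n)) (U : Lp (CVec n) 2 μ),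
    c * ‖U‖ ^ 2 ≤ (inner ℂ U (M.cometricOp μ U)).re := by
  obtain ⟨c, C, hc, -, h⟩ := M.exists_cometric_bounds
  refine ⟨c, hc, fun μ U => ?_⟩
  have h1 : ‖U‖ ^ 2 = ∫ x, ‖U x‖ ^ 2 ∂μ := by
    have h2 := inner_self_eq_norm_sq (𝕜 := ℂ) U
    rw [← h2, L2.inner_def, ← integral_re (L2.integrable_inner U U)]
    exact integral_congr_ae (ae_of_all _ fun x => inner_self_eq_norm_sq (𝕜 := ℂ) (U x))
  have h2 : (inner ℂ U (M.cometricOp μ U)).re = ∫ x, (inner ℂ (U x) (M.cometric x (U x))).re ∂μ := by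
    rw [L2.inner_def, ← RCLike.re_eq_complex_re, ← integral_re (L2.integrable_inner _ _)]
    refine integral_congr_ae ?_
    filter_upwards [M.coeFn_cometricOp _ U] with x hx
    rw [hx]
  rw [h1, h2, ← integral_const_mul]
  refine integral_mono_ae ((Lp.memLp U).norm.integrable_sq.const_mul c) ?_
    (ae_of_all _ fun x => (h x).2 (U x))
  have h3 := (L2.integrable_inner (𝕜 := ℂ) U (M.cometricOp μ U)).re
  refine h3.congr ?_
  filter_upwards [M.coeFn_cometricOp _ U] with x hx
  rw [hx]; rfl

end Exterior

end AbstractStrichartz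

end

/-! ### The form domain, its test functions and its completeness -/

noncomputable section
namespace AbstractStrichartz

section FormBase

variable {H V G : Type*} [NormedAddCommGroup H] [InnerProductSpace ℂ H] [CompleteSpace H]
  [NormedAddCommGroup V] [InnerProductSpace ℂ V] [CompleteSpace V]
  [NormedAddCommGroup G] [InnerProductSpace ℂ G] [CompleteSpace G]

/-- `exists_base` for the form `⟨u, v⟩ + ⟨γ u, A γ v⟩`. -/
theorem exists_base_of_gradient (ι : V →L[ℂ] H) (γ : V →L[ℂ] G) (A : G →L[ℂ] G)
    (hA : ∀ U U', inner ℂ (A U) U' = inner ℂ U (A U')) {c : ℝ} (hc : 0 < c)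
    (hAc : ∀ U, c * ‖U‖ ^ 2 ≤ (inner ℂ U (A U)).re)
    (hn : ∀ v, ‖v‖ ^ 2 = ‖ι v‖ ^ 2 + ‖γ v‖ ^ 2) (hι : DenseRange ι) :
    ∃ (D : H →L[ℂ] H) (W : H →L[ℂ] V) (Z : V →L[ℂ] H), IsBase D ∧ (∀ y, ι (W y) = D y) ∧
      (∀ v, D (Z v) = ι v) ∧
      (∀ y v, inner ℂ (γ v) (A (γ (W y))) = inner ℂ (Z v) (y - D (D y))) ∧
      ∀ v z, inner ℂ (γ (W z)) (A (γ v)) = inner ℂ z (Z v - D (D (Z v))) := by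
  -- E represents the form ⟨u, v⟩ + ⟨γ u, A γ v⟩ with respect to the inner product of V.
  set E : V →L[ℂ] V := ContinuousLinearMap.adjoint ι ∘L ι +
    ContinuousLinearMap.adjoint γ ∘L A ∘L γ with hE
  have hEi : ∀ v w, inner ℂ v (E w) = inner ℂ (ι v) (ι w) + inner ℂ (γ v) (A (γ w)) :=
    fun v w => by
      rw [hE, _root_.add_apply, inner_add_right, ContinuousLinearMap.comp_apply,
        ContinuousLinearMap.comp_apply, ContinuousLinearMap.comp_apply,
        ContinuousLinearMap.adjoint_inner_right, ContinuousLinearMap.adjoint_inner_right]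
  have hEi' : ∀ v w, inner ℂ (E v) w = inner ℂ v (E w) := fun v w => by
    rw [← inner_conj_symm, hEi, hEi, map_add, inner_conj_symm, inner_conj_symm, hA]
  have hEsa : IsSelfAdjoint E := by
    rw [ContinuousLinearMap.isSelfAdjoint_iff_isSymmetric]
    exact hEi'
  have hre : ∀ v, RCLike.re (inner ℂ (E v) v) =
      ‖ι v‖ ^ 2 + (inner ℂ (γ v) (A (γ v))).re := fun v => by
    rw [hEi', hEi, map_add, inner_self_eq_norm_sq]
    rfl
  obtain ⟨D, W, Z, hD, h1, h2, h3, h4⟩ := exists_base ι E hEsa (c := min c 1) (by positivity)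
    (fun v => by
      rw [hre, hn]
      have h2 := hAc (γ v)
      nlinarith [min_le_left c 1, min_le_right c 1, sq_nonneg ‖ι v‖, sq_nonneg ‖γ v‖]) hι
    (fun v => by
      rw [hre]
      have h2 := hAc (γ v)
      nlinarith [sq_nonneg ‖γ v‖])
  refine ⟨D, W, Z, hD, h1, h2, fun y v => ?_, fun v z => ?_⟩
  -- The full form equals ⟨Z v, y⟩ and its L² part equals ⟨Z v, D² y⟩; the difference is the
  -- gradient part. This encodes D^{-2} - 1 as the operator of the gradient form.
  · have h5 := hEi v (W y)
    rw [← hEi', h4, h1, ← h2, hD.inner_left] at h5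
    rw [inner_sub_right, h5]; ring
  · have h5 := hEi (W z) v
    have h6 := h4 z v
    rw [← inner_conj_symm] at h6
    have h7 := congrArg conj h6
    rw [Complex.conj_conj, inner_conj_symm] at h7
    rw [h7, h1, ← h2, hD.inner_left] at h5
    rw [inner_sub_right, h5]; ring

end FormBase

variable {n : ℕ}

/-! ### Gradients -/

theorem grad_apply (φ : Eu n → ℂ) (x : Eu n) (j : Fin n) :
    grad φ x j = fderiv ℝ φ x (EuclideanSpace.single j 1) := rfl

theorem grad_add {φ ψ : Eu n → ℂ} (hφ : Differentiable ℝ φ) (hψ : Differentiable ℝ ψ) (x : Eu n) :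
    grad (fun x => φ x + ψ x) x = grad φ x + grad ψ x := by
  ext j
  simp only [PiLp.add_apply, grad_apply]
  rw [fderiv_fun_add (hφ x) (hψ x)]; rfl

theorem grad_const_mul {φ : Eu n → ℂ} (hφ : Differentiable ℝ φ) (c : ℂ) (x : Eu n) :
    grad (fun x => c * φ x) x = c • grad φ x := by
  ext j
  simp only [PiLp.smul_apply, grad_apply]
  rw [fderiv_const_mul (hφ x)]; rfl

theorem grad_mul {φ ψ : Eu n → ℂ} (hφ : Differentiable ℝ φ) (hψ : Differentiable ℝ ψ) (x : Eu n) :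
    grad (fun x => φ x * ψ x) x = φ x • grad ψ x + ψ x • grad φ x := by
  ext j
  simp only [PiLp.smul_apply, PiLp.add_apply, grad_apply]
  rw [fderiv_fun_mul (hφ x) (hψ x)]; rfl

theorem continuous_grad {φ : Eu n → ℂ} (hφ : ContDiff ℝ ∞ φ) : Continuous (grad φ) := by
  unfold grad
  refine (PiLp.continuous_toLp 2 _).comp (continuous_pi fun j => ?_)
  exact (hφ.continuous_fderiv (by simp)).clm_apply continuous_const

theorem tsupport_grad_subset (φ : Eu n → ℂ) : tsupport (grad φ) ⊆ tsupport φ := by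
  refine closure_minimal (fun x hx => ?_) (isClosed_tsupport φ)
  by_contra h
  apply hx
  have h1 : fderiv ℝ φ x = 0 := by
    by_contra h2
    exact h (support_fderiv_subset ℝ h2)
  ext j
  simp [grad_apply, h1]

theorem hasCompactSupport_grad {φ : Eu n → ℂ} (hφ : HasCompactSupport φ) :
    HasCompactSupport (grad φ) := hφ.mono' ((subset_tsupport _).trans (tsupport_grad_subset φ))

theorem integral_mul_grad {φ ψ : Eu n → ℂ} (hφ : ContDiff ℝ ∞ φ) (hψ : ContDiff ℝ ∞ ψ)
    (hc : HasCompactSupport ψ) (j : Fin n) :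
    ∫ x, φ x * grad ψ x j = -∫ x, grad φ x j * ψ x := by
  have h1 : Continuous fun x => fderiv ℝ φ x (EuclideanSpace.single j 1) :=
    (hφ.continuous_fderiv (by simp)).clm_apply continuous_const
  have h2 : Continuous fun x => fderiv ℝ ψ x (EuclideanSpace.single j 1) :=
    (hψ.continuous_fderiv (by simp)).clm_apply continuous_const
  refine integral_mul_fderiv_eq_neg_fderiv_mul_of_integrable ?_ ?_ ?_ ?_ ?_
  · exact (h1.mul hψ.continuous).integrable_of_hasCompactSupport hc.mul_left
  · exact (hφ.continuous.mul h2).integrable_of_hasCompactSupport (hc.fderiv_apply ℝ _).mul_left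
  · exact (hφ.continuous.mul hψ.continuous).integrable_of_hasCompactSupport hc.mul_left
  · exact fun x _ => (hφ.differentiable (by simp)) x
  · exact fun x _ => (hψ.differentiable (by simp)) x

/-! ### Linear structure of the form domain -/

/-- Classes of test functions stable under the linear operations and contained in `H¹`. -/
structure IsTestClass (D : Set (Eu n)) (𝒯 : Set (Eu n → ℂ)) : Prop where
  add : ∀ φ ∈ 𝒯, ∀ ψ ∈ 𝒯, (fun x => φ x + ψ x) ∈ 𝒯
  const_mul : ∀ φ ∈ 𝒯, ∀ c : ℂ, (fun x => c * φ x) ∈ 𝒯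
  zero : (fun _ => 0) ∈ 𝒯
  smooth : ∀ φ ∈ 𝒯, ContDiff ℝ ∞ φ
  memLp : ∀ φ ∈ 𝒯, MemLp φ 2 (volume.restrict D)
  memLp_grad : ∀ φ ∈ 𝒯, MemLp (grad φ) 2 (volume.restrict D)

theorem IsTestClass.differentiable {D : Set (Eu n)} {𝒯 : Set (Eu n → ℂ)} (h : IsTestClass D 𝒯)
    {φ : Eu n → ℂ} (hφ : φ ∈ 𝒯) : Differentiable ℝ φ :=
  (h.smooth φ hφ).differentiable (by simp)

theorem MemLp.coord {μ : Measure (Eu n)} {U : Eu n → CVec n} (hU : MemLp U 2 μ) (j : Fin n) :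
    MemLp (fun x => U x j) 2 μ :=
  (EuclideanSpace.proj (𝕜 := ℂ) j).comp_memLp' hU

theorem integrable_mul_of_memLp {μ : Measure (Eu n)} {f g : Eu n → ℂ} (hf : MemLp f 2 μ)
    (hg : MemLp g 2 μ) : Integrable (fun x => f x * g x) μ :=
  MemLp.integrable_mul hf hg

namespace Exterior

variable (M : Exterior n) {D : Set (Eu n)} {𝒯 : Set (Eu n → ℂ)} {B : BC}

theorem isH1_add (h𝒯 : IsTestClass D 𝒯) {u v : Eu n → ℂ} {U V : Eu n → CVec n}
    (hu : IsH1 B M.g D 𝒯 u U) (hv : IsH1 B M.g D 𝒯 v V) :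
    IsH1 B M.g D 𝒯 (fun x => u x + v x) (fun x => U x + V x) := by
  refine ⟨hu.1.add hv.1, hu.2.1.add hv.2.1, ?_⟩
  cases B with
  | dirichlet =>
    obtain ⟨φ, hφ, h1, h2⟩ := hu.2.2
    obtain ⟨ψ, hψ, h3, h4⟩ := hv.2.2
    refine ⟨fun k x => φ k x + ψ k x, fun k => h𝒯.add _ (hφ k) _ (hψ k), ?_, ?_⟩
    · refine tendsto_of_tendsto_of_tendsto_of_le_of_le tendsto_const_nhds
        (by simpa using h1.add h3) (fun _ => zero_le) fun k => ?_
      have h5 : (fun x => φ k x + ψ k x - (u x + v x)) =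
        (fun x => φ k x - u x) + fun x => ψ k x - v x := by ext x; simp; ring
      simp only [h5]
      exact eLpNorm_add_le ((h𝒯.smooth _ (hφ k)).continuous.aestronglyMeasurable.sub hu.1.1)
        ((h𝒯.smooth _ (hψ k)).continuous.aestronglyMeasurable.sub hv.1.1) one_le_two
    · refine tendsto_of_tendsto_of_tendsto_of_le_of_le tendsto_const_nhds
        (by simpa using h2.add h4) (fun _ => zero_le) fun k => ?_
      have h5 : (fun x => grad (fun x => φ k x + ψ k x) x - (U x + V x)) =
        (fun x => grad (φ k) x - U x) + fun x => grad (ψ k) x - V x := by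
        ext1 x
        rw [grad_add (h𝒯.differentiable (hφ k)) (h𝒯.differentiable (hψ k))]
        simp only [Pi.add_apply]; abel
      simp only [h5]
      exact eLpNorm_add_le
        ((continuous_grad (h𝒯.smooth _ (hφ k))).aestronglyMeasurable.sub hu.2.1.1)
        ((continuous_grad (h𝒯.smooth _ (hψ k))).aestronglyMeasurable.sub hv.2.1.1) one_le_two
  | neumann =>
    intro φ hφ j
    have h1 := M.memLp_gvol_iff.1 hu.1
    have h2 := M.memLp_gvol_iff.1 hv.1
    have h3 := MemLp.coord (M.memLp_gvol_iff.1 hu.2.1) j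
    have h4 := MemLp.coord (M.memLp_gvol_iff.1 hv.2.1) j
    have h5 := h𝒯.memLp φ hφ
    have h6 := MemLp.coord (h𝒯.memLp_grad φ hφ) j
    simp only [add_mul, PiLp.add_apply]
    rw [integral_add (integrable_mul_of_memLp h1 h6) (integrable_mul_of_memLp h2 h6),
      integral_add (integrable_mul_of_memLp h3 h5) (integrable_mul_of_memLp h4 h5),
      hu.2.2 φ hφ j, hv.2.2 φ hφ j, neg_add]

theorem isH1_const_mul (h𝒯 : IsTestClass D 𝒯) {u : Eu n → ℂ} {U : Eu n → CVec n}
    (hu : IsH1 B M.g D 𝒯 u U) (c : ℂ) :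
    IsH1 B M.g D 𝒯 (fun x => c * u x) (fun x => c • U x) := by
  refine ⟨hu.1.const_smul c, hu.2.1.const_smul c, ?_⟩
  cases B with
  | dirichlet =>
    obtain ⟨φ, hφ, h1, h2⟩ := hu.2.2
    refine ⟨fun k x => c * φ k x, fun k => h𝒯.const_mul _ (hφ k) c, ?_, ?_⟩
    · have h3 := ENNReal.Tendsto.const_mul (a := ‖c‖ₑ) h1 (Or.inr (by simp))
      rw [mul_zero] at h3
      refine h3.congr fun k => ?_
      rw [← eLpNorm_const_smul]
      congr 1
      ext x; simp [mul_sub]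
    · have h3 := ENNReal.Tendsto.const_mul (a := ‖c‖ₑ) h2 (Or.inr (by simp))
      rw [mul_zero] at h3
      refine h3.congr fun k => ?_
      rw [← eLpNorm_const_smul]
      congr 1
      ext1 x
      rw [grad_const_mul (h𝒯.differentiable (hφ k)), Pi.smul_apply, smul_sub]
  | neumann =>
    intro φ hφ j
    simp only [mul_assoc, PiLp.smul_apply, smul_eq_mul]
    rw [integral_const_mul, integral_const_mul, hu.2.2 φ hφ j, mul_neg]

theorem isH1_zero (h𝒯 : IsTestClass D 𝒯) :
    IsH1 B M.g D 𝒯 (fun _ => 0) (fun _ => 0) := by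
  refine ⟨MemLp.zero', MemLp.zero', ?_⟩
  cases B with
  | dirichlet =>
    have h0 : grad (fun _ : Eu n => (0 : ℂ)) = fun _ => 0 := by
      ext x j; simp [grad_apply]
    refine ⟨fun _ _ => 0, fun k => h𝒯.zero, ?_, ?_⟩ <;> simp [h0]
  | neumann => simp

theorem isH1_sum (h𝒯 : IsTestClass D 𝒯) {ι : Type*} (s : Finset ι) {u : ι → Eu n → ℂ}
    {U : ι → Eu n → CVec n} (a : ι → ℂ) (hu : ∀ i ∈ s, IsH1 B M.g D 𝒯 (u i) (U i)) :
    IsH1 B M.g D 𝒯 (fun x => ∑ i ∈ s, a i * u i x) (fun x => ∑ i ∈ s, a i • U i x) := by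
  classical
  induction s using Finset.induction_on with
  | empty => simpa using M.isH1_zero h𝒯
  | insert i s hi ih =>
    simp only [Finset.sum_insert hi]
    exact M.isH1_add h𝒯 (M.isH1_const_mul h𝒯 (hu i (Finset.mem_insert_self _ _)) _)
      (ih fun j hj => hu j (Finset.mem_insert_of_mem hj))

theorem isH1_congr {u v : Eu n → ℂ} {U V : Eu n → CVec n} (hu : IsH1 B M.g D 𝒯 u U)
    (h : u =ᵐ[gvol M.g D] v) (h' : U =ᵐ[gvol M.g D] V) : IsH1 B M.g D 𝒯 v V := by
  refine ⟨(memLp_congr_ae h).1 hu.1, (memLp_congr_ae h').1 hu.2.1, ?_⟩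
  cases B with
  | dirichlet =>
    obtain ⟨φ, hφ, h1, h2⟩ := hu.2.2
    refine ⟨φ, hφ, h1.congr fun k => eLpNorm_congr_ae ?_, h2.congr fun k => eLpNorm_congr_ae ?_⟩
    · filter_upwards [h] with x hx; rw [hx]
    · filter_upwards [h'] with x hx; rw [hx]
  | neumann =>
    intro φ hφ j
    have h1 := M.ac_gvol.ae_le h
    have h2 := M.ac_gvol.ae_le h'
    rw [← integral_congr_ae (f := fun x => u x * grad φ x j), hu.2.2 φ hφ j]
    · congr 1
      refine integral_congr_ae ?_
      filter_upwards [h2] with x hx; rw [hx]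
    · filter_upwards [h1] with x hx; rw [hx]

/-! ### Test functions on the exterior domain -/

theorem isTestClass_testΩ : IsTestClass M.Ω M.testΩ where
  add φ hφ ψ hψ := ⟨hφ.1.add hψ.1, hφ.2.1.add hψ.2.1,
    (tsupport_add φ ψ).trans (union_subset hφ.2.2 hψ.2.2)⟩
  const_mul φ hφ c := ⟨contDiff_const.mul hφ.1, hφ.2.1.mul_left,
    (tsupport_mul_subset_right (f := fun _ => c)).trans hφ.2.2⟩
  zero := ⟨contDiff_const, HasCompactSupport.zero, by
    rw [show (fun _ : Eu n => (0 : ℂ)) = 0 from rfl, tsupport_zero]; exact empty_subset _⟩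
  smooth φ hφ := hφ.1
  memLp φ hφ := (hφ.1.continuous.memLp_of_hasCompactSupport hφ.2.1).restrict _
  memLp_grad φ hφ := ((continuous_grad hφ.1).memLp_of_hasCompactSupport
    (hasCompactSupport_grad hφ.2.1)).restrict _

theorem setIntegral_Ω_of_tsupport {f : Eu n → ℂ} (hf : tsupport f ⊆ M.Ω) :
    ∫ x in M.Ω, f x = ∫ x, f x :=
  setIntegral_eq_integral_of_forall_compl_eq_zero fun x hx =>
    image_eq_zero_of_notMem_tsupport fun h => hx (hf h)

theorem isH1_of_testΩ {φ : Eu n → ℂ} (hφ : φ ∈ M.testΩ) :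
    IsH1 B M.g M.Ω M.testΩ φ (grad φ) := by
  refine ⟨M.memLp_gvol_iff.2 (M.isTestClass_testΩ.memLp φ hφ),
    M.memLp_gvol_iff.2 (M.isTestClass_testΩ.memLp_grad φ hφ), ?_⟩
  cases B with
  | dirichlet => exact ⟨fun _ => φ, fun _ => hφ, by simp, by simp⟩
  | neumann =>
    intro ψ hψ j
    rw [M.setIntegral_Ω_of_tsupport, M.setIntegral_Ω_of_tsupport,
      integral_mul_grad hφ.1 hψ.1 hψ.2.1]
    · exact (tsupport_mul_subset_right (f := fun x => grad φ x j)).trans hψ.2.2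
    · exact (tsupport_mul_subset_left (f := φ)).trans hφ.2.2

end Exterior

/-! ### The form domain as a Hilbert space -/

namespace Exterior

variable (M : Exterior n) (B : BC)

/-- The graph of the weak gradient on the form domain. -/
def H1 : Submodule ℂ (WithLp 2 (M.L2 × M.L2Vec)) where
  carrier := {p | IsH1 B M.g M.Ω M.testΩ p.fst p.snd}
  add_mem' {p q} hp hq := M.isH1_congr (M.isH1_add M.isTestClass_testΩ hp hq)
    (Lp.coeFn_add p.fst q.fst).symm (Lp.coeFn_add p.snd q.snd).symm
  zero_mem' := M.isH1_congr (M.isH1_zero M.isTestClass_testΩ) (Lp.coeFn_zero _ _ _).symm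
    (Lp.coeFn_zero _ _ _).symm
  smul_mem' c p hp := M.isH1_congr (M.isH1_const_mul M.isTestClass_testΩ hp c)
    (Lp.coeFn_smul c p.fst).symm (Lp.coeFn_smul c p.snd).symm

theorem mem_H1 {p : WithLp 2 (M.L2 × M.L2Vec)} :
    p ∈ M.H1 B ↔ IsH1 B M.g M.Ω M.testΩ p.fst p.snd := Iff.rfl

theorem memLp_vol {E : Type*} [NormedAddCommGroup E] (f : Lp E 2 M.vol) :
    MemLp f 2 (volume.restrict M.Ω) := M.memLp_gvol_iff.1 (Lp.memLp f)

theorem form_vol_eq_inner (U Φ : M.L2Vec) :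
    form M.g M.Ω U Φ = inner ℂ Φ (M.cometricOp M.vol U) := M.form_Lp_eq_inner M.Ω U Φ

theorem integral_vol (f : Eu n → ℂ) : ∫ x, f x ∂M.vol = ∫ x in M.Ω, M.density x • f x :=
  M.integral_gvol f

theorem memLp_vol_of_testΩ {φ : Eu n → ℂ} (hφ : φ ∈ M.testΩ) :
    MemLp φ 2 M.vol ∧ MemLp (grad φ) 2 M.vol :=
  ⟨M.memLp_gvol_iff.2 (M.isTestClass_testΩ.memLp _ hφ),
    M.memLp_gvol_iff.2 (M.isTestClass_testΩ.memLp_grad _ hφ)⟩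

/-- With respect to the Riemannian volume this is the inner product with the conjugate of v divided
by the density, which is square integrable because the density is bounded below. -/
theorem continuous_integral_mul {v : Eu n → ℂ} (hv : MemLp v 2 (volume.restrict M.Ω)) :
    Continuous fun f : M.L2 => ∫ x in M.Ω, f x * v x := by
  have hw : MemLp (fun x => conj (((M.density x)⁻¹ : ℝ) * v x)) 2 M.vol := by
    obtain ⟨c, C, hc, h⟩ := M.exists_density_bounds
    have h1 : MemLp (fun x => (((M.density x)⁻¹ : ℝ) : ℂ) * v x) 2 (gvol M.g M.Ω) := by
      refine (M.memLp_gvol_iff.2 hv).of_le_mul (c := (c : ℝ)⁻¹) ?_ (ae_of_all _ fun x => ?_)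
      · exact (Complex.continuous_ofReal.comp (M.continuous_density.inv₀ fun x =>
          (M.density_pos x).ne')).aestronglyMeasurable.mul (M.memLp_gvol_iff.2 hv).1
      · rw [norm_mul, Complex.norm_real, Real.norm_of_nonneg (inv_nonneg.2 (M.density_pos x).le)]
        refine mul_le_mul_of_nonneg_right ?_ (norm_nonneg _)
        exact inv_anti₀ (by exact_mod_cast hc) (h x).1
    exact h1.star
  have heq : ∀ f : M.L2, ∫ x in M.Ω, f x * v x = inner ℂ (hw.toLp _) f := fun f => by
    rw [M.integral_eq_gvol, L2.inner_def]
    refine integral_congr_ae ?_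
    filter_upwards [hw.coeFn_toLp] with x hx
    rw [hx, RCLike.inner_apply, RCLike.conj_conj]
    ring
  simp_rw [heq]
  exact continuous_const.inner continuous_id

theorem continuous_integral_coord_mul {v : Eu n → ℂ} (hv : MemLp v 2 (volume.restrict M.Ω))
    (j : Fin n) : Continuous fun f : M.L2Vec => ∫ x in M.Ω, f x j * v x := by
  refine ((M.continuous_integral_mul hv).comp
    ((EuclideanSpace.proj (𝕜 := ℂ) j).compLpL 2 M.vol).continuous).congr fun f => ?_
  refine integral_congr_ae ?_
  filter_upwards [M.ac_gvol.ae_le ((EuclideanSpace.proj (𝕜 := ℂ) j).coeFn_compLpL (p := 2)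
    (μ := M.vol) f)] with x hx
  rw [hx]; rfl

/-- In the Dirichlet case the graph is the closure of the graph over test functions. In the Neumann
case it is an intersection of zero sets of continuous functionals, one for each test function and
coordinate. -/
theorem isClosed_H1 : IsClosed (M.H1 B : Set (WithLp 2 (M.L2 × M.L2Vec))) := by
  cases B with
  | dirichlet =>
    set S : Set (WithLp 2 (M.L2 × M.L2Vec)) :=
      {p | ∃ φ ∈ M.testΩ, p.fst =ᵐ[M.vol] φ ∧ p.snd =ᵐ[M.vol] grad φ} with hS
    have key : (M.H1 .dirichlet : Set (WithLp 2 (M.L2 × M.L2Vec))) = closure S := by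
      ext p
      rw [mem_closure_iff_seq_limit]
      constructor
      · rintro ⟨-, -, φ, hφ, h1, h2⟩
        have m1 := fun k => (M.memLp_vol_of_testΩ (hφ k)).1
        have m2 := fun k => (M.memLp_vol_of_testΩ (hφ k)).2
        refine ⟨fun k => WithLp.toLp 2 ((m1 k).toLp _, (m2 k).toLp _), fun k =>
          ⟨φ k, hφ k, (m1 k).coeFn_toLp, (m2 k).coeFn_toLp⟩, ?_⟩
        have h3 : Tendsto (fun k => (m1 k).toLp _) atTop (𝓝 p.fst) := by
          rw [Lp.tendsto_Lp_iff_tendsto_eLpNorm']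
          refine h1.congr fun k => eLpNorm_congr_ae ?_
          filter_upwards [(m1 k).coeFn_toLp] with x hx
          rw [Pi.sub_apply, hx]
        have h4 : Tendsto (fun k => (m2 k).toLp _) atTop (𝓝 p.snd) := by
          rw [Lp.tendsto_Lp_iff_tendsto_eLpNorm']
          refine h2.congr fun k => eLpNorm_congr_ae ?_
          filter_upwards [(m2 k).coeFn_toLp] with x hx
          rw [Pi.sub_apply, hx]
        exact ((WithLp.prod_continuous_toLp 2 _ _).tendsto _).comp (h3.prodMk_nhds h4)
      · rintro ⟨q, hq, hlim⟩
        choose φ hφ h1 h2 using hq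
        refine ⟨Lp.memLp _, Lp.memLp _, φ, hφ, ?_, ?_⟩
        · have h3 : Tendsto (fun k => (q k).fst) atTop (𝓝 p.fst) :=
            ((WithLp.fstL 2 ℂ M.L2 M.L2Vec).continuous.tendsto _).comp hlim
          rw [Lp.tendsto_Lp_iff_tendsto_eLpNorm'] at h3
          refine h3.congr fun k => eLpNorm_congr_ae ?_
          filter_upwards [h1 k] with x hx
          rw [Pi.sub_apply, hx]
        · have h3 : Tendsto (fun k => (q k).snd) atTop (𝓝 p.snd) :=
            ((WithLp.sndL 2 ℂ M.L2 M.L2Vec).continuous.tendsto _).comp hlim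
          rw [Lp.tendsto_Lp_iff_tendsto_eLpNorm'] at h3
          refine h3.congr fun k => eLpNorm_congr_ae ?_
          filter_upwards [h2 k] with x hx
          rw [Pi.sub_apply, hx]
    rw [key]
    exact isClosed_closure
  | neumann =>
    have key : (M.H1 .neumann : Set (WithLp 2 (M.L2 × M.L2Vec))) =
        ⋂ φ ∈ M.testΩ, ⋂ j, {p : WithLp 2 (M.L2 × M.L2Vec) |
          ∫ x in M.Ω, p.fst x * grad φ x j = -∫ x in M.Ω, p.snd x j * φ x} := by
      ext p
      simp only [SetLike.mem_coe, mem_H1, mem_iInter, mem_ofPred_eq]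
      exact ⟨fun h => h.2.2, fun h => ⟨Lp.memLp _, Lp.memLp _, h⟩⟩
    rw [key]
    refine isClosed_biInter fun φ hφ => isClosed_iInter fun j => ?_
    have c1 := (M.continuous_integral_mul (MemLp.coord (M.isTestClass_testΩ.memLp_grad φ hφ) j)).comp
      (WithLp.fstL 2 ℂ M.L2 M.L2Vec).continuous
    have c2 := ((M.continuous_integral_coord_mul (M.isTestClass_testΩ.memLp φ hφ) j).comp
      (WithLp.sndL 2 ℂ M.L2 M.L2Vec).continuous).neg
    exact isClosed_eq c1 c2

instance : CompleteSpace (M.H1 B) := (M.isClosed_H1 B).completeSpace_coe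

/-- The inclusion of the form domain in `L²`. -/
def incl : M.H1 B →L[ℂ] M.L2 := (WithLp.fstL 2 ℂ M.L2 M.L2Vec) ∘L (M.H1 B).subtypeL

/-- The weak gradient on the form domain. -/
def gradL : M.H1 B →L[ℂ] M.L2Vec := (WithLp.sndL 2 ℂ M.L2 M.L2Vec) ∘L (M.H1 B).subtypeL

theorem isH1_incl (v : M.H1 B) : IsH1 B M.g M.Ω M.testΩ (M.incl B v) (M.gradL B v) := v.2

theorem exists_H1 {u : Eu n → ℂ} {U : Eu n → CVec n} (h : IsH1 B M.g M.Ω M.testΩ u U) :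
    ∃ v : M.H1 B, M.incl B v =ᵐ[M.vol] u ∧ M.gradL B v =ᵐ[M.vol] U :=
  ⟨⟨WithLp.toLp 2 (h.1.toLp u, h.2.1.toLp U),
    M.isH1_congr h h.1.coeFn_toLp.symm h.2.1.coeFn_toLp.symm⟩, h.1.coeFn_toLp, h.2.1.coeFn_toLp⟩

/-- The range contains all test functions, so for f orthogonal to it the product of f and the
density vanishes as a distribution on the open set Ω. -/
theorem denseRange_incl : DenseRange (M.incl B) := by
  have h : (LinearMap.range (M.incl B).toLinearMap)ᗮ = ⊥ := by
    rw [Submodule.eq_bot_iff]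
    intro f hf
    rw [Submodule.mem_orthogonal] at hf
    have hloc : LocallyIntegrable (fun x => M.density x • f x) (volume.restrict M.Ω) := by
      exact ((M.memLp_vol f).locallyIntegrable (by norm_num)).continuous_smul M.continuous_density
    have h1 : ∀ᵐ x ∂(volume.restrict M.Ω), x ∈ M.Ω → M.density x • f x = 0 := by
      refine M.isOpen_Ω.ae_eq_zero_of_integral_contDiff_smul_eq_zero (hloc.locallyIntegrableOn _)
        fun g hg hgc hgs => ?_
      have hφ : (fun x => (g x : ℂ)) ∈ M.testΩ := by
        refine ⟨Complex.ofRealCLM.contDiff.comp hg, hgc.comp_left Complex.ofReal_zero, ?_⟩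
        refine (closure_mono fun x hx => ?_).trans hgs
        simpa using hx
      obtain ⟨v, hv, -⟩ := M.exists_H1 B (M.isH1_of_testΩ (B := B) hφ)
      have h2 := hf (M.incl B v) ⟨v, rfl⟩
      rw [L2.inner_def] at h2
      rw [← h2, M.integral_vol]
      refine integral_congr_ae ?_
      filter_upwards [M.ac_gvol.ae_le hv] with x hx
      rw [hx, RCLike.inner_apply, Complex.conj_ofReal, Complex.real_smul, Complex.real_smul,
        Complex.real_smul]
      ring
    refine Lp.ext ?_
    refine EventuallyEq.trans ?_ (Lp.coeFn_zero _ _ _).symm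
    have h3 := M.gvol_ac.ae_le (h1.and (ae_restrict_mem M.measurableSet_Ω))
    filter_upwards [h3] with x hx
    exact (smul_eq_zero.1 (hx.1 hx.2)).resolve_left (M.density_pos x).ne'
  exact Submodule.dense_iff_topologicalClosure_eq_top.2
    (Submodule.topologicalClosure_eq_top_iff.2 h)

/-- The operator `(1 - Δ_g)^{-1/2}` with the factorizations through the form domain. -/
theorem exists_wave_base : ∃ (D : M.L2 →L[ℂ] M.L2) (W : M.L2 →L[ℂ] M.H1 B)
    (Z : M.H1 B →L[ℂ] M.L2), IsBase D ∧ (∀ y, M.incl B (W y) = D y) ∧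
      (∀ v, D (Z v) = M.incl B v) ∧
      (∀ y v, form M.g M.Ω (M.gradL B (W y)) (M.gradL B v) = inner ℂ (Z v) (y - D (D y))) ∧
      ∀ v z, form M.g M.Ω (M.gradL B v) (M.gradL B (W z)) = inner ℂ z (Z v - D (D (Z v))) := by
  obtain ⟨c, hc, hG⟩ := M.exists_cometricOp_coercive
  obtain ⟨D, W, Z, hD, h1, h2, h3, h4⟩ := exists_base_of_gradient (M.incl B) (M.gradL B)
    (M.cometricOp M.vol) (M.cometricOp_inner M.vol) hc (hG M.vol)
    (fun v => WithLp.prod_norm_sq_eq_of_L2 (v : WithLp 2 (M.L2 × M.L2Vec))) (M.denseRange_incl B)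
  refine ⟨D, W, Z, hD, h1, h2, fun y v => ?_, fun v z => ?_⟩
  · rw [M.form_vol_eq_inner, h3]
  · rw [M.form_vol_eq_inner, h4]

end Exterior

end AbstractStrichartz

end

noncomputable section
namespace AbstractStrichartz

/-! ### Continuity and measurability in time -/

section Measurability

variable {H : Type*} [NormedAddCommGroup H] [InnerProductSpace ℂ H]

theorem continuous_family_apply {T : ℝ → H →L[ℂ] H} (hT : Continuous fun p : ℝ × H => T p.1 p.2)
    {f : ℝ → ℝ} (hf : Continuous f) (y : H) : Continuous fun t => T (f t) y :=
  hT.comp (hf.prodMk continuous_const)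

theorem aestronglyMeasurable_family_apply {T : ℝ → H →L[ℂ] H}
    (hT : Continuous fun p : ℝ × H => T p.1 p.2) {f : ℝ → ℝ} {F : ℝ → H} {μ : Measure ℝ}
    (hf : Continuous f) (hF : AEStronglyMeasurable F μ) :
    AEStronglyMeasurable (fun s => T (f s) (F s)) μ :=
  hT.comp_aestronglyMeasurable (hf.aestronglyMeasurable.prodMk hF)

variable [CompleteSpace H]
  {D : H →L[ℂ] H} (hD : IsBase D) {f : ℝ → ℝ} {F : ℝ → H} {μ : Measure ℝ}
include hD

theorem IsBase.continuous_opC_time (hf : Continuous f) (y : H) :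
    Continuous fun t => opC D (f t) y :=
  continuous_family_apply (T := opC D) hD.continuous_opC hf y

theorem IsBase.continuous_opS_time (hf : Continuous f) (y : H) :
    Continuous fun t => opS D (f t) y :=
  continuous_family_apply (T := opS D) hD.continuous_opS hf y

theorem IsBase.continuous_opK_time (y : H) : Continuous fun t => opK D t y :=
  continuous_family_apply (T := opK D) hD.continuous_opK continuous_id y

theorem IsBase.continuous_opL_time (y : H) : Continuous fun t => opL D t y :=
  continuous_family_apply (T := opL D) hD.continuous_opL continuous_id y

theorem IsBase.aestronglyMeasurable_opC (hf : Continuous f) (hF : AEStronglyMeasurable F μ) :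
    AEStronglyMeasurable (fun s => opC D (f s) (F s)) μ :=
  aestronglyMeasurable_family_apply (T := opC D) hD.continuous_opC hf hF

theorem IsBase.aestronglyMeasurable_opS (hf : Continuous f) (hF : AEStronglyMeasurable F μ) :
    AEStronglyMeasurable (fun s => opS D (f s) (F s)) μ :=
  aestronglyMeasurable_family_apply (T := opS D) hD.continuous_opS hf hF

theorem IsBase.aestronglyMeasurable_opK (hf : Continuous f) (hF : AEStronglyMeasurable F μ) :
    AEStronglyMeasurable (fun s => opK D (f s) (F s)) μ :=
  aestronglyMeasurable_family_apply (T := opK D) hD.continuous_opK hf hF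

end Measurability

/-! ### Duhamel's formula in a Hilbert space -/

section Hilbert

variable {H : Type*} [NormedAddCommGroup H] [InnerProductSpace ℂ H] [CompleteSpace H]
  [NormedSpace ℝ H]

/-- Integration by parts against the primitive of a merely integrable F: Fubini on the triangle σ ≤
s avoids differentiating the primitive. -/
theorem integral_inner_primitive {b b' : ℝ → H} {F : ℝ → H} {T : ℝ} (hT : 0 ≤ T)
    (hb : ∀ t, HasDerivAt b (b' t) t) (hb' : Continuous b')
    (hF : IntegrableOn F (Ioc 0 T)) :
    ∫ s in (0 : ℝ)..T, inner ℂ (b' s) (∫ σ in (0 : ℝ)..s, F σ) =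
      ∫ s in (0 : ℝ)..T, inner ℂ (b T - b s) (F s) := by
  set μ : Measure ℝ := volume.restrict (Ioc 0 T) with hμ
  have hint : Integrable (Function.uncurry fun s σ : ℝ =>
      {p : ℝ × ℝ | p.2 ≤ p.1}.indicator (fun p => inner ℂ (b' p.1) (F p.2)) (s, σ)) (μ.prod μ) := by
    have h1 : Integrable (fun p : ℝ × ℝ => ‖b' p.1‖ * ‖F p.2‖) (μ.prod μ) :=
      Integrable.mul_prod ((hb'.norm.integrableOn_Icc (a := 0) (b := T)).mono_set Ioc_subset_Icc_self)
        hF.norm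
    have h2 : Integrable (fun p : ℝ × ℝ => inner ℂ (b' p.1) (F p.2)) (μ.prod μ) := by
      refine h1.mono' ?_ (ae_of_all _ fun p => norm_inner_le_norm _ _)
      exact (hb'.aestronglyMeasurable.comp_fst).inner (hF.1.comp_snd)
    exact h2.indicator (measurableSet_le measurable_snd measurable_fst)
  have hswap := integral_integral_swap hint
  rw [intervalIntegral.integral_of_le hT, intervalIntegral.integral_of_le hT]
  calc _ = ∫ s, ∫ σ, {p : ℝ × ℝ | p.2 ≤ p.1}.indicator
        (fun p => inner ℂ (b' p.1) (F p.2)) (s, σ) ∂μ ∂μ := by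
        refine setIntegral_congr_fun measurableSet_Ioc fun s hs => ?_
        rw [intervalIntegral.integral_of_le hs.1.le,
          ← integral_inner (hF.mono_set (Ioc_subset_Ioc_right hs.2))]
        have : ∀ σ, {p : ℝ × ℝ | p.2 ≤ p.1}.indicator (fun p => inner ℂ (b' p.1) (F p.2)) (s, σ) =
            (Iic s).indicator (fun σ => inner ℂ (b' s) (F σ)) σ := fun σ => by
          simp only [indicator_apply, mem_ofPred_eq, mem_Iic]
        simp_rw [this]
        rw [integral_indicator measurableSet_Iic, hμ, Measure.restrict_restrict measurableSet_Iic]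
        congr 2
        ext σ
        simp only [mem_inter_iff, mem_Iic, mem_Ioc]
        exact ⟨fun h => ⟨h.2, h.1, h.2.trans hs.2⟩, fun h => ⟨h.2.1, h.1⟩⟩
    _ = _ := hswap
    _ = _ := by
        refine setIntegral_congr_fun measurableSet_Ioc fun σ hσ => ?_
        have : ∀ s, {p : ℝ × ℝ | p.2 ≤ p.1}.indicator (fun p => inner ℂ (b' p.1) (F p.2)) (s, σ) =
            (Ici σ).indicator (fun s => inner ℂ (b' s) (F σ)) s := fun s => by
          simp only [indicator_apply, mem_ofPred_eq, mem_Ici]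
        simp_rw [this]
        rw [integral_indicator measurableSet_Ici, hμ, Measure.restrict_restrict measurableSet_Ici]
        have h3 : Ici σ ∩ Ioc 0 T = Icc σ T := by
          ext s
          simp only [mem_inter_iff, mem_Ici, mem_Ioc, mem_Icc]
          exact ⟨fun h => ⟨h.1, h.2.2⟩, fun h => ⟨h.1, hσ.1.trans_le h.1, h.2⟩⟩
        rw [h3, integral_Icc_eq_integral_Ioc, ← intervalIntegral.integral_of_le hσ.2]
        have h4 : ∀ s, HasDerivAt (fun s => inner ℂ (b s) (F σ)) (inner ℂ (b' s) (F σ)) s :=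
          fun s => by simpa using (hb s).inner ℂ (hasDerivAt_const s (F σ))
        rw [intervalIntegral.integral_eq_sub_of_hasDerivAt (fun s _ => h4 s)
          ((hb'.inner continuous_const).intervalIntegrable _ _), inner_sub_left]

variable [IsScalarTower ℝ ℂ H]

/-- Weak solutions of `u'' + A u = F` are given by Duhamel's formula. -/
theorem IsBase.duhamel {D : H →L[ℂ] H} (hD : IsBase D) {u ut y F : ℝ → H}
    (hy : Continuous y) (huy : ∀ t, 0 ≤ t → D (y t) = u t)
    (hu : ∀ t, 0 < t → HasDerivAt u (ut t) t) (huc : ContinuousOn u (Ici 0))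
    {T : ℝ} (hT : 0 ≤ T) (hF : IntegrableOn F (Icc 0 T))
    (hweak : ∀ ζ, ∀ t ∈ Icc 0 T, inner ℂ (D ζ) (ut t) - inner ℂ (D ζ) (ut 0) =
      ∫ s in (0 : ℝ)..t, (inner ℂ (D ζ) (F s) - inner ℂ ζ (y s - D (D (y s))))) :
    u T = opC D T (u 0) + opS D T (ut 0) + ∫ s in (0 : ℝ)..T, opS D (T - s) (F s) := by
  set A : ℝ → H := fun s => y s - D (D (y s)) with hA
  have hAc : Continuous A := hy.sub (D.continuous.comp (D.continuous.comp hy))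
  -- Since F is only integrable in time, `ut` need not be differentiable. With G the primitive of F,
  -- the weak equation identifies N with D(ut - G), and N is continuously differentiable.
  set N : ℝ → H := fun t => D (ut 0) - ∫ s in (0 : ℝ)..t, A s with hN
  have hNd : ∀ t, HasDerivAt N (-A t) t := fun t => by
    have := (hAc.integral_hasStrictDerivAt 0 t).hasDerivAt.const_sub (D (ut 0))
    exact this
  set G : ℝ → H := fun t => ∫ s in (0 : ℝ)..t, F s with hG
  have hFi : ∀ t ∈ Icc 0 T, IntervalIntegrable F volume 0 t := fun t ht =>
    (intervalIntegrable_iff_integrableOn_Icc_of_le ht.1).2 (hF.mono_set (Icc_subset_Icc_right ht.2))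
  have hGc : ContinuousOn G (Icc 0 T) := by
    have := intervalIntegral.continuousOn_primitive_interval (f := F) (a := 0) (b := T)
      (μ := volume) (by rwa [uIcc_of_le hT])
    rwa [uIcc_of_le hT] at this
  have hNeq : ∀ t ∈ Icc 0 T, N t = D (ut t) - D (G t) := by
    intro t ht
    refine ext_inner_left ℂ fun ζ => ?_
    have h1 := hweak ζ t ht
    have i1 : IntervalIntegrable (fun s => inner ℂ (D ζ) (F s)) volume 0 t :=
      ⟨(hFi t ht).1.const_inner _, (hFi t ht).2.const_inner _⟩
    have i2 : IntervalIntegrable (fun s => inner ℂ ζ (A s)) volume 0 t :=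
      (continuous_const.inner hAc).intervalIntegrable _ _
    have e1 : ∫ s in (0 : ℝ)..t, inner ℂ (D ζ) (F s) = inner ℂ (D ζ) (G t) := by
      rw [intervalIntegral.integral_of_le ht.1, hG]
      simp only
      rw [intervalIntegral.integral_of_le ht.1, integral_inner (hFi t ht).1]
    have e2 : ∫ s in (0 : ℝ)..t, inner ℂ ζ (A s) = inner ℂ ζ (∫ s in (0 : ℝ)..t, A s) := by
      rw [intervalIntegral.integral_of_le ht.1, intervalIntegral.integral_of_le ht.1,
        integral_inner (hAc.intervalIntegrable 0 t).1]
    rw [intervalIntegral.integral_sub i1 i2, e1, e2, hD.inner_left, hD.inner_left, hD.inner_left] at h1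
    rw [hN]
    simp only [inner_sub_right]
    linear_combination -h1
  have hSF : IntervalIntegrable (fun s => opS D (T - s) (F s)) volume 0 T := by
    rw [intervalIntegrable_iff_integrableOn_Icc_of_le hT]
    refine (hF.norm.const_mul T).mono' ?_ ?_
    · exact hD.aestronglyMeasurable_opS (by fun_prop) hF.1
    · refine (ae_restrict_iff' measurableSet_Icc).2 (ae_of_all _ fun s hs => ?_)
      refine (hD.norm_opS_le _ _).trans ?_
      rw [abs_of_nonneg (by linarith [hs.2])]
      exact mul_le_mul_of_nonneg_right (by linarith [hs.1]) (norm_nonneg _)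
  apply hD.inj
  refine ext_inner_left ℂ fun ξ => ?_
  have hsub : ∀ s : ℝ, HasDerivAt (fun s => T - s) (-1) s := fun s => by
    simpa using (hasDerivAt_id s).const_sub T
  have dS : ∀ η s, HasDerivAt (fun s => opS D (T - s) η) (-opC D (T - s) η) s := fun η s => by
    have := (hD.hasDerivAt_opS η (T - s)).scomp s (hsub s)
    simpa [Function.comp_def] using this
  have dC : ∀ s, HasDerivAt (fun s => opC D (T - s) (D ξ)) (opL D (T - s) ξ) s := fun s => by
    have := (hD.hasDerivAt_opC ξ (T - s)).scomp s (hsub s)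
    simpa [Function.comp_def] using this
  have cC : ∀ η, Continuous fun s => opC D (T - s) η := fun η =>
    hD.continuous_opC_time (by fun_prop) η
  -- The solution is paired with a homogeneous one running backwards from T. With D ut in place of N
  -- and F = 0 the pairing would be constant; with N its derivative involves G alone.
  set Φ : ℝ → ℂ := fun s => inner ℂ (opS D (T - s) ξ) (N s) + inner ℂ (opC D (T - s) (D ξ)) (u s)
    with hΦ
  have hΦd : ∀ s ∈ Ioo 0 T, HasDerivAt Φ (inner ℂ (opC D (T - s) (D ξ)) (G s)) s := by
    intro s hs
    have h1 := ((dS ξ s).inner ℂ (hNd s)).add ((dC s).inner ℂ (hu s hs.1))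
    refine h1.congr_deriv ?_
    have hs' : s ∈ Icc 0 T := ⟨hs.1.le, hs.2.le⟩
    rw [hNeq s hs', ← huy s hs.1.le, hA]
    simp only [inner_neg_left, inner_neg_right, inner_sub_right]
    have e1 : inner ℂ (opL D (T - s) ξ) (D (y s)) = inner ℂ (opS D (T - s) ξ) (y s) -
        inner ℂ (opS D (T - s) ξ) (D (D (y s))) := by
      rw [← hD.inner_left, hD.base_opL, inner_sub_left, hD.inner_left, hD.inner_left]
    rw [e1, hD.opC_base, hD.inner_left, hD.inner_left]
    ring
  have hNc : Continuous N := continuous_iff_continuousAt.2 fun t => (hNd t).continuousAt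
  have hΦc : ContinuousOn Φ (Icc 0 T) := by
    refine ContinuousOn.add (Continuous.continuousOn ?_) ?_
    · exact (continuous_iff_continuousAt.2 fun s => (dS ξ s).continuousAt).inner hNc
    · exact (cC _).continuousOn.inner (huc.mono Icc_subset_Ici_self)
  have hint := intervalIntegral.integral_eq_sub_of_hasDerivAt_of_le hT hΦc hΦd (by
    rw [intervalIntegrable_iff_integrableOn_Icc_of_le hT]
    exact ((cC _).continuousOn.inner hGc).integrableOn_Icc)
  -- This passes from the primitive G back to F and produces the kernel S(T - s).
  have hparts := integral_inner_primitive (F := F) hT (fun s => dS (D ξ) s) (cC _).neg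
    (hF.mono_set Ioc_subset_Icc_self)
  have hN0 : N 0 = D (ut 0) := by simp [hN]
  simp only [sub_self, hD.opS_zero, zero_sub, inner_neg_left, intervalIntegral.integral_neg,
    neg_inj] at hparts
  rw [hparts] at hint
  simp only [hΦ, sub_self, sub_zero, hD.opS_zero, hD.opC_zero, inner_zero_left, zero_add, hN0]
    at hint
  have e3 : ∫ s in (0 : ℝ)..T, inner ℂ (opS D (T - s) (D ξ)) (F s) =
      inner ℂ (D ξ) (∫ s in (0 : ℝ)..T, opS D (T - s) (F s)) := by
    rw [intervalIntegral.integral_of_le hT, intervalIntegral.integral_of_le hT,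
      ← integral_inner hSF.1]
    congr 1
    ext1 s
    rw [hD.inner_opS]
  rw [e3] at hint
  rw [← hD.inner_left, ← hD.inner_left, inner_add_right, inner_add_right, ← hD.inner_opC,
    ← hD.inner_opS, hint, hD.opS_base, hD.inner_left (opS D T ξ)]
  ring

end Hilbert

/-! ### Finite energy solutions and the propagators -/

section Solutions

variable {n : ℕ} (M : Exterior n) (B : BC)

/-- The operator `(1 - Δ_g)^{-1/2}` with its factorizations through the form domain. -/
structure WaveBase where
  D : M.L2 →L[ℂ] M.L2
  W : M.L2 →L[ℂ] M.H1 B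
  Z : M.H1 B →L[ℂ] M.L2
  base : IsBase D
  incl_W : ∀ y, M.incl B (W y) = D y
  base_Z : ∀ v, D (Z v) = M.incl B v
  form_W : ∀ y v, form M.g M.Ω (M.gradL B (W y)) (M.gradL B v) = inner ℂ (Z v) (y - D (D y))
  form_W' : ∀ v z, form M.g M.Ω (M.gradL B v) (M.gradL B (W z)) = inner ℂ z (Z v - D (D (Z v)))

instance : Nonempty (WaveBase M B) := by
  obtain ⟨D, W, Z, h1, h2, h3, h4, h5⟩ := M.exists_wave_base B
  exact ⟨⟨D, W, Z, h1, h2, h3, h4, h5⟩⟩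

variable {M B}

theorem integral_mul_conj_eq_inner (f : M.L2) {φ : Eu n → ℂ} {v : M.L2} (hv : v =ᵐ[M.vol] φ) :
    ∫ x, f x * conj (φ x) ∂M.vol = inner ℂ v f := by
  rw [L2.inner_def]
  refine integral_congr_ae ?_
  filter_upwards [hv] with x hx
  rw [hx, RCLike.inner_apply]

theorem form_congr_right {M : Exterior n} (U : Eu n → CVec n) {Φ Ψ : Eu n → CVec n}
    (h : Φ =ᵐ[M.vol] Ψ) : form M.g M.Ω U Φ = form M.g M.Ω U Ψ := by
  unfold form
  refine integral_congr_ae ?_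
  filter_upwards [show Φ =ᵐ[gvol M.g M.Ω] Ψ from h] with x hx
  rw [hx]

/-- The homogeneous solution with data `(v, g)`. -/
def WaveBase.sol (w : WaveBase M B) (v : M.H1 B) (g : M.L2) : Solution M B univ 0 where
  u t := opC w.D t (M.incl B v) + opS w.D t g
  ut t := opC w.D t g - opL w.D t (w.Z v)
  -- Since u(t) = D(C(t)Z v + K(t)g), applying W to the vector in brackets gives the element of the
  -- form domain over u(t), and the gradient is read off there.
  gradu t := M.gradL B (w.W (opC w.D t (w.Z v) + opK w.D t g))
  mem_H1 t _ := by
    have h : M.incl B (w.W (opC w.D t (w.Z v) + opK w.D t g)) =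
        opC w.D t (M.incl B v) + opS w.D t g := by
      rw [w.incl_W, map_add, ← w.base.opC_base, w.base_Z, w.base.base_opK]
    rw [← h]
    exact M.isH1_incl B _
  continuousOn_gradu := by
    have h1 := (w.base.continuous_opC_time continuous_id (w.Z v)).add
      (w.base.continuous_opK_time g)
    have h2 : Continuous fun y => M.gradL B (w.W y) := (M.gradL B ∘L w.W).continuous
    exact (h2.comp h1).continuousOn
  hasDeriv t _ := by
    refine HasDerivAt.hasDerivWithinAt ?_
    have h := (w.base.hasDerivAt_opC (w.Z v) t).add (w.base.hasDerivAt_opS g t)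
    rw [w.base_Z, neg_add_eq_sub] at h
    exact h
  continuousOn_ut := by
    exact ((w.base.continuous_opC_time continuous_id g).sub
      (w.base.continuous_opL_time (w.Z v))).continuousOn
  weak φ Φ hφ t _ := by
    obtain ⟨p, hp, hP⟩ := M.exists_H1 B hφ
    rw [integral_mul_conj_eq_inner _ hp, integral_mul_conj_eq_inner _ hp]
    have h0 : ∀ s : ℝ, ∫ x, ((0 : ℝ → M.L2) s) x * conj (φ x) ∂M.vol = 0 := fun s => by
      rw [integral_mul_conj_eq_inner _ hp, Pi.zero_apply, inner_zero_right]
    simp_rw [h0, ← form_congr_right _ hP, w.form_W, ← w.base_Z p, w.base.inner_left]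
    set y : ℝ → M.L2 := fun s => opC w.D s (w.Z v) + opK w.D s g with hy
    -- Writing the test function as D(Z p) moves one factor D onto `ut`, which makes the pairing
    -- differentiable; the weak equation is then the fundamental theorem of calculus.
    have hd : ∀ s, HasDerivAt (fun s => inner ℂ (w.Z p) (w.D (opC w.D s g - opL w.D s (w.Z v))))
        (0 - inner ℂ (w.Z p) (y s - w.D (w.D (y s)))) s := fun s => by
      have h1 := (w.base.hasDerivAt_opC g s).sub (w.base.hasDerivAt_opL (w.Z v) s)
      have h2 := (hasDerivAt_const s (w.Z p)).inner ℂ h1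
      simp only [w.base.opC_base, w.base.opL_base, Pi.sub_apply, ← map_sub] at h2
      refine h2.congr_deriv ?_
      rw [inner_zero_left, add_zero, zero_sub, ← inner_neg_right, w.base.opL_eq, hy]
      congr 1
      simp only [map_add]
      abel
    have hyc : Continuous y :=
      (w.base.continuous_opC_time continuous_id (w.Z v)).add (w.base.continuous_opK_time g)
    have hc : Continuous fun s => (0 : ℂ) - inner ℂ (w.Z p) (y s - w.D (w.D (y s))) :=
      continuous_const.sub (continuous_const.inner
        (hyc.sub (w.D.continuous.comp (w.D.continuous.comp hyc))))
    exact (intervalIntegral.integral_eq_sub_of_hasDerivAt (fun s _ => hd s)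
      (hc.intervalIntegrable _ _)).symm

theorem WaveBase.sol_u (w : WaveBase M B) (v : M.H1 B) (g : M.L2) (t : ℝ) :
    (w.sol v g).u t = opC w.D t (M.incl B v) + opS w.D t g := rfl

theorem WaveBase.sol_u_zero (w : WaveBase M B) (v : M.H1 B) (g : M.L2) :
    (w.sol v g).u 0 = M.incl B v := by
  rw [w.sol_u, w.base.opC_zero, w.base.opS_zero, add_zero]

theorem WaveBase.sol_ut_zero (w : WaveBase M B) (v : M.H1 B) (g : M.L2) :
    (w.sol v g).ut 0 = g := by
  change opC w.D 0 g - opL w.D 0 (w.Z v) = g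
  rw [w.base.opC_zero, w.base.opL_zero, sub_zero]

/-- Duhamel's formula for finite energy weak solutions. -/
theorem WaveBase.duhamel (w : WaveBase M B) {F : ℝ → M.L2} (hF : LocallyIntegrableOn F (Ici 0))
    (s : Solution M B (Ici 0) F) : (∃ v, M.incl B v = s.u 0) ∧ ∀ T, 0 ≤ T →
    s.u T = opC w.D T (s.u 0) + opS w.D T (s.ut 0) + ∫ t in (0 : ℝ)..T, opS w.D (T - t) (F t) := by
  have huc : ContinuousOn s.u (Ici 0) := fun t ht => (s.hasDeriv t ht).continuousWithinAt
  -- Freezing the solution at its initial value for negative times makes it continuous on all of ℝ.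
  set p : ℝ → M.H1 B := fun t => ⟨WithLp.toLp 2 (s.u (max t 0), s.gradu (max t 0)),
    s.mem_H1 (max t 0) (le_max_right t 0)⟩ with hp
  have hmax : Continuous fun t : ℝ => max t 0 := by fun_prop
  have hpc : Continuous p := by
    refine Continuous.subtype_mk ((WithLp.prod_continuous_toLp 2 _ _).comp ?_) _
    exact (huc.comp_continuous hmax fun t => le_max_right t 0).prodMk
      (s.continuousOn_gradu.comp_continuous hmax fun t => le_max_right t 0)
  have hpi : ∀ t, 0 ≤ t → M.incl B (p t) = s.u t := fun t ht => by
    change s.u (max t 0) = s.u t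
    rw [max_eq_left ht]
  have hpg : ∀ t, 0 ≤ t → M.gradL B (p t) = s.gradu t := fun t ht => by
    change s.gradu (max t 0) = s.gradu t
    rw [max_eq_left ht]
  refine ⟨⟨p 0, hpi 0 le_rfl⟩, fun T hT => ?_⟩
  refine w.base.duhamel (ut := s.ut) (y := fun t => w.Z (p t)) (w.Z.continuous.comp hpc)
    (fun t ht => by rw [w.base_Z, hpi t ht])
    (fun t ht => (s.hasDeriv t ht.le).hasDerivAt (Ici_mem_nhds ht)) huc hT
    (hF.integrableOn_compact_subset Icc_subset_Ici_self isCompact_Icc) fun ζ t ht => ?_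
  have h1 := s.weak _ _ (M.isH1_incl B (w.W ζ)) t ht.1
  rw [integral_mul_conj_eq_inner _ EventuallyEq.rfl, integral_mul_conj_eq_inner _ EventuallyEq.rfl,
    w.incl_W] at h1
  rw [h1]
  refine intervalIntegral.integral_congr fun r hr => ?_
  rw [uIcc_of_le ht.1] at hr
  rw [integral_mul_conj_eq_inner (F r) (v := w.D ζ) EventuallyEq.rfl,
    ← hpg r hr.1, w.form_W']

end Solutions

end AbstractStrichartz

end

noncomputable section
namespace AbstractStrichartz

/-! ### Interpolation of weighted L² norms -/

section Interpolation

variable {α β : Type*} [MeasurableSpace α] [MeasurableSpace β] {μ : Measure α} {ν : Measure β}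

theorem lintegral_rpowIntegrand {σ w : ℝ} (hσ : σ ∈ Ioo (0 : ℝ) 1) (hw : 0 ≤ w) :
    ∫⁻ t in Ioi (0 : ℝ), ENNReal.ofReal (Real.rpowIntegrand₀₁ σ t w) =
      ENNReal.ofReal (w ^ σ) *
        ENNReal.ofReal (∫ t in Ioi (0 : ℝ), Real.rpowIntegrand₀₁ σ t 1) := by
  rw [← ofReal_integral_eq_lintegral_ofReal (Real.integrableOn_rpowIntegrand₀₁_Ioi hσ hw),
    Real.integral_rpowIntegrand₀₁_eq_rpow_mul_const hσ hw, ENNReal.ofReal_mul (by positivity)]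
  exact ae_restrict_of_forall_mem measurableSet_Ioi fun t ht =>
    Real.rpowIntegrand₀₁_nonneg hσ.1 (le_of_lt ht) hw

theorem measurable_rpowIntegrand {σ : ℝ} :
    Measurable fun p : ℝ × ℝ => Real.rpowIntegrand₀₁ σ p.1 p.2 := by
  unfold Real.rpowIntegrand₀₁
  fun_prop

/-- For 0 < σ < 1, the power w^σ is a multiple of ∫ t^{σ-2} · t w/(t + w) dt over t > 0, so powers
are mixtures of parallel sums with constants. Tonelli transfers this to the weighted integrals. -/
theorem lintegral_rpow_mul_eq [SFinite μ] {w : α → ℝ} {c : α → ℝ≥0∞} (hw : Measurable w)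
    (hw0 : ∀ x, 0 ≤ w x) (hc : AEMeasurable c μ) {σ : ℝ} (hσ : σ ∈ Ioo (0 : ℝ) 1) :
    ENNReal.ofReal (∫ t in Ioi (0 : ℝ), Real.rpowIntegrand₀₁ σ t 1) *
        ∫⁻ x, ENNReal.ofReal (w x ^ σ) * c x ∂μ =
      ∫⁻ t in Ioi (0 : ℝ), ENNReal.ofReal (t ^ (σ - 2)) *
        ∫⁻ x, ENNReal.ofReal (t * w x / (t + w x)) * c x ∂μ := by
  set κ := ENNReal.ofReal (∫ t in Ioi (0 : ℝ), Real.rpowIntegrand₀₁ σ t 1)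
  have h1 : κ * ∫⁻ x, ENNReal.ofReal (w x ^ σ) * c x ∂μ =
      ∫⁻ x, (∫⁻ t in Ioi (0 : ℝ), ENNReal.ofReal (Real.rpowIntegrand₀₁ σ t (w x)) * c x) ∂μ := by
    rw [← lintegral_const_mul'' _ (by fun_prop)]
    refine lintegral_congr fun x => ?_
    rw [lintegral_mul_const'' _ , lintegral_rpowIntegrand hσ (hw0 x)]
    · ring
    · exact (measurable_rpowIntegrand.comp
        (measurable_id.prodMk measurable_const)).ennreal_ofReal.aemeasurable
  rw [h1, lintegral_lintegral_swap]
  · refine setLIntegral_congr_fun measurableSet_Ioi fun t (ht : 0 < t) => ?_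
    rw [← lintegral_const_mul'' _ (by fun_prop)]
    refine lintegral_congr fun x => ?_
    rw [← mul_assoc, ← ENNReal.ofReal_mul (by positivity),
      Real.rpowIntegrand₀₁_eq_pow_div hσ ht.le (hw0 x)]
    congr 2
    rw [mul_div_assoc', ← mul_assoc, ← Real.rpow_add_one ht.ne']
    ring_nf
  · refine AEMeasurable.mul ?_ hc.comp_fst
    exact (measurable_rpowIntegrand.comp (measurable_snd.prodMk
      (hw.comp measurable_fst))).ennreal_ofReal.aemeasurable

/-- The endpoint σ = 0: divide by t and let t → 0. Then w/(t + w) tends to 1 wherever w > 0, and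
Fatou's lemma applies. -/
theorem lintegral_le_of_forall_parallel {w : α → ℝ} {c : α → ℝ≥0∞}
    (hw : Measurable w) (hw0 : ∀ᵐ x ∂μ, 0 < w x) (hc : AEMeasurable c μ) {w' : β → ℝ}
    {c' : β → ℝ≥0∞} (hw0' : ∀ y, 0 ≤ w' y) {C : ℝ≥0∞}
    (h : ∀ t, 0 < t → ∫⁻ x, ENNReal.ofReal (t * w x / (t + w x)) * c x ∂μ ≤
      C * ∫⁻ y, ENNReal.ofReal (t * w' y / (t + w' y)) * c' y ∂ν) :
    ∫⁻ x, c x ∂μ ≤ C * ∫⁻ y, c' y ∂ν := by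
  have key : ∀ t, 0 < t → ∫⁻ x, ENNReal.ofReal (w x / (t + w x)) * c x ∂μ ≤
      C * ∫⁻ y, c' y ∂ν := fun t ht => by
    have h1 : ∫⁻ x, ENNReal.ofReal (w x / (t + w x)) * c x ∂μ =
        ENNReal.ofReal t⁻¹ * ∫⁻ x, ENNReal.ofReal (t * w x / (t + w x)) * c x ∂μ := by
      rw [← lintegral_const_mul'' _ (by fun_prop)]
      refine lintegral_congr fun x => ?_
      rw [← mul_assoc, ← ENNReal.ofReal_mul (by positivity)]
      congr 2
      field_simp
    rw [h1]
    refine (mul_le_mul_right (h t ht) _).trans ?_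
    rw [mul_left_comm, ← lintegral_const_mul' _ _ ENNReal.ofReal_ne_top]
    refine mul_le_mul_right (lintegral_mono fun y => ?_) _
    rw [← mul_assoc, ← ENNReal.ofReal_mul (by positivity)]
    refine mul_le_of_le_one_left (zero_le) (ENNReal.ofReal_le_one.2 ?_)
    rw [mul_div_assoc, inv_mul_cancel_left₀ ht.ne']
    exact div_le_one_of_le₀ (by linarith) (by linarith [hw0' y])
  have hlim : Tendsto (fun k : ℕ => (1 : ℝ) / (k + 1)) atTop (𝓝 0) :=
    tendsto_one_div_add_atTop_nhds_zero_nat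
  calc ∫⁻ x, c x ∂μ ≤ ∫⁻ x, liminf (fun k : ℕ =>
        ENNReal.ofReal (w x / ((1 : ℝ) / (k + 1) + w x)) * c x) atTop ∂μ := by
        refine lintegral_mono_ae ?_
        filter_upwards [hw0] with x hx
        have h1 : Tendsto (fun k : ℕ => ENNReal.ofReal (w x / ((1 : ℝ) / (k + 1) + w x)) * c x)
            atTop (𝓝 (ENNReal.ofReal (w x / (0 + w x)) * c x)) := by
          refine ENNReal.Tendsto.mul_const (ENNReal.tendsto_ofReal ?_) ?_
          · exact tendsto_const_nhds.div (hlim.add tendsto_const_nhds) (by simpa using hx.ne')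
          · simp [div_self hx.ne']
        rw [zero_add, div_self hx.ne', ENNReal.ofReal_one, one_mul] at h1
        exact h1.liminf_eq.ge
    _ ≤ liminf (fun k : ℕ => ∫⁻ x, ENNReal.ofReal (w x / ((1 : ℝ) / (k + 1) + w x)) * c x ∂μ)
        atTop := lintegral_liminf_le' fun k => by fun_prop
    _ ≤ C * ∫⁻ y, c' y ∂ν :=
        liminf_le_of_le (by isBoundedDefault) fun b hb => by
          obtain ⟨k, hk⟩ := hb.exists
          exact hk.trans (key _ (by positivity))

/-- The endpoint σ = 1: as t → ∞ the parallel sum of t and w tends to w, and it never exceeds w. -/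
theorem lintegral_mul_le_of_forall_parallel {w : α → ℝ} {c : α → ℝ≥0∞}
    (hw : Measurable w) (hw0 : ∀ x, 0 ≤ w x) (hc : AEMeasurable c μ) {w' : β → ℝ}
    {c' : β → ℝ≥0∞} (hw0' : ∀ y, 0 ≤ w' y) {C : ℝ≥0∞}
    (h : ∀ t, 0 < t → ∫⁻ x, ENNReal.ofReal (t * w x / (t + w x)) * c x ∂μ ≤
      C * ∫⁻ y, ENNReal.ofReal (t * w' y / (t + w' y)) * c' y ∂ν) :
    ∫⁻ x, ENNReal.ofReal (w x) * c x ∂μ ≤ C * ∫⁻ y, ENNReal.ofReal (w' y) * c' y ∂ν := by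
  calc ∫⁻ x, ENNReal.ofReal (w x) * c x ∂μ ≤ ∫⁻ x, liminf (fun k : ℕ =>
        ENNReal.ofReal ((k + 1 : ℝ) * w x / ((k + 1 : ℝ) + w x)) * c x) atTop ∂μ := by
        refine lintegral_mono fun x => ?_
        have hlim : Tendsto (fun k : ℕ => w x / (1 + w x * ((1 : ℝ) / (k + 1)))) atTop
            (𝓝 (w x / (1 + w x * 0))) :=
          tendsto_const_nhds.div (tendsto_const_nhds.add
            (tendsto_one_div_add_atTop_nhds_zero_nat.const_mul _)) (by simp)
        have h2 : (fun k : ℕ => w x / (1 + w x * ((1 : ℝ) / (k + 1)))) =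
            fun k : ℕ => (k + 1 : ℝ) * w x / ((k + 1 : ℝ) + w x) := by
          funext k
          have : (0 : ℝ) < k + 1 := by positivity
          have := hw0 x
          field_simp
        rw [mul_zero, add_zero, div_one, h2] at hlim
        rcases (hw0 x).eq_or_lt with h0 | h0
        · simp [← h0]
        · have := ENNReal.Tendsto.mul_const (b := c x) (ENNReal.tendsto_ofReal hlim)
            (Or.inl (by simpa using h0))
          exact this.liminf_eq.ge
    _ ≤ liminf (fun k : ℕ =>
        ∫⁻ x, ENNReal.ofReal ((k + 1 : ℝ) * w x / ((k + 1 : ℝ) + w x)) * c x ∂μ)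
        atTop := lintegral_liminf_le' fun k => by fun_prop
    _ ≤ C * ∫⁻ y, ENNReal.ofReal (w' y) * c' y ∂ν :=
        liminf_le_of_le (by isBoundedDefault) fun b hb => by
          obtain ⟨k, hk⟩ := hb.exists
          refine hk.trans ((h _ (by positivity)).trans ?_)
          refine mul_le_mul_right (lintegral_mono fun y => ?_) _
          refine mul_le_mul_left (ENNReal.ofReal_le_ofReal ?_) _
          have h1 := hw0' y
          have h2 : (0 : ℝ) < k + 1 := by positivity
          rw [div_le_iff₀ (by positivity)]
          nlinarith [mul_nonneg h1 h1]

/-- Interpolation of weighted `L²` estimates: an estimate for the parallel sums `t w / (t + w)` of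
the weights with all constants `t` implies the estimate for their powers. -/
theorem lintegral_rpow_le_of_forall_parallel [SFinite μ] [SFinite ν] {w : α → ℝ} {c : α → ℝ≥0∞}
    (hw : Measurable w) (hw0 : ∀ x, 0 ≤ w x) (hw1 : ∀ᵐ x ∂μ, 0 < w x) (hc : AEMeasurable c μ)
    {w' : β → ℝ} {c' : β → ℝ≥0∞} (hw' : Measurable w') (hw0' : ∀ y, 0 ≤ w' y)
    (hc' : AEMeasurable c' ν) {C : ℝ≥0}
    (h : ∀ t, 0 < t → ∫⁻ x, ENNReal.ofReal (t * w x / (t + w x)) * c x ∂μ ≤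
      C * ∫⁻ y, ENNReal.ofReal (t * w' y / (t + w' y)) * c' y ∂ν) {σ : ℝ} (h0 : 0 ≤ σ)
    (h1 : σ ≤ 1) :
    ∫⁻ x, ENNReal.ofReal (w x ^ σ) * c x ∂μ ≤ C * ∫⁻ y, ENNReal.ofReal (w' y ^ σ) * c' y ∂ν := by
  rcases h0.eq_or_lt with rfl | h0
  · simpa using lintegral_le_of_forall_parallel hw hw1 hc hw0' h
  rcases h1.eq_or_lt with rfl | h1
  · simpa using lintegral_mul_le_of_forall_parallel hw hw0 hc hw0' h
  have hσ : σ ∈ Ioo (0 : ℝ) 1 := ⟨h0, h1⟩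
  have hκ := Real.integral_rpowIntegrand₀₁_one_pos hσ
  rw [← ENNReal.mul_le_mul_iff_right (ENNReal.ofReal_pos.2 hκ).ne' ENNReal.ofReal_ne_top,
    lintegral_rpow_mul_eq hw hw0 hc hσ, mul_left_comm, lintegral_rpow_mul_eq hw' hw0' hc' hσ,
    ← lintegral_const_mul' _ _ ENNReal.coe_ne_top]
  refine setLIntegral_mono' measurableSet_Ioi fun t ht => ?_
  rw [mul_left_comm]
  exact mul_le_mul_right (h t ht) _

/-- The infimum of `t |a|² + w |b|²` over `a + b = c` is at least `(t w / (t + w)) |c|²`. -/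
theorem parallel_mul_enorm_add_le {E : Type*} [NormedAddCommGroup E] {t w : ℝ} (ht : 0 < t)
    (hw : 0 ≤ w) (a b : E) :
    ENNReal.ofReal (t * w / (t + w)) * ‖a + b‖ₑ ^ 2 ≤
      ENNReal.ofReal t * ‖a‖ₑ ^ 2 + ENNReal.ofReal w * ‖b‖ₑ ^ 2 := by
  simp only [← ofReal_norm]
  rw [← ENNReal.ofReal_pow (norm_nonneg _), ← ENNReal.ofReal_pow (norm_nonneg _),
    ← ENNReal.ofReal_pow (norm_nonneg _), ← ENNReal.ofReal_mul (by positivity),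
    ← ENNReal.ofReal_mul (by positivity), ← ENNReal.ofReal_mul (by positivity),
    ← ENNReal.ofReal_add (by positivity) (by positivity)]
  refine ENNReal.ofReal_le_ofReal ?_
  rw [div_mul_eq_mul_div, div_le_iff₀ (by positivity)]
  have h1 : ‖a + b‖ ^ 2 ≤ (‖a‖ + ‖b‖) ^ 2 := by gcongr; exact norm_add_le a b
  have h2 : t * w * ‖a + b‖ ^ 2 ≤ t * w * (‖a‖ + ‖b‖) ^ 2 := by gcongr
  nlinarith [sq_nonneg (t * ‖a‖ - w * ‖b‖)]

/-- The optimal splitting in `parallel_mul_enorm_add_le`. -/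
theorem parallel_split {t w : ℝ} (ht : 0 < t) (hw : 0 ≤ w) (e : ℝ≥0∞) :
    ENNReal.ofReal t * (ENNReal.ofReal (w / (t + w)) ^ 2 * e) +
      ENNReal.ofReal w * (ENNReal.ofReal (t / (t + w)) ^ 2 * e) =
      ENNReal.ofReal (t * w / (t + w)) * e := by
  rw [← mul_assoc, ← mul_assoc, ← add_mul, ← ENNReal.ofReal_pow (by positivity),
    ← ENNReal.ofReal_pow (by positivity), ← ENNReal.ofReal_mul ht.le, ← ENNReal.ofReal_mul hw,
    ← ENNReal.ofReal_add (by positivity) (by positivity)]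
  congr 2
  field_simp
  ring

end Interpolation

end AbstractStrichartz

end

noncomputable section
namespace AbstractStrichartz

theorem rpow_sq {x : ℝ} (hx : 0 ≤ x) (a : ℝ) : (x ^ a) ^ 2 = x ^ (2 * a) := by
  rw [← Real.rpow_natCast, ← Real.rpow_mul hx]
  congr 1
  push_cast
  ring

/-! ### A weighted convolution inequality -/

section Young

theorem ENNReal_add_sq_le (a b : ℝ≥0∞) : (a + b) ^ 2 ≤ 2 * (a ^ 2 + b ^ 2) := by
  have h := ENNReal.rpow_add_le_mul_rpow_add_rpow a b (p := 2) (by norm_num)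
  norm_num at h
  simpa only [ENNReal.rpow_two] using h

theorem lintegral_mul_sq_le {α : Type*} [MeasurableSpace α] {μ : Measure α} {f g : α → ℝ≥0∞}
    (hf : AEMeasurable f μ) (hg : AEMeasurable g μ) :
    (∫⁻ x, f x * g x ∂μ) ^ 2 ≤ (∫⁻ x, f x ^ 2 ∂μ) * ∫⁻ x, g x ^ 2 ∂μ := by
  have h := ENNReal.lintegral_mul_le_Lp_mul_Lq μ (p := 2) (q := 2) ⟨by norm_num, by norm_num,
    by norm_num⟩ hf hg
  simp only [Pi.mul_apply, ENNReal.rpow_two] at h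
  refine (pow_le_pow_left₀ zero_le h 2).trans ?_
  rw [mul_pow, ← ENNReal.rpow_two, ← ENNReal.rpow_mul, ← ENNReal.rpow_two, ← ENNReal.rpow_mul]
  norm_num

variable {G : Type*} [AddCommGroup G] [MeasurableSpace G] [MeasurableAdd₂ G] [MeasurableNeg G]
  {μ : Measure G} [SFinite μ] [μ.IsAddLeftInvariant]

/-- Cauchy–Schwarz for the measure g(x - y) dy separates p from k; what remains is a convolution of
g with k², integrated by translation invariance. The weight p may be unbounded, as only the
convolution of g with p² has to be bounded. -/
theorem lintegral_sq_le_of_le_convolution {f g p k : G → ℝ≥0∞} (hg : Measurable g)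
    (hp : Measurable p) (hk : Measurable k) {C : ℝ≥0∞}
    (hC : ∀ x, ∫⁻ y, g (x - y) * p y ^ 2 ∂μ ≤ C)
    (hf : ∀ x, f x ≤ ∫⁻ y, g (x - y) * (p y * k y) ∂μ) :
    ∫⁻ x, f x ^ 2 ∂μ ≤ C * ((∫⁻ x, g x ∂μ) * ∫⁻ x, k x ^ 2 ∂μ) := by
  have hgm : Measurable fun q : G × G => g (q.1 - q.2) := hg.comp (by fun_prop)
  have h1 : ∀ x, f x ^ 2 ≤ C * ∫⁻ y, g (x - y) * k y ^ 2 ∂μ := fun x => by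
    have hgx : Measurable fun y => g (x - y) := hg.comp (by fun_prop)
    have h2 := lintegral_mul_sq_le (μ := μ.withDensity fun y => g (x - y)) hp.aemeasurable
      hk.aemeasurable
    rw [lintegral_withDensity_eq_lintegral_mul _ hgx (by fun_prop),
      lintegral_withDensity_eq_lintegral_mul _ hgx (by fun_prop),
      lintegral_withDensity_eq_lintegral_mul _ hgx (by fun_prop)] at h2
    exact (pow_le_pow_left₀ zero_le (hf x) 2).trans (h2.trans (mul_le_mul_left (hC x) _))
  refine (lintegral_mono h1).trans ?_
  have hm : Measurable fun q : G × G => g (q.1 - q.2) * k q.2 ^ 2 := by fun_prop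
  rw [lintegral_const_mul _ hm.lintegral_prod_right]
  refine mul_le_mul_right ?_ _
  rw [lintegral_lintegral_swap (by fun_prop), ← lintegral_const_mul _ (by fun_prop)]
  refine lintegral_mono fun y => ?_
  simp only
  rw [lintegral_mul_const (f := fun x => g (x - y)) _ (hg.comp (by fun_prop)),
    lintegral_sub_right_eq_self (μ := μ) (fun x => g x) y]

end Young

/-! ### Localization from homogeneous to inhomogeneous Sobolev norms -/

section Fourier

variable {n : ℕ}

open SchwartzMap

/-- The product of two Schwartz functions. -/
abbrev schwartzMul (χ h : 𝓢(Eu n, ℂ)) : 𝓢(Eu n, ℂ) := pairing (ContinuousLinearMap.mul ℂ ℂ) χ h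

theorem schwartzMul_apply (χ h : 𝓢(Eu n, ℂ)) (x : Eu n) : schwartzMul χ h x = χ x * h x := by
  simp [schwartzMul]

theorem fourierInv_schwartzMul (χ h : 𝓢(Eu n, ℂ)) (x : Eu n) :
    𝓕⁻ (schwartzMul χ h) x = ∫ y, (𝓕⁻ χ) (x - y) * (𝓕⁻ h) y := by
  have h1 : 𝓕⁻ (schwartzMul χ h) =
      SchwartzMap.convolution (ContinuousLinearMap.mul ℂ ℂ) (𝓕⁻ χ) (𝓕⁻ h) := by
    simp [SchwartzMap.convolution]
  rw [h1, SchwartzMap.convolution_apply, convolution_def,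
    ← integral_sub_left_eq_self _ volume x]
  simp

theorem fourier_eq_fourierInv_neg (h : 𝓢(Eu n, ℂ)) (ξ : Eu n) : (𝓕 h) ξ = (𝓕⁻ h) (-ξ) := by
  rw [fourier_coe, fourierInv_coe, Real.fourierInv_eq_fourier_neg, neg_neg]

theorem fourier_schwartzMul (χ h : 𝓢(Eu n, ℂ)) (ξ : Eu n) :
    𝓕 (schwartzMul χ h) ξ = ∫ η, (𝓕 χ) (ξ - η) * (𝓕 h) η := by
  rw [fourier_eq_fourierInv_neg, fourierInv_schwartzMul, ← integral_neg_eq_self]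
  refine integral_congr_ae (ae_of_all _ fun η => ?_)
  simp only [fourier_eq_fourierInv_neg]
  congr 2
  abel

/-- In polar coordinates the integrand is r^{n-1-a}, and its exponent exceeds -1. -/
theorem lintegral_norm_rpow_lt_top (hn : 0 < n) {a : ℝ} (ha : a < n) :
    ∫⁻ ξ in Metric.ball (0 : Eu n) 1, ENNReal.ofReal (‖ξ‖ ^ (-a)) < ⊤ := by
  have : Nontrivial (Eu n) := Module.nontrivial_of_finrank_pos (R := ℝ) (by simpa using hn)
  have h : IntegrableOn (fun ξ : Eu n => ‖ξ‖ ^ (-a)) (Metric.ball 0 1) := by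
    rw [integrableOn_fun_norm_addHaar (μ := volume) (f := fun r : ℝ => r ^ (-a))]
    have h1 : IntegrableOn (fun r : ℝ => r ^ ((n : ℝ) - 1 - a)) (Ioo 0 1) := by
      rw [intervalIntegral.integrableOn_Ioo_rpow_iff one_pos]
      linarith
    refine h1.congr_fun (fun r hr => ?_) measurableSet_Ioo
    simp only [finrank_euclideanSpace, Fintype.card_fin, smul_eq_mul]
    rw [← Real.rpow_natCast, ← Real.rpow_add hr.1, Nat.cast_sub hn]
    norm_num
    ring_nf
  rw [← ofReal_integral_eq_lintegral_ofReal h (ae_of_all _ fun ξ => by positivity)]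
  exact ENNReal.ofReal_lt_top

theorem one_add_sq_rpow_le {s : ℝ} (hs : 0 ≤ s) (x y : Eu n) :
    (1 + ‖x‖ ^ 2) ^ s ≤ 2 ^ s * ((1 + ‖x - y‖ ^ 2) ^ s * (1 + ‖y‖ ^ 2) ^ s) := by
  rw [← Real.mul_rpow (by positivity) (by positivity), ← Real.mul_rpow (by positivity)
    (by positivity)]
  refine Real.rpow_le_rpow (by positivity) ?_ hs
  have h : ‖x‖ ≤ ‖x - y‖ + ‖y‖ := by simpa using norm_add_le (x - y) y
  have h2 : ‖x‖ ^ 2 ≤ (‖x - y‖ + ‖y‖) ^ 2 := by gcongr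
  nlinarith [sq_nonneg (‖x - y‖ - ‖y‖), mul_nonneg (sq_nonneg ‖x - y‖) (sq_nonneg ‖y‖)]

/-- Outside the unit ball the two weights are comparable. Inside, the inhomogeneous weight is
bounded while |y|^{-σ}|y|^σ = 1. The singular factor |y|^{-σ} is thus the price of the homogeneous
weight at low frequency. -/
theorem one_add_sq_rpow_le_mul {σ : ℝ} (hσ : 0 ≤ σ) {y : Eu n} (hy : y ≠ 0) :
    ENNReal.ofReal ((1 + ‖y‖ ^ 2) ^ (σ / 2)) ≤ ENNReal.ofReal (2 ^ (σ / 2)) *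
      ((1 + (Metric.ball (0 : Eu n) 1).indicator (fun η => ENNReal.ofReal (‖η‖ ^ (-σ))) y) *
        ENNReal.ofReal (‖y‖ ^ σ)) := by
  have hy0 : 0 < ‖y‖ := norm_pos_iff.2 hy
  rcases lt_or_ge ‖y‖ 1 with h | h
  · rw [indicator_of_mem (by simpa using h)]
    calc ENNReal.ofReal ((1 + ‖y‖ ^ 2) ^ (σ / 2)) ≤ ENNReal.ofReal (2 ^ (σ / 2)) * 1 := by
          rw [mul_one]
          refine ENNReal.ofReal_le_ofReal (Real.rpow_le_rpow (by positivity) ?_ (by positivity))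
          nlinarith
      _ ≤ _ := by
          refine mul_le_mul_right ?_ _
          rw [add_mul]
          refine le_add_left ?_
          rw [← ENNReal.ofReal_mul (by positivity), ← Real.rpow_add hy0]
          simp
  · rw [indicator_of_notMem (by simpa using h), add_zero, one_mul,
      ← ENNReal.ofReal_mul (by positivity)]
    refine ENNReal.ofReal_le_ofReal ?_
    have : ‖y‖ ^ σ = (‖y‖ ^ 2) ^ (σ / 2) := by
      rw [← Real.rpow_natCast_mul hy0.le]
      congr 1
      push_cast
      ring
    rw [this, ← Real.mul_rpow (by positivity) (by positivity)]
    refine Real.rpow_le_rpow (by positivity) ?_ (by positivity)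
    nlinarith

/-- The `H^σ` norm of `χ h` for a Schwartz function `χ` is controlled by the `Ḣ^σ` norm of `h`,
for `0 ≤ σ < n / 2`. -/
theorem exists_sobolev_schwartzMul_le (hn : 0 < n) {σ : ℝ} (hσ : 0 ≤ σ) (hσn : σ < n / 2) (χ : 𝓢(Eu n, ℂ)) :
    ∃ C : ℝ≥0, ∀ h : 𝓢(Eu n, ℂ),
      ∫⁻ ξ, ENNReal.ofReal ((1 + (2 * Real.pi * ‖ξ‖) ^ 2) ^ σ) * ‖𝓕 (schwartzMul χ h) ξ‖ₑ ^ 2 ≤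
        C * ∫⁻ ξ, ENNReal.ofReal ((2 * Real.pi * ‖ξ‖) ^ (2 * σ)) * ‖𝓕 h ξ‖ₑ ^ 2 := by
  set g : Eu n → ℝ≥0∞ := fun ξ => ENNReal.ofReal ((1 + ‖ξ‖ ^ 2) ^ (σ / 2)) * ‖𝓕 χ ξ‖ₑ with hg
  set p : Eu n → ℝ≥0∞ := fun η =>
    1 + (Metric.ball (0 : Eu n) 1).indicator (fun η => ENNReal.ofReal (‖η‖ ^ (-σ))) η with hp
  have hgm : Measurable g := by
    have := (𝓕 χ).continuous
    fun_prop
  have hpm : Measurable p := measurable_const.add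
    ((by fun_prop : Measurable fun η : Eu n => ENNReal.ofReal (‖η‖ ^ (-σ))).indicator
      measurableSet_ball)
  -- The kernel g is the modulus of a Schwartz function, hence bounded and integrable.
  set γ : 𝓢(Eu n, ℂ) := smulLeftCLM ℂ (fun ξ : Eu n => (1 + ‖ξ‖ ^ 2) ^ (σ / 2)) (𝓕 χ) with hγ
  have hgγ : ∀ ξ, g ξ = ‖γ ξ‖ₑ := fun ξ => by
    rw [hγ, smulLeftCLM_apply_apply (by fun_prop), enorm_smul, Real.enorm_of_nonneg (by positivity)]
  obtain ⟨A, hA⟩ : ∃ A : ℝ≥0, ∀ ξ, g ξ ≤ A := by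
    refine ⟨(SchwartzMap.seminorm ℝ 0 0 γ).toNNReal, fun ξ => ?_⟩
    rw [hgγ, ← ofReal_norm]
    exact ENNReal.ofReal_le_ofReal (norm_le_seminorm ℝ γ ξ)
  have hgi : ∫⁻ ξ, g ξ < ⊤ := by
    simp only [hgγ]
    exact γ.integrable.2
  -- The square of the singular factor is |η|^{-2σ}; its integrability near 0 is the condition σ <
  -- n/2.
  set q : ℝ≥0∞ := ∫⁻ η in Metric.ball (0 : Eu n) 1, ENNReal.ofReal (‖η‖ ^ (-(2 * σ))) with hq
  have hq' : q < ⊤ := lintegral_norm_rpow_lt_top hn (by linarith)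
  have hgp : ∀ x, ∫⁻ y, g (x - y) * p y ^ 2 ≤ 2 * (∫⁻ ξ, g ξ) + 2 * (A * q) := fun x => by
    have h1 : ∀ y, g (x - y) * p y ^ 2 ≤ 2 * g (x - y) + 2 * (A *
        (Metric.ball (0 : Eu n) 1).indicator (fun η => ENNReal.ofReal (‖η‖ ^ (-(2 * σ)))) y) := by
      intro y
      have h2 : p y ^ 2 ≤ 2 * (1 + (Metric.ball (0 : Eu n) 1).indicator
          (fun η => ENNReal.ofReal (‖η‖ ^ (-(2 * σ)))) y) := by
        simp only [hp]
        by_cases hy : y ∈ Metric.ball (0 : Eu n) 1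
        · rw [indicator_of_mem hy, indicator_of_mem hy]
          refine (ENNReal_add_sq_le _ _).trans_eq ?_
          rw [one_pow, ← ENNReal.ofReal_pow (by positivity), rpow_sq (norm_nonneg _), mul_neg]
        · rw [indicator_of_notMem hy, indicator_of_notMem hy]
          norm_num
      calc g (x - y) * p y ^ 2 ≤ g (x - y) * (2 * (1 + (Metric.ball (0 : Eu n) 1).indicator
          (fun η => ENNReal.ofReal (‖η‖ ^ (-(2 * σ)))) y)) := mul_le_mul_right h2 _
        _ = 2 * g (x - y) + 2 * (g (x - y) * (Metric.ball (0 : Eu n) 1).indicator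
          (fun η => ENNReal.ofReal (‖η‖ ^ (-(2 * σ)))) y) := by ring
        _ ≤ _ := by gcongr; exact hA _
    refine (lintegral_mono h1).trans ?_
    rw [lintegral_add_left (by fun_prop), lintegral_const_mul _ (by fun_prop),
      lintegral_sub_left_eq_self (μ := volume) g x, lintegral_const_mul' _ _ (by simp),
      lintegral_const_mul' _ _ (by simp), lintegral_indicator measurableSet_ball]
  set f : Eu n → ℝ≥0∞ := fun ξ =>
    ENNReal.ofReal ((1 + ‖ξ‖ ^ 2) ^ (σ / 2)) with hf
  set k : 𝓢(Eu n, ℂ) → Eu n → ℝ≥0∞ := fun h η => ENNReal.ofReal (‖η‖ ^ σ) * ‖𝓕 h η‖ₑ with hk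
  have hconv : ∀ (h : 𝓢(Eu n, ℂ)) (ξ : Eu n), f ξ * ‖𝓕 (schwartzMul χ h) ξ‖ₑ ≤
      ∫⁻ η, g (ξ - η) * (p η * (ENNReal.ofReal (2 ^ σ) * k h η)) := fun h ξ => by
    have h1 : ‖𝓕 (schwartzMul χ h) ξ‖ₑ ≤ ∫⁻ η, ‖𝓕 χ (ξ - η)‖ₑ * ‖𝓕 h η‖ₑ := by
      rw [fourier_schwartzMul]
      refine (enorm_integral_le_lintegral_enorm _).trans_eq ?_
      simp only [enorm_mul]
    refine (mul_le_mul_right h1 _).trans ?_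
    rw [← lintegral_const_mul' _ _ ENNReal.ofReal_ne_top]
    have h0 : ∀ᵐ η : Eu n, η ≠ 0 := by
      have : Nontrivial (Eu n) := Module.nontrivial_of_finrank_pos (R := ℝ) (by simpa using hn)
      simp [ae_iff]
    refine lintegral_mono_ae ?_
    filter_upwards [h0] with η hη
    have h2 : f ξ ≤ ENNReal.ofReal (2 ^ (σ / 2)) * (f (ξ - η) * f η) := by
      simp only [hf]
      rw [← ENNReal.ofReal_mul (by positivity), ← ENNReal.ofReal_mul (by positivity)]
      exact ENNReal.ofReal_le_ofReal (one_add_sq_rpow_le (by positivity) ξ η)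
    have h3 : f η ≤ ENNReal.ofReal (2 ^ (σ / 2)) * (p η * ENNReal.ofReal (‖η‖ ^ σ)) :=
      one_add_sq_rpow_le_mul hσ hη
    have h4 : ENNReal.ofReal (2 ^ σ) =
        ENNReal.ofReal (2 ^ (σ / 2)) * ENNReal.ofReal (2 ^ (σ / 2)) := by
      rw [← ENNReal.ofReal_mul (by positivity), ← Real.rpow_add two_pos, add_halves]
    calc f ξ * (‖𝓕 χ (ξ - η)‖ₑ * ‖𝓕 h η‖ₑ)
        ≤ (ENNReal.ofReal (2 ^ (σ / 2)) * (f (ξ - η) * (ENNReal.ofReal (2 ^ (σ / 2)) *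
          (p η * ENNReal.ofReal (‖η‖ ^ σ))))) * (‖𝓕 χ (ξ - η)‖ₑ * ‖𝓕 h η‖ₑ) := by
          gcongr
          exact h2.trans (by gcongr)
      _ = _ := by
          rw [h4]
          simp only [hg, hk, hf]
          ring
  set c : ℝ≥0∞ := (2 * (∫⁻ ξ, g ξ) + 2 * (A * q)) * (∫⁻ ξ, g ξ) * ENNReal.ofReal (2 ^ σ) ^ 2 with hc
  have hct : c ≠ ⊤ := by
    rw [hc]
    finiteness
  -- The factor 4π² compares 1 + (2π|ξ|)² with 1 + |ξ|².
  refine ⟨(ENNReal.ofReal ((4 * Real.pi ^ 2) ^ σ) * c).toNNReal, fun h => ?_⟩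
  rw [ENNReal.coe_toNNReal (by finiteness)]
  have hkm : Measurable (k h) := by
    have := (𝓕 h).continuous
    fun_prop
  have h5 := lintegral_sq_le_of_le_convolution (μ := volume) hgm hpm
    (hkm.const_mul (ENNReal.ofReal (2 ^ σ))) hgp (hconv h)
  have hpi : (1 : ℝ) ≤ 2 * Real.pi := by linarith [Real.pi_gt_three]
  calc ∫⁻ ξ, ENNReal.ofReal ((1 + (2 * Real.pi * ‖ξ‖) ^ 2) ^ σ) * ‖𝓕 (schwartzMul χ h) ξ‖ₑ ^ 2
      ≤ ∫⁻ ξ, ENNReal.ofReal ((4 * Real.pi ^ 2) ^ σ) * (f ξ * ‖𝓕 (schwartzMul χ h) ξ‖ₑ) ^ 2 := by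
        refine lintegral_mono fun ξ => ?_
        rw [mul_pow (f ξ), ← mul_assoc, hf, ← ENNReal.ofReal_pow (by positivity),
          rpow_sq (by positivity), ← ENNReal.ofReal_mul (by positivity)]
        gcongr
        rw [show 2 * (σ / 2) = σ by ring,
          ← Real.mul_rpow (by positivity) (by positivity)]
        refine Real.rpow_le_rpow (by positivity) ?_ hσ
        nlinarith
    _ = ENNReal.ofReal ((4 * Real.pi ^ 2) ^ σ) *
        ∫⁻ ξ, (f ξ * ‖𝓕 (schwartzMul χ h) ξ‖ₑ) ^ 2 :=
        lintegral_const_mul' _ _ ENNReal.ofReal_ne_top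
    _ ≤ ENNReal.ofReal ((4 * Real.pi ^ 2) ^ σ) * (c * ∫⁻ x, k h x ^ 2) := by
        refine mul_le_mul_right (h5.trans_eq ?_) _
        simp only [mul_pow]
        rw [lintegral_const_mul _ (by fun_prop), hc]
        ring
    _ ≤ _ := by
        rw [← mul_assoc]
        refine mul_le_mul_right (lintegral_mono fun ξ => ?_) _
        rw [hk, mul_pow, ← ENNReal.ofReal_pow (by positivity), rpow_sq (by positivity)]
        gcongr
        exact le_mul_of_one_le_left (norm_nonneg _) hpi

end Fourier

end AbstractStrichartz

end

/-! ### Homogeneous Sobolev norms, Plancherel and weak gradients -/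

noncomputable section
namespace AbstractStrichartz

open SchwartzMap

variable {n : ℕ}

/-- The Fourier transform of a square integrable function. -/
def l2Fourier {f : Eu n → ℂ} (hf : MemLp f 2 volume) : Lp ℂ 2 (volume : Measure (Eu n)) :=
  𝓕 (hf.toLp f)

theorem homSob_eq {f : Eu n → ℂ} (hf : MemLp f 2 volume) (s : ℝ) :
    homSob s f = (∫⁻ ξ, ENNReal.ofReal ((2 * Real.pi * ‖ξ‖) ^ (2 * s)) *
      ‖l2Fourier hf ξ‖ₑ ^ 2) ^ (1 / 2 : ℝ) := by
  rw [homSob, dif_pos hf]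
  rfl

theorem homSob_sq {f : Eu n → ℂ} (hf : MemLp f 2 volume) (s : ℝ) :
    homSob s f ^ 2 = ∫⁻ ξ, ENNReal.ofReal ((2 * Real.pi * ‖ξ‖) ^ (2 * s)) *
      ‖l2Fourier hf ξ‖ₑ ^ 2 := by
  rw [homSob_eq hf, ← ENNReal.rpow_two, ← ENNReal.rpow_mul]
  norm_num

theorem homSob_congr {f h : Eu n → ℂ} (hfh : f =ᵐ[volume] h) (s : ℝ) :
    homSob s f = homSob s h := by
  by_cases hf : MemLp f 2 volume
  · have hh : MemLp h 2 volume := hf.ae_eq hfh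
    rw [homSob_eq hf, homSob_eq hh, l2Fourier, l2Fourier, MemLp.toLp_congr hf hh hfh]
  · have hh : ¬ MemLp h 2 volume := fun hh => hf (hh.ae_eq hfh.symm)
    rw [homSob, dif_neg hf, homSob, dif_neg hh]

theorem homSob_zero (s : ℝ) : homSob s (fun _ : Eu n => 0) = 0 := by
  have h : MemLp (fun _ : Eu n => (0 : ℂ)) 2 volume := MemLp.zero
  have h0 : l2Fourier h = 0 := by
    rw [l2Fourier]
    have : h.toLp (fun _ : Eu n => (0 : ℂ)) = 0 := MemLp.toLp_zero h
    rw [this, FourierTransform.fourier_zero]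
  rw [homSob_eq h, h0]
  have : ∫⁻ ξ : Eu n, ENNReal.ofReal ((2 * Real.pi * ‖ξ‖) ^ (2 * s)) *
      ‖(0 : Lp ℂ 2 (volume : Measure (Eu n))) ξ‖ₑ ^ 2 = 0 := by
    rw [← lintegral_zero (μ := (volume : Measure (Eu n)))]
    refine lintegral_congr_ae ?_
    filter_upwards [Lp.coeFn_zero ℂ 2 (volume : Measure (Eu n))] with ξ hξ
    rw [hξ]
    simp
  rw [this, ENNReal.zero_rpow_of_pos (by norm_num)]

theorem l2Fourier_schwartz (h : 𝓢(Eu n, ℂ)) (hh : MemLp h 2 volume) :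
    l2Fourier hh =ᵐ[volume] ⇑(𝓕 h : 𝓢(Eu n, ℂ)) := by
  have h1 : l2Fourier hh = (𝓕 h).toLp 2 := by
    rw [← SchwartzMap.toLp_fourier_eq]
    rfl
  rw [h1]
  exact (𝓕 h).coeFn_toLp 2

theorem homSob_schwartz_sq (h : 𝓢(Eu n, ℂ)) (s : ℝ) :
    homSob s h ^ 2 = ∫⁻ ξ, ENNReal.ofReal ((2 * Real.pi * ‖ξ‖) ^ (2 * s)) * ‖𝓕 h ξ‖ₑ ^ 2 := by
  rw [homSob_sq (h.memLp 2)]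
  refine lintegral_congr_ae ?_
  filter_upwards [l2Fourier_schwartz h (h.memLp 2)] with ξ hξ
  rw [hξ]

theorem lintegral_l2Fourier {f : Eu n → ℂ} (hf : MemLp f 2 volume) :
    ∫⁻ ξ, ‖l2Fourier hf ξ‖ₑ ^ 2 = ∫⁻ x, ‖f x‖ₑ ^ 2 := by
  have h1 : eLpNorm (l2Fourier hf) 2 volume = eLpNorm f 2 volume := by
    rw [← eLpNorm_congr_ae hf.coeFn_toLp, ← Lp.enorm_def, ← Lp.enorm_def, l2Fourier,
      ← ofReal_norm, ← ofReal_norm, Lp.norm_fourier_eq]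
  simp only [eLpNorm_eq_lintegral_rpow_enorm_toReal two_ne_zero ENNReal.ofNat_ne_top,
    ENNReal.toReal_ofNat, ENNReal.rpow_two] at h1
  exact ENNReal.rpow_left_injective (by norm_num : (1 / 2 : ℝ) ≠ 0) h1

theorem l2Fourier_add {f g : Eu n → ℂ} (hf : MemLp f 2 volume) (hg : MemLp g 2 volume)
    (h : MemLp (fun x => f x + g x) 2 volume) : l2Fourier h = l2Fourier hf + l2Fourier hg := by
  rw [l2Fourier, l2Fourier, l2Fourier, ← FourierTransform.fourier_add, ← MemLp.toLp_add]
  rfl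

theorem integral_mul_conj_eq_l2Fourier {f h : Eu n → ℂ} (hf : MemLp f 2 volume)
    (hh : MemLp h 2 volume) :
    ∫ x, f x * conj (h x) = ∫ ξ, l2Fourier hf ξ * conj (l2Fourier hh ξ) := by
  have h1 := Lp.inner_fourier_eq (hh.toLp h) (hf.toLp f)
  rw [L2.inner_def, L2.inner_def] at h1
  simp only [RCLike.inner_apply] at h1
  rw [l2Fourier, l2Fourier, h1]
  refine integral_congr_ae ?_
  filter_upwards [hf.coeFn_toLp, hh.coeFn_toLp] with x h2 h3
  rw [h2, h3]

/-- Plancherel followed by Cauchy–Schwarz with the weights |2πξ|^s and |2πξ|^{-s}, whose product is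
1 off the null set {0}. -/
theorem enorm_integral_mul_conj_le (hn : 0 < n) {f h : Eu n → ℂ} (hf : MemLp f 2 volume)
    (hh : MemLp h 2 volume) (s : ℝ) :
    ‖∫ x, f x * conj (h x)‖ₑ ≤ homSob s f * homSob (-s) h := by
  rw [integral_mul_conj_eq_l2Fourier hf hh]
  refine (enorm_integral_le_lintegral_enorm _).trans ?_
  have hw : ∀ t : ℝ, Measurable fun ξ : Eu n => ENNReal.ofReal ((2 * Real.pi * ‖ξ‖) ^ t) :=
    fun t => by fun_prop
  have hm : ∀ u : Lp ℂ 2 (volume : Measure (Eu n)), AEMeasurable (fun ξ => ‖u ξ‖ₑ) volume :=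
    fun u => (Lp.aestronglyMeasurable u).enorm
  have h1 := lintegral_mul_sq_le ((hw s).aemeasurable.mul (hm (l2Fourier hf)))
    ((hw (-s)).aemeasurable.mul (hm (l2Fourier hh)))
  have h2 : ∀ (t : ℝ) (ξ : Eu n), ENNReal.ofReal ((2 * Real.pi * ‖ξ‖) ^ t) ^ 2 =
      ENNReal.ofReal ((2 * Real.pi * ‖ξ‖) ^ (2 * t)) := fun t ξ => by
    rw [← ENNReal.ofReal_pow (by positivity), rpow_sq (by positivity)]
  simp only [Pi.mul_apply, mul_pow, h2] at h1
  rw [← homSob_sq hf, ← homSob_sq hh, ← mul_pow] at h1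
  refine le_trans (le_of_eq ?_) ((ENNReal.pow_le_pow_left_iff two_ne_zero).1 h1)
  have h0 : ∀ᵐ η : Eu n, η ≠ 0 := by
    have : Nontrivial (Eu n) := Module.nontrivial_of_finrank_pos (R := ℝ) (by simpa using hn)
    simp [ae_iff]
  refine lintegral_congr_ae ?_
  filter_upwards [h0] with ξ hξ
  have h3 : 0 < 2 * Real.pi * ‖ξ‖ := by positivity
  rw [enorm_mul, RCLike.enorm_conj, mul_mul_mul_comm, ← ENNReal.ofReal_mul (by positivity),
    ← Real.rpow_add h3]
  simp

/-- The function is a multiple of (1 + |aξ|²)^{-1} for a suitable dilation a. -/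
theorem hasTemperateGrowth_resolvent {t : ℝ} (ht : 0 < t) :
    (fun ξ : Eu n => t / (t + (1 + (2 * Real.pi * ‖ξ‖) ^ 2))).HasTemperateGrowth := by
  set a : ℝ := 2 * Real.pi / √(t + 1) with ha
  have h1 := (Function.hasTemperateGrowth_one_add_norm_sq_rpow (Eu n) (-1)).comp
    ((a • ContinuousLinearMap.id ℝ (Eu n)).hasTemperateGrowth)
  have h2 := (Function.HasTemperateGrowth.const (E := Eu n) (t / (t + 1))).mul h1
  refine (congrArg Function.HasTemperateGrowth ?_).mp h2
  funext ξ
  symm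
  simp only [Function.comp_apply, Pi.mul_apply, _root_.smul_apply, ContinuousLinearMap.id_apply,
    norm_smul, Real.norm_eq_abs, Real.rpow_neg_one]
  have hs : √(t + 1) ^ 2 = t + 1 := Real.sq_sqrt (by positivity)
  rw [ha, abs_of_nonneg (by positivity)]
  have h3 : 0 < √(t + 1) := by positivity
  have h4 : (2 * Real.pi / √(t + 1) * ‖ξ‖) ^ 2 = (2 * Real.pi * ‖ξ‖) ^ 2 / (t + 1) := by
    rw [div_mul_eq_mul_div, div_pow, hs]
  rw [h4]
  field_simp
  ring

/-- The splitting of a Schwartz function into low and high frequencies. -/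
theorem exists_schwartz_split (v : 𝓢(Eu n, ℂ)) {t : ℝ} (ht : 0 < t) :
    ∃ v₀ v₁ : 𝓢(Eu n, ℂ), v = v₀ + v₁ ∧
      (∀ ξ, ‖𝓕 v₀ ξ‖ₑ = ENNReal.ofReal ((1 + (2 * Real.pi * ‖ξ‖) ^ 2) /
        (t + (1 + (2 * Real.pi * ‖ξ‖) ^ 2))) * ‖𝓕 v ξ‖ₑ) ∧
      ∀ ξ, ‖𝓕 v₁ ξ‖ₑ = ENNReal.ofReal (t / (t + (1 + (2 * Real.pi * ‖ξ‖) ^ 2))) * ‖𝓕 v ξ‖ₑ := by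
  set w := smulLeftCLM ℂ (fun ξ : Eu n => t / (t + (1 + (2 * Real.pi * ‖ξ‖) ^ 2))) (𝓕 v) with hw
  have hwa : ∀ ξ, w ξ = (t / (t + (1 + (2 * Real.pi * ‖ξ‖) ^ 2))) • 𝓕 v ξ := fun ξ => by
    rw [hw, smulLeftCLM_apply_apply (hasTemperateGrowth_resolvent ht)]
  refine ⟨𝓕⁻ (𝓕 v - w), 𝓕⁻ w, ?_, fun ξ => ?_, fun ξ => ?_⟩
  · rw [← FourierTransform.fourierInv_add, sub_add_cancel, FourierTransform.fourierInv_fourier_eq]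
  · rw [FourierTransform.fourier_fourierInv_eq, _root_.sub_apply, hwa]
    have h2 : 𝓕 v ξ - (t / (t + (1 + (2 * Real.pi * ‖ξ‖) ^ 2))) • 𝓕 v ξ =
        ((1 + (2 * Real.pi * ‖ξ‖) ^ 2) / (t + (1 + (2 * Real.pi * ‖ξ‖) ^ 2))) • 𝓕 v ξ := by
      nth_rewrite 1 [← one_smul ℝ (𝓕 v ξ)]
      rw [← sub_smul]
      congr 1
      field_simp
      ring
    rw [h2, enorm_smul, Real.enorm_of_nonneg (by positivity)]
  · rw [FourierTransform.fourier_fourierInv_eq, hwa, enorm_smul,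
      Real.enorm_of_nonneg (by positivity)]

theorem grad_schwartz (v : 𝓢(Eu n, ℂ)) (x : Eu n) (j : Fin n) :
    grad v x j = LineDeriv.lineDerivOp (EuclideanSpace.single j (1 : ℝ)) v x := by
  rw [SchwartzMap.lineDerivOp_apply_eq_fderiv]
  rfl

theorem fourier_lineDeriv_apply (v : 𝓢(Eu n, ℂ)) (j : Fin n) (ξ : Eu n) :
    𝓕 (LineDeriv.lineDerivOp (EuclideanSpace.single j (1 : ℝ)) v) ξ =
      (2 * Real.pi * Complex.I) * ((ξ j : ℝ) : ℂ) * 𝓕 v ξ := by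
  rw [SchwartzMap.fourier_lineDerivOp_eq, _root_.smul_apply, smulLeftCLM_apply_apply
    (Function.hasTemperateGrowth_inner_left _)]
  simp [EuclideanSpace.inner_single_right, mul_assoc]

theorem enorm_sq_eq_sum (z : CVec n) : ‖z‖ₑ ^ 2 = ∑ j, ‖z j‖ₑ ^ 2 := by
  rw [← ofReal_norm, ← ENNReal.ofReal_pow (norm_nonneg _), EuclideanSpace.norm_sq_eq,
    ENNReal.ofReal_sum_of_nonneg fun _ _ => by positivity]
  refine Finset.sum_congr rfl fun j _ => ?_
  rw [ENNReal.ofReal_pow (norm_nonneg _), ofReal_norm]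

theorem sum_enorm_freq (ξ : Eu n) (z : ℂ) :
    ∑ j, ‖(2 * Real.pi * Complex.I) * ((ξ j : ℝ) : ℂ) * z‖ₑ ^ 2 =
      ENNReal.ofReal ((2 * Real.pi * ‖ξ‖) ^ 2) * ‖z‖ₑ ^ 2 := by
  have h1 : ∀ j, ‖(2 * Real.pi * Complex.I) * ((ξ j : ℝ) : ℂ) * z‖ₑ ^ 2 =
      ENNReal.ofReal ((2 * Real.pi) ^ 2 * ‖ξ j‖ ^ 2) * ‖z‖ₑ ^ 2 := fun j => by
    rw [← ofReal_norm, ← ofReal_norm, ← ENNReal.ofReal_pow (norm_nonneg _),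
      ← ENNReal.ofReal_pow (norm_nonneg _), ← ENNReal.ofReal_mul (by positivity)]
    congr 1
    simp only [norm_mul, Complex.norm_real, Complex.norm_I, mul_one, Complex.norm_ofNat]
    rw [Real.norm_of_nonneg Real.pi_pos.le]
    ring
  simp only [h1]
  rw [← Finset.sum_mul, ← ENNReal.ofReal_sum_of_nonneg (fun _ _ => by positivity),
    ← Finset.mul_sum, mul_pow (2 * Real.pi) ‖ξ‖, EuclideanSpace.norm_sq_eq]

theorem lintegral_grad_schwartz (v : 𝓢(Eu n, ℂ)) :
    ∫⁻ x, ‖grad v x‖ₑ ^ 2 = ∫⁻ ξ, ENNReal.ofReal ((2 * Real.pi * ‖ξ‖) ^ 2) * ‖𝓕 v ξ‖ₑ ^ 2 := by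
  have hp : ∀ w : 𝓢(Eu n, ℂ), ∫⁻ x, ‖w x‖ₑ ^ 2 = ∫⁻ ξ, ‖𝓕 w ξ‖ₑ ^ 2 := fun w => by
    rw [← lintegral_l2Fourier (w.memLp 2)]
    refine lintegral_congr_ae ?_
    filter_upwards [l2Fourier_schwartz w (w.memLp 2)] with ξ hξ
    rw [hξ]
  have hm : ∀ w : 𝓢(Eu n, ℂ), Measurable fun x => ‖w x‖ₑ ^ 2 := fun w => by
    have := w.continuous
    fun_prop
  simp only [enorm_sq_eq_sum, grad_schwartz]
  rw [lintegral_finsetSum _ fun j _ => hm _]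
  rw [Finset.sum_congr rfl fun j _ => hp _, ← lintegral_finsetSum _ fun j _ => hm _]
  refine lintegral_congr fun ξ => ?_
  simp only [fourier_lineDeriv_apply]
  exact sum_enorm_freq ξ _

/-- Weak derivatives on the Fourier side. -/
theorem lintegral_l2Fourier_le_of_weak_grad {v : Eu n → ℂ} {V : Eu n → CVec n}
    (hv : MemLp v 2 volume) (hV : MemLp V 2 volume)
    (h : ∀ (φ : 𝓢(Eu n, ℂ)) (j : Fin n),
      ∫ x, v x * conj (grad φ x j : ℂ) = -∫ x, V x j * conj (φ x)) :
    ∫⁻ ξ, ENNReal.ofReal ((2 * Real.pi * ‖ξ‖) ^ 2) * ‖l2Fourier hv ξ‖ₑ ^ 2 =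
      ∫⁻ x, ‖V x‖ₑ ^ 2 := by
  have hVj : ∀ j, MemLp (fun x => V x j) 2 volume := fun j => MemLp.coord hV j
  have key : ∀ j, l2Fourier (hVj j) =ᵐ[volume]
      fun ξ => (2 * Real.pi * Complex.I) * ((ξ j : ℝ) : ℂ) * l2Fourier hv ξ := fun j => by
    refine ae_eq_of_integral_contDiff_smul_eq ?_ ?_ fun φ hφ hφc => ?_
    · exact (Lp.memLp _).locallyIntegrable (by norm_num)
    · have h1 : Continuous fun ξ : Eu n => (2 * Real.pi * Complex.I) * ((ξ j : ℝ) : ℂ) := by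
        fun_prop
      exact (((Lp.memLp (l2Fourier hv)).locallyIntegrable (by norm_num)).smul_continuous
        h1).congr (ae_of_all _ fun ξ => by simp [mul_comm])
    · have hΦs : ContDiff ℝ ∞ fun ξ => (φ ξ : ℂ) := Complex.ofRealCLM.contDiff.comp hφ
      set Φ : 𝓢(Eu n, ℂ) := HasCompactSupport.toSchwartzMap
        (hφc.comp_left (g := Complex.ofReal) Complex.ofReal_zero) hΦs with hΦ
      have hΦa : ∀ ξ, Φ ξ = φ ξ := fun ξ => rfl
      -- Testing the weak identity with the inverse transform of a real test function φ yields the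
      -- desired identity integrated against φ on the Fourier side.
      set k : 𝓢(Eu n, ℂ) := 𝓕⁻ Φ with hk
      have hFk : 𝓕 k = Φ := FourierTransform.fourier_fourierInv_eq Φ
      set k' := LineDeriv.lineDerivOp (EuclideanSpace.single j (1 : ℝ)) k with hk'
      have h1 := h k j
      simp only [grad_schwartz] at h1
      rw [integral_mul_conj_eq_l2Fourier hv (k'.memLp 2),
        integral_mul_conj_eq_l2Fourier (hVj j) (k.memLp 2)] at h1
      have h2 : ∫ ξ, l2Fourier (hVj j) ξ * conj (l2Fourier (k.memLp 2) ξ) =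
          ∫ ξ, φ ξ • l2Fourier (hVj j) ξ := by
        refine integral_congr_ae ?_
        filter_upwards [l2Fourier_schwartz k (k.memLp 2)] with ξ hξ
        rw [hξ, hFk, hΦa, Complex.conj_ofReal, Complex.real_smul, mul_comm]
      have h3 : ∫ ξ, l2Fourier hv ξ * conj (l2Fourier (k'.memLp 2) ξ) =
          -∫ ξ, φ ξ • ((2 * Real.pi * Complex.I) * ((ξ j : ℝ) : ℂ) * l2Fourier hv ξ) := by
        rw [← integral_neg]
        refine integral_congr_ae ?_
        filter_upwards [l2Fourier_schwartz k' (k'.memLp 2)] with ξ hξ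
        rw [hξ, hk', fourier_lineDeriv_apply, hFk, hΦa]
        simp only [map_mul, Complex.conj_ofReal, Complex.conj_I, Complex.real_smul, map_ofNat]
        ring
      rw [h2, h3] at h1
      exact (neg_injective h1).symm
  have hm : ∀ u : Lp ℂ 2 (volume : Measure (Eu n)), AEMeasurable (fun ξ => ‖u ξ‖ₑ ^ 2) volume :=
    fun u => (Lp.aestronglyMeasurable u).enorm.pow_const 2
  have hVm : ∀ j, AEMeasurable (fun x => ‖V x j‖ₑ ^ 2) volume :=
    fun j => (hVj j).aestronglyMeasurable.enorm.pow_const 2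
  simp only [enorm_sq_eq_sum]
  rw [lintegral_finsetSum' _ fun j _ => hVm j]
  rw [Finset.sum_congr rfl fun j _ => (lintegral_l2Fourier (hVj j)).symm, ← lintegral_finsetSum' _ fun j _ => hm _]
  refine lintegral_congr_ae ?_
  filter_upwards [ae_all_iff.2 key] with ξ hξ
  simp only [hξ]
  exact (sum_enorm_freq ξ _).symm

end AbstractStrichartz

end

/-! ### Duality and cutoff bounds for homogeneous norms -/

noncomputable section
namespace AbstractStrichartz

open SchwartzMap

variable {n : ℕ}

theorem rpow_le_add_rpow {a b x : ℝ} (ha : 0 < a) (hax : a ≤ x) (hxb : x ≤ b) (t : ℝ) :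
    x ^ t ≤ a ^ t + b ^ t := by
  have hx : 0 < x := ha.trans_le hax
  have hb : 0 < b := hx.trans_le hxb
  rcases le_total 0 t with ht | ht
  · exact (Real.rpow_le_rpow hx.le hxb ht).trans (le_add_of_nonneg_left (by positivity))
  · exact (Real.rpow_le_rpow_of_nonpos ha hax ht).trans (le_add_of_nonneg_right (by positivity))

/-- A smooth cutoff to an annulus. -/
def annulusCutoff (ε : ℝ) (ξ : Eu n) : ℝ :=
  Real.smoothTransition (2 / ε ^ 2 * ‖ξ‖ ^ 2 - 1) * Real.smoothTransition (2 - ε ^ 2 * ‖ξ‖ ^ 2)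

theorem contDiff_annulusCutoff (ε : ℝ) : ContDiff ℝ ∞ (annulusCutoff (n := n) ε) := by
  have h : ContDiff ℝ ∞ fun ξ : Eu n => ‖ξ‖ ^ 2 := contDiff_norm_sq ℝ
  exact (Real.smoothTransition.contDiff.comp ((contDiff_const.mul h).sub contDiff_const)).mul
    (Real.smoothTransition.contDiff.comp (contDiff_const.sub (contDiff_const.mul h)))

theorem annulusCutoff_mem_Icc (ε : ℝ) (ξ : Eu n) : annulusCutoff ε ξ ∈ Icc (0 : ℝ) 1 :=
  ⟨mul_nonneg (Real.smoothTransition.nonneg _) (Real.smoothTransition.nonneg _),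
    mul_le_one₀ (Real.smoothTransition.le_one _) (Real.smoothTransition.nonneg _)
      (Real.smoothTransition.le_one _)⟩

theorem annulusCutoff_eq_one {ε : ℝ} (hε : 0 < ε) {ξ : Eu n} (h1 : ε ≤ ‖ξ‖) (h2 : ‖ξ‖ ≤ ε⁻¹) :
    annulusCutoff ε ξ = 1 := by
  have h3 : 2 / ε ^ 2 * ε ^ 2 ≤ 2 / ε ^ 2 * ‖ξ‖ ^ 2 := by gcongr
  have h4 : ε ^ 2 * ‖ξ‖ ^ 2 ≤ ε ^ 2 * ε⁻¹ ^ 2 := by gcongr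
  rw [div_mul_cancel₀ _ (by positivity)] at h3
  rw [← mul_pow ε ε⁻¹, mul_inv_cancel₀ hε.ne'] at h4
  rw [annulusCutoff, Real.smoothTransition.one_of_one_le (by linarith),
    Real.smoothTransition.one_of_one_le (by linarith), one_mul]

theorem norm_mem_of_annulusCutoff_ne_zero {ε : ℝ} (hε : 0 < ε) {ξ : Eu n}
    (h : annulusCutoff ε ξ ≠ 0) : ε / 2 ≤ ‖ξ‖ ∧ ‖ξ‖ ≤ 2 / ε := by
  have h1 : 0 < 2 / ε ^ 2 * ‖ξ‖ ^ 2 - 1 := by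
    by_contra! h0
    exact h (by rw [annulusCutoff, Real.smoothTransition.zero_of_nonpos h0, zero_mul])
  have h2 : 0 < 2 - ε ^ 2 * ‖ξ‖ ^ 2 := by
    by_contra! h0
    exact h (by rw [annulusCutoff, Real.smoothTransition.zero_of_nonpos h0, mul_zero])
  constructor
  · rw [sub_pos, div_mul_eq_mul_div, lt_div_iff₀ (by positivity)] at h1
    refine abs_le_of_sq_le_sq' ?_ (norm_nonneg _) |>.2
    nlinarith
  · rw [le_div_iff₀ hε]
    refine abs_le_of_sq_le_sq' ?_ zero_le_two |>.2
    nlinarith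

theorem homSob_eq_eLpNorm {f : Eu n → ℂ} (hf : MemLp f 2 volume) (s : ℝ) :
    homSob s f = eLpNorm (fun ξ => ((2 * Real.pi * ‖ξ‖) ^ s) • l2Fourier hf ξ) 2 volume := by
  rw [homSob_eq hf, eLpNorm_eq_lintegral_rpow_enorm_toReal two_ne_zero ENNReal.ofNat_ne_top]
  simp only [ENNReal.toReal_ofNat, ENNReal.rpow_two, enorm_smul, mul_pow]
  congr 1
  refine lintegral_congr fun ξ => ?_
  rw [Real.enorm_of_nonneg (by positivity), ← ENNReal.ofReal_pow (by positivity),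
    rpow_sq (by positivity)]

theorem memLp_conj {α : Type*} [MeasurableSpace α] {μ : Measure α} {f : α → ℂ} {p : ℝ≥0∞}
    (hf : MemLp f p μ) : MemLp (fun x => conj (f x)) p μ :=
  Complex.conjCLE.toContinuousLinearMap.comp_memLp' hf

theorem enorm_integral_mul_conj_le_eLpNorm {α : Type*} [MeasurableSpace α] {μ : Measure α}
    {f g : α → ℂ} (hf : MemLp f 2 μ) (hg : MemLp g 2 μ) :
    ‖∫ x, f x * conj (g x) ∂μ‖ₑ ≤ eLpNorm f 2 μ * eLpNorm g 2 μ := by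
  refine (enorm_integral_le_lintegral_enorm _).trans ?_
  simp only [enorm_mul, RCLike.enorm_conj]
  have := ENNReal.lintegral_mul_le_Lp_mul_Lq μ (p := 2) (q := 2) ⟨by norm_num,
    by norm_num, by norm_num⟩ hf.1.enorm hg.1.enorm
  simp only [Pi.mul_apply] at this
  refine this.trans_eq ?_
  rw [eLpNorm_eq_lintegral_rpow_enorm_toReal two_ne_zero ENNReal.ofNat_ne_top,
    eLpNorm_eq_lintegral_rpow_enorm_toReal two_ne_zero ENNReal.ofNat_ne_top]
  simp only [ENNReal.toReal_ofNat]

theorem enorm_integral_mul_conj_indicator {S : Set (Eu n)} (hS : MeasurableSet S) {F : Eu n → ℂ}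
    (hF : MemLp F 2 volume) {w : Eu n → ℝ} (hw : ∀ ξ, 0 ≤ w ξ)
    (hG : MemLp (S.indicator fun ξ => w ξ • F ξ) 2 volume) :
    ‖∫ ξ, F ξ * conj (S.indicator (fun ξ => w ξ • F ξ) ξ)‖ₑ =
      ∫⁻ ξ in S, ENNReal.ofReal (w ξ) * ‖F ξ‖ₑ ^ 2 := by
  have h1 : ∀ ξ, F ξ * conj (S.indicator (fun ξ => w ξ • F ξ) ξ) =
      ((S.indicator (fun ξ => w ξ * ‖F ξ‖ ^ 2) ξ : ℝ) : ℂ) := fun ξ => by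
    by_cases hξ : ξ ∈ S
    · rw [indicator_of_mem hξ, indicator_of_mem hξ, Complex.real_smul, map_mul,
        Complex.conj_ofReal, mul_left_comm, Complex.mul_conj, Complex.normSq_eq_norm_sq]
      push_cast
      rfl
    · rw [indicator_of_notMem hξ, indicator_of_notMem hξ]
      simp
  have h2 : Integrable (S.indicator fun ξ => w ξ * ‖F ξ‖ ^ 2) := by
    refine (integrable_mul_of_memLp hF (memLp_conj hG)).re.congr (ae_of_all _ fun ξ => ?_)
    have h3 := h1 ξ
    simp only at h3 ⊢
    rw [h3]
    simp
  have h3 : ∀ ξ, 0 ≤ S.indicator (fun ξ => w ξ * ‖F ξ‖ ^ 2) ξ :=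
    fun ξ => indicator_nonneg (fun ξ _ => mul_nonneg (hw ξ) (by positivity)) ξ
  simp only [h1]
  rw [integral_complex_ofReal, ← ofReal_norm, Complex.norm_real,
    Real.norm_of_nonneg (integral_nonneg h3),
    ofReal_integral_eq_lintegral_ofReal h2 (ae_of_all _ h3), ← lintegral_indicator hS]
  refine lintegral_congr fun ξ => ?_
  by_cases hξ : ξ ∈ S
  · rw [indicator_of_mem hξ, indicator_of_mem hξ, ENNReal.ofReal_mul (hw ξ),
      ENNReal.ofReal_pow (norm_nonneg _), ofReal_norm]
  · rw [indicator_of_notMem hξ, indicator_of_notMem hξ, ENNReal.ofReal_zero]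

theorem exists_schwartz_eq {f : Eu n → ℂ} (hc : HasCompactSupport f) (hf : ContDiff ℝ ∞ f) :
    ∃ Ψ : 𝓢(Eu n, ℂ), ∀ x, Ψ x = f x :=
  ⟨hc.toSchwartzMap hf, fun _ => rfl⟩

/-- Approximation in `L²` of functions supported in an annulus by Schwartz functions supported in
a slightly larger annulus. -/
theorem exists_schwartz_annulus {ε : ℝ} (hε : 0 < ε) {G : Eu n → ℂ} (hG : MemLp G 2 volume)
    (hGS : ∀ ξ, ¬ (ε ≤ ‖ξ‖ ∧ ‖ξ‖ ≤ ε⁻¹) → G ξ = 0) {δ : ℝ} (hδ : 0 < δ) :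
    ∃ Ψ : 𝓢(Eu n, ℂ), eLpNorm (fun ξ => Ψ ξ - G ξ) 2 volume ≤ ENNReal.ofReal δ ∧
      ∀ ξ, annulusCutoff ε ξ = 0 → Ψ ξ - G ξ = 0 := by
  obtain ⟨φ, hφc, hφ, hφG⟩ := hG.exist_eLpNorm_sub_le ENNReal.ofNat_ne_top one_le_two hδ
  obtain ⟨Ψ, hΨa⟩ := exists_schwartz_eq (f := fun ξ => annulusCutoff ε ξ • φ ξ)
    (hφc.smul_left (f := annulusCutoff ε)) ((contDiff_annulusCutoff ε).smul hφ)
  have hd : ∀ ξ, Ψ ξ - G ξ = annulusCutoff ε ξ • (φ ξ - G ξ) := fun ξ => by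
    rw [hΨa, smul_sub]
    by_cases hξ : ε ≤ ‖ξ‖ ∧ ‖ξ‖ ≤ ε⁻¹
    · rw [annulusCutoff_eq_one hε hξ.1 hξ.2, one_smul, one_smul]
    · rw [hGS ξ hξ, smul_zero]
  have hdle : ∀ ξ, ‖Ψ ξ - G ξ‖ ≤ ‖G ξ - φ ξ‖ := fun ξ => by
    rw [hd, norm_smul, Real.norm_of_nonneg (annulusCutoff_mem_Icc ε ξ).1, norm_sub_rev]
    exact mul_le_of_le_one_left (norm_nonneg _) (annulusCutoff_mem_Icc ε ξ).2
  exact ⟨Ψ, (eLpNorm_mono hdle).trans hφG, fun ξ hξ => by rw [hd, hξ, zero_smul]⟩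

theorem memLp_annulus_indicator {ε : ℝ} (hε : 0 < ε) {F : Eu n → ℂ} (hF : MemLp F 2 volume)
    (t : ℝ) : MemLp ({ξ : Eu n | ε ≤ ‖ξ‖ ∧ ‖ξ‖ ≤ ε⁻¹}.indicator
      fun ξ => ((2 * Real.pi * ‖ξ‖) ^ t) • F ξ) 2 volume := by
  have hSm : MeasurableSet {ξ : Eu n | ε ≤ ‖ξ‖ ∧ ‖ξ‖ ≤ ε⁻¹} :=
    (measurableSet_le measurable_const measurable_norm).inter
      (measurableSet_le measurable_norm measurable_const)
  have hwm : Measurable fun ξ : Eu n => (2 * Real.pi * ‖ξ‖) ^ t := by fun_prop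
  refine MemLp.of_le_mul (c := (2 * Real.pi * ε) ^ t + (2 * Real.pi * ε⁻¹) ^ t) hF
    ((hwm.aestronglyMeasurable.smul hF.1).indicator hSm) (ae_of_all _ fun ξ => ?_)
  by_cases hξ : ε ≤ ‖ξ‖ ∧ ‖ξ‖ ≤ ε⁻¹
  · rw [indicator_of_mem (s := {ξ : Eu n | ε ≤ ‖ξ‖ ∧ ‖ξ‖ ≤ ε⁻¹}) hξ, norm_smul,
      Real.norm_of_nonneg (by positivity)]
    obtain ⟨h1, h2⟩ := hξ
    gcongr
    exact rpow_le_add_rpow (by positivity) (by gcongr) (by gcongr) t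
  · rw [indicator_of_notMem (s := {ξ : Eu n | ε ≤ ‖ξ‖ ∧ ‖ξ‖ ≤ ε⁻¹}) hξ, norm_zero]
    positivity

/-- Test with G = |2πξ|^{2s}F restricted to the annulus: the square integral I satisfies I ≤ A
I^{1/2}. On the annulus the weight is bounded above and below, so I is finite and one factor I^{1/2}
can be cancelled. As G is not Schwartz, it is first approximated by Schwartz functions supported in
a slightly larger annulus. -/
theorem lintegral_annulus_le {F : Eu n → ℂ} (hF : MemLp F 2 volume) {s : ℝ} {A : ℝ≥0∞}
    (hA : A ≠ ⊤) (h : ∀ Ψ : 𝓢(Eu n, ℂ), ‖∫ ξ, F ξ * conj (Ψ ξ)‖ₑ ≤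
      A * eLpNorm (fun ξ => ((2 * Real.pi * ‖ξ‖) ^ (-s)) • Ψ ξ) 2 volume) {ε : ℝ}
    (hε : 0 < ε) :
    ∫⁻ ξ in {ξ | ε ≤ ‖ξ‖ ∧ ‖ξ‖ ≤ ε⁻¹}, ENNReal.ofReal ((2 * Real.pi * ‖ξ‖) ^ (2 * s)) *
      ‖F ξ‖ₑ ^ 2 ≤ A ^ 2 := by
  set S : Set (Eu n) := {ξ | ε ≤ ‖ξ‖ ∧ ‖ξ‖ ≤ ε⁻¹} with hS
  have hSm : MeasurableSet S :=
    (measurableSet_le measurable_const measurable_norm).inter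
      (measurableSet_le measurable_norm measurable_const)
  -- The weight is a monotone power of |ξ|, so the sum of its values at the two radii bounds it on
  -- the larger annulus whatever the sign of s.
  set W : ℝ := (2 * Real.pi * (ε / 2)) ^ (-s) + (2 * Real.pi * (2 / ε)) ^ (-s) with hW
  set G : Eu n → ℂ := S.indicator fun ξ => ((2 * Real.pi * ‖ξ‖) ^ (2 * s)) • F ξ with hG
  have hwm : Measurable fun ξ : Eu n => (2 * Real.pi * ‖ξ‖) ^ (-s) := by fun_prop
  have hGm : MemLp G 2 volume := memLp_annulus_indicator hε hF _
  set I : ℝ≥0∞ := ∫⁻ ξ in S, ENNReal.ofReal ((2 * Real.pi * ‖ξ‖) ^ (2 * s)) * ‖F ξ‖ₑ ^ 2 with hI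
  have hIG : ‖∫ ξ, F ξ * conj (G ξ)‖ₑ = I :=
    enorm_integral_mul_conj_indicator hSm hF (fun ξ => by positivity) hGm
  have hItop : I ≠ ⊤ := hIG ▸ enorm_ne_top
  have hNG : eLpNorm (fun ξ => ((2 * Real.pi * ‖ξ‖) ^ (-s)) • G ξ) 2 volume = I ^ (1 / 2 : ℝ) := by
    rw [eLpNorm_eq_lintegral_rpow_enorm_toReal two_ne_zero ENNReal.ofNat_ne_top, hI,
      ← lintegral_indicator hSm]
    simp only [ENNReal.toReal_ofNat, ENNReal.rpow_two]
    congr 1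
    refine lintegral_congr fun ξ => ?_
    by_cases hξ : ξ ∈ S
    · have h0 : 0 < 2 * Real.pi * ‖ξ‖ := by
        have := hε.trans_le hξ.1
        positivity
      rw [hG, indicator_of_mem hξ, indicator_of_mem hξ, smul_smul, ← Real.rpow_add h0,
        enorm_smul, mul_pow, Real.enorm_of_nonneg (by positivity),
        ← ENNReal.ofReal_pow (by positivity), rpow_sq (by positivity)]
      ring_nf
    · rw [hG, indicator_of_notMem hξ, indicator_of_notMem hξ]
      simp
  have key : ∀ δ : ℝ, 0 < δ → I ≤ A * I ^ (1 / 2 : ℝ) +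
      (A * ENNReal.ofReal W + eLpNorm F 2 volume) * ENNReal.ofReal δ := fun δ hδ => by
    obtain ⟨Ψ, hdn, hd0⟩ := exists_schwartz_annulus hε hGm
      (fun ξ hξ => indicator_of_notMem (show ξ ∉ S from hξ) _) hδ
    have hdm : MemLp (fun ξ => Ψ ξ - G ξ) 2 volume := (Ψ.memLp 2).sub hGm
    have hdw : eLpNorm (fun ξ => ((2 * Real.pi * ‖ξ‖) ^ (-s)) • (Ψ ξ - G ξ)) 2 volume ≤
        ENNReal.ofReal W * ENNReal.ofReal δ := by
      refine (eLpNorm_le_mul_eLpNorm_of_ae_le_mul (c := W) (ae_of_all _ fun ξ => ?_)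
        2).trans (mul_le_mul_right hdn _)
      rw [norm_smul, Real.norm_of_nonneg (by positivity)]
      by_cases hξ : annulusCutoff ε ξ = 0
      · rw [hd0 ξ hξ, norm_zero, mul_zero, mul_zero]
      · obtain ⟨h1, h2⟩ := norm_mem_of_annulusCutoff_ne_zero hε hξ
        gcongr
        exact rpow_le_add_rpow (by positivity) (by gcongr) (by gcongr) _
    have hk := h Ψ
    have hΨ : (fun ξ => ((2 * Real.pi * ‖ξ‖) ^ (-s)) • Ψ ξ) =
        (fun ξ => ((2 * Real.pi * ‖ξ‖) ^ (-s)) • G ξ) +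
        fun ξ => ((2 * Real.pi * ‖ξ‖) ^ (-s)) • (Ψ ξ - G ξ) := by
      funext ξ
      rw [Pi.add_apply, ← smul_add]
      congr 1
      ring
    have h5 : ∫ ξ, F ξ * conj (G ξ) =
        (∫ ξ, F ξ * conj (Ψ ξ)) - ∫ ξ, F ξ * conj (Ψ ξ - G ξ) := by
      rw [← integral_sub (integrable_mul_of_memLp hF (memLp_conj (Ψ.memLp 2)))
        (integrable_mul_of_memLp hF (memLp_conj hdm))]
      refine integral_congr_ae (ae_of_all _ fun ξ => ?_)
      simp only [map_sub]
      ring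
    have h6 : ‖∫ ξ, F ξ * conj (Ψ ξ - G ξ)‖ₑ ≤ eLpNorm F 2 volume * ENNReal.ofReal δ :=
      (enorm_integral_mul_conj_le_eLpNorm hF hdm).trans (mul_le_mul_right hdn _)
    calc I = ‖∫ ξ, F ξ * conj (G ξ)‖ₑ := hIG.symm
      _ ≤ ‖∫ ξ, F ξ * conj (Ψ ξ)‖ₑ + ‖∫ ξ, F ξ * conj (Ψ ξ - G ξ)‖ₑ := by
          rw [h5]; exact enorm_sub_le
      _ ≤ A * (I ^ (1 / 2 : ℝ) + ENNReal.ofReal W * ENNReal.ofReal δ) +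
          eLpNorm F 2 volume * ENNReal.ofReal δ := by
          refine add_le_add (hk.trans (mul_le_mul_right ?_ _)) h6
          rw [hΨ]
          exact (eLpNorm_add_le (hwm.aestronglyMeasurable.smul hGm.1)
            (hwm.aestronglyMeasurable.smul hdm.1) one_le_two).trans (add_le_add hNG.le hdw)
      _ = _ := by ring
  have hle : I ≤ A * I ^ (1 / 2 : ℝ) := by
    have hc : A * ENNReal.ofReal W + eLpNorm F 2 volume ≠ ⊤ := by
      have := hF.2.ne
      finiteness
    have h1 : Tendsto (fun k : ℕ => A * I ^ (1 / 2 : ℝ) +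
        (A * ENNReal.ofReal W + eLpNorm F 2 volume) *
          ENNReal.ofReal ((1 : ℝ) / (k + 1))) atTop (𝓝 (A * I ^ (1 / 2 : ℝ) +
        (A * ENNReal.ofReal W + eLpNorm F 2 volume) * ENNReal.ofReal 0)) :=
      tendsto_const_nhds.add (ENNReal.Tendsto.const_mul
        (ENNReal.tendsto_ofReal tendsto_one_div_add_atTop_nhds_zero_nat) (Or.inr hc))
    rw [ENNReal.ofReal_zero, mul_zero, add_zero] at h1
    exact ge_of_tendsto' h1 fun k => key _ (by positivity)
  rcases eq_or_ne I 0 with h0 | h0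
  · rw [h0]; exact zero_le
  have hI2 : I = I ^ (1 / 2 : ℝ) * I ^ (1 / 2 : ℝ) := by
    rw [← ENNReal.rpow_add _ _ h0 hItop]; norm_num
  have h7 : I ^ (1 / 2 : ℝ) ≤ A := by
    have h8 : I ^ (1 / 2 : ℝ) * I ^ (1 / 2 : ℝ) ≤ A * I ^ (1 / 2 : ℝ) := hI2 ▸ hle
    exact (ENNReal.mul_le_mul_iff_left (by simp [h0, hItop]) (by finiteness)).1 h8
  calc I = I ^ (1 / 2 : ℝ) * I ^ (1 / 2 : ℝ) := hI2
    _ ≤ A * A := mul_le_mul' h7 h7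
    _ = A ^ 2 := (sq A).symm

theorem sq_lintegral_annulus_le {f : Eu n → ℂ} (hf : MemLp f 2 volume) {s : ℝ} {A : ℝ≥0∞}
    (hA : A ≠ ⊤) (h : ∀ h : 𝓢(Eu n, ℂ), ‖∫ x, f x * conj (h x)‖ₑ ≤ A * homSob (-s) h) {ε : ℝ}
    (hε : 0 < ε) :
    ∫⁻ ξ in {ξ | ε ≤ ‖ξ‖ ∧ ‖ξ‖ ≤ ε⁻¹}, ENNReal.ofReal ((2 * Real.pi * ‖ξ‖) ^ (2 * s)) *
      ‖l2Fourier hf ξ‖ₑ ^ 2 ≤ A ^ 2 := by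
  refine lintegral_annulus_le (Lp.memLp _) hA (fun Ψ => ?_) hε
  have hk := h (𝓕⁻ Ψ)
  have hkF := l2Fourier_schwartz (𝓕⁻ Ψ) ((𝓕⁻ Ψ).memLp 2)
  rw [FourierTransform.fourier_fourierInv_eq] at hkF
  rwa [integral_mul_conj_eq_l2Fourier hf ((𝓕⁻ Ψ).memLp 2), homSob_eq_eLpNorm ((𝓕⁻ Ψ).memLp 2),
    eLpNorm_congr_ae (g := fun ξ => ((2 * Real.pi * ‖ξ‖) ^ (-s)) • Ψ ξ)
      (by filter_upwards [hkF] with ξ hξ; rw [hξ]),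
    integral_congr_ae (g := fun ξ => l2Fourier hf ξ * conj (Ψ ξ))
      (by filter_upwards [hkF] with ξ hξ; rw [hξ])] at hk

/-- Duality of the homogeneous Sobolev norms. -/
theorem homSob_le_of_forall_schwartz (hn : 0 < n) {f : Eu n → ℂ} (hf : MemLp f 2 volume) {s : ℝ}
    {A : ℝ≥0∞} (h : ∀ h : 𝓢(Eu n, ℂ), ‖∫ x, f x * conj (h x)‖ₑ ≤ A * homSob (-s) h) :
    homSob s f ≤ A := by
  rcases eq_or_ne A ⊤ with rfl | hA
  · exact le_top
  refine (ENNReal.pow_le_pow_left_iff two_ne_zero).1 ?_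
  rw [homSob_sq hf]
  -- Annuli that exhaust everything but the origin, a null set since n > 0.
  set S : ℕ → Set (Eu n) := fun k => {ξ | ((k : ℝ) + 1)⁻¹ ≤ ‖ξ‖ ∧ ‖ξ‖ ≤ (((k : ℝ) + 1)⁻¹)⁻¹}
    with hS
  have hmono : Monotone S := fun k l hkl ξ hξ => by
    have : (k : ℝ) ≤ l := by exact_mod_cast hkl
    refine ⟨le_trans (by gcongr) hξ.1, hξ.2.trans (by gcongr)⟩
  have hU : (⋃ k, S k) =ᵐ[volume] (univ : Set (Eu n)) := by
    have : Nontrivial (Eu n) := Module.nontrivial_of_finrank_pos (R := ℝ) (by simpa using hn)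
    have h0 : ∀ᵐ η : Eu n, η ≠ 0 := by simp [ae_iff]
    refine eventuallyEq_univ.2 ?_
    filter_upwards [h0] with ξ hξ
    obtain ⟨k, hk⟩ := exists_nat_ge (max ‖ξ‖ ‖ξ‖⁻¹)
    have hξ0 : 0 < ‖ξ‖ := norm_pos_iff.2 hξ
    refine mem_iUnion.2 ⟨k, ?_, ?_⟩
    · rw [inv_le_comm₀ (by positivity) hξ0]
      linarith [le_max_right ‖ξ‖ ‖ξ‖⁻¹]
    · rw [inv_inv]
      linarith [le_max_left ‖ξ‖ ‖ξ‖⁻¹]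
  rw [← setLIntegral_univ, ← setLIntegral_congr hU,
    setLIntegral_iUnion_of_directed _ hmono.directed_le]
  exact iSup_le fun k => sq_lintegral_annulus_le hf hA h (by positivity)

theorem exists_homSob_schwartzMul_le (hn : 0 < n) {σ : ℝ} (hσ : 0 ≤ σ) (hσn : σ < n / 2)
    (χ : 𝓢(Eu n, ℂ)) :
    ∃ C : ℝ≥0, ∀ h : 𝓢(Eu n, ℂ), homSob σ (schwartzMul χ h) ≤ C * homSob σ h := by
  obtain ⟨C, hC⟩ := exists_sobolev_schwartzMul_le hn hσ hσn χ
  refine ⟨NNReal.sqrt C, fun h => (ENNReal.pow_le_pow_left_iff two_ne_zero).1 ?_⟩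
  rw [mul_pow, ← ENNReal.coe_pow, NNReal.sq_sqrt, homSob_schwartz_sq, homSob_schwartz_sq]
  refine le_trans (lintegral_mono fun ξ => ?_) (hC h)
  gcongr
  rw [← rpow_sq (by positivity), sq, ← Real.mul_rpow (by positivity) (by positivity), ← sq]
  refine Real.rpow_le_rpow (by positivity) ?_ hσ
  linarith

theorem exists_homSob_sub_schwartzMul_le (hn : 0 < n) {σ : ℝ} (hσ : 0 ≤ σ) (hσn : σ < n / 2)
    (χ : 𝓢(Eu n, ℂ)) :
    ∃ C : ℝ≥0, ∀ h : 𝓢(Eu n, ℂ), homSob σ (h - schwartzMul χ h : 𝓢(Eu n, ℂ)) ≤ C * homSob σ h := by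
  obtain ⟨C, hC⟩ := exists_homSob_schwartzMul_le hn hσ hσn χ
  refine ⟨2 * (1 + C), fun h => (ENNReal.pow_le_pow_left_iff two_ne_zero).1 ?_⟩
  have h1 : ∀ ξ, ‖𝓕 (h - schwartzMul χ h) ξ‖ₑ ^ 2 ≤
      2 * (‖𝓕 h ξ‖ₑ ^ 2 + ‖𝓕 (schwartzMul χ h) ξ‖ₑ ^ 2) := fun ξ => by
    have h2 : 𝓕 (h - schwartzMul χ h) = 𝓕 h - 𝓕 (schwartzMul χ h) :=
      map_sub (FourierTransform.fourierCLM ℂ 𝓢(Eu n, ℂ)) _ _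
    rw [h2, _root_.sub_apply]
    exact (pow_le_pow_left₀ zero_le enorm_sub_le 2).trans (ENNReal_add_sq_le _ _)
  have h3 : homSob σ (h - schwartzMul χ h : 𝓢(Eu n, ℂ)) ^ 2 ≤
      2 * (homSob σ h ^ 2 + homSob σ (schwartzMul χ h) ^ 2) := by
    have hm : ∀ w : 𝓢(Eu n, ℂ), Measurable fun ξ => ‖𝓕 w ξ‖ₑ ^ 2 := fun w => by
      have := (𝓕 w).continuous
      fun_prop
    rw [homSob_schwartz_sq, homSob_schwartz_sq, homSob_schwartz_sq,
      ← lintegral_add_left (by have := hm h; fun_prop), ← lintegral_const_mul' _ _ (by simp)]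
    refine lintegral_mono fun ξ => ?_
    refine (mul_le_mul_right (h1 ξ) _).trans_eq ?_
    ring
  refine h3.trans ?_
  have h4 : homSob σ (schwartzMul χ h) ^ 2 ≤ (C * homSob σ h) ^ 2 := pow_le_pow_left₀ zero_le (hC h) 2
  calc 2 * (homSob σ h ^ 2 + homSob σ (schwartzMul χ h) ^ 2)
      ≤ 2 * (homSob σ h ^ 2 + (C * homSob σ h) ^ 2) := by gcongr
    _ = (2 + 2 * (C : ℝ≥0∞) ^ 2) * homSob σ h ^ 2 := by ring
    _ ≤ ((2 + 2 * (C : ℝ≥0∞) ^ 2) + (2 + 8 * C + 2 * C ^ 2)) * homSob σ h ^ 2 := by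
        gcongr ?_ * _; exact le_self_add
    _ = _ := by push_cast; ring

/-- Boundedness of `h ↦ (1 - χ) h` on the homogeneous Sobolev spaces, for real `χ`. -/
theorem exists_homSob_sub_schwartzMul_le_of_abs_lt (hn : 0 < n) {s : ℝ} (hs : |s| < n / 2)
    {χ : 𝓢(Eu n, ℂ)} (hχ : ∀ x, conj (χ x) = χ x) :
    ∃ C : ℝ≥0, ∀ h : 𝓢(Eu n, ℂ), homSob s (h - schwartzMul χ h : 𝓢(Eu n, ℂ)) ≤ C * homSob s h := by
  rcases le_total 0 s with h0 | h0
  · exact exists_homSob_sub_schwartzMul_le hn h0 (by rwa [abs_of_nonneg h0] at hs) χ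
  obtain ⟨C, hC⟩ := exists_homSob_sub_schwartzMul_le hn (neg_nonneg.2 h0)
    (by rwa [abs_of_nonpos h0] at hs) χ
  refine ⟨C, fun h => homSob_le_of_forall_schwartz hn ((h - schwartzMul χ h).memLp 2) fun k => ?_⟩
  have h1 : ∫ x, (h - schwartzMul χ h) x * conj (k x) =
      ∫ x, h x * conj ((k - schwartzMul χ k) x) := by
    refine integral_congr_ae (ae_of_all _ fun x => ?_)
    simp only [_root_.sub_apply, schwartzMul_apply, map_sub, map_mul, hχ]
    ring
  rw [h1]
  refine (enorm_integral_mul_conj_le hn (h.memLp 2) ((k - schwartzMul χ k).memLp 2) s).trans ?_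
  calc homSob s h * homSob (-s) (k - schwartzMul χ k : 𝓢(Eu n, ℂ))
      ≤ homSob s h * (C * homSob (-s) k) := mul_le_mul_right (hC k) _
    _ = _ := by ring

end AbstractStrichartz

end

/-! ### Periodization and transfer between Ω and the torus -/

noncomputable section
namespace AbstractStrichartz

variable {n : ℕ}

namespace Exterior

variable (M : Exterior n)

/-- The open ball `{|x| < 2R}`, on which the exterior domain and the torus agree. -/
abbrev core : Set (Eu n) := Metric.ball 0 (2 * M.R)

theorem abs_coord_le (x : Eu n) (i : Fin n) : |x i| ≤ ‖x‖ := by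
  simpa using PiLp.norm_apply_le x i

theorem cube_inter_core : M.cube ∩ M.core = M.Ω ∩ M.core := by
  ext x
  simp only [cube, Ω, mem_inter_iff, Set.mem_sdiff, mem_compl_iff, Metric.mem_ball, dist_zero_right]
  refine ⟨fun h => ⟨h.1.2, h.2⟩, fun h => ⟨⟨fun i => ?_, h.1⟩, h.2⟩⟩
  have h1 := abs_lt.1 ((abs_coord_le x i).trans_lt h.2)
  exact ⟨by linarith [h1.1], h1.2⟩

theorem measurableSet_cube : MeasurableSet M.cube := by
  refine MeasurableSet.diff ?_ M.isCompact_K.measurableSet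
  have : {x : Eu n | ∀ i, x i ∈ Ico (-2 * M.R) (2 * M.R)} =
      ⋂ i, (fun x : Eu n => x i) ⁻¹' Ico (-2 * M.R) (2 * M.R) := by
    ext x; simp
  rw [this]
  exact MeasurableSet.iInter fun i => measurableSet_Ico.preimage (by fun_prop)

theorem exists_cube_subset_closedBall : ∃ ρ : ℝ, M.cube ⊆ Metric.closedBall 0 ρ := by
  refine ⟨∑ _i : Fin n, 2 * M.R, fun x hx => ?_⟩
  have h1 : ‖x‖ ≤ ∑ i, ‖x i‖ := by
    calc ‖x‖ = ‖∑ i, EuclideanSpace.single i (x i)‖ := by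
          congr 1
          ext j
          simp [Finset.sum_apply, Pi.single_apply]
      _ ≤ ∑ i, ‖EuclideanSpace.single i (x i)‖ := norm_sum_le _ _
      _ = ∑ i, ‖x i‖ := by simp
  rw [mem_closedBall_zero_iff]
  refine h1.trans (Finset.sum_le_sum fun i _ => ?_)
  have := hx.1 i
  exact abs_le.2 ⟨by linarith [this.1], this.2.le⟩

theorem volume_cube_lt_top : volume M.cube < ⊤ := by
  obtain ⟨ρ, hρ⟩ := M.exists_cube_subset_closedBall
  exact (measure_mono hρ).trans_lt measure_closedBall_lt_top

theorem memLp_cube_of_continuous {E : Type*} [NormedAddCommGroup E] {f : Eu n → E}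
    (hf : Continuous f) (hm : AEStronglyMeasurable f (volume.restrict M.cube)) :
    MemLp f 2 (volume.restrict M.cube) := by
  obtain ⟨ρ, hρ⟩ := M.exists_cube_subset_closedBall
  obtain ⟨C, hC⟩ := (isCompact_closedBall (0 : Eu n) ρ).exists_bound_of_continuousOn hf.continuousOn
  have : IsFiniteMeasure (volume.restrict M.cube) := ⟨by
    rw [Measure.restrict_apply_univ]; exact M.volume_cube_lt_top⟩
  exact MemLp.of_bound hm C (ae_restrict_of_forall_mem M.measurableSet_cube fun x hx => hC x (hρ hx))

theorem isTestClass_testTorus : IsTestClass M.cube M.testTorus where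
  add φ hφ ψ hψ := ⟨hφ.1.add hψ.1, fun i x => by
    simp only [hφ.2.1, hψ.2.1],
    Disjoint.mono_left (tsupport_add φ ψ) (disjoint_union_left.2 ⟨hφ.2.2, hψ.2.2⟩)⟩
  const_mul φ hφ c := ⟨contDiff_const.mul hφ.1, fun i x => by
    simp only [hφ.2.1],
    Disjoint.mono_left (tsupport_mul_subset_right (f := fun _ => c)) hφ.2.2⟩
  zero := ⟨contDiff_const, fun _ _ => rfl, by
    rw [show (fun _ : Eu n => (0 : ℂ)) = 0 from rfl, tsupport_zero]; exact empty_disjoint _⟩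
  smooth φ hφ := hφ.1
  memLp φ hφ := M.memLp_cube_of_continuous hφ.1.continuous hφ.1.continuous.aestronglyMeasurable
  memLp_grad φ hφ := M.memLp_cube_of_continuous (continuous_grad hφ.1)
    (continuous_grad hφ.1).aestronglyMeasurable

/-! ### Periodization -/

theorem period_pos : 0 < 4 * M.R := by linarith [M.R_pos]

/-- The representative of a point in the fundamental cube. -/
def wrap (x : Eu n) : Eu n := WithLp.toLp 2 fun i => toIcoMod M.period_pos (-2 * M.R) (x i)

/-- Lattice vectors. -/
def latticeVec (m : Fin n → ℤ) : Eu n := WithLp.toLp 2 fun i => m i • (4 * M.R)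

theorem wrap_add_latticeVec (x : Eu n) (m : Fin n → ℤ) : M.wrap (x + M.latticeVec m) = M.wrap x := by
  ext i
  exact toIcoMod_add_zsmul M.period_pos (-2 * M.R) (x i) (m i)

theorem exists_wrap_eq (x : Eu n) : ∃ m, M.wrap x = x + M.latticeVec m := by
  refine ⟨fun i => -toIcoDiv M.period_pos (-2 * M.R) (x i), ?_⟩
  ext i
  simp only [wrap, latticeVec, PiLp.add_apply, toIcoMod, neg_smul]
  abel

theorem single_eq_latticeVec (i : Fin n) :
    EuclideanSpace.single i (4 * M.R) = M.latticeVec (Pi.single i 1) := by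
  ext j
  rcases eq_or_ne j i with rfl | h
  · simp [latticeVec]
  · simp [latticeVec, h]

theorem wrap_mem (x : Eu n) (i : Fin n) : M.wrap x i ∈ Ico (-2 * M.R) (2 * M.R) := by
  have := toIcoMod_mem_Ico M.period_pos (-2 * M.R) (x i)
  rwa [show -2 * M.R + 4 * M.R = 2 * M.R by ring] at this

/-- The periodic extension of a function supported in the core. -/
def periodize (f : Eu n → ℂ) (x : Eu n) : ℂ := f (M.wrap x)

/-- If wrapping moves x, some coordinate changes by at least 4R while the wrapped one is at most 2R
in modulus. Hence |x_i| ≥ 2R > ρ, and |x_i| < 4R - ρ forces the wrapped coordinate beyond ρ as well;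
f vanishes at both points. -/
theorem periodize_eq {f : Eu n → ℂ} {ρ : ℝ} (hρ : ρ < 2 * M.R)
    (hf : ∀ x, ρ < ‖x‖ → f x = 0) {x : Eu n} (hx : ∀ i, |x i| < 4 * M.R - ρ) :
    M.periodize f x = f x := by
  rw [periodize]
  obtain ⟨m, hm⟩ := M.exists_wrap_eq x
  by_cases h0 : m = 0
  · rw [hm, h0]
    congr 1
    ext i
    simp [latticeVec]
  · obtain ⟨i, hi⟩ := Function.ne_iff.1 h0
    have hmi : M.wrap x i = x i + m i * (4 * M.R) := by rw [hm]; simp [latticeVec]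
    have hw := M.wrap_mem x i
    have h1 : (1 : ℝ) ≤ |(m i : ℝ)| := by
      exact_mod_cast Int.one_le_abs hi
    have hR := M.R_pos
    have h2 : 4 * M.R ≤ |(m i : ℝ) * (4 * M.R)| := by
      rw [abs_mul, abs_of_pos M.period_pos]
      nlinarith
    have h3 : |(m i : ℝ) * (4 * M.R)| ≤ |M.wrap x i| + |x i| := by
      have := abs_sub (M.wrap x i) (x i)
      rwa [hmi, add_sub_cancel_left, ← hmi] at this
    have h4 : |M.wrap x i| ≤ 2 * M.R := abs_le.2 ⟨by linarith [hw.1], hw.2.le⟩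
    rw [hf (M.wrap x) (by linarith [abs_coord_le (M.wrap x) i, hx i]),
      hf x (by linarith [abs_coord_le x i])]

theorem exists_radius_lt {f : Eu n → ℂ} (hc : HasCompactSupport f) (hf : tsupport f ⊆ M.core) :
    ∃ ρ < 2 * M.R, ∀ x, ρ < ‖x‖ → f x = 0 := by
  have hR := M.R_pos
  rcases (tsupport f).eq_empty_or_nonempty with h0 | h0
  · exact ⟨0, by linarith, fun x _ => image_eq_zero_of_notMem_tsupport (by simp [h0])⟩
  · obtain ⟨y, hy, hmax⟩ := hc.isCompact.exists_isMaxOn h0 continuous_norm.continuousOn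
    refine ⟨‖y‖, by simpa using hf hy, fun x hx => image_eq_zero_of_notMem_tsupport fun h => ?_⟩
    exact absurd (hmax h) (not_le.2 hx)

theorem isOpen_coord_lt (r : ℝ) : IsOpen {x : Eu n | ∀ i, |x i| < r} := by
  have : {x : Eu n | ∀ i, |x i| < r} = ⋂ i, {x | |x i| < r} := by ext x; simp
  rw [this]
  exact isOpen_iInter_of_finite fun i => isOpen_lt (by fun_prop) continuous_const

theorem periodize_eventuallyEq {f : Eu n → ℂ} (hc : HasCompactSupport f)
    (hf : tsupport f ⊆ M.core) {x : Eu n} (hx : ∀ i, |x i| ≤ 2 * M.R) :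
    M.periodize f =ᶠ[𝓝 x] f := by
  obtain ⟨ρ, hρ, h0⟩ := M.exists_radius_lt hc hf
  filter_upwards [(isOpen_coord_lt (4 * M.R - ρ)).mem_nhds fun i => by linarith [hx i]] with y hy
  exact M.periodize_eq hρ h0 hy

/-- Near every point the periodization is the translate of f by one fixed lattice vector, even at
the faces of the cube, since f vanishes in a neighbourhood of them. -/
theorem contDiff_periodize {f : Eu n → ℂ} (hs : ContDiff ℝ ∞ f) (hc : HasCompactSupport f)
    (hf : tsupport f ⊆ M.core) : ContDiff ℝ ∞ (M.periodize f) := by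
  rw [contDiff_iff_contDiffAt]
  intro x
  obtain ⟨m, hm⟩ := M.exists_wrap_eq x
  have h1 : M.periodize f =ᶠ[𝓝 (x + M.latticeVec m)] f :=
    M.periodize_eventuallyEq hc hf fun i => by
      rw [← hm]
      have := M.wrap_mem x i
      exact abs_le.2 ⟨by linarith [this.1], this.2.le⟩
  have h2 : Tendsto (fun y => y + M.latticeVec m) (𝓝 x) (𝓝 (x + M.latticeVec m)) :=
    (continuous_id.add continuous_const).tendsto x
  have h3 : M.periodize f =ᶠ[𝓝 x] fun y => f (y + M.latticeVec m) := by
    filter_upwards [h2.eventually h1] with y hy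
    rw [← hy, periodize, periodize, wrap_add_latticeVec]
  refine ContDiffAt.congr_of_eventuallyEq ?_ h3
  exact (hs.comp (contDiff_id.add contDiff_const)).contDiffAt

theorem periodize_mem_testTorus {f : Eu n → ℂ} (hs : ContDiff ℝ ∞ f) (hc : HasCompactSupport f)
    (hf : tsupport f ⊆ M.core) (hK : Disjoint (tsupport f) M.K) : M.periodize f ∈ M.testTorus := by
  refine ⟨M.contDiff_periodize hs hc hf, fun i x => ?_, ?_⟩
  · rw [single_eq_latticeVec, periodize, wrap_add_latticeVec, periodize]
  · rw [Set.disjoint_right] at hK ⊢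
    intro x hx
    have hxR : ‖x‖ < M.R := by simpa using M.K_subset hx
    have h1 := M.periodize_eventuallyEq hc hf (x := x) fun i => by
      linarith [abs_coord_le x i, M.R_pos]
    rw [notMem_tsupport_iff_eventuallyEq]
    exact h1.trans (notMem_tsupport_iff_eventuallyEq.1 (hK hx))

theorem abs_coord_le_of_mem_cube {x : Eu n} (hx : x ∈ M.cube) (i : Fin n) : |x i| ≤ 2 * M.R :=
  abs_le.2 ⟨by linarith [(hx.1 i).1], (hx.1 i).2.le⟩

theorem grad_congr {φ ψ : Eu n → ℂ} {x : Eu n} (h : φ =ᶠ[𝓝 x] ψ) : grad φ x = grad ψ x := by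
  ext j
  rw [grad_apply, grad_apply, h.fderiv_eq]

/-! ### Localization of the form domain to the core -/

/-- Multiplication by `χ` maps test functions in `𝒯` to test functions in `𝒯'`. -/
def MapsTest (χ : Eu n → ℂ) (𝒯 : Set (Eu n → ℂ)) (D' : Set (Eu n)) (𝒯' : Set (Eu n → ℂ)) : Prop :=
  ∀ φ ∈ 𝒯, ∃ φ' ∈ 𝒯', ∀ x ∈ D', φ' x = χ x * φ x ∧ grad φ' x = grad (fun x => χ x * φ x) x

theorem mapsTest_testΩ {χ : Eu n → ℂ} (hs : ContDiff ℝ ∞ χ) (hc : HasCompactSupport χ)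
    {𝒯 : Set (Eu n → ℂ)} (h𝒯 : ∀ φ ∈ 𝒯, ContDiff ℝ ∞ φ ∧ Disjoint (tsupport φ) M.K) :
    MapsTest χ 𝒯 M.Ω M.testΩ := fun φ hφ => by
  refine ⟨fun x => χ x * φ x, ⟨hs.mul (h𝒯 φ hφ).1, hc.mul_right, ?_⟩, fun x _ => ⟨rfl, rfl⟩⟩
  exact (tsupport_mul_subset_right (f := χ)).trans (subset_compl_iff_disjoint_right.2 (h𝒯 φ hφ).2)

theorem mapsTest_testTorus {χ : Eu n → ℂ} (hs : ContDiff ℝ ∞ χ) (hc : HasCompactSupport χ)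
    (hχ : tsupport χ ⊆ M.core) {𝒯 : Set (Eu n → ℂ)}
    (h𝒯 : ∀ φ ∈ 𝒯, ContDiff ℝ ∞ φ ∧ Disjoint (tsupport φ) M.K) :
    MapsTest χ 𝒯 M.cube M.testTorus := fun φ hφ => by
  have h1 : tsupport (fun x => χ x * φ x) ⊆ M.core := (tsupport_mul_subset_left (f := χ)).trans hχ
  refine ⟨M.periodize fun x => χ x * φ x, M.periodize_mem_testTorus (hs.mul (h𝒯 φ hφ).1)
    hc.mul_right h1 (Disjoint.mono_left (tsupport_mul_subset_right (f := χ)) (h𝒯 φ hφ).2),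
    fun x hx => ?_⟩
  have h2 := M.periodize_eventuallyEq (f := fun x => χ x * φ x) hc.mul_right h1
    (M.abs_coord_le_of_mem_cube hx)
  exact ⟨h2.eq_of_nhds, grad_congr h2⟩

theorem testΩ_props : ∀ φ ∈ M.testΩ, ContDiff ℝ ∞ φ ∧ Disjoint (tsupport φ) M.K :=
  fun _ hφ => ⟨hφ.1, subset_compl_iff_disjoint_right.1 hφ.2.2⟩

theorem testTorus_props : ∀ φ ∈ M.testTorus, ContDiff ℝ ∞ φ ∧ Disjoint (tsupport φ) M.K :=
  fun _ hφ => ⟨hφ.1, hφ.2.2⟩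

theorem gvol_restrict_core {D : Set (Eu n)} :
    (gvol M.g D).restrict M.core = gvol M.g (D ∩ M.core) := by
  rw [gvol_eq, gvol_eq, restrict_withDensity Metric.isOpen_ball.measurableSet,
    Measure.restrict_restrict Metric.isOpen_ball.measurableSet, inter_comm]

theorem eq_indicator_core {E : Type*} [Zero E] {f : Eu n → E} (hf : ∀ x ∉ M.core, f x = 0) :
    f = M.core.indicator f := (indicator_eq_self.2 fun x hx => by
      by_contra h; exact hx (hf x h)).symm

section Transfer

variable {D D' : Set (Eu n)} (hD : D ∩ M.core = D' ∩ M.core)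
include hD

theorem eLpNorm_core_eq {E : Type*} [NormedAddCommGroup E] {f : Eu n → E} {p : ℝ≥0∞}
    (hf : ∀ x ∉ M.core, f x = 0) : eLpNorm f p (gvol M.g D) = eLpNorm f p (gvol M.g D') := by
  rw [M.eq_indicator_core hf, eLpNorm_indicator_eq_eLpNorm_restrict
    Metric.isOpen_ball.measurableSet, eLpNorm_indicator_eq_eLpNorm_restrict
    Metric.isOpen_ball.measurableSet, M.gvol_restrict_core, M.gvol_restrict_core, hD]

theorem memLp_core_iff {E : Type*} [NormedAddCommGroup E] {f : Eu n → E} {p : ℝ≥0∞}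
    (hf : ∀ x ∉ M.core, f x = 0) : MemLp f p (gvol M.g D) ↔ MemLp f p (gvol M.g D') := by
  rw [M.eq_indicator_core hf, memLp_indicator_iff_restrict Metric.isOpen_ball.measurableSet,
    memLp_indicator_iff_restrict Metric.isOpen_ball.measurableSet, M.gvol_restrict_core,
    M.gvol_restrict_core, hD]

theorem setIntegral_core_eq {f : Eu n → ℂ} (hf : ∀ x ∉ M.core, f x = 0) :
    ∫ x in D, f x = ∫ x in D', f x := by
  rw [M.eq_indicator_core hf, setIntegral_indicator Metric.isOpen_ball.measurableSet,
    setIntegral_indicator Metric.isOpen_ball.measurableSet, hD]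

omit hD in
theorem memLp_smul_of_continuous {E : Type*} [NormedAddCommGroup E] [NormedSpace ℂ E]
    {μ : Measure (Eu n)} {χ : Eu n → ℂ} (hs : Continuous χ) (hc : HasCompactSupport χ)
    {f : Eu n → E} (hf : MemLp f 2 μ) : MemLp (fun x => χ x • f x) 2 μ := by
  obtain ⟨C, hC⟩ := hs.bounded_above_of_compact_support hc
  refine hf.of_le_mul (c := C) (hs.aestronglyMeasurable.smul hf.1) (ae_of_all _ fun x => ?_)
  rw [norm_smul]
  gcongr
  exact hC x

omit hD in
theorem memLp_smul_vec_of_continuous {μ : Measure (Eu n)} {V : Eu n → CVec n} (hs : Continuous V)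
    (hc : HasCompactSupport V) {f : Eu n → ℂ} (hf : MemLp f 2 μ) :
    MemLp (fun x => f x • V x) 2 μ := by
  obtain ⟨C, hC⟩ := hs.bounded_above_of_compact_support hc
  refine hf.of_le_mul (c := C) (hf.1.smul hs.aestronglyMeasurable) (ae_of_all _ fun x => ?_)
  rw [norm_smul, mul_comm]
  gcongr
  exact hC x

/-- Multiplication by cutoffs supported in the core transfers the form domain of one domain to
another one with the same core. -/
theorem isH1_mul_core (hDm : MeasurableSet D) (hDm' : MeasurableSet D')
    {𝒯 𝒯' : Set (Eu n → ℂ)} (h𝒯 : IsTestClass D 𝒯) (h𝒯' : IsTestClass D' 𝒯') {χ : Eu n → ℂ}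
    (hs : ContDiff ℝ ∞ χ) (hc : HasCompactSupport χ) (hχ : tsupport χ ⊆ M.core)
    (hmap : MapsTest χ 𝒯 D' 𝒯') (hmap' : MapsTest χ 𝒯' D 𝒯) {B : BC} {u : Eu n → ℂ}
    {U : Eu n → CVec n} (hu : IsH1 B M.g D 𝒯 u U) :
    IsH1 B M.g D' 𝒯' (fun x => χ x * u x) (fun x => χ x • U x + u x • grad χ x) := by
  have hgc := continuous_grad hs
  have hgs := hasCompactSupport_grad hc
  have hχ0 : ∀ x ∉ M.core, χ x = 0 := fun x hx => image_eq_zero_of_notMem_tsupport fun h => hx (hχ h)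
  have hg0 : ∀ x ∉ M.core, grad χ x = 0 := fun x hx =>
    image_eq_zero_of_notMem_tsupport fun h => hx (hχ (tsupport_grad_subset χ h))
  have hm1 : MemLp (fun x => χ x * u x) 2 (gvol M.g D) := memLp_smul_of_continuous hs.continuous hc hu.1
  have hm2 : MemLp (fun x => χ x • U x + u x • grad χ x) 2 (gvol M.g D) :=
    (memLp_smul_of_continuous hs.continuous hc hu.2.1).add
      (memLp_smul_vec_of_continuous hgc hgs hu.1)
  refine ⟨(M.memLp_core_iff hD fun x hx => by rw [hχ0 x hx, zero_mul]).1 hm1,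
    (M.memLp_core_iff hD fun x hx => by rw [hχ0 x hx, hg0 x hx, zero_smul, smul_zero, add_zero]).1
      hm2, ?_⟩
  cases B with
  | dirichlet =>
    obtain ⟨φ, hφ, h1, h2⟩ := hu.2.2
    -- In the Dirichlet case the approximating test functions are carried forward, from D to D'.
    choose φ' hφ' heq using fun k => hmap (φ k) (hφ k)
    have hae : ∀ᵐ x ∂(gvol M.g D'), x ∈ D' :=
      M.gvol_ac.ae_le (ae_restrict_mem hDm')
    obtain ⟨C₁, hC₁⟩ := hs.continuous.bounded_above_of_compact_support hc
    obtain ⟨C₂, hC₂⟩ := hgc.bounded_above_of_compact_support hgs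
    have h5 : ∀ k, eLpNorm (fun x => χ x * φ k x - χ x * u x) 2 (gvol M.g D) ≤
        ENNReal.ofReal C₁ * eLpNorm (fun x => φ k x - u x) 2 (gvol M.g D) := fun k =>
      eLpNorm_le_mul_eLpNorm_of_ae_le_mul (ae_of_all _ fun x => by
        rw [← mul_sub, norm_mul]; gcongr; exact hC₁ x) 2
    have h6 : ∀ k, eLpNorm (fun x => χ x • (grad (φ k) x - U x)) 2 (gvol M.g D) ≤
        ENNReal.ofReal C₁ * eLpNorm (fun x => grad (φ k) x - U x) 2 (gvol M.g D) := fun k =>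
      eLpNorm_le_mul_eLpNorm_of_ae_le_mul (ae_of_all _ fun x => by
        rw [norm_smul]; gcongr; exact hC₁ x) 2
    have h7 : ∀ k, eLpNorm (fun x => (φ k x - u x) • grad χ x) 2 (gvol M.g D) ≤
        ENNReal.ofReal C₂ * eLpNorm (fun x => φ k x - u x) 2 (gvol M.g D) := fun k =>
      eLpNorm_le_mul_eLpNorm_of_ae_le_mul (ae_of_all _ fun x => by
        rw [norm_smul, mul_comm]; gcongr; exact hC₂ x) 2
    have h1' : ∀ C : ℝ, Tendsto (fun k => ENNReal.ofReal C *
        eLpNorm (fun x => φ k x - u x) 2 (gvol M.g D)) atTop (𝓝 0) := fun C => by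
      simpa using ENNReal.Tendsto.const_mul (a := ENNReal.ofReal C) h1 (Or.inr ENNReal.ofReal_ne_top)
    have h2' : Tendsto (fun k => ENNReal.ofReal C₁ *
        eLpNorm (fun x => grad (φ k) x - U x) 2 (gvol M.g D)) atTop (𝓝 0) := by
      simpa using ENNReal.Tendsto.const_mul (a := ENNReal.ofReal C₁) h2
        (Or.inr ENNReal.ofReal_ne_top)
    refine ⟨φ', hφ', ?_, ?_⟩
    · refine tendsto_of_tendsto_of_tendsto_of_le_of_le tendsto_const_nhds (h1' C₁)
        (fun _ => zero_le) fun k => ?_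
      refine le_trans (le_of_eq ?_) (h5 k)
      rw [M.eLpNorm_core_eq hD fun x hx => by rw [hχ0 x hx]; ring]
      refine eLpNorm_congr_ae ?_
      filter_upwards [hae] with x hx
      rw [(heq k x hx).1]
    · refine tendsto_of_tendsto_of_tendsto_of_le_of_le tendsto_const_nhds
        (by simpa using h2'.add (h1' C₂)) (fun _ => zero_le) fun k => ?_
      refine le_trans ?_ (add_le_add (h6 k) (h7 k))
      refine le_trans (le_of_eq ?_) (eLpNorm_add_le (hs.continuous.aestronglyMeasurable.smul
        ((continuous_grad (h𝒯.smooth _ (hφ k))).aestronglyMeasurable.sub hu.2.1.1))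
        (((h𝒯.smooth _ (hφ k)).continuous.aestronglyMeasurable.sub hu.1.1).smul
          hgc.aestronglyMeasurable) one_le_two)
      rw [M.eLpNorm_core_eq hD fun x hx => by
        rw [Pi.add_apply, hχ0 x hx, hg0 x hx, zero_smul, smul_zero, add_zero]]
      refine eLpNorm_congr_ae ?_
      filter_upwards [hae] with x hx
      rw [(heq k x hx).2, grad_mul (hs.differentiable (by simp)) (h𝒯.differentiable (hφ k)),
        Pi.add_apply, smul_sub, sub_smul]
      abel
  | neumann =>
    intro φ hφ j
    -- In the Neumann case the roles are reversed: a test function on D' is cut off to one on D, and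
    -- the product rule moves the cutoff onto u.
    obtain ⟨φ', hφ', heq⟩ := hmap' φ hφ
    have hφs := h𝒯'.smooth φ hφ
    have h1 := hu.2.2 φ' hφ' j
    have hu1 := M.memLp_gvol_iff.1 hu.1
    have hU1 := MemLp.coord (M.memLp_gvol_iff.1 hu.2.1) j
    rw [← M.setIntegral_core_eq hD fun x hx => by
        simp only [hχ0 x hx, zero_mul],
      ← M.setIntegral_core_eq hD fun x hx => by
        simp only [hχ0 x hx, hg0 x hx, zero_smul, smul_zero, add_zero]; simp]
    have hg1 : MemLp (fun x => grad χ x j * φ x) 2 (volume.restrict D) := by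
      have hcont : Continuous fun x => grad χ x j * φ x :=
        ((EuclideanSpace.proj (𝕜 := ℂ) j).continuous.comp hgc).mul hφs.continuous
      refine (hcont.memLp_of_hasCompactSupport ?_).restrict _
      exact (hgs.comp_left (g := fun v : CVec n => v j) rfl).mul_right
    have h2 : ∀ x ∈ D, u x * grad φ' x j =
        χ x * u x * grad φ x j + u x * (grad χ x j * φ x) := fun x hx => by
      rw [(heq x hx).2, grad_mul (hs.differentiable (by simp)) (hφs.differentiable (by simp))]
      simp only [PiLp.add_apply, PiLp.smul_apply, smul_eq_mul]
      ring
    have h3 : ∀ x ∈ D, (χ x • U x + u x • grad χ x) j * φ x =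
        U x j * φ' x + u x * (grad χ x j * φ x) := fun x hx => by
      rw [(heq x hx).1]
      simp only [PiLp.add_apply, PiLp.smul_apply, smul_eq_mul]
      ring
    have hi1 := integrable_mul_of_memLp hu1 hg1
    have hi2 := integrable_mul_of_memLp hu1 (MemLp.coord (h𝒯.memLp_grad φ' hφ') j)
    have hi3 := integrable_mul_of_memLp hU1 (h𝒯.memLp φ' hφ')
    have h4 : ∫ x in D, χ x * u x * grad φ x j =
        (∫ x in D, u x * grad φ' x j) - ∫ x in D, u x * (grad χ x j * φ x) := by
      rw [← integral_sub hi2 hi1]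
      refine setIntegral_congr_fun hDm fun x hx => ?_
      simp only
      rw [h2 x hx]
      ring
    rw [h4, h1, setIntegral_congr_fun hDm h3, integral_add hi3 hi1]
    ring

end Transfer

end Exterior

end AbstractStrichartz

end

/-! ### Abstract tools for spectral square sums -/

noncomputable section
namespace AbstractStrichartz

/-! ### Bessel inequalities for a positive semidefinite form -/

section Bessel

variable {H ι : Type*} [NormedAddCommGroup H] [InnerProductSpace ℂ H] {G : H →L[ℂ] H}
  {x : ι → H} {μ : ι → ℝ} {S : Finset ι}

theorem re_inner_sum_le (horth : ∀ i ∈ S, ∀ j ∈ S, i ≠ j → inner ℂ (x j) (G (x i)) = 0)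
    (hdiag : ∀ i ∈ S, (inner ℂ (x i) (G (x i))).re ≤ μ i) (a : ι → ℂ) :
    (inner ℂ (∑ i ∈ S, a i • x i) (G (∑ i ∈ S, a i • x i))).re ≤ ∑ i ∈ S, μ i * ‖a i‖ ^ 2 := by
  have h1 : inner ℂ (∑ i ∈ S, a i • x i) (G (∑ i ∈ S, a i • x i)) =
      ∑ i ∈ S, ((‖a i‖ ^ 2 : ℝ) : ℂ) * inner ℂ (x i) (G (x i)) := by
    rw [sum_inner]
    refine Finset.sum_congr rfl fun i hi => ?_
    rw [map_sum, inner_sum, Finset.sum_eq_single_of_mem i hi]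
    · rw [map_smul, inner_smul_left, inner_smul_right, ← mul_assoc, mul_comm (conj (a i)),
        Complex.mul_conj, Complex.normSq_eq_norm_sq]
    · intro j hj hji
      rw [map_smul, inner_smul_left, inner_smul_right, horth j hj i hi hji, mul_zero, mul_zero]
  rw [h1, Complex.re_sum]
  refine Finset.sum_le_sum fun i hi => ?_
  rw [Complex.re_ofReal_mul, mul_comm]
  exact mul_le_mul_of_nonneg_right (hdiag i hi) (by positivity)

/-- Expand 0 ≤ ⟨v - w, G(v - w)⟩ with w the sum of the c_i x_i. Only an upper bound on the diagonal
is required, so vectors shorter than normalized ones, even zero, are allowed. -/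
theorem bessel_le (hG : ∀ v w, inner ℂ (G v) w = inner ℂ v (G w))
    (hpos : ∀ v, 0 ≤ (inner ℂ v (G v)).re)
    (horth : ∀ i ∈ S, ∀ j ∈ S, i ≠ j → inner ℂ (x j) (G (x i)) = 0)
    (hdiag : ∀ i ∈ S, (inner ℂ (x i) (G (x i))).re ≤ μ i) {v : H} {c : ι → ℂ}
    (hc : ∀ i ∈ S, inner ℂ (x i) (G v) = μ i * c i) :
    ∑ i ∈ S, μ i * ‖c i‖ ^ 2 ≤ (inner ℂ v (G v)).re := by
  set w := ∑ i ∈ S, c i • x i with hw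
  have h1 : inner ℂ w (G v) = ((∑ i ∈ S, μ i * ‖c i‖ ^ 2 : ℝ) : ℂ) := by
    rw [hw, sum_inner, Complex.ofReal_sum]
    refine Finset.sum_congr rfl fun i hi => ?_
    rw [inner_smul_left, hc i hi]
    push_cast
    rw [← Complex.conj_mul']
    ring
  have h2 : inner ℂ v (G w) = ((∑ i ∈ S, μ i * ‖c i‖ ^ 2 : ℝ) : ℂ) := by
    rw [← hG, ← inner_conj_symm, h1, Complex.conj_ofReal]
  have h3 := re_inner_sum_le horth hdiag c
  have h4 := hpos (v - w)
  rw [map_sub, inner_sub_left, inner_sub_right, inner_sub_right, h1, h2] at h4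
  simp only [Complex.sub_re, Complex.ofReal_re] at h4
  linarith

end Bessel

theorem ofReal_norm_toLp_sq {α E : Type*} [MeasurableSpace α] {μ : Measure α}
    [NormedAddCommGroup E] {f : α → E} (hf : MemLp f 2 μ) :
    ENNReal.ofReal (‖hf.toLp f‖ ^ 2) = ∫⁻ x, ‖f x‖ₑ ^ 2 ∂μ := by
  rw [Lp.norm_toLp, ENNReal.ofReal_pow ENNReal.toReal_nonneg, ENNReal.ofReal_toReal hf.2.ne,
    eLpNorm_eq_lintegral_rpow_enorm_toReal (by simp) (by simp), ← ENNReal.rpow_natCast,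
    ← ENNReal.rpow_mul]
  simp

/-! ### Weighted square sums -/

/-- The square of the norm of a sequence of spectral coefficients. -/
def specSum (S : Finset ℝ≥0) (s : ℝ) (c : ℝ≥0 → ℂ) : ℝ≥0∞ :=
  ∑ l ∈ S, ENNReal.ofReal ((1 + (l : ℝ)) ^ s) * ‖c l‖ₑ ^ 2

theorem specSum_ne_top (S : Finset ℝ≥0) (s : ℝ) (c : ℝ≥0 → ℂ) : specSum S s c ≠ ⊤ :=
  ENNReal.sum_ne_top.2 fun _ _ => ENNReal.mul_ne_top ENNReal.ofReal_ne_top (by simp)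

theorem enorm_sum_mul_conj_sq_le (S : Finset ℝ≥0) (s : ℝ) (a b : ℝ≥0 → ℂ) :
    ‖∑ l ∈ S, a l * conj (b l)‖ₑ ^ 2 ≤ specSum S s a * specSum S (-s) b := by
  have h1 : ‖∑ l ∈ S, a l * conj (b l)‖ ^ 2 ≤ (∑ l ∈ S, (1 + (l : ℝ)) ^ s * ‖a l‖ ^ 2) *
      ∑ l ∈ S, (1 + (l : ℝ)) ^ (-s) * ‖b l‖ ^ 2 := by
    have h2 : ‖∑ l ∈ S, a l * conj (b l)‖ ≤ ∑ l ∈ S, ‖a l‖ * ‖b l‖ :=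
      (norm_sum_le _ _).trans_eq (Finset.sum_congr rfl fun l _ => by simp)
    refine (pow_le_pow_left₀ (norm_nonneg _) h2 2).trans ?_
    refine Finset.sum_sq_le_sum_mul_sum_of_sq_le_mul S (fun l _ => by positivity)
      (fun l _ => by positivity) fun l _ => le_of_eq ?_
    rw [Real.rpow_neg (by positivity)]
    have : (1 + (l : ℝ)) ^ s ≠ 0 := by positivity
    field_simp
  have h2 : ∀ (t : ℝ) (c : ℝ≥0 → ℂ), specSum S t c =
      ENNReal.ofReal (∑ l ∈ S, (1 + (l : ℝ)) ^ t * ‖c l‖ ^ 2) := fun t c => by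
    rw [ENNReal.ofReal_sum_of_nonneg fun l _ => by positivity]
    refine Finset.sum_congr rfl fun l _ => ?_
    rw [ENNReal.ofReal_mul (by positivity), ENNReal.ofReal_pow (norm_nonneg _), ofReal_norm]
  rw [h2, h2, ← ENNReal.ofReal_mul (Finset.sum_nonneg fun l _ => by positivity), ← ofReal_norm,
    ← ENNReal.ofReal_pow (norm_nonneg _)]
  exact ENNReal.ofReal_le_ofReal h1

/-- Duality for weighted square sums. -/
theorem specSum_le_of_forall {S : Finset ℝ≥0} {s : ℝ} {c : ℝ≥0 → ℂ} {A : ℝ≥0∞}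
    (h : ∀ b : ℝ≥0 → ℂ, ‖∑ l ∈ S, c l * conj (b l)‖ₑ ^ 2 ≤ A * specSum S (-s) b) :
    specSum S s c ≤ A := by
  have h1 := h fun l => (((1 + (l : ℝ)) ^ s : ℝ) : ℂ) * c l
  have h2 : specSum S (-s) (fun l => (((1 + (l : ℝ)) ^ s : ℝ) : ℂ) * c l) = specSum S s c := by
    refine Finset.sum_congr rfl fun l _ => ?_
    have h0 : (0 : ℝ) < (1 + (l : ℝ)) ^ s := by positivity
    rw [enorm_mul, mul_pow, ← mul_assoc, ← ofReal_norm (_ : ℂ), Complex.norm_real,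
      Real.norm_of_nonneg h0.le, ← ENNReal.ofReal_pow h0.le, ← ENNReal.ofReal_mul (by positivity),
      Real.rpow_neg (by positivity)]
    congr 2
    field_simp
  have h3 : ‖∑ l ∈ S, c l * conj ((((1 + (l : ℝ)) ^ s : ℝ) : ℂ) * c l)‖ₑ = specSum S s c := by
    have : ∑ l ∈ S, c l * conj ((((1 + (l : ℝ)) ^ s : ℝ) : ℂ) * c l) =
        ((∑ l ∈ S, (1 + (l : ℝ)) ^ s * ‖c l‖ ^ 2 : ℝ) : ℂ) := by
      rw [Complex.ofReal_sum]
      refine Finset.sum_congr rfl fun l _ => ?_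
      rw [map_mul, Complex.conj_ofReal]
      push_cast
      rw [← Complex.mul_conj']
      ring
    rw [this, ← ofReal_norm, Complex.norm_real,
      Real.norm_of_nonneg (Finset.sum_nonneg fun l _ => by positivity),
      ENNReal.ofReal_sum_of_nonneg fun l _ => by positivity]
    refine Finset.sum_congr rfl fun l _ => ?_
    rw [ENNReal.ofReal_mul (by positivity), ENNReal.ofReal_pow (norm_nonneg _), ofReal_norm]
  rw [h2, h3, pow_two] at h1
  rcases eq_or_ne (specSum S s c) 0 with h0 | h0
  · rw [h0]; exact zero_le
  · exact (ENNReal.mul_le_mul_iff_left h0 (specSum_ne_top S s c)).1 h1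

/-- Interpolation by decompositions. -/
theorem lintegral_rpow_le_of_decomposition {α β : Type*} [MeasurableSpace α] [MeasurableSpace β]
    {μ : Measure α} {ν : Measure β} [SFinite μ] [SFinite ν] {w : α → ℝ} {e : α → ℂ}
    (hw : Measurable w) (hw0 : ∀ x, 0 ≤ w x) (hw1 : ∀ᵐ x ∂μ, 0 < w x)
    (he : AEStronglyMeasurable e μ) {w' : β → ℝ} {c' : β → ℝ≥0∞} (hw' : Measurable w')
    (hw0' : ∀ y, 0 ≤ w' y) (hc' : AEMeasurable c' ν) {C : ℝ≥0}
    (h : ∀ t, 0 < t → ∃ a b : α → ℂ, AEStronglyMeasurable a μ ∧ (∀ᵐ x ∂μ, e x = a x + b x) ∧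
      ∫⁻ x, ‖a x‖ₑ ^ 2 ∂μ ≤ C * ∫⁻ y, ENNReal.ofReal (w' y / (t + w' y)) ^ 2 * c' y ∂ν ∧
      ∫⁻ x, ENNReal.ofReal (w x) * ‖b x‖ₑ ^ 2 ∂μ ≤
        C * ∫⁻ y, ENNReal.ofReal (w' y) * (ENNReal.ofReal (t / (t + w' y)) ^ 2 * c' y) ∂ν)
    {σ : ℝ} (h0 : 0 ≤ σ) (h1 : σ ≤ 1) :
    ∫⁻ x, ENNReal.ofReal (w x ^ σ) * ‖e x‖ₑ ^ 2 ∂μ ≤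
      C * ∫⁻ y, ENNReal.ofReal (w' y ^ σ) * c' y ∂ν := by
  refine lintegral_rpow_le_of_forall_parallel hw hw0 hw1 (he.enorm.pow_const 2) hw' hw0' hc'
    (fun t ht => ?_) h0 h1
  obtain ⟨a, b, ha, hab, hA, hB⟩ := h t ht
  calc ∫⁻ x, ENNReal.ofReal (t * w x / (t + w x)) * ‖e x‖ₑ ^ 2 ∂μ
      ≤ ∫⁻ x, (ENNReal.ofReal t * ‖a x‖ₑ ^ 2 + ENNReal.ofReal (w x) * ‖b x‖ₑ ^ 2) ∂μ := by
        refine lintegral_mono_ae ?_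
        filter_upwards [hab] with x hx
        rw [hx]
        exact parallel_mul_enorm_add_le ht (hw0 x) _ _
    _ = ENNReal.ofReal t * ∫⁻ x, ‖a x‖ₑ ^ 2 ∂μ + ∫⁻ x, ENNReal.ofReal (w x) * ‖b x‖ₑ ^ 2 ∂μ := by
        rw [lintegral_add_left' ((ha.enorm.pow_const 2).const_mul _),
          lintegral_const_mul'' _ (ha.enorm.pow_const 2)]
    _ ≤ ENNReal.ofReal t * (C * ∫⁻ y, ENNReal.ofReal (w' y / (t + w' y)) ^ 2 * c' y ∂ν) +
        C * ∫⁻ y, ENNReal.ofReal (w' y) * (ENNReal.ofReal (t / (t + w' y)) ^ 2 * c' y) ∂ν := by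
        gcongr
    _ = C * ∫⁻ y, ENNReal.ofReal (t * w' y / (t + w' y)) * c' y ∂ν := by
        have hm : AEMeasurable (fun y => ENNReal.ofReal (w' y / (t + w' y)) ^ 2 * c' y) ν :=
          ((hw'.div (measurable_const.add hw')).ennreal_ofReal.pow_const 2).aemeasurable.mul hc'
        rw [mul_left_comm, ← mul_add, ← lintegral_const_mul'' _ hm,
          ← lintegral_add_left' (hm.const_mul _)]
        congr 1
        exact lintegral_congr fun y => parallel_split ht (hw0' y) _

theorem lintegral_count_finset (S : Finset ℝ≥0) (f : ℝ≥0 → ℝ≥0∞) :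
    ∫⁻ l : S, f l ∂Measure.count = ∑ l ∈ S, f l := by
  rw [lintegral_count, tsum_fintype]
  exact Finset.sum_coe_sort S f

end AbstractStrichartz

end

/-! ### Families of eigenfunctions on the torus with the obstacle removed -/

noncomputable section
namespace AbstractStrichartz

variable {n : ℕ}

theorem toLp_sum_smul {α ι E : Type*} [MeasurableSpace α] {μ : Measure α} [NormedAddCommGroup E]
    [NormedSpace ℂ E] (S : Finset ι) (a : ι → ℂ) {f : ι → α → E} (hf : ∀ i, MemLp (f i) 2 μ)
    (h : MemLp (fun x => ∑ i ∈ S, a i • f i x) 2 μ) :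
    h.toLp = ∑ i ∈ S, a i • (hf i).toLp := by
  classical
  induction S using Finset.induction_on with
  | empty =>
    refine Lp.ext (h.coeFn_toLp.trans ?_)
    rw [Finset.sum_empty]
    filter_upwards [Lp.coeFn_zero E 2 μ] with x hx
    rw [hx, Finset.sum_empty]; rfl
  | insert i S hi ih =>
    have hS : MemLp (fun x => ∑ i ∈ S, a i • f i x) 2 μ :=
      memLp_finsetSum S fun i _ => (hf i).const_smul (a i)
    rw [Finset.sum_insert hi, ← ih hS]
    refine Lp.ext (h.coeFn_toLp.trans ?_)
    filter_upwards [Lp.coeFn_add (a i • (hf i).toLp) hS.toLp, Lp.coeFn_smul (a i) (hf i).toLp,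
      (hf i).coeFn_toLp, hS.coeFn_toLp] with x h1 h2 h3 h4
    rw [h1, Pi.add_apply, h2, h4, Pi.smul_apply, h3, Finset.sum_insert hi]

namespace Exterior

/-- The Riemannian volume of the torus with the obstacle removed. -/
abbrev torusVol (M : Exterior n) : Measure (Eu n) := gvol M.g M.cube

/-- A choice of one eigenfunction in the closed unit ball of each eigenspace. -/
structure EigenFamily (M : Exterior n) (B : BC) where
  e : ℝ≥0 → Eu n → ℂ
  E : ℝ≥0 → Eu n → CVec n
  isH1 : ∀ l, IsH1 B M.g M.cube M.testTorus (e l) (E l)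
  eigen : ∀ l φ Φ, IsH1 B M.g M.cube M.testTorus φ Φ →
    form M.g M.cube (E l) Φ = (l : ℝ) * ∫ x, e l x * conj (φ x) ∂M.torusVol
  norm_le : ∀ l, eLpNorm (e l) 2 M.torusVol ≤ 1

namespace EigenFamily

variable {M : Exterior n} {B : BC} (e : M.EigenFamily B)

instance : Nonempty (M.EigenFamily B) := ⟨{
  e := fun _ _ => 0
  E := fun _ _ => 0
  isH1 := fun _ => M.isH1_zero M.isTestClass_testTorus
  eigen := fun l φ Φ _ => by simp [form]
  norm_le := fun _ => by simp }⟩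

theorem isEigenfunction (l : ℝ≥0) : M.IsEigenfunction B l (e.e l) := ⟨e.E l, e.isH1 l, e.eigen l⟩

/-- The spectral coefficients of a function. -/
def coef (f : Eu n → ℂ) (l : ℝ≥0) : ℂ := ∫ x, f x * conj (e.e l x) ∂M.torusVol

/-- Finite combinations of eigenfunctions. -/
def synth (S : Finset ℝ≥0) (a : ℝ≥0 → ℂ) (x : Eu n) : ℂ := ∑ l ∈ S, a l * e.e l x

/-- The weak gradient of `synth`. -/
def synthGrad (S : Finset ℝ≥0) (a : ℝ≥0 → ℂ) (x : Eu n) : CVec n := ∑ l ∈ S, a l • e.E l x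

theorem isH1_synth (S : Finset ℝ≥0) (a : ℝ≥0 → ℂ) :
    IsH1 B M.g M.cube M.testTorus (e.synth S a) (e.synthGrad S a) :=
  M.isH1_sum M.isTestClass_testTorus S a fun l _ => e.isH1 l

theorem coef_add {f h : Eu n → ℂ} (hf : MemLp f 2 M.torusVol) (hh : MemLp h 2 M.torusVol)
    (l : ℝ≥0) : e.coef (fun x => f x + h x) l = e.coef f l + e.coef h l := by
  simp only [coef, add_mul]
  exact integral_add (integrable_mul_of_memLp hf (memLp_conj (e.isH1 l).1))
    (integrable_mul_of_memLp hh (memLp_conj (e.isH1 l).1))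

theorem integral_mul_conj_synth {f : Eu n → ℂ} (hf : MemLp f 2 M.torusVol) (S : Finset ℝ≥0)
    (a : ℝ≥0 → ℂ) :
    ∫ x, f x * conj (e.synth S a x) ∂M.torusVol = ∑ l ∈ S, e.coef f l * conj (a l) := by
  simp only [synth, map_sum, map_mul, Finset.mul_sum]
  rw [integral_finsetSum]
  · refine Finset.sum_congr rfl fun l _ => ?_
    rw [coef, ← integral_mul_const]
    congr 1
    ext1 x
    ring
  · intro l _
    refine ((integrable_mul_of_memLp hf (memLp_conj (e.isH1 l).1)).mul_const (conj (a l))).congr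
      (ae_of_all _ fun x => ?_)
    simp only
    ring

theorem integral_synth_mul_conj {f : Eu n → ℂ} (hf : MemLp f 2 M.torusVol) (S : Finset ℝ≥0)
    (a : ℝ≥0 → ℂ) :
    ∫ x, e.synth S a x * conj (f x) ∂M.torusVol = ∑ l ∈ S, a l * conj (e.coef f l) := by
  have h := congrArg conj (e.integral_mul_conj_synth hf S a)
  rw [← integral_conj, map_sum] at h
  simp only [map_mul, Complex.conj_conj] at h
  rw [← Finset.sum_congr rfl fun l _ => mul_comm _ _, ← h]
  congr 1
  ext1 x
  ring

theorem inner_toLp_eq (l : ℝ≥0) {f : Eu n → ℂ} (hf : MemLp f 2 M.torusVol) :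
    inner ℂ ((e.isH1 l).1.toLp) (hf.toLp f) = e.coef f l := by
  rw [L2.inner_def, coef]
  refine integral_congr_ae ?_
  filter_upwards [(e.isH1 l).1.coeFn_toLp, hf.coeFn_toLp] with x h1 h2
  rw [h1, h2, RCLike.inner_apply]

theorem inner_grad_eq (l : ℝ≥0) {f : Eu n → ℂ} {F : Eu n → CVec n}
    (hf : IsH1 B M.g M.cube M.testTorus f F) :
    inner ℂ ((e.isH1 l).2.1.toLp) (M.cometricOp _ (hf.2.1.toLp F)) = (l : ℝ) * e.coef f l := by
  rw [← M.cometricOp_inner, ← inner_conj_symm, ← M.form_eq_inner, e.eigen l f F hf, map_mul,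
    Complex.conj_ofReal, ← integral_conj, coef]
  congr 2
  ext1 x
  rw [map_mul, Complex.conj_conj, mul_comm]

/-- By symmetry of the form, (m - l)⟨e_l, e_m⟩ = 0. -/
theorem orthogonal {l m : ℝ≥0} (hlm : l ≠ m) : e.coef (e.e l) m = 0 := by
  have h1 := e.inner_grad_eq m (e.isH1 l)
  have h2 := congrArg conj (e.inner_grad_eq l (e.isH1 m))
  have h3 : conj (e.coef (e.e m) l) = e.coef (e.e l) m := by
    rw [coef, coef, ← integral_conj]
    congr 1
    ext1 x
    rw [map_mul, Complex.conj_conj, mul_comm]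
  rw [inner_conj_symm, M.cometricOp_inner, map_mul, Complex.conj_ofReal, h3, h1] at h2
  have h4 : (((m : ℝ) - (l : ℝ) : ℝ) : ℂ) * e.coef (e.e l) m = 0 := by
    push_cast
    rw [sub_mul, h2, sub_self]
  refine (mul_eq_zero.1 h4).resolve_left ?_
  rw [Complex.ofReal_eq_zero, sub_eq_zero]
  exact fun h => hlm (NNReal.coe_injective h).symm

theorem norm_toLp_le (l : ℝ≥0) : ‖(e.isH1 l).1.toLp‖ ≤ 1 := by
  rw [Lp.norm_toLp]
  exact ENNReal.toReal_le_of_le_ofReal zero_le_one (by simpa using e.norm_le l)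

theorem re_coef_self_le (l : ℝ≥0) : (e.coef (e.e l) l).re ≤ 1 := by
  rw [← e.inner_toLp_eq l (e.isH1 l).1, ← RCLike.re_eq_complex_re, inner_self_eq_norm_sq]
  exact pow_le_one₀ (norm_nonneg _) (e.norm_toLp_le l)

theorem re_form_self_le (l : ℝ≥0) : (inner ℂ ((e.isH1 l).2.1.toLp)
    (M.cometricOp _ ((e.isH1 l).2.1.toLp))).re ≤ l := by
  rw [e.inner_grad_eq l (e.isH1 l), Complex.re_ofReal_mul]
  exact mul_le_of_le_one_right l.2 (e.re_coef_self_le l)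

theorem toLp_synth (S : Finset ℝ≥0) (a : ℝ≥0 → ℂ) :
    (e.isH1_synth S a).1.toLp = ∑ l ∈ S, a l • (e.isH1 l).1.toLp :=
  toLp_sum_smul S a (fun l => (e.isH1 l).1) _

theorem toLp_synthGrad (S : Finset ℝ≥0) (a : ℝ≥0 → ℂ) :
    (e.isH1_synth S a).2.1.toLp = ∑ l ∈ S, a l • (e.isH1 l).2.1.toLp :=
  toLp_sum_smul S a (fun l => (e.isH1 l).2.1) _

theorem ofReal_sum_eq (S : Finset ℝ≥0) (c : ℝ≥0 → ℂ) {μ : ℝ≥0 → ℝ} (hμ : ∀ l, 0 ≤ μ l) :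
    ENNReal.ofReal (∑ l ∈ S, μ l * ‖c l‖ ^ 2) = ∑ l ∈ S, ENNReal.ofReal (μ l) * ‖c l‖ₑ ^ 2 := by
  rw [ENNReal.ofReal_sum_of_nonneg fun l _ => mul_nonneg (hμ l) (by positivity)]
  refine Finset.sum_congr rfl fun l _ => ?_
  rw [ENNReal.ofReal_mul (hμ l), ENNReal.ofReal_pow (norm_nonneg _), ofReal_norm]

theorem sum_coef_sq_le {f : Eu n → ℂ} (hf : MemLp f 2 M.torusVol) (S : Finset ℝ≥0) :
    ∑ l ∈ S, ‖e.coef f l‖ₑ ^ 2 ≤ ∫⁻ x, ‖f x‖ₑ ^ 2 ∂M.torusVol := by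
  have h := bessel_le (G := ContinuousLinearMap.id ℂ (Lp ℂ 2 M.torusVol))
    (x := fun l => (e.isH1 l).1.toLp) (S := S) (μ := fun _ => 1) (v := hf.toLp f)
    (c := e.coef f) (fun _ _ => rfl) (fun v => by
      rw [ContinuousLinearMap.id_apply, ← RCLike.re_eq_complex_re, inner_self_eq_norm_sq]
      positivity)
    (fun i _ j _ hij => by
      rw [ContinuousLinearMap.id_apply, e.inner_toLp_eq, e.orthogonal hij])
    (fun i _ => by rw [ContinuousLinearMap.id_apply, e.inner_toLp_eq]; exact e.re_coef_self_le i)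
    (fun i _ => by rw [ContinuousLinearMap.id_apply, e.inner_toLp_eq]; simp)
  rw [ContinuousLinearMap.id_apply, ← RCLike.re_eq_complex_re, inner_self_eq_norm_sq] at h
  have h2 := ENNReal.ofReal_le_ofReal h
  rw [ofReal_norm_toLp_sq, ofReal_sum_eq S _ fun _ => zero_le_one] at h2
  simpa using h2

theorem lintegral_synth_le (S : Finset ℝ≥0) (a : ℝ≥0 → ℂ) :
    ∫⁻ x, ‖e.synth S a x‖ₑ ^ 2 ∂M.torusVol ≤ ∑ l ∈ S, ‖a l‖ₑ ^ 2 := by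
  have h := re_inner_sum_le (G := ContinuousLinearMap.id ℂ (Lp ℂ 2 M.torusVol))
    (x := fun l => (e.isH1 l).1.toLp) (S := S) (μ := fun _ => 1)
    (fun i _ j _ hij => by
      rw [ContinuousLinearMap.id_apply, e.inner_toLp_eq, e.orthogonal hij])
    (fun i _ => by rw [ContinuousLinearMap.id_apply, e.inner_toLp_eq]; exact e.re_coef_self_le i) a
  rw [ContinuousLinearMap.id_apply, ← RCLike.re_eq_complex_re, inner_self_eq_norm_sq,
    ← e.toLp_synth] at h
  have h2 := ENNReal.ofReal_le_ofReal h
  rw [ofReal_norm_toLp_sq, ofReal_sum_eq S _ fun _ => zero_le_one] at h2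
  simpa using h2

theorem gradient_orthogonal {l m : ℝ≥0} (hlm : l ≠ m) : inner ℂ ((e.isH1 m).2.1.toLp)
    (M.cometricOp _ ((e.isH1 l).2.1.toLp)) = 0 := by
  rw [e.inner_grad_eq m (e.isH1 l), e.orthogonal hlm, mul_zero]

/-- Bessel's inequality for the gradient form: the gradients of the eigenfunctions are orthogonal
for it, with squares at most l. The constant is the norm of the cometric operator, hence the same
for all families. -/
theorem exists_sum_mul_coef_sq_le (M : Exterior n) (B : BC) : ∃ C : ℝ≥0, ∀ (e : M.EigenFamily B)
    (f : Eu n → ℂ) (F : Eu n → CVec n), IsH1 B M.g M.cube M.testTorus f F → ∀ S : Finset ℝ≥0,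
    ∑ l ∈ S, ENNReal.ofReal l * ‖e.coef f l‖ₑ ^ 2 ≤ C * ∫⁻ x, ‖F x‖ₑ ^ 2 ∂M.torusVol := by
  obtain ⟨c, hc, hcoer⟩ := M.exists_cometricOp_coercive
  refine ⟨‖M.cometricOp M.torusVol‖₊, fun e f F hf S => ?_⟩
  have h := bessel_le (G := M.cometricOp M.torusVol)
    (x := fun l => (e.isH1 l).2.1.toLp) (S := S) (μ := fun l => (l : ℝ)) (v := hf.2.1.toLp F)
    (c := e.coef f) (M.cometricOp_inner _) (fun v => le_trans (by positivity) (hcoer _ v))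
    (fun i _ j _ hij => e.gradient_orthogonal hij) (fun i _ => e.re_form_self_le i)
    (fun i _ => e.inner_grad_eq i hf)
  have h1 : (inner ℂ (hf.2.1.toLp F) (M.cometricOp M.torusVol (hf.2.1.toLp F))).re ≤
      ‖M.cometricOp M.torusVol‖ * ‖hf.2.1.toLp F‖ ^ 2 := by
    refine (Complex.re_le_norm _).trans ((norm_inner_le_norm _ _).trans ?_)
    rw [pow_two, ← mul_assoc, mul_comm ‖_‖ ‖_‖]
    exact mul_le_mul_of_nonneg_right (ContinuousLinearMap.le_opNorm _ _) (norm_nonneg _)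
  have h2 := ENNReal.ofReal_le_ofReal (h.trans h1)
  rw [ENNReal.ofReal_mul (norm_nonneg _), ofReal_norm_toLp_sq, ofReal_sum_eq (μ := fun l => (l : ℝ)) S _ fun l => l.2] at h2
  refine h2.trans_eq ?_
  rw [ofReal_norm, enorm_eq_nnnorm]

/-- The converse bound: coercivity of the cometric estimates the gradient by the form, and
orthogonality evaluates the form on the combination. -/
theorem exists_lintegral_synthGrad_le (M : Exterior n) (B : BC) : ∃ C : ℝ≥0,
    ∀ (e : M.EigenFamily B) (S : Finset ℝ≥0) (a : ℝ≥0 → ℂ),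
    ∫⁻ x, ‖e.synthGrad S a x‖ₑ ^ 2 ∂M.torusVol ≤
      C * ∑ l ∈ S, ENNReal.ofReal l * ‖a l‖ₑ ^ 2 := by
  obtain ⟨c, hc, hcoer⟩ := M.exists_cometricOp_coercive
  refine ⟨Real.toNNReal c⁻¹, fun e S a => ?_⟩
  have h := re_inner_sum_le (G := M.cometricOp M.torusVol)
    (x := fun l => (e.isH1 l).2.1.toLp) (S := S) (μ := fun l => (l : ℝ))
    (fun i _ j _ hij => e.gradient_orthogonal hij) (fun i _ => e.re_form_self_le i) a
  rw [← e.toLp_synthGrad] at h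
  have h1 : ‖(e.isH1_synth S a).2.1.toLp‖ ^ 2 ≤ c⁻¹ * ∑ l ∈ S, (l : ℝ) * ‖a l‖ ^ 2 := by
    rw [← div_eq_inv_mul, le_div_iff₀ hc, mul_comm]
    exact (hcoer _ _).trans h
  have h2 := ENNReal.ofReal_le_ofReal h1
  rw [ENNReal.ofReal_mul (inv_pos.2 hc).le, ofReal_norm_toLp_sq, ofReal_sum_eq (μ := fun l => (l : ℝ)) S _ fun l => l.2] at h2
  exact h2

end EigenFamily

/-! ### The spectral norm through families of eigenfunctions -/

/-- The eigenfunctions at different l are chosen independently, so the suprema in a finite sum can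
be inserted one at a time. The parameter `a` carries the terms whose eigenfunction is already fixed.
-/
theorem sum_iSup_le_of_forall {M : Exterior n} {B : BC} {s : ℝ} {f : Eu n → ℂ} {A : ℝ≥0∞}
    (S : Finset ℝ≥0) : ∀ a : ℝ≥0∞, (∀ e : M.EigenFamily B, a + specSum S s (e.coef f) ≤ A) →
    a + ∑ l ∈ S, ENNReal.ofReal ((1 + (l : ℝ)) ^ s) *
      (⨆ (e : Eu n → ℂ) (_ : M.IsEigenfunction B l e ∧ eLpNorm e 2 (gvol M.g M.cube) ≤ 1),
        ‖∫ x, f x * conj (e x) ∂(gvol M.g M.cube)‖ₑ) ^ 2 ≤ A := by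
  classical
  induction S using Finset.induction_on with
  | empty =>
    intro a h
    simpa [specSum] using h (Classical.arbitrary _)
  | insert m S hm ih =>
    intro a h
    rw [Finset.sum_insert hm, ← add_assoc]
    have key : ∀ v : Eu n → ℂ, M.IsEigenfunction B m v ∧ eLpNorm v 2 (gvol M.g M.cube) ≤ 1 →
        a + ENNReal.ofReal ((1 + (m : ℝ)) ^ s) *
          ‖∫ x, f x * conj (v x) ∂(gvol M.g M.cube)‖ₑ ^ 2 +
        ∑ l ∈ S, ENNReal.ofReal ((1 + (l : ℝ)) ^ s) *
      (⨆ (e : Eu n → ℂ) (_ : M.IsEigenfunction B l e ∧ eLpNorm e 2 (gvol M.g M.cube) ≤ 1),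
        ‖∫ x, f x * conj (e x) ∂(gvol M.g M.cube)‖ₑ) ^ 2 ≤ A := by
      rintro v ⟨⟨V, hV, hV'⟩, hv⟩
      refine ih _ fun e => ?_
      -- Overwriting the family at m by v leaves the coefficients over S unchanged, as m ∉ S.
      let e' : M.EigenFamily B :=
        { e := Function.update e.e m v
          E := Function.update e.E m V
          isH1 := fun l => by
            rcases eq_or_ne l m with rfl | hl
            · simpa using hV
            · simpa [hl] using e.isH1 l
          eigen := fun l φ Φ hφ => by
            rcases eq_or_ne l m with rfl | hl
            · simpa using hV' φ Φ hφ
            · simpa [hl] using e.eigen l φ Φ hφ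
          norm_le := fun l => by
            rcases eq_or_ne l m with rfl | hl
            · simpa using hv
            · simpa [hl] using e.norm_le l }
      have h1 := h e'
      rw [specSum, Finset.sum_insert hm, ← add_assoc] at h1
      refine le_trans (le_of_eq ?_) h1
      congr 1
      · simp [e', EigenFamily.coef]
      · refine Finset.sum_congr rfl fun l hl => ?_
        have : l ≠ m := fun h => hm (h ▸ hl)
        simp [e', EigenFamily.coef, this]
    set b := ∑ l ∈ S, ENNReal.ofReal ((1 + (l : ℝ)) ^ s) *
      (⨆ (e : Eu n → ℂ) (_ : M.IsEigenfunction B l e ∧ eLpNorm e 2 (gvol M.g M.cube) ≤ 1),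
        ‖∫ x, f x * conj (e x) ∂(gvol M.g M.cube)‖ₑ) ^ 2 with hb
    rw [iSup_subtype']
    have hne : Nonempty {v : Eu n → ℂ // M.IsEigenfunction B m v ∧
        eLpNorm v 2 (gvol M.g M.cube) ≤ 1} :=
      let e : M.EigenFamily B := Classical.arbitrary _
      ⟨⟨e.e m, e.isEigenfunction m, e.norm_le m⟩⟩
    -- The expression is monotone and continuous in the value at m, so it commutes with the supremum
    -- over eigenfunctions.
    have hmono : Monotone fun y : ℝ≥0∞ => a + ENNReal.ofReal ((1 + (m : ℝ)) ^ s) * y ^ 2 + b :=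
      fun y z hyz => by
        simp only
        gcongr
    have hcont : Continuous fun y : ℝ≥0∞ => a + ENNReal.ofReal ((1 + (m : ℝ)) ^ s) * y ^ 2 + b :=
      (continuous_const.add ((ENNReal.continuous_const_mul ENNReal.ofReal_ne_top).comp
        (ENNReal.continuous_pow 2))).add continuous_const
    have := Monotone.map_ciSup_of_continuousAt (f := fun y : ℝ≥0∞ =>
      a + ENNReal.ofReal ((1 + (m : ℝ)) ^ s) * y ^ 2 + b) (g := fun v : {v : Eu n → ℂ //
        M.IsEigenfunction B m v ∧ eLpNorm v 2 (gvol M.g M.cube) ≤ 1} =>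
        ‖∫ x, f x * conj (v.1 x) ∂(gvol M.g M.cube)‖ₑ) hcont.continuousAt hmono (OrderTop.bddAbove _)
    exact this.trans_le (iSup_le fun v => key v.1 v.2)

theorem sobTorus_le_of_forall {M : Exterior n} {B : BC} {s : ℝ} {f : Eu n → ℂ} {A : ℝ≥0∞}
    (h : ∀ (e : M.EigenFamily B) (S : Finset ℝ≥0), specSum S s (e.coef f) ≤ A ^ 2) :
    M.sobTorus B s f ≤ A := by
  rw [sobTorus, one_div, ENNReal.rpow_inv_le_iff two_pos, ENNReal.tsum_eq_iSup_sum]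
  refine iSup_le fun S => ?_
  have := sum_iSup_le_of_forall (M := M) (B := B) (s := s) (f := f) (A := A ^ 2) S 0
    fun e => by rw [zero_add]; exact h e S
  rw [zero_add] at this
  exact_mod_cast this

theorem sobTorus_congr {M : Exterior n} {B : BC} {f h : Eu n → ℂ} (hfh : f =ᵐ[M.torusVol] h)
    (s : ℝ) : M.sobTorus B s f = M.sobTorus B s h := by
  have : ∀ e : Eu n → ℂ, ∫ x, f x * conj (e x) ∂(gvol M.g M.cube) =
      ∫ x, h x * conj (e x) ∂(gvol M.g M.cube) := fun e => by
    refine integral_congr_ae ?_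
    filter_upwards [hfh] with x hx
    rw [hx]
  simp only [sobTorus, this]

end Exterior

end AbstractStrichartz

end

/-! ### The annulus, where the torus and Euclidean space agree -/

noncomputable section
namespace AbstractStrichartz

variable {n : ℕ}

theorem grad_conj {φ : Eu n → ℂ} (hφ : Differentiable ℝ φ) (x : Eu n) (j : Fin n) :
    grad (fun x => conj (φ x)) x j = conj (grad φ x j : ℂ) := by
  have h : HasFDerivAt (fun x => conj (φ x))
      ((Complex.conjCLE : ℂ →L[ℝ] ℂ).comp (fderiv ℝ φ x)) x :=
    (Complex.conjCLE : ℂ →L[ℝ] ℂ).hasFDerivAt.comp x (hφ x).hasFDerivAt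
  rw [grad_apply, grad_apply, h.fderiv]
  rfl

theorem lintegral_eq_setLIntegral_of_forall_notMem {α : Type*} [MeasurableSpace α] {μ : Measure α}
    {A : Set α} (hA : MeasurableSet A) {f : α → ℝ≥0∞} (hf : ∀ x ∉ A, f x = 0) :
    ∫⁻ x, f x ∂μ = ∫⁻ x in A, f x ∂μ := by
  rw [← lintegral_indicator hA]
  refine lintegral_congr fun x => ?_
  by_cases hx : x ∈ A
  · rw [indicator_of_mem hx]
  · rw [indicator_of_notMem hx, hf x hx]

namespace Exterior

variable (M : Exterior n)

section Euclidean

variable {D A : Set (Eu n)} (hA : MeasurableSet A) (hAD : A ⊆ D) (hAR : ∀ x ∈ A, M.R ≤ ‖x‖)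

include hA hAD hAR

theorem gvol_restrict_eq : (gvol M.g D).restrict A = volume.restrict A := by
  rw [gvol_eq, restrict_withDensity hA, Measure.restrict_restrict hA, inter_eq_self_of_subset_left hAD]
  conv_rhs => rw [← withDensity_one (μ := volume.restrict A)]
  refine withDensity_congr_ae ?_
  filter_upwards [ae_restrict_mem hA] with x hx
  rw [M.density_eq_one (hAR x hx), ENNReal.ofReal_one, Pi.one_apply]

theorem memLp_gvol_iff_of_forall_notMem {E : Type*} [NormedAddCommGroup E] {f : Eu n → E}
    (hf : ∀ x ∉ A, f x = 0) {p : ℝ≥0∞} : MemLp f p (gvol M.g D) ↔ MemLp f p volume := by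
  have h : f = A.indicator f := (indicator_eq_self.2 fun x hx => by
      by_contra h; exact hx (hf x h)).symm
  rw [h, memLp_indicator_iff_restrict hA, memLp_indicator_iff_restrict hA,
    M.gvol_restrict_eq hA hAD hAR]

theorem lintegral_gvol_of_forall_notMem {f : Eu n → ℝ≥0∞} (hf : ∀ x ∉ A, f x = 0) :
    ∫⁻ x, f x ∂(gvol M.g D) = ∫⁻ x, f x := by
  rw [lintegral_eq_setLIntegral_of_forall_notMem hA hf,
    lintegral_eq_setLIntegral_of_forall_notMem (μ := volume) hA hf, M.gvol_restrict_eq hA hAD hAR]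

theorem integral_gvol_of_forall_notMem {f : Eu n → ℂ} (hf : ∀ x ∉ A, f x = 0) :
    ∫ x, f x ∂(gvol M.g D) = ∫ x, f x := by
  rw [← setIntegral_eq_integral_of_forall_compl_eq_zero hf,
    ← setIntegral_eq_integral_of_forall_compl_eq_zero (μ := volume) hf,
    M.gvol_restrict_eq hA hAD hAR]

end Euclidean

/-- The annulus, on which both the torus and the exterior domain are Euclidean. -/
def annulus : Set (Eu n) := {x | M.R ≤ ‖x‖} ∩ M.core

theorem measurableSet_annulus : MeasurableSet M.annulus :=
  (isClosed_le continuous_const continuous_norm).measurableSet.inter measurableSet_ball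

theorem le_norm_of_mem_annulus : ∀ x ∈ M.annulus, M.R ≤ ‖x‖ := fun _ hx => hx.1

theorem notMem_K {x : Eu n} (hx : M.R ≤ ‖x‖) : x ∉ M.K := fun h => by
  have := M.K_subset h
  rw [mem_ball_zero_iff] at this
  linarith

theorem annulus_subset_Ω : M.annulus ⊆ M.Ω := fun _ hx => M.notMem_K hx.1

theorem annulus_subset_cube : M.annulus ⊆ M.cube := fun x hx =>
  (M.cube_inter_core.symm.subset ⟨M.annulus_subset_Ω hx, hx.2⟩).1

theorem tendsto_setIntegral_mul {D : Set (Eu n)} {φ : ℕ → Eu n → ℂ} {u v : Eu n → ℂ}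
    (hφ : ∀ k, MemLp (φ k) 2 (gvol M.g D)) (hu : MemLp u 2 (gvol M.g D))
    (h : Tendsto (fun k => eLpNorm (fun x => φ k x - u x) 2 (gvol M.g D)) atTop (𝓝 0))
    (hv : MemLp v 2 (volume.restrict D)) :
    Tendsto (fun k => ∫ x in D, φ k x * v x) atTop (𝓝 (∫ x in D, u x * v x)) := by
  have hw : MemLp (fun x => conj (((M.density x)⁻¹ : ℝ) * v x)) 2 (gvol M.g D) := by
    obtain ⟨c, C, hc, h⟩ := M.exists_density_bounds
    refine memLp_conj ((M.memLp_gvol_iff.2 hv).of_le_mul (c := (c : ℝ)⁻¹) ?_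
      (ae_of_all _ fun x => ?_))
    · exact (Complex.continuous_ofReal.comp (M.continuous_density.inv₀
        fun x => (M.density_pos x).ne')).aestronglyMeasurable.mul (M.memLp_gvol_iff.2 hv).1
    · rw [norm_mul, Complex.norm_real, Real.norm_of_nonneg (inv_pos.2 (M.density_pos x)).le]
      gcongr
      exact (h x).1
  rw [tendsto_iff_edist_tendsto_0]
  refine tendsto_of_tendsto_of_tendsto_of_le_of_le tendsto_const_nhds
    (by
      have := ENNReal.Tendsto.mul_const h (Or.inr hw.2.ne)
      rwa [zero_mul] at this) (fun _ => zero_le) fun k => ?_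
  have h1 : ∫ x in D, (φ k x - u x) * v x =
      ∫ x, (φ k x - u x) * conj (conj (((M.density x)⁻¹ : ℝ) * v x)) ∂(gvol M.g D) := by
    rw [M.integral_eq_gvol]
    congr 1
    ext1 x
    rw [Complex.conj_conj]
    ring
  simp only
  rw [edist_eq_enorm_sub, ← integral_sub (integrable_mul_of_memLp (M.memLp_gvol_iff.1 (hφ k)) hv)
    (integrable_mul_of_memLp (M.memLp_gvol_iff.1 hu) hv)]
  simp only [← sub_mul]
  rw [h1]
  exact enorm_integral_mul_conj_le_eLpNorm ((hφ k).sub hu) hw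

section CoreTest

variable {θ : Eu n → ℂ} (hs : ContDiff ℝ ∞ θ) (hc : HasCompactSupport θ)
  (hcore : tsupport θ ⊆ M.core) (hK : Disjoint (tsupport θ) M.K)

include hcore hK in
theorem tsupport_subset_cube : tsupport θ ⊆ M.cube := fun x hx =>
  (M.cube_inter_core.symm.subset ⟨fun h => Set.disjoint_left.1 hK hx h, hcore hx⟩).1

include hcore hK in
theorem eq_zero_of_notMem_cube {x : Eu n} (hx : x ∉ M.cube) : θ x = 0 ∧ grad θ x = 0 :=
  ⟨image_eq_zero_of_notMem_tsupport fun h => hx (M.tsupport_subset_cube hcore hK h),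
    image_eq_zero_of_notMem_tsupport fun h =>
      hx (M.tsupport_subset_cube hcore hK (tsupport_grad_subset θ h))⟩

include hc hcore in
theorem periodize_eq_on_cube {x : Eu n} (hx : x ∈ M.cube) :
    M.periodize θ x = θ x ∧ grad (M.periodize θ) x = grad θ x := by
  have h := M.periodize_eventuallyEq hc hcore fun i => M.abs_coord_le_of_mem_cube hx i
  exact ⟨h.eq_of_nhds, grad_congr h⟩

include hs hc hcore hK in
theorem isH1_torus_of_test {B : BC} : IsH1 B M.g M.cube M.testTorus θ (grad θ) := by
  have h1 : MemLp θ 2 volume := hs.continuous.memLp_of_hasCompactSupport hc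
  have h2 : MemLp (grad θ) 2 volume :=
    (continuous_grad hs).memLp_of_hasCompactSupport (hasCompactSupport_grad hc)
  refine ⟨M.memLp_gvol_iff.2 (h1.restrict _), M.memLp_gvol_iff.2 (h2.restrict _), ?_⟩
  have hae : ∀ᵐ x ∂(gvol M.g M.cube), x ∈ M.cube :=
    M.gvol_ac.ae_le (ae_restrict_mem M.measurableSet_cube)
  cases B with
  | dirichlet =>
    refine ⟨fun _ => M.periodize θ, fun _ => M.periodize_mem_testTorus hs hc hcore hK, ?_, ?_⟩
    · refine tendsto_const_nhds.congr fun k => ?_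
      rw [eq_comm, eLpNorm_congr_ae (g := fun _ => (0 : ℂ)), eLpNorm_zero']
      filter_upwards [hae] with x hx
      rw [(M.periodize_eq_on_cube hc hcore hx).1, sub_self]
    · refine tendsto_const_nhds.congr fun k => ?_
      rw [eq_comm, eLpNorm_congr_ae (g := fun _ => (0 : CVec n)), eLpNorm_zero']
      filter_upwards [hae] with x hx
      rw [(M.periodize_eq_on_cube hc hcore hx).2, sub_self]
  | neumann =>
    intro φ hφ j
    rw [setIntegral_eq_integral_of_forall_compl_eq_zero fun x hx => by
        rw [(M.eq_zero_of_notMem_cube hcore hK hx).1, zero_mul],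
      setIntegral_eq_integral_of_forall_compl_eq_zero fun x hx => by
        rw [(M.eq_zero_of_notMem_cube hcore hK hx).2]; simp,
      ← neg_eq_iff_eq_neg]
    have := integral_mul_grad hφ.1 hs hc j
    rw [← neg_eq_iff_eq_neg] at this
    simp only [mul_comm] at this ⊢
    rw [← this, neg_neg]

include hs hc hcore hK in
-- For Neumann this is the defining identity tested with the periodization of θ. For Dirichlet it
-- holds for the approximating test functions by integration by parts and passes to the limit.
theorem setIntegral_mul_grad_of_isH1 {B : BC} {u : Eu n → ℂ} {U : Eu n → CVec n}
    (hu : IsH1 B M.g M.cube M.testTorus u U) (j : Fin n) :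
    ∫ x in M.cube, u x * grad θ x j = -∫ x in M.cube, U x j * θ x := by
  have h1 : MemLp θ 2 volume := hs.continuous.memLp_of_hasCompactSupport hc
  have h2 : MemLp (grad θ) 2 volume :=
    (continuous_grad hs).memLp_of_hasCompactSupport (hasCompactSupport_grad hc)
  cases B with
  | neumann =>
    have h := hu.2.2 _ (M.periodize_mem_testTorus hs hc hcore hK) j
    have e1 : ∫ x in M.cube, u x * grad (M.periodize θ) x j = ∫ x in M.cube, u x * grad θ x j :=
      setIntegral_congr_fun M.measurableSet_cube fun x hx => by
        simp only [(M.periodize_eq_on_cube hc hcore hx).2]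
    have e2 : ∫ x in M.cube, U x j * M.periodize θ x = ∫ x in M.cube, U x j * θ x :=
      setIntegral_congr_fun M.measurableSet_cube fun x hx => by
        simp only [(M.periodize_eq_on_cube hc hcore hx).1]
    rwa [e1, e2] at h
  | dirichlet =>
    obtain ⟨φ, hφ, hφ1, hφ2⟩ := hu.2.2
    have hT := M.isTestClass_testTorus
    have t1 := M.tendsto_setIntegral_mul (fun k => M.memLp_gvol_iff.2 (hT.memLp _ (hφ k))) hu.1 hφ1
      ((MemLp.coord h2 j).restrict M.cube)
    have t2 := M.tendsto_setIntegral_mul (φ := fun k x => grad (φ k) x j) (u := fun x => U x j)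
      (fun k => MemLp.coord (M.memLp_gvol_iff.2 (hT.memLp_grad _ (hφ k))) j) (MemLp.coord hu.2.1 j)
      (tendsto_of_tendsto_of_tendsto_of_le_of_le tendsto_const_nhds hφ2 (fun _ => zero_le)
        fun k => eLpNorm_mono fun x => by
          rw [← PiLp.sub_apply]
          exact PiLp.norm_apply_le _ j) (h1.restrict M.cube)
    refine tendsto_nhds_unique t1 (t2.neg.congr fun k => ?_)
    rw [setIntegral_eq_integral_of_forall_compl_eq_zero fun x hx => by
        rw [(M.eq_zero_of_notMem_cube hcore hK hx).1, mul_zero],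
      setIntegral_eq_integral_of_forall_compl_eq_zero fun x hx => by
        rw [(M.eq_zero_of_notMem_cube hcore hK hx).2]; simp,
      integral_mul_grad (hφ k).1 hs hc j]

end CoreTest

/-- Real cutoffs supported in the core. -/
structure IsCoreCutoff (ψ : Eu n → ℂ) : Prop where
  smooth : ContDiff ℝ ∞ ψ
  compact : HasCompactSupport ψ
  core : tsupport ψ ⊆ M.core
  conj_eq : ∀ x, conj (ψ x) = ψ x

variable {M}

theorem IsCoreCutoff.isH1_mul {ψ : Eu n → ℂ} (hψ : M.IsCoreCutoff ψ) {B : BC} {u : Eu n → ℂ}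
    {U : Eu n → CVec n} (hu : IsH1 B M.g M.cube M.testTorus u U) :
    IsH1 B M.g M.cube M.testTorus (fun x => ψ x * u x) (fun x => ψ x • U x + u x • grad ψ x) :=
  M.isH1_mul_core rfl M.measurableSet_cube M.measurableSet_cube M.isTestClass_testTorus
    M.isTestClass_testTorus hψ.smooth hψ.compact hψ.core
    (M.mapsTest_testTorus hψ.smooth hψ.compact hψ.core M.testTorus_props)
    (M.mapsTest_testTorus hψ.smooth hψ.compact hψ.core M.testTorus_props) hu

/-- Cutoffs supported in the annulus. -/
structure IsAnnulusCutoff (M : Exterior n) (ψ : Eu n → ℂ) : Prop extends M.IsCoreCutoff ψ where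
  annulus : tsupport ψ ⊆ {x | M.R ≤ ‖x‖}

namespace IsAnnulusCutoff

variable {ψ : Eu n → ℂ} (hψ : M.IsAnnulusCutoff ψ)

include hψ

theorem eq_zero {x : Eu n} (hx : x ∉ M.annulus) : ψ x = 0 ∧ grad ψ x = 0 :=
  have h : tsupport ψ ⊆ M.annulus := subset_inter hψ.annulus hψ.core
  ⟨image_eq_zero_of_notMem_tsupport fun h' => hx (h h'),
    image_eq_zero_of_notMem_tsupport fun h' => hx (h (tsupport_grad_subset ψ h'))⟩

theorem disjoint_K : Disjoint (tsupport ψ) M.K :=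
  Set.disjoint_left.2 fun _ hx => M.notMem_K (hψ.annulus hx)

theorem memLp_mul {D : Set (Eu n)} (hD : M.annulus ⊆ D) {u : Eu n → ℂ}
    (hu : MemLp u 2 (gvol M.g D)) : MemLp (fun x => ψ x * u x) 2 volume :=
  (M.memLp_gvol_iff_of_forall_notMem M.measurableSet_annulus hD M.le_norm_of_mem_annulus
    fun x hx => by rw [(hψ.eq_zero hx).1, zero_mul]).1
    (Exterior.memLp_smul_of_continuous hψ.smooth.continuous hψ.compact hu)

theorem memLp_mul_grad {u : Eu n → ℂ} {U : Eu n → CVec n} (hu : MemLp u 2 M.torusVol)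
    (hU : MemLp U 2 M.torusVol) :
    MemLp (fun x => ψ x • U x + u x • grad ψ x) 2 volume :=
  (M.memLp_gvol_iff_of_forall_notMem M.measurableSet_annulus M.annulus_subset_cube
    M.le_norm_of_mem_annulus fun x hx => by
      rw [(hψ.eq_zero hx).1, (hψ.eq_zero hx).2, zero_smul, smul_zero, add_zero]).1
    ((Exterior.memLp_smul_of_continuous hψ.smooth.continuous hψ.compact hU).add
      (Exterior.memLp_smul_vec_of_continuous (continuous_grad hψ.smooth) (hasCompactSupport_grad hψ.compact)
        hu))

/-- Testing u with ψη shows that ψu, extended by zero, has the expected weak gradient on all of ℝⁿ.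
The function η needs no decay because ψ is compactly supported. -/
theorem integral_mul_grad {B : BC} {u : Eu n → ℂ} {U : Eu n → CVec n}
    (hu : IsH1 B M.g M.cube M.testTorus u U) {η : Eu n → ℂ} (hη : ContDiff ℝ ∞ η) (j : Fin n) :
    ∫ x, ψ x * u x * grad η x j = -∫ x, (ψ x • U x + u x • grad ψ x) j * η x := by
  have hcube : ∀ x ∉ M.cube, ψ x = 0 ∧ grad ψ x = 0 := fun x hx =>
    hψ.eq_zero fun h => hx (M.annulus_subset_cube h)
  have hsub : tsupport (fun x => ψ x * η x) ⊆ tsupport ψ := tsupport_mul_subset_left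
  have h := M.setIntegral_mul_grad_of_isH1 (θ := fun x => ψ x * η x) (hψ.smooth.mul hη)
    hψ.compact.mul_right (hsub.trans hψ.core) (hψ.disjoint_K.mono_left hsub) hu j
  have f1 : ∫ x in M.cube, ψ x * u x * grad η x j = ∫ x, ψ x * u x * grad η x j :=
    setIntegral_eq_integral_of_forall_compl_eq_zero fun x hx => by
      rw [(hcube x hx).1, zero_mul, zero_mul]
  have f2 : ∫ x in M.cube, (ψ x • U x + u x • grad ψ x) j * η x =
      ∫ x, (ψ x • U x + u x • grad ψ x) j * η x :=
    setIntegral_eq_integral_of_forall_compl_eq_zero fun x hx => by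
      rw [(hcube x hx).1, (hcube x hx).2, zero_smul, smul_zero, add_zero]; simp
  rw [← f1, ← f2]
  have hu1 := M.memLp_gvol_iff.1 hu.1
  have hU1 := MemLp.coord (M.memLp_gvol_iff.1 hu.2.1) j
  have hgj : ∀ {φ : Eu n → ℂ}, ContDiff ℝ ∞ φ → Continuous fun x => grad φ x j := fun hφ =>
    (EuclideanSpace.proj (𝕜 := ℂ) j).continuous.comp (continuous_grad hφ)
  have i1 : MemLp (fun x => ψ x * grad η x j) 2 (volume.restrict M.cube) :=
    ((hψ.smooth.continuous.mul (hgj hη)).memLp_of_hasCompactSupport hψ.compact.mul_right).restrict _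
  have i2 : MemLp (fun x => grad ψ x j * η x) 2 (volume.restrict M.cube) :=
    (((hgj hψ.smooth).mul hη.continuous).memLp_of_hasCompactSupport
      ((hasCompactSupport_grad hψ.compact).comp_left (g := fun v : CVec n => v j) rfl).mul_right).restrict _
  have i3 : MemLp (fun x => ψ x * η x) 2 (volume.restrict M.cube) :=
    ((hψ.smooth.continuous.mul hη.continuous).memLp_of_hasCompactSupport
      hψ.compact.mul_right).restrict _
  have e1 : ∀ x, u x * grad (fun x => ψ x * η x) x j =
      u x * (ψ x * grad η x j) + u x * (grad ψ x j * η x) := fun x => by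
    rw [grad_mul (hψ.smooth.differentiable (by simp)) (hη.differentiable (by simp))]
    simp only [PiLp.add_apply, PiLp.smul_apply, smul_eq_mul]
    ring
  have e2 : ∀ x, (ψ x • U x + u x • grad ψ x) j * η x =
      U x j * (ψ x * η x) + u x * (grad ψ x j * η x) := fun x => by
    simp only [PiLp.add_apply, PiLp.smul_apply, smul_eq_mul]
    ring
  have e3 : ∀ x, ψ x * u x * grad η x j = u x * (ψ x * grad η x j) := fun x => by ring
  simp only [e1] at h
  simp only [e2, e3]
  rw [integral_add (integrable_mul_of_memLp hu1 i1) (integrable_mul_of_memLp hu1 i2)] at h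
  rw [integral_add (integrable_mul_of_memLp hU1 i3) (integrable_mul_of_memLp hu1 i2), neg_add, ← h]
  ring

open SchwartzMap in
theorem lintegral_l2Fourier_mul {B : BC} {u : Eu n → ℂ} {U : Eu n → CVec n}
    (hu : IsH1 B M.g M.cube M.testTorus u U) (hm : MemLp (fun x => ψ x * u x) 2 volume) :
    ∫⁻ ξ, ENNReal.ofReal ((2 * Real.pi * ‖ξ‖) ^ 2) * ‖l2Fourier hm ξ‖ₑ ^ 2 =
      ∫⁻ x, ‖ψ x • U x + u x • grad ψ x‖ₑ ^ 2 ∂M.torusVol := by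
  rw [lintegral_l2Fourier_le_of_weak_grad hm (hψ.memLp_mul_grad hu.1 hu.2.1)]
  · exact (M.lintegral_gvol_of_forall_notMem M.measurableSet_annulus M.annulus_subset_cube
      M.le_norm_of_mem_annulus fun x hx => by
        rw [(hψ.eq_zero hx).1, (hψ.eq_zero hx).2, zero_smul, smul_zero, add_zero]; simp).symm
  · intro φ j
    have hφ : ContDiff ℝ ∞ (fun x => conj (φ x)) :=
      (Complex.conjCLE : ℂ →L[ℝ] ℂ).contDiff.comp φ.smooth'
    have h := hψ.integral_mul_grad hu hφ j
    simp only [grad_conj (φ := φ) (φ.smooth'.differentiable (by simp))] at h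
    exact h

end IsAnnulusCutoff

end Exterior

end AbstractStrichartz

end

/-! ### Cutoff multipliers of order between 0 and 1 -/

noncomputable section
namespace AbstractStrichartz

variable {n : ℕ}

open SchwartzMap

/-! ### Multipliers between the spectral and the Fourier side -/

theorem exists_lintegral_mul_sq_le {χ : Eu n → ℂ} (hs : ContDiff ℝ ∞ χ) (hc : HasCompactSupport χ) :
    ∃ C : ℝ≥0, ∀ (μ : Measure (Eu n)) (u : Eu n → ℂ) (U : Eu n → CVec n),
      AEStronglyMeasurable u μ → ∫⁻ x, ‖χ x * u x‖ₑ ^ 2 ∂μ ≤ C * ∫⁻ x, ‖u x‖ₑ ^ 2 ∂μ ∧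
      ∫⁻ x, ‖χ x • U x + u x • grad χ x‖ₑ ^ 2 ∂μ ≤
        C * (∫⁻ x, ‖u x‖ₑ ^ 2 ∂μ + ∫⁻ x, ‖U x‖ₑ ^ 2 ∂μ) := by
  obtain ⟨C₁, hC₁⟩ := hs.continuous.bounded_above_of_compact_support hc
  obtain ⟨C₂, hC₂⟩ := (continuous_grad hs).bounded_above_of_compact_support
    (hasCompactSupport_grad hc)
  set c : ℝ≥0 := (max C₁ C₂).toNNReal with hcdef
  have b1 : ∀ x, ‖χ x‖ₑ ≤ c := fun x => by
    rw [← ofReal_norm]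
    exact ENNReal.ofReal_le_ofReal ((hC₁ x).trans (le_max_left _ _))
  have b2 : ∀ x, ‖grad χ x‖ₑ ≤ c := fun x => by
    rw [← ofReal_norm]
    exact ENNReal.ofReal_le_ofReal ((hC₂ x).trans (le_max_right _ _))
  refine ⟨2 * c ^ 2, fun μ u U hu => ⟨?_, ?_⟩⟩
  · rw [← lintegral_const_mul'' _ (hu.enorm.pow_const 2)]
    refine lintegral_mono fun x => ?_
    rw [enorm_mul, mul_pow]
    push_cast
    rw [mul_assoc]
    calc ‖χ x‖ₑ ^ 2 * ‖u x‖ₑ ^ 2 ≤ (c : ℝ≥0∞) ^ 2 * ‖u x‖ₑ ^ 2 := by gcongr; exact b1 x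
      _ ≤ 2 * ((c : ℝ≥0∞) ^ 2 * ‖u x‖ₑ ^ 2) := le_mul_of_one_le_left' one_le_two
  · rw [← lintegral_add_left' (hu.enorm.pow_const 2), ← lintegral_const_mul' _ _ ENNReal.coe_ne_top]
    refine lintegral_mono fun x => ?_
    calc ‖χ x • U x + u x • grad χ x‖ₑ ^ 2 ≤ (c * ‖U x‖ₑ + ‖u x‖ₑ * c) ^ 2 := by
          gcongr
          refine (enorm_add_le _ _).trans ?_
          rw [enorm_smul, enorm_smul]
          gcongr
          · exact b1 x
          · exact b2 x
      _ ≤ 2 * ((c * ‖U x‖ₑ) ^ 2 + (‖u x‖ₑ * c) ^ 2) := ENNReal_add_sq_le _ _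
      _ = _ := by push_cast; ring

theorem specSum_one (S : Finset ℝ≥0) (c : ℝ≥0 → ℂ) :
    specSum S 1 c = ∑ l ∈ S, ‖c l‖ₑ ^ 2 + ∑ l ∈ S, ENNReal.ofReal l * ‖c l‖ₑ ^ 2 := by
  rw [specSum, ← Finset.sum_add_distrib]
  refine Finset.sum_congr rfl fun l _ => ?_
  rw [Real.rpow_one, ENNReal.ofReal_add zero_le_one (NNReal.coe_nonneg l), ENNReal.ofReal_one,
    add_mul, one_mul]

/-- Interpolation of bounds for weighted square sums. -/
theorem specSum_le_of_decomposition {S : Finset ℝ≥0} {e : ℝ≥0 → ℂ} {β : Type*} [MeasurableSpace β]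
    {ν : Measure β} [SFinite ν] {w' : β → ℝ} {c' : β → ℝ≥0∞} (hw' : Measurable w')
    (hw0' : ∀ y, 0 ≤ w' y) (hc' : AEMeasurable c' ν) {C : ℝ≥0}
    (h : ∀ t, 0 < t → ∃ a b : ℝ≥0 → ℂ, (∀ l ∈ S, e l = a l + b l) ∧
      ∑ l ∈ S, ‖a l‖ₑ ^ 2 ≤ C * ∫⁻ y, ENNReal.ofReal (w' y / (t + w' y)) ^ 2 * c' y ∂ν ∧
      specSum S 1 b ≤
        C * ∫⁻ y, ENNReal.ofReal (w' y) * (ENNReal.ofReal (t / (t + w' y)) ^ 2 * c' y) ∂ν)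
    {σ : ℝ} (h0 : 0 ≤ σ) (h1 : σ ≤ 1) :
    specSum S σ e ≤ C * ∫⁻ y, ENNReal.ofReal (w' y ^ σ) * c' y ∂ν := by
  rw [specSum, ← lintegral_count_finset S fun l => ENNReal.ofReal ((1 + (l : ℝ)) ^ σ) * ‖e l‖ₑ ^ 2]
  refine lintegral_rpow_le_of_decomposition (μ := (Measure.count : Measure S))
    (w := fun l : S => 1 + ((l : ℝ≥0) : ℝ)) (e := fun l : S => e l) .of_discrete
    (fun l => by positivity) (ae_of_all _ fun l => by positivity)
    Measurable.of_discrete.aestronglyMeasurable hw' hw0' hc' (fun t ht => ?_) h0 h1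
  obtain ⟨a, b, hab, hA, hB⟩ := h t ht
  refine ⟨fun l => a l, fun l => b l, Measurable.of_discrete.aestronglyMeasurable,
    ae_of_all _ fun l => hab l l.2, ?_, ?_⟩
  · rwa [lintegral_count_finset S fun l => ‖a l‖ₑ ^ 2]
  · rw [lintegral_count_finset S fun l => ENNReal.ofReal (1 + (l : ℝ)) * ‖b l‖ₑ ^ 2]
    simpa only [specSum, Real.rpow_one] using hB

namespace Exterior

variable {M : Exterior n} {B : BC}

namespace EigenFamily

theorem exists_specSum_coef_le (M : Exterior n) (B : BC) : ∃ C : ℝ≥0, ∀ (e : M.EigenFamily B)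
    (f : Eu n → ℂ) (F : Eu n → CVec n), IsH1 B M.g M.cube M.testTorus f F → ∀ S : Finset ℝ≥0,
    specSum S 1 (e.coef f) ≤
      C * (∫⁻ x, ‖f x‖ₑ ^ 2 ∂M.torusVol + ∫⁻ x, ‖F x‖ₑ ^ 2 ∂M.torusVol) := by
  obtain ⟨C, hC⟩ := exists_sum_mul_coef_sq_le M B
  refine ⟨max 1 C, fun e f F hf S => ?_⟩
  rw [specSum_one, mul_add]
  refine add_le_add ((e.sum_coef_sq_le hf.1 S).trans ?_) ((hC e f F hf S).trans ?_)
  · exact le_mul_of_one_le_left' (by exact_mod_cast le_max_left _ _)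
  · gcongr
    exact le_max_right _ _

theorem exists_lintegral_synth_le (M : Exterior n) (B : BC) : ∃ C : ℝ≥0, ∀ (e : M.EigenFamily B)
    (S : Finset ℝ≥0) (a : ℝ≥0 → ℂ),
    ∫⁻ x, ‖e.synth S a x‖ₑ ^ 2 ∂M.torusVol + ∫⁻ x, ‖e.synthGrad S a x‖ₑ ^ 2 ∂M.torusVol ≤
      C * specSum S 1 a := by
  obtain ⟨C, hC⟩ := exists_lintegral_synthGrad_le M B
  refine ⟨max 1 C, fun e S a => ?_⟩
  rw [specSum_one, mul_add]
  refine add_le_add ((e.lintegral_synth_le S a).trans ?_) ((hC e S a).trans ?_)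
  · exact le_mul_of_one_le_left' (by exact_mod_cast le_max_left _ _)
  · gcongr
    exact le_max_right _ _

/-- The low part of a spectral sequence at height `t`. -/
def lowPart (t : ℝ) (a : ℝ≥0 → ℂ) (l : ℝ≥0) : ℂ := ((1 + (l : ℝ)) / (t + (1 + (l : ℝ))) : ℝ) * a l

/-- The high part of a spectral sequence at height `t`. -/
def highPart (t : ℝ) (a : ℝ≥0 → ℂ) (l : ℝ≥0) : ℂ := (t / (t + (1 + (l : ℝ))) : ℝ) * a l

theorem enorm_lowPart_sq {t : ℝ} (ht : 0 < t) (a : ℝ≥0 → ℂ) (l : ℝ≥0) : ‖lowPart t a l‖ₑ ^ 2 =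
    ENNReal.ofReal ((1 + (l : ℝ)) / (t + (1 + (l : ℝ)))) ^ 2 * ‖a l‖ₑ ^ 2 := by
  rw [lowPart, enorm_mul, mul_pow, ← ofReal_norm ((_ : ℝ) : ℂ), Complex.norm_real,
    Real.norm_of_nonneg (by positivity)]

theorem enorm_highPart_sq {t : ℝ} (ht : 0 < t) (a : ℝ≥0 → ℂ) (l : ℝ≥0) : ‖highPart t a l‖ₑ ^ 2 =
    ENNReal.ofReal (t / (t + (1 + (l : ℝ)))) ^ 2 * ‖a l‖ₑ ^ 2 := by
  rw [highPart, enorm_mul, mul_pow, ← ofReal_norm ((_ : ℝ) : ℂ), Complex.norm_real,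
    Real.norm_of_nonneg (by positivity)]

theorem synth_eq_add (e : M.EigenFamily B) (S : Finset ℝ≥0) {t : ℝ} (ht : 0 < t) (a : ℝ≥0 → ℂ)
    (x : Eu n) : e.synth S a x = e.synth S (lowPart t a) x + e.synth S (highPart t a) x := by
  rw [synth, synth, synth, ← Finset.sum_add_distrib]
  refine Finset.sum_congr rfl fun l _ => ?_
  have h : (t + (1 + (l : ℝ))) ≠ 0 := by positivity
  rw [← add_mul, lowPart, highPart, ← add_mul, ← Complex.ofReal_add, ← add_div, add_comm _ t,
    div_self h, Complex.ofReal_one, one_mul]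

theorem sum_lowPart {t : ℝ} (ht : 0 < t) (S : Finset ℝ≥0) (a : ℝ≥0 → ℂ) :
    ∑ l ∈ S, ‖lowPart t a l‖ₑ ^ 2 = ∫⁻ l : S, ENNReal.ofReal ((1 + ((l : ℝ≥0) : ℝ)) /
      (t + (1 + ((l : ℝ≥0) : ℝ)))) ^ 2 * ‖a l‖ₑ ^ 2 ∂Measure.count := by
  rw [lintegral_count_finset S fun l => ENNReal.ofReal ((1 + (l : ℝ)) / (t + (1 + (l : ℝ)))) ^ 2 *
    ‖a l‖ₑ ^ 2]
  exact Finset.sum_congr rfl fun l _ => enorm_lowPart_sq ht a l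

theorem specSum_highPart {t : ℝ} (ht : 0 < t) (S : Finset ℝ≥0) (a : ℝ≥0 → ℂ) :
    specSum S 1 (highPart t a) = ∫⁻ l : S, ENNReal.ofReal (1 + ((l : ℝ≥0) : ℝ)) *
      (ENNReal.ofReal (t / (t + (1 + ((l : ℝ≥0) : ℝ)))) ^ 2 * ‖a l‖ₑ ^ 2) ∂Measure.count := by
  rw [lintegral_count_finset S fun l => ENNReal.ofReal (1 + (l : ℝ)) *
    (ENNReal.ofReal (t / (t + (1 + (l : ℝ)))) ^ 2 * ‖a l‖ₑ ^ 2)]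
  refine Finset.sum_congr rfl fun l _ => ?_
  rw [enorm_highPart_sq ht, Real.rpow_one]

theorem specSum_eq_lintegral (S : Finset ℝ≥0) (s : ℝ) (a : ℝ≥0 → ℂ) :
    specSum S s a = ∫⁻ l : S, ENNReal.ofReal ((1 + ((l : ℝ≥0) : ℝ)) ^ s) * ‖a l‖ₑ ^ 2
      ∂Measure.count :=
  (lintegral_count_finset S fun l => ENNReal.ofReal ((1 + (l : ℝ)) ^ s) * ‖a l‖ₑ ^ 2).symm

end EigenFamily

open EigenFamily

/-- The cutoff is bounded on L² by Bessel and on the form domain by the product rule; splitting the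
coefficients into `lowPart` and `highPart` interpolates. The two families are unrelated: one builds
the function, the other runs through the suprema in the norm of the product. -/
theorem exists_specSum_coef_mul_synth_le_of_nonneg {χ : Eu n → ℂ} (hχ : M.IsCoreCutoff χ) (B : BC)
    {σ : ℝ} (h0 : 0 ≤ σ) (h1 : σ ≤ 1) : ∃ C : ℝ≥0, ∀ (e e' : M.EigenFamily B) (S S' : Finset ℝ≥0)
    (a : ℝ≥0 → ℂ), specSum S' σ (e'.coef fun x => χ x * e.synth S a x) ≤ C * specSum S σ a := by
  obtain ⟨C₁, hC₁⟩ := exists_specSum_coef_le M B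
  obtain ⟨C₂, hC₂⟩ := exists_lintegral_synth_le M B
  obtain ⟨C₃, hC₃⟩ := exists_lintegral_mul_sq_le hχ.smooth hχ.compact
  refine ⟨max C₃ (C₁ * (2 * C₃) * C₂), fun e e' S S' a => ?_⟩
  rw [specSum_eq_lintegral S]
  refine specSum_le_of_decomposition (ν := (Measure.count : Measure S))
    (w' := fun l => 1 + ((l : ℝ≥0) : ℝ)) (c' := fun l => ‖a l‖ₑ ^ 2) .of_discrete
    (fun l => by positivity) Measurable.of_discrete.aemeasurable (fun t ht => ?_) h0 h1
  have hk : ∀ b, IsH1 B M.g M.cube M.testTorus (fun x => χ x * e.synth S b x) _ := fun b =>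
    hχ.isH1_mul (e.isH1_synth S b)
  have hm : ∀ b, AEStronglyMeasurable (e.synth S b) M.torusVol := fun b => (e.isH1_synth S b).1.1
  refine ⟨e'.coef fun x => χ x * e.synth S (lowPart t a) x,
    e'.coef fun x => χ x * e.synth S (highPart t a) x, fun l _ => ?_, ?_, ?_⟩
  · rw [← e'.coef_add (hk _).1 (hk _).1]
    simp only [e.synth_eq_add S ht a, mul_add]
  · rw [← sum_lowPart ht]
    calc _ ≤ _ := e'.sum_coef_sq_le (hk _).1 S'
      _ ≤ C₃ * ∫⁻ x, ‖e.synth S (lowPart t a) x‖ₑ ^ 2 ∂M.torusVol :=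
        (hC₃ _ _ (e.synthGrad S (lowPart t a)) (hm _)).1
      _ ≤ _ := by
        gcongr
        · exact le_max_left _ _
        · exact e.lintegral_synth_le S _
  · rw [← specSum_highPart ht]
    have h2 := hC₃ M.torusVol _ (e.synthGrad S (highPart t a)) (hm (highPart t a))
    calc _ ≤ _ := hC₁ e' _ _ (hk _) S'
      _ ≤ C₁ * (C₃ * (∫⁻ x, ‖e.synth S (highPart t a) x‖ₑ ^ 2 ∂M.torusVol +
            ∫⁻ x, ‖e.synthGrad S (highPart t a) x‖ₑ ^ 2 ∂M.torusVol) +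
          C₃ * (∫⁻ x, ‖e.synth S (highPart t a) x‖ₑ ^ 2 ∂M.torusVol +
            ∫⁻ x, ‖e.synthGrad S (highPart t a) x‖ₑ ^ 2 ∂M.torusVol)) := by
        gcongr
        · exact h2.1.trans (by gcongr; exact le_self_add)
        · exact h2.2
      _ = C₁ * (2 * C₃) * (∫⁻ x, ‖e.synth S (highPart t a) x‖ₑ ^ 2 ∂M.torusVol +
            ∫⁻ x, ‖e.synthGrad S (highPart t a) x‖ₑ ^ 2 ∂M.torusVol) := by ring
      _ ≤ C₁ * (2 * C₃) * (C₂ * specSum S 1 (highPart t a)) := by gcongr; exact hC₂ e S _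
      _ = ((C₁ * (2 * C₃) * C₂ : ℝ≥0) : ℝ≥0∞) * specSum S 1 (highPart t a) := by push_cast; ring
      _ ≤ _ := by gcongr; exact le_max_right _ _

/-- The same interpolation with target on the Fourier side: for a cutoff in the annulus the product
lives on ℝⁿ, and Plancherel evaluates its L² norm and the L² norm of its gradient. -/
theorem exists_homSob_mul_synth_le_of_nonneg {ψ : Eu n → ℂ} (hψ : M.IsAnnulusCutoff ψ) (hn : 0 < n)
    (B : BC) {σ : ℝ} (h0 : 0 ≤ σ) (h1 : σ ≤ 1) : ∃ C : ℝ≥0, ∀ (e : M.EigenFamily B)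
    (S : Finset ℝ≥0) (a : ℝ≥0 → ℂ),
    homSob σ (fun x => ψ x * e.synth S a x) ^ 2 ≤ C * specSum S σ a := by
  obtain ⟨C₂, hC₂⟩ := exists_lintegral_synth_le M B
  obtain ⟨C₃, hC₃⟩ := exists_lintegral_mul_sq_le hψ.smooth hψ.compact
  refine ⟨max C₃ (C₃ * C₂), fun e S a => ?_⟩
  have hk : ∀ b, MemLp (fun x => ψ x * e.synth S b x) 2 volume := fun b =>
    hψ.memLp_mul M.annulus_subset_cube (e.isH1_synth S b).1
  have hm : ∀ b, AEStronglyMeasurable (e.synth S b) M.torusVol := fun b => (e.isH1_synth S b).1.1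
  have hσ : ∀ ξ : Eu n, (2 * Real.pi * ‖ξ‖) ^ (2 * σ) = ((2 * Real.pi * ‖ξ‖) ^ 2) ^ σ := fun ξ => by
    rw [← Real.rpow_natCast, ← Real.rpow_mul (by positivity)]; norm_num
  have : Nontrivial (Eu n) := Module.nontrivial_of_finrank_pos (R := ℝ) (by simpa using hn)
  rw [homSob_sq (hk a), specSum_eq_lintegral S]
  simp only [hσ]
  refine lintegral_rpow_le_of_decomposition (w := fun ξ : Eu n => (2 * Real.pi * ‖ξ‖) ^ 2)
    (ν := (Measure.count : Measure S))
    (w' := fun l => 1 + ((l : ℝ≥0) : ℝ)) (c' := fun l => ‖a l‖ₑ ^ 2) (by fun_prop)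
    (fun _ => by positivity) ?_ (Lp.aestronglyMeasurable _) .of_discrete
    (fun l => by positivity) Measurable.of_discrete.aemeasurable (fun t ht => ?_) h0 h1
  · have : ∀ᵐ ξ : Eu n, ξ ≠ 0 := by simp [ae_iff]
    filter_upwards [this] with ξ hξ
    positivity
  refine ⟨l2Fourier (hk (lowPart t a)), l2Fourier (hk (highPart t a)), Lp.aestronglyMeasurable _,
    ?_, ?_, ?_⟩
  · have h2 : (fun x => ψ x * e.synth S a x) = fun x => ψ x * e.synth S (lowPart t a) x +
        ψ x * e.synth S (highPart t a) x := by
      ext1 x; rw [e.synth_eq_add S ht a, mul_add]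
    have h3 : l2Fourier (hk a) = l2Fourier (hk (lowPart t a)) + l2Fourier (hk (highPart t a)) := by
      rw [← l2Fourier_add (hk _) (hk _) (h2 ▸ hk a)]
      congr 1
    rw [h3]
    exact Lp.coeFn_add _ _
  · rw [← sum_lowPart ht, lintegral_l2Fourier]
    calc _ = ∫⁻ x, ‖ψ x * e.synth S (lowPart t a) x‖ₑ ^ 2 ∂M.torusVol :=
          (M.lintegral_gvol_of_forall_notMem M.measurableSet_annulus M.annulus_subset_cube
            M.le_norm_of_mem_annulus fun x hx => by
              rw [(hψ.eq_zero hx).1]; simp).symm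
      _ ≤ C₃ * ∫⁻ x, ‖e.synth S (lowPart t a) x‖ₑ ^ 2 ∂M.torusVol :=
        (hC₃ _ _ (e.synthGrad S (lowPart t a)) (hm _)).1
      _ ≤ _ := by
        gcongr
        · exact le_max_left _ _
        · exact e.lintegral_synth_le S _
  · rw [← specSum_highPart ht, hψ.lintegral_l2Fourier_mul (e.isH1_synth S _)]
    calc _ ≤ (C₃ : ℝ≥0∞) * _ := (hC₃ M.torusVol _ (e.synthGrad S (highPart t a)) (hm (highPart t a))).2
      _ ≤ C₃ * (C₂ * specSum S 1 (highPart t a)) := by gcongr; exact hC₂ e S _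
      _ = ((C₃ * C₂ : ℝ≥0) : ℝ≥0∞) * specSum S 1 (highPart t a) := by push_cast; ring
      _ ≤ _ := by gcongr; exact le_max_right _ _

/-- Since ψh = ψ(χh), the function h may be replaced by χh, whose inhomogeneous norm is controlled
by the homogeneous norm of h because σ < n/2. Splitting χh by the resolvent of 1 + |2πξ|² then
interpolates between L² and H¹. -/
theorem exists_specSum_coef_mul_schwartz_le_of_nonneg {ψ : Eu n → ℂ} (hψ : M.IsAnnulusCutoff ψ)
    (hn : 0 < n) (B : BC) {σ : ℝ} (h0 : 0 ≤ σ) (h1 : σ ≤ 1) (hσ : σ < n / 2) :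
    ∃ C : ℝ≥0, ∀ (e : M.EigenFamily B) (S : Finset ℝ≥0) (h : 𝓢(Eu n, ℂ)),
      specSum S σ (e.coef fun x => ψ x * h x) ≤ C * homSob σ h ^ 2 := by
  have hR := M.R_pos
  -- The bump equals 1 on the closed ball of radius 2R, which contains the core and hence the
  -- support of ψ.
  let b : ContDiffBump (0 : Eu n) := ⟨2 * M.R, 3 * M.R, by linarith, by linarith⟩
  obtain ⟨χ, hχ⟩ := exists_schwartz_eq (f := fun x => ((b x : ℝ) : ℂ))
    (b.hasCompactSupport.comp_left (g := fun r : ℝ => (r : ℂ)) rfl)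
    (Complex.ofRealCLM.contDiff.comp b.contDiff)
  have hχ1 : ∀ h : 𝓢(Eu n, ℂ), (fun x => ψ x * h x) = fun x => ψ x * schwartzMul χ h x := fun h => by
    ext1 x
    by_cases hx : x ∈ M.annulus
    · rw [schwartzMul_apply, hχ, b.one_of_mem_closedBall (Metric.ball_subset_closedBall hx.2)]
      simp
    · rw [(hψ.eq_zero hx).1, zero_mul, zero_mul]
  obtain ⟨C₀, hC₀⟩ := exists_sobolev_schwartzMul_le hn h0 hσ χ
  obtain ⟨C₁, hC₁⟩ := exists_specSum_coef_le M B
  obtain ⟨C₃, hC₃⟩ := exists_lintegral_mul_sq_le hψ.smooth hψ.compact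
  set C : ℝ≥0 := max C₃ (C₁ * (2 * C₃)) with hC
  refine ⟨C * C₀, fun e S h => ?_⟩
  rw [hχ1, homSob_schwartz_sq]
  push_cast
  rw [mul_assoc]
  refine le_trans ?_ (mul_le_mul_right (hC₀ h) (C : ℝ≥0∞))
  set v := schwartzMul χ h with hv
  have hH1 : ∀ w : 𝓢(Eu n, ℂ), IsH1 B M.g M.cube M.testTorus (fun x => ψ x * w x)
      (grad fun x => ψ x * w x) := fun w => by
    have hsub : tsupport (fun x => ψ x * w x) ⊆ tsupport ψ := tsupport_mul_subset_left
    exact M.isH1_torus_of_test (hψ.smooth.mul w.smooth') hψ.compact.mul_right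
      (hsub.trans hψ.core) (hψ.disjoint_K.mono_left hsub)
  have hL2 : ∀ w : 𝓢(Eu n, ℂ), ∫⁻ x, ‖w x‖ₑ ^ 2 = ∫⁻ ξ, ‖𝓕 w ξ‖ₑ ^ 2 := fun w => by
    rw [← lintegral_l2Fourier (w.memLp 2 volume)]
    refine lintegral_congr_ae ?_
    filter_upwards [l2Fourier_schwartz w (w.memLp 2 volume)] with ξ hξ
    rw [hξ]
  have hz : ∀ w : 𝓢(Eu n, ℂ), ∫⁻ x, ‖ψ x * w x‖ₑ ^ 2 ∂M.torusVol = ∫⁻ x, ‖ψ x * w x‖ₑ ^ 2 :=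
    fun w => M.lintegral_gvol_of_forall_notMem M.measurableSet_annulus M.annulus_subset_cube
      M.le_norm_of_mem_annulus fun x hx => by rw [(hψ.eq_zero hx).1]; simp
  have hmeas : ∀ w : 𝓢(Eu n, ℂ), Continuous fun ξ => 𝓕 w ξ := fun w =>
    (𝓕 w : 𝓢(Eu n, ℂ)).continuous
  refine specSum_le_of_decomposition (ν := (volume : Measure (Eu n)))
    (w' := fun ξ => 1 + (2 * Real.pi * ‖ξ‖) ^ 2) (c' := fun ξ => ‖𝓕 v ξ‖ₑ ^ 2) (by fun_prop)
    (fun l => by positivity) ((hmeas v).measurable.enorm.pow_const 2).aemeasurable (fun t ht => ?_) h0 h1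
  obtain ⟨v₀, v₁, hv01, hv0, hv1⟩ := exists_schwartz_split v ht
  refine ⟨e.coef fun x => ψ x * v₀ x, e.coef fun x => ψ x * v₁ x, fun l _ => ?_, ?_, ?_⟩
  · rw [← e.coef_add (hH1 _).1 (hH1 _).1, hv01]
    simp only [_root_.add_apply, mul_add]
  · calc _ ≤ _ := e.sum_coef_sq_le (hH1 v₀).1 S
      _ ≤ C₃ * ∫⁻ x, ‖v₀ x‖ₑ ^ 2 := by
        rw [hz]
        exact (hC₃ volume v₀ (grad v₀) v₀.continuous.aestronglyMeasurable).1
      _ ≤ C * ∫⁻ ξ, ‖𝓕 v₀ ξ‖ₑ ^ 2 := by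
        rw [hL2]
        gcongr
        exact le_max_left _ _
      _ = _ := by simp only [hv0, mul_pow]
  · have hgr : ∀ x, grad (fun x => ψ x * v₁ x) x = ψ x • grad v₁ x + v₁ x • grad ψ x := fun x =>
      grad_mul (hψ.smooth.differentiable (by simp)) (v₁.smooth'.differentiable (by simp)) x
    have h2 := hC₃ volume v₁ (grad v₁) v₁.continuous.aestronglyMeasurable
    have h3 : ∫⁻ x, ‖grad (fun x => ψ x * v₁ x) x‖ₑ ^ 2 ∂M.torusVol ≤
        C₃ * ((∫⁻ x, ‖v₁ x‖ₑ ^ 2) + ∫⁻ x, ‖grad v₁ x‖ₑ ^ 2) := by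
      simp only [hgr]
      rw [M.lintegral_gvol_of_forall_notMem M.measurableSet_annulus M.annulus_subset_cube
        M.le_norm_of_mem_annulus fun x hx => by
          rw [(hψ.eq_zero hx).1, (hψ.eq_zero hx).2, zero_smul, smul_zero, add_zero]; simp]
      exact h2.2
    calc _ ≤ _ := hC₁ e _ _ (hH1 v₁) S
      _ ≤ C₁ * (C₃ * ((∫⁻ x, ‖v₁ x‖ₑ ^ 2) + ∫⁻ x, ‖grad v₁ x‖ₑ ^ 2) +
          C₃ * ((∫⁻ x, ‖v₁ x‖ₑ ^ 2) + ∫⁻ x, ‖grad v₁ x‖ₑ ^ 2)) := by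
        rw [hz]
        gcongr
        exact h2.1.trans (by gcongr; exact le_self_add)
      _ = ((C₁ * (2 * C₃) : ℝ≥0) : ℝ≥0∞) * ((∫⁻ x, ‖v₁ x‖ₑ ^ 2) + ∫⁻ x, ‖grad v₁ x‖ₑ ^ 2) := by
        push_cast; ring
      _ ≤ C * ((∫⁻ x, ‖v₁ x‖ₑ ^ 2) + ∫⁻ x, ‖grad v₁ x‖ₑ ^ 2) := by
        gcongr
        exact le_max_right _ _
      _ = C * ∫⁻ ξ, ENNReal.ofReal (1 + (2 * Real.pi * ‖ξ‖) ^ 2) * ‖𝓕 v₁ ξ‖ₑ ^ 2 := by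
        rw [hL2, lintegral_grad_schwartz, ← lintegral_add_left ((hmeas v₁).measurable.enorm.pow_const 2)]
        congr 1
        refine lintegral_congr fun ξ => ?_
        rw [ENNReal.ofReal_add zero_le_one (by positivity), ENNReal.ofReal_one, add_mul, one_mul]
      _ = _ := by simp only [hv1, mul_pow]

end Exterior

end AbstractStrichartz

end

/-! ### Cutoff multipliers of negative order, and Schwartz test functions -/

noncomputable section
namespace AbstractStrichartz

variable {n : ℕ}

open SchwartzMap

theorem ENNReal_le_of_sq_le_sq {a b : ℝ≥0∞} (h : a ^ 2 ≤ b ^ 2) : a ≤ b :=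
  (ENNReal.pow_le_pow_left_iff two_ne_zero).1 h

theorem ENNReal_sqrt_sq (a : ℝ≥0∞) : (a ^ (1 / 2 : ℝ)) ^ 2 = a := by
  rw [← ENNReal.rpow_natCast, ← ENNReal.rpow_mul]
  norm_num

namespace Exterior

variable {M : Exterior n} {B : BC}

/-- Multiplication by a real function is symmetric, so the bound of order s < 0 is the transpose of
the one of order -s, with the two families exchanged. -/
theorem exists_specSum_coef_mul_synth_le {χ : Eu n → ℂ} (hχ : M.IsCoreCutoff χ) (B : BC)
    {s : ℝ} (hs : |s| ≤ 1) : ∃ C : ℝ≥0, ∀ (e e' : M.EigenFamily B) (S S' : Finset ℝ≥0)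
    (a : ℝ≥0 → ℂ), specSum S' s (e'.coef fun x => χ x * e.synth S a x) ≤ C * specSum S s a := by
  rcases le_total 0 s with h0 | h0
  · exact exists_specSum_coef_mul_synth_le_of_nonneg hχ B h0 ((le_abs_self s).trans hs)
  obtain ⟨C, hC⟩ := exists_specSum_coef_mul_synth_le_of_nonneg hχ B (neg_nonneg.2 h0)
    ((neg_le_abs s).trans hs)
  refine ⟨C, fun e e' S S' a => specSum_le_of_forall fun b => ?_⟩
  have h1 := (hχ.isH1_mul (e.isH1_synth S a)).1
  have h2 := (hχ.isH1_mul (e'.isH1_synth S' b)).1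
  have h3 : ∫ x, χ x * e.synth S a x * conj (e'.synth S' b x) ∂M.torusVol =
      ∫ x, e.synth S a x * conj (χ x * e'.synth S' b x) ∂M.torusVol := by
    congr 1
    ext1 x
    rw [map_mul, hχ.conj_eq]
    ring
  rw [← e'.integral_mul_conj_synth h1, h3, e.integral_synth_mul_conj h2]
  refine (enorm_sum_mul_conj_sq_le S s _ _).trans ?_
  rw [mul_comm (C : ℝ≥0∞), mul_assoc]
  gcongr
  exact hC e' e S' S b

namespace IsAnnulusCutoff

variable {ψ : Eu n → ℂ} (hψ : M.IsAnnulusCutoff ψ)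

include hψ

theorem integral_mul_conj_torus (f h : Eu n → ℂ) :
    ∫ x, ψ x * f x * conj (h x) ∂M.torusVol = ∫ x, f x * conj (ψ x * h x) := by
  rw [M.integral_gvol_of_forall_notMem M.measurableSet_annulus M.annulus_subset_cube
    M.le_norm_of_mem_annulus fun x hx => by rw [(hψ.eq_zero hx).1]; ring]
  congr 1
  ext1 x
  rw [map_mul, hψ.conj_eq]
  ring

theorem integral_mul_conj_torus' (f h : Eu n → ℂ) :
    ∫ x, ψ x * f x * conj (h x) = ∫ x, f x * conj (ψ x * h x) ∂M.torusVol := by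
  rw [← M.integral_gvol_of_forall_notMem M.measurableSet_annulus M.annulus_subset_cube
    M.le_norm_of_mem_annulus fun x hx => by rw [(hψ.eq_zero hx).1]; ring]
  congr 1
  ext1 x
  rw [map_mul, hψ.conj_eq]
  ring

theorem memLp_mul_schwartz (h : 𝓢(Eu n, ℂ)) : MemLp (fun x => ψ x * h x) 2 M.torusVol :=
  (M.memLp_gvol_iff_of_forall_notMem M.measurableSet_annulus M.annulus_subset_cube
    M.le_norm_of_mem_annulus fun x hx => by rw [(hψ.eq_zero hx).1, zero_mul]).2
    (memLp_smul_of_continuous hψ.smooth.continuous hψ.compact (h.memLp 2 volume))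

end IsAnnulusCutoff

/-- For s < 0 this is the transpose of the bound from Schwartz functions to spectral coefficients,
which is where |s| < n/2 is spent. -/
theorem exists_homSob_mul_synth_le {ψ : Eu n → ℂ} (hψ : M.IsAnnulusCutoff ψ) (hn : 0 < n)
    (B : BC) {s : ℝ} (hs : |s| ≤ 1) (hsn : |s| < n / 2) : ∃ C : ℝ≥0, ∀ (e : M.EigenFamily B)
    (S : Finset ℝ≥0) (a : ℝ≥0 → ℂ),
    homSob s (fun x => ψ x * e.synth S a x) ^ 2 ≤ C * specSum S s a := by
  rcases le_total 0 s with h0 | h0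
  · exact exists_homSob_mul_synth_le_of_nonneg hψ hn B h0 ((le_abs_self s).trans hs)
  obtain ⟨C, hC⟩ := exists_specSum_coef_mul_schwartz_le_of_nonneg hψ hn B (neg_nonneg.2 h0)
    ((neg_le_abs s).trans hs) ((neg_le_abs s).trans_lt hsn)
  refine ⟨C, fun e S a => ?_⟩
  have hk := hψ.memLp_mul M.annulus_subset_cube (e.isH1_synth S a).1
  have h1 : homSob s (fun x => ψ x * e.synth S a x) ≤ (C * specSum S s a) ^ (1 / 2 : ℝ) := by
    refine homSob_le_of_forall_schwartz hn hk fun h => ENNReal_le_of_sq_le_sq ?_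
    rw [mul_pow, ENNReal_sqrt_sq, hψ.integral_mul_conj_torus',
      e.integral_synth_mul_conj (hψ.memLp_mul_schwartz h)]
    refine (enorm_sum_mul_conj_sq_le S s _ _).trans ?_
    rw [mul_comm (C : ℝ≥0∞), mul_assoc]
    gcongr
    exact hC e S h
  calc _ ≤ ((C * specSum S s a) ^ (1 / 2 : ℝ)) ^ 2 := by gcongr
    _ = _ := ENNReal_sqrt_sq _

/-- For s < 0 this is the transpose of the bound from spectral combinations to the Fourier side. -/
theorem exists_specSum_coef_mul_schwartz_le {ψ : Eu n → ℂ} (hψ : M.IsAnnulusCutoff ψ)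
    (hn : 0 < n) (B : BC) {s : ℝ} (hs : |s| ≤ 1) (hsn : |s| < n / 2) :
    ∃ C : ℝ≥0, ∀ (e : M.EigenFamily B) (S : Finset ℝ≥0) (h : 𝓢(Eu n, ℂ)),
      specSum S s (e.coef fun x => ψ x * h x) ≤ C * homSob s h ^ 2 := by
  rcases le_total 0 s with h0 | h0
  · exact exists_specSum_coef_mul_schwartz_le_of_nonneg hψ hn B h0 ((le_abs_self s).trans hs)
      ((le_abs_self s).trans_lt hsn)
  obtain ⟨C, hC⟩ := exists_homSob_mul_synth_le_of_nonneg hψ hn B (neg_nonneg.2 h0)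
    ((neg_le_abs s).trans hs)
  refine ⟨C, fun e S h => specSum_le_of_forall fun b => ?_⟩
  rw [← e.integral_mul_conj_synth (hψ.memLp_mul_schwartz h), hψ.integral_mul_conj_torus]
  have h1 := enorm_integral_mul_conj_le hn (h.memLp 2 volume)
    (hψ.memLp_mul M.annulus_subset_cube (e.isH1_synth S b).1) s
  calc _ ≤ (homSob s h * homSob (-s) fun x => ψ x * e.synth S b x) ^ 2 := by gcongr
    _ ≤ homSob s h ^ 2 * (C * specSum S (-s) b) := by
      rw [mul_pow]
      gcongr
      exact hC e S b
    _ = _ := by ring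

end Exterior

/-! ### Schwartz functions vanishing near the obstacle -/

theorem tendsto_eLpNorm_zero_of_dominated {α E : Type*} [MeasurableSpace α] {μ : Measure α}
    [NormedAddCommGroup E] {F : ℕ → α → E} {G : α → ℝ} (hF : ∀ k, AEStronglyMeasurable (F k) μ)
    (hG : MemLp G 2 μ) (hle : ∀ k x, ‖F k x‖ ≤ G x)
    (h0 : ∀ x, ∀ᶠ k in atTop, F k x = 0) : Tendsto (fun k => eLpNorm (F k) 2 μ) atTop (𝓝 0) := by
  have h1 : Tendsto (fun k => ∫⁻ x, ‖F k x‖ₑ ^ 2 ∂μ) atTop (𝓝 (∫⁻ _, 0 ∂μ)) := by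
    refine tendsto_lintegral_of_dominated_convergence' (fun x => ‖G x‖ₑ ^ 2)
      (fun k => (hF k).enorm.pow_const 2) (fun k => ae_of_all _ fun x => ?_) ?_
      (ae_of_all _ fun x => ?_)
    · refine pow_le_pow_left' ?_ 2
      rw [← ofReal_norm, ← ofReal_norm]
      exact ENNReal.ofReal_le_ofReal ((hle k x).trans (le_abs_self _))
    · rw [← ofReal_norm_toLp_sq hG]
      exact ENNReal.ofReal_ne_top
    · refine tendsto_const_nhds.congr' ?_
      filter_upwards [h0 x] with k hk
      simp [hk]
  rw [lintegral_zero] at h1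
  have h2 := (ENNReal.continuous_rpow_const (y := (1 / 2 : ℝ))).tendsto 0 |>.comp h1
  rw [ENNReal.zero_rpow_of_pos (by norm_num)] at h2
  refine h2.congr fun k => ?_
  rw [eLpNorm_eq_lintegral_rpow_enorm_toReal (by simp) (by simp)]
  simp

theorem memLp_grad_schwartz (v : 𝓢(Eu n, ℂ)) : MemLp (grad v) 2 volume := by
  refine MemLp.of_le (g := fun x => ∑ j : Fin n,
    ‖(LineDeriv.lineDerivOp (EuclideanSpace.single j (1 : ℝ)) v : 𝓢(Eu n, ℂ)) x‖) ?_
    (continuous_grad v.smooth').aestronglyMeasurable (ae_of_all _ fun x => ?_)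
  · exact memLp_finsetSum _ fun j _ =>
      ((LineDeriv.lineDerivOp (EuclideanSpace.single j (1 : ℝ)) v : 𝓢(Eu n, ℂ)).memLp 2 volume).norm
  · rw [Real.norm_of_nonneg (Finset.sum_nonneg fun j _ => norm_nonneg _)]
    simp only [← grad_schwartz]
    calc ‖grad v x‖ = ‖∑ i, EuclideanSpace.single i (grad v x i)‖ := by
          congr 1
          ext j
          simp [Finset.sum_apply, Pi.single_apply]
      _ ≤ ∑ i, ‖EuclideanSpace.single i (grad v x i)‖ := norm_sum_le _ _
      _ = ∑ i, ‖grad v x i‖ := by simp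

/-- Dilations x ↦ b(x/(k + 1)) of one bump function: they are eventually 1 near each point and their
gradients are uniformly bounded, so dominated convergence applies. -/
theorem exists_cutoff_sequence (v : 𝓢(Eu n, ℂ)) : ∃ η : ℕ → Eu n → ℂ, (∀ k, ContDiff ℝ ∞ (η k)) ∧
    (∀ k, HasCompactSupport (η k)) ∧
    Tendsto (fun k => eLpNorm (fun x => η k x * v x - v x) 2 volume) atTop (𝓝 0) ∧
    Tendsto (fun k => eLpNorm (fun x => grad (fun x => η k x * v x) x - grad v x) 2 volume)
      atTop (𝓝 0) := by
  let b : ContDiffBump (0 : Eu n) := ⟨1, 2, by norm_num, by norm_num⟩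
  set η₀ : Eu n → ℂ := fun x => ((b x : ℝ) : ℂ) with hη₀
  have hs₀ : ContDiff ℝ ∞ η₀ := Complex.ofRealCLM.contDiff.comp b.contDiff
  have hc₀ : HasCompactSupport η₀ :=
    b.hasCompactSupport.comp_left (g := fun r : ℝ => (r : ℂ)) rfl
  set c : ℕ → ℝ := fun k => ((k : ℝ) + 1)⁻¹ with hc
  have hcpos : ∀ k, 0 < c k := fun k => by positivity
  have hc1 : ∀ k, c k ≤ 1 := fun k => inv_le_one_of_one_le₀ (by linarith [k.cast_nonneg (α := ℝ)])
  obtain ⟨C, hC⟩ := (continuous_grad hs₀).bounded_above_of_compact_support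
    (hasCompactSupport_grad hc₀)
  set η : ℕ → Eu n → ℂ := fun k x => η₀ (c k • x) with hη
  have hs : ∀ k, ContDiff ℝ ∞ (η k) := fun k => hs₀.comp (contDiff_const_smul (c k))
  have hgrad : ∀ k x, grad (η k) x = (c k : ℂ) • grad η₀ (c k • x) := fun k x => by
    ext j
    rw [grad_apply, PiLp.smul_apply, grad_apply, hη]
    simp only
    rw [fderiv_comp_smul]
    simp
  have hev : ∀ x, ∀ᶠ k in atTop, η k =ᶠ[𝓝 x] fun _ => 1 := fun x => by
    filter_upwards [eventually_ge_atTop (Nat.ceil ‖x‖)] with k hk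
    have h1 : ‖x‖ < k + 1 := by
      have : (Nat.ceil ‖x‖ : ℝ) ≤ k := by exact_mod_cast hk
      linarith [Nat.le_ceil ‖x‖]
    have h2 : ∀ᶠ y in 𝓝 x, ‖y‖ < k + 1 := continuous_norm.continuousAt.eventually_lt_const h1
    filter_upwards [h2] with y hy
    simp only [hη, hη₀]
    rw [b.one_of_mem_closedBall, Complex.ofReal_one]
    rw [mem_closedBall_zero_iff, norm_smul, Real.norm_of_nonneg (hcpos k).le]
    exact (inv_mul_le_one₀ (by positivity)).2 hy.le
  have hle1 : ∀ k x, ‖η k x - 1‖ ≤ 1 := fun k x => by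
    simp only [hη, hη₀]
    rw [← Complex.ofReal_one, ← Complex.ofReal_sub, Complex.norm_real, Real.norm_eq_abs]
    exact abs_le.2 ⟨by linarith [b.nonneg (x := c k • x)], by linarith [b.le_one (x := c k • x)]⟩
  have hgr : ∀ k x, grad (fun x => η k x * v x) x = η k x • grad v x + v x • grad (η k) x :=
    fun k x => grad_mul ((hs k).differentiable (by simp)) (v.smooth'.differentiable (by simp)) x
  refine ⟨η, hs, fun k => ?_, ?_, ?_⟩
  · exact hc₀.comp_homeomorph (Homeomorph.smulOfNeZero (c k) (hcpos k).ne')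
  · refine tendsto_eLpNorm_zero_of_dominated (G := fun x => ‖v x‖) (fun k =>
      (((hs k).continuous.mul v.continuous).sub v.continuous).aestronglyMeasurable)
      (v.memLp 2 volume).norm (fun k x => ?_) fun x => ?_
    · rw [← sub_one_mul, norm_mul]
      exact mul_le_of_le_one_left (norm_nonneg _) (hle1 k x)
    · filter_upwards [hev x] with k hk
      rw [hk.eq_of_nhds, one_mul, sub_self]
  · refine tendsto_eLpNorm_zero_of_dominated (G := fun x => ‖grad v x‖ + C * ‖v x‖) (fun k =>
      ((continuous_grad ((hs k).mul v.smooth')).sub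
        (continuous_grad v.smooth')).aestronglyMeasurable)
      ((memLp_grad_schwartz v).norm.add ((v.memLp 2 volume).norm.const_mul C))
      (fun k x => ?_) fun x => ?_
    · rw [hgr, show η k x • grad v x + v x • grad (η k) x - grad v x =
        (η k x - 1) • grad v x + v x • grad (η k) x by rw [sub_smul, one_smul]; abel]
      refine (norm_add_le _ _).trans (add_le_add ?_ ?_)
      · rw [norm_smul]
        exact mul_le_of_le_one_left (norm_nonneg _) (hle1 k x)
      · rw [norm_smul, hgrad, norm_smul, Complex.norm_real, Real.norm_of_nonneg (hcpos k).le,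
          mul_comm]
        gcongr
        exact (mul_le_of_le_one_left (norm_nonneg _) (hc1 k)).trans (hC _)
    · filter_upwards [hev x] with k hk
      rw [sub_eq_zero]
      refine Exterior.grad_congr ?_
      filter_upwards [hk] with y hy
      rw [hy, one_mul]

/-- The support stays away from the obstacle, so in the Dirichlet case only a cutoff at infinity is
necessary to approximate by test functions. -/
theorem Exterior.isH1_schwartz (M : Exterior n) {B : BC} (v : 𝓢(Eu n, ℂ))
    (hv : Disjoint (tsupport v) M.K) : IsH1 B M.g M.Ω M.testΩ v (grad v) := by
  have hv' : tsupport v ⊆ M.Ω := subset_compl_iff_disjoint_right.2 hv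
  refine ⟨M.memLp_gvol_iff.2 ((v.memLp 2 volume).restrict _),
    M.memLp_gvol_iff.2 ((memLp_grad_schwartz v).restrict _), ?_⟩
  cases B with
  | dirichlet =>
    obtain ⟨η, hs, hc, h1, h2⟩ := exists_cutoff_sequence v
    obtain ⟨C, hC⟩ := M.gvol_le
    have key : ∀ {E : Type} [NormedAddCommGroup E] (F : ℕ → Eu n → E),
        Tendsto (fun k => eLpNorm (F k) 2 volume) atTop (𝓝 0) →
        Tendsto (fun k => eLpNorm (F k) 2 (gvol M.g M.Ω)) atTop (𝓝 0) := fun F hF => by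
      have h3 : ∀ k, eLpNorm (F k) 2 (gvol M.g M.Ω) ≤
          (C : ℝ≥0∞) ^ (1 / (2 : ℝ≥0∞)).toReal * eLpNorm (F k) 2 volume := fun k => by
        refine (eLpNorm_mono_measure _ (hC M.Ω)).trans ?_
        rw [eLpNorm_smul_measure_of_ne_top (by simp), smul_eq_mul]
        exact mul_le_mul_right (eLpNorm_mono_measure (F k) Measure.restrict_le_self) _
      refine tendsto_of_tendsto_of_tendsto_of_le_of_le tendsto_const_nhds ?_ (fun _ => zero_le) h3
      have := ENNReal.Tendsto.const_mul (a := (C : ℝ≥0∞) ^ (1 / (2 : ℝ≥0∞)).toReal) hF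
        (Or.inr (ENNReal.rpow_ne_top_of_nonneg (by positivity) ENNReal.coe_ne_top))
      rwa [mul_zero] at this
    exact ⟨fun k x => η k x * v x, fun k => ⟨(hs k).mul v.smooth', (hc k).mul_right,
      (tsupport_mul_subset_right (f := η k)).trans hv'⟩, key _ h1, key _ h2⟩
  | neumann =>
    intro φ hφ j
    rw [M.setIntegral_Ω_of_tsupport, M.setIntegral_Ω_of_tsupport,
      integral_mul_grad (φ := v) v.smooth' hφ.1 hφ.2.1]
    · exact (tsupport_mul_subset_right (f := fun x => grad v x j)).trans hφ.2.2
    · exact (tsupport_mul_subset_left (f := v)).trans hv'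

end AbstractStrichartz

end

/-! ### Duality for the Sobolev norms on the exterior domain -/

noncomputable section
namespace AbstractStrichartz

variable {n : ℕ}

open SchwartzMap

namespace Exterior

variable {M : Exterior n} {B : BC} {β : Eu n → ℝ}

namespace IsCutoff

variable (hβ : M.IsCutoff β)

include hβ

theorem hasCompactSupport : HasCompactSupport β :=
  (isCompact_closedBall (0 : Eu n) (2 * M.R)).of_isClosed_subset (isClosed_tsupport _)
    (hβ.supp.trans fun x hx => mem_closedBall_zero_iff.2 (le_of_lt hx))

theorem isCoreCutoff : M.IsCoreCutoff fun x => (β x : ℂ) where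
  smooth := Complex.ofRealCLM.contDiff.comp hβ.smooth
  compact := hβ.hasCompactSupport.comp_left (g := fun r : ℝ => (r : ℂ)) rfl
  core := (closure_mono fun _ hx => by simpa using hx).trans
    (hβ.supp.trans fun _ hx => mem_ball_zero_iff.2 hx)
  conj_eq x := Complex.conj_ofReal _

theorem isCoreCutoff_sq : M.IsCoreCutoff fun x => (β x : ℂ) * (β x : ℂ) where
  smooth := hβ.isCoreCutoff.smooth.mul hβ.isCoreCutoff.smooth
  compact := hβ.isCoreCutoff.compact.mul_right
  core := tsupport_mul_subset_left.trans hβ.isCoreCutoff.core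
  conj_eq x := by rw [map_mul, Complex.conj_ofReal]

theorem contDiff_one_sub : ContDiff ℝ ∞ fun x => ((1 - β x : ℝ) : ℂ) :=
  Complex.ofRealCLM.contDiff.comp (contDiff_const.sub hβ.smooth)

theorem tsupport_one_sub : tsupport (fun x => ((1 - β x : ℝ) : ℂ)) ⊆ {x | M.R < ‖x‖} :=
  (closure_mono fun x hx => by
    rw [Function.mem_support] at hx ⊢
    exact fun h => hx (by rw [h, Complex.ofReal_zero])).trans hβ.supp'

theorem one_sub_eq_zero {x : Eu n} (hx : x ∉ {x : Eu n | M.R ≤ ‖x‖}) : ((1 - β x : ℝ) : ℂ) = 0 :=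
  image_eq_zero_of_notMem_tsupport (f := fun x => ((1 - β x : ℝ) : ℂ))
    fun h => hx (show M.R ≤ ‖x‖ from (show M.R < ‖x‖ from hβ.tsupport_one_sub h).le)

theorem isAnnulusCutoff : M.IsAnnulusCutoff fun x => (β x : ℂ) * ((1 - β x : ℝ) : ℂ) where
  smooth := hβ.isCoreCutoff.smooth.mul hβ.contDiff_one_sub
  compact := hβ.isCoreCutoff.compact.mul_right
  core := tsupport_mul_subset_left.trans hβ.isCoreCutoff.core
  conj_eq x := by rw [map_mul, Complex.conj_ofReal, Complex.conj_ofReal]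
  annulus := tsupport_mul_subset_right.trans fun x hx =>
    show M.R ≤ ‖x‖ from (show M.R < ‖x‖ from hβ.tsupport_one_sub hx).le

omit hβ in
theorem measurableSet_far : MeasurableSet {x : Eu n | M.R ≤ ‖x‖} :=
  (isClosed_le continuous_const continuous_norm).measurableSet

theorem memLp_one_sub_mul {f : Eu n → ℂ} (hf : MemLp f 2 M.vol) :
    MemLp (fun x => ((1 - β x : ℝ) : ℂ) * f x) 2 volume := by
  refine (M.memLp_gvol_iff_of_forall_notMem (D := M.Ω) measurableSet_far
    (fun x hx => M.notMem_K hx) (fun _ hx => hx) fun x hx => by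
      rw [hβ.one_sub_eq_zero hx, zero_mul]).1 ?_
  obtain ⟨C, hC⟩ := hβ.isCoreCutoff.smooth.continuous.bounded_above_of_compact_support
    hβ.isCoreCutoff.compact
  refine MemLp.of_le_mul (c := 1 + C) hf
    (hβ.contDiff_one_sub.continuous.aestronglyMeasurable.mul hf.1) (ae_of_all _ fun x => ?_)
  rw [norm_mul]
  gcongr
  rw [Complex.ofReal_sub, Complex.ofReal_one]
  exact (norm_sub_le _ _).trans (add_le_add (by simp) (hC x))

theorem memLp_mul {f : Eu n → ℂ} (hf : MemLp f 2 M.vol) :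
    MemLp (fun x => (β x : ℂ) * f x) 2 M.torusVol :=
  (M.memLp_core_iff M.cube_inter_core fun x hx => by
    rw [show (β x : ℂ) = 0 from image_eq_zero_of_notMem_tsupport (f := fun x => (β x : ℂ))
      fun h => hx (hβ.isCoreCutoff.core h), zero_mul]).2
    (memLp_smul_of_continuous hβ.isCoreCutoff.smooth.continuous hβ.isCoreCutoff.compact hf)

theorem integral_torus_eq (f k : Eu n → ℂ) :
    ∫ x, (β x : ℂ) * f x * conj (k x) ∂M.torusVol = ∫ x, f x * conj ((β x : ℂ) * k x) ∂M.vol := by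
  rw [M.integral_gvol, M.integral_vol, M.setIntegral_core_eq M.cube_inter_core fun x hx => by
    rw [show (β x : ℂ) = 0 from image_eq_zero_of_notMem_tsupport (f := fun x => (β x : ℂ))
      fun h => hx (hβ.isCoreCutoff.core h), zero_mul, zero_mul, smul_zero]]
  congr 1
  ext1 x
  rw [map_mul, Complex.conj_ofReal]
  congr 1
  ring

theorem integral_far_eq (f k : Eu n → ℂ) :
    ∫ x, ((1 - β x : ℝ) : ℂ) * f x * conj (k x) =
      ∫ x, f x * conj (((1 - β x : ℝ) : ℂ) * k x) ∂M.vol := by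
  rw [← M.integral_gvol_of_forall_notMem (D := M.Ω) measurableSet_far
    (fun x hx => M.notMem_K hx) (fun _ hx => hx) fun x hx => by
      rw [hβ.one_sub_eq_zero hx, zero_mul, zero_mul]]
  refine integral_congr_ae (ae_of_all _ fun x => ?_)
  simp only [map_mul, Complex.conj_ofReal]
  ring

theorem isH1_mul_synth (e : M.EigenFamily B) (S : Finset ℝ≥0) (b : ℝ≥0 → ℂ) :
    ∃ H, IsH1 B M.g M.Ω M.testΩ (fun x => (β x : ℂ) * e.synth S b x) H :=
  have h := hβ.isCoreCutoff
  ⟨_, M.isH1_mul_core M.cube_inter_core M.measurableSet_cube M.measurableSet_Ω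
    M.isTestClass_testTorus M.isTestClass_testΩ h.smooth h.compact h.core
    (M.mapsTest_testΩ h.smooth h.compact M.testTorus_props)
    (M.mapsTest_testTorus h.smooth h.compact h.core M.testΩ_props) (e.isH1_synth S b)⟩

/-- The duality bound for the part of `f` near the obstacle. -/
theorem exists_sobTorus_le_of_forall (hn : 0 < n) (B : BC) {s : ℝ} (hs : |s| ≤ 1)
    (hsn : |s| < n / 2) : ∃ C : ℝ≥0, ∀ (f : Eu n → ℂ), MemLp f 2 M.vol → ∀ A : ℝ≥0∞,
    (∀ h H, IsH1 B M.g M.Ω M.testΩ h H →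
      ‖∫ x, f x * conj (h x) ∂M.vol‖ₑ ≤ A * M.homSobB B β (-s) h) →
    M.sobTorus B s (fun x => (β x : ℂ) * f x) ≤ C * A := by
  -- The test function is β times a combination of eigenfunctions, so the two pieces of its norm
  -- involve the multipliers β² and (1 - β)β.
  obtain ⟨C₁, hC₁⟩ := exists_specSum_coef_mul_synth_le hβ.isCoreCutoff_sq B
    (s := -s) (by rwa [abs_neg])
  obtain ⟨C₂, hC₂⟩ := exists_homSob_mul_synth_le hβ.isAnnulusCutoff hn B
    (s := -s) (by rwa [abs_neg]) (by rwa [abs_neg])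
  refine ⟨NNReal.sqrt (2 * (C₁ + C₂)), fun f hf A hA => sobTorus_le_of_forall fun e S =>
    specSum_le_of_forall fun b => ?_⟩
  obtain ⟨H, hH⟩ := hβ.isH1_mul_synth e S b
  rw [← e.integral_mul_conj_synth (hβ.memLp_mul hf), hβ.integral_torus_eq]
  have h1 : M.sobTorus B (-s) (fun x => (β x : ℂ) * ((β x : ℂ) * e.synth S b x)) ≤
      (C₁ * specSum S (-s) b) ^ (1 / 2 : ℝ) := by
    refine sobTorus_le_of_forall fun e' S' => ?_
    rw [ENNReal_sqrt_sq]
    simpa only [mul_assoc] using hC₁ e e' S S' b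
  have h2 : homSob (-s) (fun x => ((1 - β x : ℝ) : ℂ) * ((β x : ℂ) * e.synth S b x)) ^ 2 ≤
      C₂ * specSum S (-s) b := by
    have h3 : (fun x => ((1 - β x : ℝ) : ℂ) * ((β x : ℂ) * e.synth S b x)) =
        fun x => (β x : ℂ) * ((1 - β x : ℝ) : ℂ) * e.synth S b x := by ext1 x; ring
    rw [h3]
    exact hC₂ e S b
  have h3 := hA _ H hH
  rw [homSobB] at h3
  calc _ ≤ (A * (_ + _)) ^ 2 := pow_le_pow_left' h3 2
    _ ≤ A ^ 2 * (2 * (((C₁ * specSum S (-s) b) ^ (1 / 2 : ℝ)) ^ 2 + C₂ * specSum S (-s) b)) := by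
      rw [mul_pow]
      refine mul_le_mul_right ((ENNReal_add_sq_le _ _).trans ?_) _
      gcongr
    _ = _ := by
      rw [ENNReal_sqrt_sq, mul_pow, ← ENNReal.coe_pow, NNReal.sq_sqrt]
      push_cast
      ring

/-- The duality bound for the part of `f` away from the obstacle. -/
theorem exists_homSob_le_of_forall (hn : 0 < n) (B : BC) {s : ℝ} (hs : |s| ≤ 1)
    (hsn : |s| < n / 2) : ∃ C : ℝ≥0, ∀ (f : Eu n → ℂ), MemLp f 2 M.vol → ∀ A : ℝ≥0∞,
    (∀ h H, IsH1 B M.g M.Ω M.testΩ h H →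
      ‖∫ x, f x * conj (h x) ∂M.vol‖ₑ ≤ A * M.homSobB B β (-s) h) →
    homSob s (fun x => ((1 - β x : ℝ) : ℂ) * f x) ≤ C * A := by
  obtain ⟨b, hb⟩ := exists_schwartz_eq hβ.isCoreCutoff.compact hβ.isCoreCutoff.smooth
  -- The test function is (1 - β)h, so the Fourier piece of its norm contains (1 - β)²h, and χ = 2β
  -- - β² is what makes 1 - χ equal to (1 - β)².
  set χ : 𝓢(Eu n, ℂ) := b + b - schwartzMul b b with hχ
  have hχb : ∀ x, χ x = (β x : ℂ) + β x - β x * β x := fun x => by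
    rw [hχ, _root_.sub_apply, _root_.add_apply, schwartzMul_apply, hb]
  obtain ⟨C₃, hC₃⟩ := exists_specSum_coef_mul_schwartz_le hβ.isAnnulusCutoff hn B
    (s := -s) (by rwa [abs_neg]) (by rwa [abs_neg])
  obtain ⟨C₄, hC₄⟩ := exists_homSob_sub_schwartzMul_le_of_abs_lt hn (s := -s)
    (by rwa [abs_neg]) (χ := χ) fun x => by
      rw [hχb, map_sub, map_add, map_mul, Complex.conj_ofReal]
  refine ⟨NNReal.sqrt C₃ + C₄, fun f hf A hA => homSob_le_of_forall_schwartz hn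
    (hβ.memLp_one_sub_mul hf) fun h => ?_⟩
  rw [hβ.integral_far_eq]
  have hv : ∀ x, (h - schwartzMul b h : 𝓢(Eu n, ℂ)) x = ((1 - β x : ℝ) : ℂ) * h x := fun x => by
    rw [_root_.sub_apply, schwartzMul_apply, hb]
    push_cast
    ring
  have hvf : ⇑(h - schwartzMul b h : 𝓢(Eu n, ℂ)) = fun x => ((1 - β x : ℝ) : ℂ) * h x := funext hv
  have hH := M.isH1_schwartz (B := B) (h - schwartzMul b h) (by
    rw [hvf]
    exact Set.disjoint_left.2 fun x hx =>
      M.notMem_K (le_of_lt (hβ.tsupport_one_sub (tsupport_mul_subset_left hx))))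
  rw [hvf] at hH
  have h3 := hA _ _ hH
  refine h3.trans ?_
  rw [mul_right_comm, mul_comm]
  refine mul_le_mul_left ?_ A
  rw [homSobB, ENNReal.coe_add, add_mul]
  refine add_le_add (sobTorus_le_of_forall fun e S => ?_) ?_
  · rw [mul_pow, ← ENNReal.coe_pow, NNReal.sq_sqrt]
    simpa only [mul_assoc] using hC₃ e S h
  · refine le_trans (le_of_eq ?_) (hC₄ h)
    congr 1
    ext1 x
    rw [_root_.sub_apply, schwartzMul_apply, hχb]
    push_cast
    ring

/-- Duality for the spaces `Ḣ^s_B(Ω)`. -/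
theorem exists_homSobB_le_of_forall (hn : 0 < n) (B : BC) {s : ℝ} (hs : |s| ≤ 1)
    (hsn : |s| < n / 2) : ∃ C : ℝ≥0, ∀ (f : Eu n → ℂ), MemLp f 2 M.vol → ∀ A : ℝ≥0∞,
    (∀ h H, IsH1 B M.g M.Ω M.testΩ h H →
      ‖∫ x, f x * conj (h x) ∂M.vol‖ₑ ≤ A * M.homSobB B β (-s) h) →
    M.homSobB B β s f ≤ C * A := by
  obtain ⟨C₁, hC₁⟩ := hβ.exists_sobTorus_le_of_forall hn B hs hsn
  obtain ⟨C₂, hC₂⟩ := hβ.exists_homSob_le_of_forall hn B hs hsn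
  refine ⟨C₁ + C₂, fun f hf A hA => ?_⟩
  push_cast
  rw [homSobB, add_mul]
  exact add_le_add (hC₁ f hf A hA) (hC₂ f hf A hA)

theorem homSobB_congr {f h : Eu n → ℂ} (hfh : f =ᵐ[M.vol] h) (s : ℝ) :
    M.homSobB B β s f = M.homSobB B β s h := by
  have h1 : ∀ᵐ x, x ∈ M.Ω → f x = h x :=
    (ae_restrict_iff' M.measurableSet_Ω).1 (M.ac_gvol.ae_le hfh)
  rw [homSobB, homSobB]
  congr 1
  · refine sobTorus_congr (M.gvol_ac.ae_le ((ae_restrict_iff' M.measurableSet_cube).2 ?_)) s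
    filter_upwards [h1] with x hx hxc
    rw [hx fun hK => hxc.2 hK]
  · refine homSob_congr ?_ s
    filter_upwards [h1] with x hx
    by_cases hxK : x ∈ {x : Eu n | M.R ≤ ‖x‖}
    · rw [hx (M.notMem_K hxK)]
    · rw [hβ.one_sub_eq_zero hxK, zero_mul, zero_mul]

end IsCutoff

theorem sobTorus_zero (s : ℝ) : M.sobTorus B s (fun _ => 0) = 0 := by
  refine le_antisymm (sobTorus_le_of_forall fun e S => ?_) zero_le
  simp [specSum, EigenFamily.coef]

theorem homSobB_zero (s : ℝ) : M.homSobB B β s (fun _ => 0) = 0 := by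
  simp only [homSobB, mul_zero, sobTorus_zero, homSob_zero, add_zero]

end Exterior

end AbstractStrichartz

end

noncomputable section
namespace AbstractStrichartz

/-! ### The Christ–Kiselev lemma -/

section ELpNorm

variable {α : Type*} [MeasurableSpace α] {μ : Measure α}

/-- Monotone convergence for L^q norms, including q = ∞. -/
theorem eLpNorm_le_of_monotone {q : ℝ≥0∞} (hq : q ≠ 0) {f : ℕ → α → ℝ≥0∞} {g : α → ℝ≥0∞}
    (hf : ∀ k, AEMeasurable (f k) μ) (hmono : ∀ x, Monotone fun k => f k x)
    (hg : ∀ x, g x ≤ ⨆ k, f k x) {A : ℝ≥0∞} (h : ∀ k, eLpNorm (f k) q μ ≤ A) :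
    eLpNorm g q μ ≤ A := by
  rcases eq_or_ne q ⊤ with rfl | hq'
  · rw [eLpNorm_exponent_top]
    refine eLpNormEssSup_le_of_ae_enorm_bound ?_
    have : ∀ᵐ x ∂μ, ∀ k, f k x ≤ A := ae_all_iff.2 fun k => by
      have h1 := h k
      rw [eLpNorm_exponent_top] at h1
      filter_upwards [ae_le_eLpNormEssSup (f := f k) (μ := μ)] with x hx
      rw [enorm_eq_self] at hx
      exact hx.trans h1
    filter_upwards [this] with x hx
    rw [enorm_eq_self]
    exact (hg x).trans (iSup_le hx)
  · have hq0 := ENNReal.toReal_pos hq hq'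
    rw [eLpNorm_eq_lintegral_rpow_enorm_toReal hq hq', one_div, ENNReal.rpow_inv_le_iff hq0]
    calc ∫⁻ x, ‖g x‖ₑ ^ q.toReal ∂μ ≤ ∫⁻ x, ⨆ k, f k x ^ q.toReal ∂μ := by
          refine lintegral_mono fun x => ?_
          rw [enorm_eq_self]
          refine (ENNReal.rpow_le_rpow (hg x) hq0.le).trans_eq ?_
          exact (ENNReal.orderIsoRpow q.toReal hq0).map_iSup fun k => f k x
      _ = ⨆ k, ∫⁻ x, f k x ^ q.toReal ∂μ := lintegral_iSup' (fun k => (hf k).pow_const _)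
          (ae_of_all _ fun x i j hij => ENNReal.rpow_le_rpow (hmono x hij) hq0.le)
      _ ≤ A ^ q.toReal := iSup_le fun k => by
          have h1 := h k
          rw [eLpNorm_eq_lintegral_rpow_enorm_toReal hq hq', one_div,
            ENNReal.rpow_inv_le_iff hq0] at h1
          simpa only [enorm_eq_self] using h1

theorem eLpNorm_tsum_le {q : ℝ≥0∞} (hq : 1 ≤ q) {f : ℕ → α → ℝ≥0∞}
    (hf : ∀ k, AEMeasurable (f k) μ) :
    eLpNorm (fun x => ∑' k, f k x) q μ ≤ ∑' k, eLpNorm (f k) q μ := by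
  refine eLpNorm_le_of_monotone (one_pos.trans_le hq).ne'
    (f := fun m x => ∑ k ∈ Finset.range m, f k x)
    (fun m => Finset.aemeasurable_fun_sum _ fun k _ => hf k)
    (fun x i j hij => Finset.sum_le_sum_of_subset (Finset.range_mono hij))
    (fun x => (ENNReal.tsum_eq_iSup_nat).le) fun m => ?_
  refine le_trans ?_ (ENNReal.sum_le_tsum (Finset.range m))
  induction m with
  | zero => simp
  | succ m ih =>
    simp only [Finset.sum_range_succ]
    refine (eLpNorm_add_le (f := fun x => ∑ k ∈ Finset.range m, f k x)
      (Finset.aemeasurable_fun_sum _ fun k _ => hf k).aestronglyMeasurable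
      (hf m).aestronglyMeasurable hq).trans ?_
    gcongr

/-- The supremum is bounded by the ℓ^q sum. For q = ∞ nothing is lost, in accordance with the
convention that the exponent `q.toReal⁻¹` is then 0. -/
theorem eLpNorm_iSup_finset_le {q : ℝ≥0∞} (hq : q ≠ 0) {f : ℕ → α → ℝ≥0∞}
    (hf : ∀ k, AEMeasurable (f k) μ) (m : ℕ) {A : ℝ≥0∞} (h : ∀ k, eLpNorm (f k) q μ ≤ A) :
    eLpNorm (fun x => ⨆ k ∈ Finset.range m, f k x) q μ ≤ (m : ℝ≥0∞) ^ (q.toReal⁻¹) * A := by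
  rcases eq_or_ne q ⊤ with rfl | hq'
  · rw [ENNReal.toReal_top, inv_zero, ENNReal.rpow_zero, one_mul, eLpNorm_exponent_top]
    refine eLpNormEssSup_le_of_ae_enorm_bound ?_
    have : ∀ᵐ x ∂μ, ∀ k, f k x ≤ A := ae_all_iff.2 fun k => by
      have h1 := h k
      rw [eLpNorm_exponent_top] at h1
      filter_upwards [ae_le_eLpNormEssSup (f := f k) (μ := μ)] with x hx
      rw [enorm_eq_self] at hx
      exact hx.trans h1
    filter_upwards [this] with x hx
    rw [enorm_eq_self]
    exact iSup₂_le fun k _ => hx k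
  · have hq0 := ENNReal.toReal_pos hq hq'
    rw [eLpNorm_eq_lintegral_rpow_enorm_toReal hq hq', one_div, ENNReal.rpow_inv_le_iff hq0,
      ENNReal.mul_rpow_of_nonneg _ _ hq0.le, ENNReal.rpow_inv_rpow hq0.ne']
    calc ∫⁻ x, ‖⨆ k ∈ Finset.range m, f k x‖ₑ ^ q.toReal ∂μ
        ≤ ∫⁻ x, ∑ k ∈ Finset.range m, f k x ^ q.toReal ∂μ := by
          refine lintegral_mono fun x => ?_
          rw [enorm_eq_self, ← ENNReal.le_rpow_inv_iff hq0]
          refine iSup₂_le fun k hk => ?_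
          rw [ENNReal.le_rpow_inv_iff hq0]
          exact Finset.single_le_sum (f := fun k => f k x ^ q.toReal) (fun _ _ => zero_le) hk
      _ = ∑ k ∈ Finset.range m, ∫⁻ x, f k x ^ q.toReal ∂μ :=
          lintegral_finsetSum' _ fun k _ => (hf k).pow_const _
      _ ≤ ∑ k ∈ Finset.range m, A ^ q.toReal := Finset.sum_le_sum fun k _ => by
          have h1 := h k
          rw [eLpNorm_eq_lintegral_rpow_enorm_toReal hq hq', one_div,
            ENNReal.rpow_inv_le_iff hq0] at h1
          simpa only [enorm_eq_self] using h1
      _ = m * A ^ q.toReal := by rw [Finset.sum_const, Finset.card_range, nsmul_eq_mul]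

end ELpNorm

/-- By inner regularity E may be replaced by a compact subset, which lies between its least and
greatest elements s and t. Absence of atoms makes [s, t] and (s, t] equally large. -/
theorem measure_le_of_measureReal_Iic_sub_le {ν : Measure ℝ} [IsFiniteMeasure ν] [NullSingletonClass ν]
    {E : Set ℝ} (hE : MeasurableSet E) {δ : ℝ}
    (h : ∀ s ∈ E, ∀ t ∈ E, s ≤ t → ν.real (Iic t) - ν.real (Iic s) ≤ δ) :
    ν E ≤ ENNReal.ofReal δ := by
  rw [hE.measure_eq_iSup_isCompact]
  refine iSup₂_le fun K hKE => iSup_le fun hK => ?_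
  rcases K.eq_empty_or_nonempty with rfl | hne
  · simp
  obtain ⟨s, hs⟩ := hK.exists_isLeast hne
  obtain ⟨t, ht⟩ := hK.exists_isGreatest hne
  have hst : s ≤ t := hs.2 ht.1
  calc ν K ≤ ν (Icc s t) := measure_mono fun x hx => ⟨hs.2 hx, ht.2 hx⟩
    _ = ν (Ioc s t) := measure_congr Ioc_ae_eq_Icc.symm
    _ = ENNReal.ofReal (ν.real (Iic t) - ν.real (Iic s)) := by
      rw [show Ioc s t = Iic t \ Iic s by ext; simp [and_comm], ← measureReal_sdiff (Iic_subset_Iic.2 hst) measurableSet_Iic,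
        ofReal_measureReal]
    _ ≤ _ := ENNReal.ofReal_le_ofReal (h s (hKE hs.1) t (hKE ht.1) hst)

section Cells

variable (ν : Measure ℝ) [IsFiniteMeasure ν]

/-- The normalized distribution function of a finite measure. -/
def massFraction (t : ℝ) : ℝ := ν.real (Iic t) / ν.real univ

/-- The index of the dyadic cell of generation `j` containing `t`. -/
def cellIndex (j : ℕ) (t : ℝ) : ℕ := ⌊massFraction ν t * 2 ^ j⌋₊

theorem monotone_massFraction : Monotone (massFraction ν) := fun s t hst => by
  unfold massFraction
  gcongr
  exact measure_ne_top _ _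

theorem massFraction_nonneg (t : ℝ) : 0 ≤ massFraction ν t := by unfold massFraction; positivity

theorem massFraction_le_one (t : ℝ) : massFraction ν t ≤ 1 :=
  div_le_one_of_le₀ (measureReal_mono (subset_univ _)) measureReal_nonneg

theorem massFraction_mul (t : ℝ) : massFraction ν t * ν.real univ = ν.real (Iic t) := by
  rcases eq_or_ne (ν.real univ) 0 with h | h
  · rw [h, mul_zero, eq_comm]
    exact le_antisymm (h ▸ measureReal_mono (subset_univ _)) measureReal_nonneg
  · exact div_mul_cancel₀ _ h

theorem measurable_cellIndex (j : ℕ) : Measurable (cellIndex ν j) :=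
  Nat.measurable_floor.comp ((monotone_massFraction ν).measurable.mul_const _)

theorem cellIndex_le (j : ℕ) (t : ℝ) : cellIndex ν j t ≤ 2 ^ j := by
  refine Nat.floor_le_of_le ?_
  push_cast
  exact mul_le_of_le_one_left (by positivity) (massFraction_le_one ν t)

/-- The cells are nested: those of generation j + 1 with index 2k and 2k + 1 make up the cell k of
generation j. -/
theorem cellIndex_succ_div (j : ℕ) (t : ℝ) : cellIndex ν (j + 1) t / 2 = cellIndex ν j t := by
  have := Nat.mul_cast_floor_div_cancel (n := 2) two_ne_zero (massFraction ν t * 2 ^ j)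
  rw [← cellIndex] at this
  rw [← this, cellIndex, pow_succ, mul_assoc]
  rfl

/-- Within a cell the distribution function varies by at most a 2^{-j} fraction of the total mass.
-/
theorem measure_cell_le [NullSingletonClass ν] (j k : ℕ) :
    ν {s | cellIndex ν j s = k} ≤ 2⁻¹ ^ j * ν univ := by
  have hm : MeasurableSet {s | cellIndex ν j s = k} := measurable_cellIndex ν j (measurableSet_singleton k)
  refine (measure_le_of_measureReal_Iic_sub_le hm (δ := (2 ^ j)⁻¹ * ν.real univ)
    fun s hs t ht _ => ?_).trans_eq ?_
  · rw [← massFraction_mul, ← massFraction_mul, ← sub_mul]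
    refine mul_le_mul_of_nonneg_right ?_ measureReal_nonneg
    have h1 : (k : ℝ) ≤ massFraction ν s * 2 ^ j := by
      rw [← show cellIndex ν j s = k from hs]
      exact Nat.floor_le (mul_nonneg (massFraction_nonneg ν s) (by positivity))
    have h2 : massFraction ν t * 2 ^ j < k + 1 := by
      rw [← show cellIndex ν j t = k from ht]
      exact Nat.lt_floor_add_one _
    rw [inv_eq_one_div, le_div_iff₀ (by positivity)]
    linarith
  · rw [ENNReal.ofReal_mul (by positivity), ofReal_measureReal, ENNReal.ofReal_inv_of_pos (by positivity),
      ENNReal.ofReal_pow (by norm_num), ENNReal.inv_pow]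
    simp

/-- A generation j with 2^j times the difference of the mass fractions at least 1 separates the two
points. -/
theorem exists_cellIndex_lt {s t : ℝ} (h : massFraction ν s < massFraction ν t) :
    ∃ j, cellIndex ν j s < cellIndex ν j t := by
  obtain ⟨j, hj⟩ := pow_unbounded_of_one_lt (massFraction ν t - massFraction ν s)⁻¹ one_lt_two
  refine ⟨j, Nat.lt_of_lt_of_le (Nat.lt_succ_self _) (Nat.le_floor ?_)⟩
  have h1 : 1 ≤ 2 ^ j * (massFraction ν t - massFraction ν s) := by
    rw [← div_le_iff₀ (sub_pos.2 h), one_div]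
    exact hj.le
  have h2 : (cellIndex ν j s : ℝ) ≤ massFraction ν s * 2 ^ j :=
    Nat.floor_le (mul_nonneg (massFraction_nonneg ν s) (by positivity))
  push_cast
  linarith

theorem massFraction_lt_of_cellIndex_lt {j : ℕ} {s t : ℝ} (h : cellIndex ν j s < cellIndex ν j t) :
    massFraction ν s < massFraction ν t := by
  by_contra! h'
  exact absurd h (not_lt_of_ge (Nat.floor_mono (mul_le_mul_of_nonneg_right h' (by positivity))))

theorem cellIndex_lt_succ {j : ℕ} {s t : ℝ} (h : cellIndex ν j s < cellIndex ν j t) :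
    cellIndex ν (j + 1) s < cellIndex ν (j + 1) t := by
  rw [← cellIndex_succ_div ν j s, ← cellIndex_succ_div ν j t] at h
  omega

end Cells

section ChristKiselev

variable {H : Type*} [NormedAddCommGroup H] [NormedSpace ℝ H] {N : H → ℝ≥0∞}
  (hN0 : ∀ x, N x = 0 ↔ x = 0) (hNadd : ∀ x y, N (x + y) ≤ N x + N y)
  {ν : Measure ℝ} [IsFiniteMeasure ν] {K : ℝ → ℝ → H} (hK : ∀ t, Integrable (K t))

/-- The largest contribution of a cell of generation `j`. -/
def layer (N : H → ℝ≥0∞) (ν : Measure ℝ) [IsFiniteMeasure ν] (K : ℝ → ℝ → H) (j : ℕ) (t : ℝ) :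
    ℝ≥0∞ :=
  ⨆ k ∈ Finset.range (2 ^ j + 1), N (∫ s in {s | cellIndex ν j s = k}, K t s)

theorem le_layer {j k : ℕ} (hk : k ≤ 2 ^ j) (t : ℝ) :
    N (∫ s in {s | cellIndex ν j s = k}, K t s) ≤ layer N ν K j t :=
  le_iSup₂_of_le (f := fun k (_ : k ∈ Finset.range (2 ^ j + 1)) =>
    N (∫ s in {s | cellIndex ν j s = k}, K t s)) k (by simpa using by omega) le_rfl

include hN0 hNadd hK in
-- A Whitney decomposition of the region to the left of t: each generation adds at most one cell,
-- the left sibling of the cell containing t. So one maximal cell per generation is enough.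
theorem apply_setIntegral_cellIndex_lt_le (J : ℕ) (t : ℝ) :
    N (∫ s in {s | cellIndex ν J s < cellIndex ν J t}, K t s) ≤
      ∑ j ∈ Finset.range (J + 1), layer N ν K j t := by
  have hN00 : N 0 = 0 := (hN0 0).2 rfl
  induction J with
  | zero =>
    rw [zero_add, Finset.sum_range_one]
    have h1 := cellIndex_le ν 0 t
    rcases Nat.eq_zero_or_pos (cellIndex ν 0 t) with h0 | h0
    -- At generation 0 the index is 0 or 1, and the value 1 occurs only when the mass fraction of t
    -- is 1.
    · simp [h0, hN00]
    · have h2 : cellIndex ν 0 t = 1 := le_antisymm (by simpa using h1) h0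
      have h3 : {s | cellIndex ν 0 s < cellIndex ν 0 t} = {s | cellIndex ν 0 s = 0} := by
        ext s
        rw [mem_ofPred_eq, mem_ofPred_eq, h2, Nat.lt_one_iff]
      rw [h3]
      exact le_layer (by norm_num) t
  | succ J ih =>
    have hm := measurable_cellIndex ν
    set b := cellIndex ν (J + 1) t with hb
    have hbJ : b / 2 = cellIndex ν J t := cellIndex_succ_div ν J t
    have hb2 : b ≤ 2 ^ (J + 1) := cellIndex_le ν (J + 1) t
    rw [Finset.sum_range_succ]
    -- If b is odd, its left sibling b - 1 is the cell to add; if b is even, t lies in the left half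
    -- of its parent and the region does not change.
    by_cases hodd : b % 2 = 1
    · have h3 : {s | cellIndex ν (J + 1) s < b} =
          {s | cellIndex ν J s < cellIndex ν J t} ∪ {s | cellIndex ν (J + 1) s = b - 1} := by
        ext s
        simp only [mem_ofPred_eq, mem_union, ← hbJ, ← cellIndex_succ_div ν J s]
        omega
      rw [h3, setIntegral_union ?_ (show MeasurableSet {s | cellIndex ν (J + 1) s = b - 1} from
        hm _ (measurableSet_singleton _)) (hK t).integrableOn
        (hK t).integrableOn]
      · exact (hNadd _ _).trans (add_le_add ih (le_layer (by omega) t))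
      · refine Set.disjoint_left.2 fun s hs hs' => ?_
        simp only [mem_ofPred_eq, ← hbJ, ← cellIndex_succ_div ν J s] at hs hs'
        omega
    · have h3 : {s | cellIndex ν (J + 1) s < b} = {s | cellIndex ν J s < cellIndex ν J t} := by
        ext s
        simp only [mem_ofPred_eq, ← hbJ, ← cellIndex_succ_div ν J s]
        omega
      rw [h3]
      exact ih.trans le_self_add

include hN0 hNadd hK in
-- As J → ∞ the regions increase to the set of smaller mass fraction, and lower semicontinuity of N
-- carries the bound to the limit.
theorem apply_setIntegral_massFraction_lt_le (hlsc : LowerSemicontinuous N) (t : ℝ) :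
    N (∫ s in {s | massFraction ν s < massFraction ν t}, K t s) ≤ ∑' j, layer N ν K j t := by
  have hm := measurable_cellIndex ν
  have hU : ⋃ j, {s | cellIndex ν j s < cellIndex ν j t} =
      {s | massFraction ν s < massFraction ν t} := by
    ext s
    rw [mem_iUnion]
    exact ⟨fun ⟨j, hj⟩ => massFraction_lt_of_cellIndex_lt ν hj, exists_cellIndex_lt ν⟩
  have hlim := tendsto_setIntegral_of_monotone (μ := volume) (f := K t)
    (s := fun j => {s | cellIndex ν j s < cellIndex ν j t})
    (fun j => measurableSet_lt (hm j) measurable_const)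
    (monotone_nat_of_le_succ fun j s hs => cellIndex_lt_succ ν hs) (hK t).integrableOn
  rw [hU] at hlim
  exact (hlsc.isClosed_preimage _).mem_of_tendsto hlim (Eventually.of_forall fun J =>
    (apply_setIntegral_cellIndex_lt_le hN0 hNadd hK J t).trans
      (ENNReal.sum_le_tsum (Finset.range (J + 1))))

include hN0 hK in
-- The sets of integration differ by the times s ≤ t with the same mass fraction as t, which form a
-- ν-null set E. By hypothesis the integral over E vanishes for almost every value of the time
-- parameter, hence for every value by continuity, in particular at t.
theorem setIntegral_Iic_eq [NullSingletonClass ν] {q : ℝ≥0∞} (hq : q ≠ 0) (hlsc : LowerSemicontinuous N)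
    (hcont : ∀ E, MeasurableSet E → Continuous fun t => ∫ s in E, K t s)
    (hnull : ∀ E, MeasurableSet E → ν E = 0 →
      eLpNorm (fun t => N (∫ s in E, K t s)) q volume = 0) (t : ℝ) :
    ∫ s in Iic t, K t s = ∫ s in {s | massFraction ν s < massFraction ν t}, K t s := by
  have hmf := (monotone_massFraction ν).measurable
  set E := {s | s ≤ t ∧ massFraction ν s = massFraction ν t} with hE
  have hEm : MeasurableSet E :=
    measurableSet_Iic.inter (measurableSet_eq_fun hmf measurable_const)
  have hE0 : ν E = 0 := by
    refine le_antisymm ?_ zero_le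
    refine (measure_le_of_measureReal_Iic_sub_le hEm (δ := 0) fun a ha b hb _ => ?_).trans_eq
      ENNReal.ofReal_zero
    rw [← massFraction_mul, ← massFraction_mul, ha.2, hb.2, sub_self]
  have h1 := hnull E hEm hE0
  have hmeas : Measurable fun t => N (∫ s in E, K t s) :=
    (LowerSemicontinuous.comp hlsc (hcont E hEm)).measurable
  rw [eLpNorm_eq_zero_iff hmeas.aestronglyMeasurable hq] at h1
  have h2 : (fun t => ∫ s in E, K t s) =ᵐ[volume] fun _ => 0 := by
    filter_upwards [h1] with x hx
    exact (hN0 _).1 hx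
  have h3 := congrFun ((hcont E hEm).ae_eq_iff_eq volume continuous_const |>.1 h2) t
  have h4 : Iic t = {s | massFraction ν s < massFraction ν t} ∪ E := by
    ext s
    simp only [mem_Iic, mem_union, mem_ofPred_eq, hE]
    refine ⟨fun h => ?_, fun h => ?_⟩
    · rcases (monotone_massFraction ν h).lt_or_eq with h' | h'
      · exact Or.inl h'
      · exact Or.inr ⟨h, h'⟩
    · rcases h with h | h
      · exact ((monotone_massFraction ν).reflect_lt h).le
      · exact h.1
  rw [h4, setIntegral_union ?_ hEm (hK t).integrableOn (hK t).integrableOn, h3, add_zero]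
  exact Set.disjoint_left.2 fun s hs hs' => hs.ne hs'.2

end ChristKiselev

/-- **The Christ–Kiselev lemma.** -/
theorem exists_eLpNorm_setIntegral_Iic_le {p : ℝ} (hp : 0 < p) {q : ℝ≥0∞} (hq : 1 ≤ q)
    (hpq : ENNReal.ofReal p < q) : ∃ C' : ℝ≥0, ∀ {H : Type} [NormedAddCommGroup H]
    [NormedSpace ℝ H] {N : H → ℝ≥0∞}, (∀ x, N x = 0 ↔ x = 0) → (∀ x y, N (x + y) ≤ N x + N y) →
    LowerSemicontinuous N → ∀ (ν : Measure ℝ) [IsFiniteMeasure ν] [NullSingletonClass ν] (K : ℝ → ℝ → H),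
    (∀ t, Integrable (K t)) →
    (∀ E, MeasurableSet E → Continuous fun t => ∫ s in E, K t s) → ∀ C : ℝ≥0∞,
    (∀ E, MeasurableSet E →
      eLpNorm (fun t => N (∫ s in E, K t s)) q volume ≤ C * ν E ^ (1 / p)) →
    eLpNorm (fun t => N (∫ s in Iic t, K t s)) q volume ≤ C' * (C * ν univ ^ (1 / p)) := by
  set a := q.toReal⁻¹ with ha
  have hq0 : q ≠ 0 := (one_pos.trans_le hq).ne'
  have hab : a < 1 / p := by
    rcases eq_or_ne q ⊤ with rfl | hq'
    · rw [ha, ENNReal.toReal_top, inv_zero]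
      positivity
    · rw [ha, one_div]
      refine inv_strictAnti₀ hp ?_
      exact (ENNReal.ofReal_lt_iff_lt_toReal hp.le hq').1 hpq
  have ha0 : 0 ≤ a := inv_nonneg.2 ENNReal.toReal_nonneg
  -- Taking the largest of about 2^j cells costs 2^{j/q}, while their mass gains 2^{-j/p}. The ratio
  -- ρ of the resulting geometric series is below 1 because p < q.
  set ρ : ℝ≥0∞ := 2 ^ a * 2⁻¹ ^ (1 / p) with hρ
  have hρ1 : ρ < 1 := by
    rw [hρ, ENNReal.inv_rpow, ← ENNReal.rpow_neg, ← ENNReal.rpow_add _ _ two_ne_zero (by simp)]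
    exact ENNReal.rpow_lt_one_of_one_lt_of_neg (by norm_num) (by linarith)
  refine ⟨(2 ^ a * (1 - ρ)⁻¹).toNNReal, fun {H} _ _ {N} hN0 hNadd hlsc ν _ _ K hK hcont C hC => ?_⟩
  rw [ENNReal.coe_toNNReal (ENNReal.mul_ne_top
    (ENNReal.rpow_ne_top_of_nonneg ha0 (by simp)) (ENNReal.inv_ne_top.2 (tsub_pos_iff_lt.2 hρ1).ne'))]
  have hcell : ∀ j k, MeasurableSet {s | cellIndex ν j s = k} := fun j k =>
    measurable_cellIndex ν j (measurableSet_singleton k)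
  have hmeas : ∀ j k, AEMeasurable (fun t => N (∫ s in {s | cellIndex ν j s = k}, K t s)) volume :=
    fun j k => (LowerSemicontinuous.comp hlsc (hcont _ (hcell j k))).measurable.aemeasurable
  have hcomm : ∀ (x : ℝ≥0∞) (j : ℕ) (b : ℝ), (x ^ j) ^ b = (x ^ b) ^ j := fun x j b => by
    rw [← ENNReal.rpow_natCast, ← ENNReal.rpow_natCast, ← ENNReal.rpow_mul, ← ENNReal.rpow_mul,
      mul_comm]
  have hlayer : ∀ j, eLpNorm (layer N ν K j) q volume ≤
      2 ^ a * (C * ν univ ^ (1 / p)) * ρ ^ j := fun j => by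
    refine (eLpNorm_iSup_finset_le hq0 (hmeas j) _ (A := C * (2⁻¹ ^ j * ν univ) ^ (1 / p))
      fun k => (hC _ (hcell j k)).trans ?_).trans ?_
    · gcongr
      exact measure_cell_le ν j k
    -- There are 2^j + 1 indices, the last one being reached only at full mass; doubling absorbs it
    -- and leaves the factor 2^a.
    · have h1 : (((2 ^ j + 1 : ℕ) : ℝ≥0∞)) ≤ 2 * 2 ^ j := by
        push_cast
        rw [two_mul]
        exact add_le_add le_rfl (one_le_pow₀ (by norm_num))
      calc _ ≤ (2 * 2 ^ j : ℝ≥0∞) ^ a * (C * (2⁻¹ ^ j * ν univ) ^ (1 / p)) := by gcongr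
        _ = _ := by
          rw [ENNReal.mul_rpow_of_nonneg _ _ ha0, ENNReal.mul_rpow_of_nonneg _ _ (by positivity),
            hρ, mul_pow, hcomm, hcomm]
          ring
  calc eLpNorm (fun t => N (∫ s in Iic t, K t s)) q volume
      ≤ eLpNorm (fun t => ∑' j, layer N ν K j t) q volume := by
        refine eLpNorm_mono_enorm fun t => ?_
        rw [enorm_eq_self, enorm_eq_self,
          setIntegral_Iic_eq (ν := ν) hN0 hK hq0 hlsc hcont fun E hE hE0 => ?_]
        · exact apply_setIntegral_massFraction_lt_le hN0 hNadd hK hlsc t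
        · have := hC E hE
          rw [hE0, ENNReal.zero_rpow_of_pos (by positivity), mul_zero] at this
          exact le_antisymm this zero_le
    _ ≤ ∑' j, eLpNorm (layer N ν K j) q volume :=
        eLpNorm_tsum_le hq fun j => AEMeasurable.biSup _ (Finset.countable_toSet _)
          fun k _ => hmeas j k
    _ ≤ ∑' j, 2 ^ a * (C * ν univ ^ (1 / p)) * ρ ^ j := ENNReal.tsum_le_tsum hlayer
    _ = _ := by rw [ENNReal.tsum_mul_left, ENNReal.tsum_geometric]; ring

end AbstractStrichartz

end

/-! ### Function spaces, dual norms and Hölder's inequality -/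

noncomputable section
namespace AbstractStrichartz

namespace FunSpace

variable {n : ℕ} {μ : Measure (Eu n)} (X : FunSpace μ)

theorem integral_mul_conj (f : Lp ℂ 2 μ) {v : Eu n → ℂ} {g : Lp ℂ 2 μ} (hv : g =ᵐ[μ] v) :
    ∫ x, f x * conj (v x) ∂μ = inner ℂ g f := by
  rw [L2.inner_def]
  refine integral_congr_ae ?_
  filter_upwards [hv] with x hx
  rw [hx, RCLike.inner_apply]

theorem norm_eq_zero_iff (f : Lp ℂ 2 μ) : X.N f = 0 ↔ f = 0 :=
  (X.eq_zero_iff f (Lp.aestronglyMeasurable f)).trans (Lp.eq_zero_iff_ae_eq_zero).symm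

theorem norm_add_le (f h : Lp ℂ 2 μ) : X.N ↑(f + h) ≤ X.N f + X.N h := by
  rw [X.congr_ae _ _ (Lp.coeFn_add f h)]
  exact X.add_le f h (Lp.aestronglyMeasurable f) (Lp.aestronglyMeasurable h)

/-- By the assumed duality the norm is a supremum of continuous functions on L². This provides the
measurability in time and the passage to the limit in the Christ–Kiselev lemma. -/
theorem lowerSemicontinuous_norm : LowerSemicontinuous fun f : Lp ℂ 2 μ => X.N f := by
  rw [show (fun f : Lp ℂ 2 μ => X.N f) = fun f : Lp ℂ 2 μ => ⨆ (v : Eu n → ℂ)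
    (_ : MemLp v 2 μ ∧ dualNorm μ X.N v ≤ 1), ‖∫ x, f x * conj (v x) ∂μ‖ₑ from
    funext fun f => X.dual f (Lp.memLp f)]
  refine lowerSemicontinuous_iSup fun v => lowerSemicontinuous_iSup fun hv =>
    Continuous.lowerSemicontinuous ?_
  simp_rw [fun f => integral_mul_conj f hv.1.coeFn_toLp]
  fun_prop

theorem lowerSemicontinuous_dualNorm (N : (Eu n → ℂ) → ℝ≥0∞) :
    LowerSemicontinuous fun f : Lp ℂ 2 μ => dualNorm μ N f := by
  unfold dualNorm
  refine lowerSemicontinuous_iSup fun v => lowerSemicontinuous_iSup fun hv =>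
    Continuous.lowerSemicontinuous ?_
  have h : ∀ f : Lp ℂ 2 μ, ∫ x, v x * conj (f x) ∂μ = inner ℂ f (hv.1.toLp v) := fun f => by
    rw [← integral_mul_conj (hv.1.toLp v) (v := f) EventuallyEq.rfl]
    refine integral_congr_ae ?_
    filter_upwards [hv.1.coeFn_toLp] with x hx
    rw [hx]
  simp_rw [h]
  fun_prop

/-- Normalize u in X. If its norm is 0 then u vanishes almost everywhere; an infinite norm is
excluded because ∞ times a zero dual norm would be 0. -/
theorem enorm_integral_le {u : Eu n → ℂ} (hu : MemLp u 2 μ) (hX : X.N u ≠ ⊤) (v : Eu n → ℂ) :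
    ‖∫ x, u x * conj (v x) ∂μ‖ₑ ≤ X.N u * dualNorm μ X.N v := by
  rcases eq_or_ne (X.N u) 0 with h0 | h0
  · have h1 : ∫ x, u x * conj (v x) ∂μ = 0 := by
      refine integral_eq_zero_of_ae ?_
      filter_upwards [(X.eq_zero_iff u hu.1).1 h0] with x hx
      simp [hx]
    rw [h1, enorm_zero]
    exact zero_le
  · set c : ℂ := (((X.N u).toReal⁻¹ : ℝ) : ℂ) with hc
    have hce : ‖c‖ₑ = (X.N u)⁻¹ := by
      rw [hc, ← ofReal_norm, Complex.norm_real, Real.norm_of_nonneg (by positivity),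
        ENNReal.ofReal_inv_of_pos (ENNReal.toReal_pos h0 hX), ENNReal.ofReal_toReal hX]
    have h1 : ‖∫ x, c * u x * conj (v x) ∂μ‖ₑ ≤ dualNorm μ X.N v :=
      le_iSup₂_of_le (f := fun (u : Eu n → ℂ) (_ : MemLp u 2 μ ∧ X.N u ≤ 1) =>
        ‖∫ x, u x * conj (v x) ∂μ‖ₑ) (fun x => c * u x) ⟨hu.const_mul c, by
          rw [X.smul_eq c u hu.1, hce, ENNReal.inv_mul_cancel h0 hX]⟩ le_rfl
    simp_rw [mul_assoc, integral_const_mul, enorm_mul, hce] at h1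
    rwa [← ENNReal.inv_mul_le_iff h0 hX]

theorem enorm_inner_le (u v : Lp ℂ 2 μ) (hX : X.N u ≠ ⊤) :
    ‖inner ℂ u v‖ₑ ≤ X.N u * dualNorm μ X.N v := by
  refine le_trans (le_of_eq ?_) (X.enorm_integral_le (Lp.memLp u) hX v)
  rw [integral_mul_conj u (v := v) EventuallyEq.rfl, ← ofReal_norm, ← ofReal_norm, norm_inner_symm]

theorem aemeasurable_dualNorm {N : (Eu n → ℂ) → ℝ≥0∞} {F : ℝ → Lp ℂ 2 μ} {m : Measure ℝ}
    (hF : AEStronglyMeasurable F m) : AEMeasurable (fun t => dualNorm μ N (F t)) m := by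
  let _ : MeasurableSpace (Lp ℂ 2 μ) := borel _
  have : BorelSpace (Lp ℂ 2 μ) := ⟨rfl⟩
  exact (lowerSemicontinuous_dualNorm N).measurable.comp_aemeasurable hF.aemeasurable

theorem measurable_norm_comp {y : ℝ → Lp ℂ 2 μ} (hy : Continuous y) :
    Measurable fun t => X.N (y t) :=
  (LowerSemicontinuous.comp X.lowerSemicontinuous_norm hy).measurable

theorem dualNorm_zero (N : (Eu n → ℂ) → ℝ≥0∞) : dualNorm μ N ((0 : Lp ℂ 2 μ) : Eu n → ℂ) = 0 := by
  refine le_antisymm (iSup₂_le fun u _ => ?_) zero_le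
  have h1 : ∫ x, u x * conj (((0 : Lp ℂ 2 μ) : Eu n → ℂ) x) ∂μ = 0 := by
    refine integral_eq_zero_of_ae ?_
    filter_upwards [Lp.coeFn_zero ℂ 2 μ] with x hx
    rw [hx]
    simp
  rw [h1, enorm_zero]

end FunSpace

theorem ae_lt_top_of_eLpNorm_ne_top {α : Type*} [MeasurableSpace α] {μ : Measure α} {q : ℝ≥0∞}
    (hq : q ≠ 0) {f : α → ℝ≥0∞} (hf : AEMeasurable f μ) (h : eLpNorm f q μ ≠ ⊤) :
    ∀ᵐ x ∂μ, f x < ⊤ := by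
  rcases eq_or_ne q ⊤ with rfl | hq'
  · rw [eLpNorm_exponent_top] at h
    filter_upwards [ae_le_eLpNormEssSup (f := f) (μ := μ)] with x hx
    rw [enorm_eq_self] at hx
    exact hx.trans_lt h.lt_top
  · have h1 := lintegral_rpow_enorm_lt_top_of_eLpNorm_lt_top hq hq' h.lt_top
    simp only [enorm_eq_self] at h1
    filter_upwards [ae_lt_top' (hf.pow_const _) h1.ne] with x hx
    by_contra hx'
    rw [not_lt_top_iff.1 hx', ENNReal.top_rpow_of_pos (ENNReal.toReal_pos hq hq')] at hx
    exact hx.ne rfl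

theorem lintegral_mul_le_eLpNorm_mul_eLpNorm {α : Type*} [MeasurableSpace α] {μ : Measure α}
    {r r' : ℝ≥0∞} (hr : r.HolderConjugate r') (hr' : r' ≠ ⊤) {a b : α → ℝ≥0∞}
    (ha : AEMeasurable a μ) (hb : AEMeasurable b μ) :
    ∫⁻ x, a x * b x ∂μ ≤ eLpNorm a r μ * eLpNorm b r' μ := by
  have hr0 : r ≠ 0 := ENNReal.HolderConjugate.ne_zero r r'
  have hr0' : r' ≠ 0 := (ENNReal.HolderConjugate.ne_zero r' r)
  rcases eq_or_ne r ⊤ with rfl | hrt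
  · have : r' = 1 := by
      have := hr.inv_add_inv_eq_one
      simpa using this
    subst this
    rw [eLpNorm_exponent_top, eLpNorm_one_eq_lintegral_enorm]
    simp only [enorm_eq_self]
    rw [← lintegral_const_mul'' _ hb]
    refine lintegral_mono_ae ?_
    filter_upwards [ae_le_eLpNormEssSup (f := a) (μ := μ)] with x hx
    rw [enorm_eq_self] at hx
    gcongr
  · have h1 : r.toReal.HolderConjugate r'.toReal :=
      ENNReal.HolderConjugate.toReal_of_ne_top hrt hr'
    refine (ENNReal.lintegral_mul_le_Lp_mul_Lq μ h1 ha hb).trans_eq ?_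
    rw [eLpNorm_eq_lintegral_rpow_enorm_toReal hr0 hrt, eLpNorm_eq_lintegral_rpow_enorm_toReal hr0' hr']
    simp only [enorm_eq_self]

end AbstractStrichartz

end

/-! ### The dual of the homogeneous estimate -/

noncomputable section
namespace AbstractStrichartz

section LinearEstimate

variable {n : ℕ} {M : Exterior n} {B : BC}

/-- Duality of Y and Y' at almost every time, then Hölder in time. Finiteness of A ensures that the
norm of y is finite almost everywhere, as the pointwise duality requires. -/
theorem FunSpace.setLIntegral_inner_le (Y : FunSpace M.vol) {r r' : ℝ≥0∞}
    (hr : r.HolderConjugate r') (hr' : r' ≠ ⊤) {y F : ℝ → M.L2} (hy : Continuous y)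
    (hF : AEStronglyMeasurable F volume) {A : ℝ≥0∞} (hA : A ≠ ⊤)
    (h : mixedNorm Y.N r univ y ≤ A) (E : Set ℝ) :
    ∫⁻ s in E, ‖(inner ℂ (y s) (F s) : ℂ)‖ₑ ≤
      A * mixedNorm (dualNorm M.vol Y.N) r' E F := by
  rw [mixedNorm, Measure.restrict_univ] at h
  have hm := Y.measurable_norm_comp hy
  have h1 : ∀ᵐ s, Y.N (y s) < ⊤ := ae_lt_top_of_eLpNorm_ne_top
    (ENNReal.HolderConjugate.ne_zero r r') hm.aemeasurable (ne_top_of_le_ne_top hA h)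
  calc ∫⁻ s in E, ‖(inner ℂ (y s) (F s) : ℂ)‖ₑ
      ≤ ∫⁻ s in E, Y.N (y s) * dualNorm M.vol Y.N (F s) := by
        refine lintegral_mono_ae (ae_restrict_of_ae ?_)
        filter_upwards [h1] with s hs
        exact Y.enorm_inner_le _ _ hs.ne
    _ ≤ eLpNorm (fun s => Y.N (y s)) r (volume.restrict E) *
        mixedNorm (dualNorm M.vol Y.N) r' E F :=
        lintegral_mul_le_eLpNorm_mul_eLpNorm hr hr' hm.aemeasurable
          (FunSpace.aemeasurable_dualNorm hF.restrict)
    _ ≤ _ := by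
        gcongr
        exact (eLpNorm_mono_measure _ Measure.restrict_le_self).trans h

namespace WaveBase

variable (w : WaveBase M B)

theorem integrable_of_norm_le {T : ℝ} {F G : ℝ → M.L2} (hF : Integrable F)
    (hF0 : ∀ s ∉ Ioc 0 T, F s = 0) (hG : AEStronglyMeasurable G volume)
    (h : ∀ s, ‖G s‖ ≤ (2 * |s| + 2) * ‖F s‖) : Integrable G := by
  refine (hF.norm.const_mul (2 * T + 2)).mono' hG (ae_of_all _ fun s => ?_)
  by_cases hs : s ∈ Ioc 0 T
  · refine (h s).trans ?_
    gcongr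
    rw [abs_of_pos hs.1]
    exact hs.2
  · have := h s
    rw [hF0 s hs, norm_zero, mul_zero] at this ⊢
    exact this

variable {T : ℝ} {F : ℝ → M.L2} (hF : Integrable F) (hF0 : ∀ s ∉ Ioc 0 T, F s = 0)

include hF hF0 in
theorem integrable_opC : Integrable fun s => opC w.D s (F s) :=
  integrable_of_norm_le hF hF0 (w.base.aestronglyMeasurable_opC continuous_id hF.1) fun s =>
    (w.base.norm_opC_le s _).trans (le_mul_of_one_le_left (norm_nonneg _) (by
      linarith [abs_nonneg s]))

include hF hF0 in
theorem integrable_opS : Integrable fun s => opS w.D s (F s) :=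
  integrable_of_norm_le hF hF0 (w.base.aestronglyMeasurable_opS continuous_id hF.1) fun s =>
    (w.base.norm_opS_le s _).trans (by
      gcongr
      linarith [abs_nonneg s])

include hF hF0 in
theorem integrable_opK : Integrable fun s => opK w.D s (F s) :=
  integrable_of_norm_le hF hF0 (w.base.aestronglyMeasurable_opK continuous_id hF.1) fun s =>
    w.base.norm_opK_le s _

include hF hF0 in
theorem integrable_opS_sub (t : ℝ) : Integrable fun s => opS w.D (t - s) (F s) := by
  simp_rw [w.base.opS_sub]
  exact ((opS w.D t).integrable_comp (w.integrable_opC hF hF0)).sub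
    ((opC w.D t).integrable_comp (w.integrable_opS hF hF0))

include hF hF0 in
-- Since S(s) = D K(s), the integral lies in the range of D, hence in the form domain, and qualifies
-- as initial position of a finite energy solution although F is only square integrable in space.
theorem exists_incl_eq_neg_setIntegral (E : Set ℝ) :
    ∃ v : M.H1 B, M.incl B v = -∫ s in E, opS w.D s (F s) := by
  refine ⟨w.W (-∫ s in E, opK w.D s (F s)), ?_⟩
  rw [w.incl_W, map_neg, ← w.D.integral_comp_comm (w.integrable_opK hF hF0).integrableOn]
  simp_rw [w.base.base_opK]

include hF hF0 in
-- The formula S(t-s) = S(t)C(s) - C(t)S(s) takes the dependence on t out of the integral. This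
-- requires E not to depend on t.
theorem sol_eq_setIntegral {E : Set ℝ} {v : M.H1 B}
    (hv : M.incl B v = -∫ s in E, opS w.D s (F s)) (t : ℝ) :
    (w.sol v (∫ s in E, opC w.D s (F s))).u t = ∫ s in E, opS w.D (t - s) (F s) := by
  have hC := (w.integrable_opC hF hF0).integrableOn (s := E)
  have hS := (w.integrable_opS hF hF0).integrableOn (s := E)
  simp_rw [w.base.opS_sub]
  rw [integral_sub ((opS w.D t).integrable_comp hC) ((opC w.D t).integrable_comp hS),
    (opS w.D t).integral_comp_comm hC, (opC w.D t).integral_comp_comm hS, w.sol_u, hv, map_neg]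
  abel

theorem continuous_sol_u (v : M.H1 B) (g : M.L2) : Continuous (w.sol v g).u :=
  (w.base.continuous_opC_time continuous_id _).add (w.base.continuous_opS_time continuous_id _)

end WaveBase

/-- Duality for `Ḣ^s_B(Ω)`, tested on functions of finite norm. -/
theorem Exterior.IsCutoff.exists_homSobB_le_of_inner {β : Eu n → ℝ} (hβ : M.IsCutoff β)
    (hn : 0 < n) (B : BC) {s : ℝ} (hs : |s| ≤ 1) (hsn : |s| < n / 2) :
    ∃ C : ℝ≥0, ∀ (f : M.L2) (A : ℝ≥0∞),
    (∀ v : M.H1 B, M.homSobB B β (-s) (M.incl B v) ≠ ⊤ →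
      ‖(inner ℂ (M.incl B v) f : ℂ)‖ₑ ≤ A * M.homSobB B β (-s) (M.incl B v)) →
    M.homSobB B β s f ≤ C * A := by
  obtain ⟨C, hC⟩ := hβ.exists_homSobB_le_of_forall hn B hs hsn
  -- Test functions of infinite norm need A · ∞ = ∞, which fails for A = 0. Enlarging A by ε/(C + 1)
  -- repairs this and costs at most ε in the conclusion.
  refine ⟨C, fun f A hA => ENNReal.le_of_forall_pos_le_add fun ε hε _ => ?_⟩
  have hδ : 0 < ε / (C + 1) := by positivity
  have h1 := hC f (Lp.memLp f) (A + (ε / (C + 1) : ℝ≥0)) fun h H hh => by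
    obtain ⟨v, hv, -⟩ := M.exists_H1 B hh
    rw [integral_mul_conj_eq_inner f hv, ← hβ.homSobB_congr hv]
    rcases eq_or_ne (M.homSobB B β (-s) (M.incl B v)) ⊤ with htop | htop
    · rw [htop, ENNReal.mul_top]
      · exact le_top
      · exact (lt_of_lt_of_le (by exact_mod_cast hδ) le_add_self).ne'
    · exact (hA v htop).trans (mul_le_mul_left le_self_add _)
  refine h1.trans ?_
  rw [mul_add]
  gcongr
  rw [← ENNReal.coe_mul, ENNReal.coe_le_coe, mul_div_left_comm]
  exact mul_le_of_le_one_right zero_le (div_le_one_of_le₀ (by simp) zero_le)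

variable {β : Eu n → ℝ} {Y : SpacePair M} {γ : ℝ} {r r' : ℝ≥0∞}

/-- Pair the data with h and move the propagators onto h by self-adjointness. Data (0, h) give the
solution S(s)h, with norm of order -γ, and bound the first integral; data (h, 0) give C(s)h, with
norm of order 1 - γ, and bound the second. The constant depends on neither E nor T. -/
theorem GlobalStrichartz.exists_homSobB_setIntegral_le (hY : GlobalStrichartz B β Y (1 - γ) r)
    (hβ : M.IsCutoff β) (hn : 0 < n) (hγ₀ : 0 ≤ γ) (hγ₁ : γ ≤ 1) (hγ : γ < n / 2)
    (hγ' : 1 - γ < n / 2) (hr : r.HolderConjugate r') (hr' : r' ≠ ⊤) (w : WaveBase M B) :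
    ∃ C : ℝ≥0, ∀ (T : ℝ) (F : ℝ → M.L2), Integrable F → (∀ s ∉ Ioc 0 T, F s = 0) → ∀ E : Set ℝ,
      M.homSobB B β γ ↑(-∫ s in E, opS w.D s (F s)) +
        M.homSobB B β (γ - 1) ↑(∫ s in E, opC w.D s (F s)) ≤
      C * mixedNorm (dualNorm M.vol Y.ext.N) r' E F := by
  obtain ⟨CY, hCY⟩ := hY
  obtain ⟨C₁, hC₁⟩ := hβ.exists_homSobB_le_of_inner hn B (s := γ)
    (by rwa [abs_of_nonneg hγ₀]) (by rwa [abs_of_nonneg hγ₀])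
  have habs : |γ - 1| = 1 - γ := by rw [abs_sub_comm, abs_of_nonneg (by linarith)]
  obtain ⟨C₂, hC₂⟩ := hβ.exists_homSobB_le_of_inner hn B (s := γ - 1)
    (by rw [habs]; linarith) (by rwa [habs])
  refine ⟨(C₁ + C₂) * CY, fun T F hF hF0 E => ?_⟩
  have hzero : ∀ s, M.homSobB B β s ((0 : M.L2) : Eu n → ℂ) = 0 := fun s => by
    rw [hβ.homSobB_congr (Lp.coeFn_zero ℂ 2 M.vol)]
    exact Exterior.homSobB_zero s
  set G := mixedNorm (dualNorm M.vol Y.ext.N) r' E F with hG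
  have key : ∀ (v : M.H1 B) (g : M.L2), M.homSobB B β (1 - γ) (M.incl B v) ≠ ⊤ →
      M.homSobB B β (-γ) g ≠ ⊤ →
      ∫⁻ s in E, ‖(inner ℂ ((w.sol v g).u s) (F s) : ℂ)‖ₑ ≤
        CY * (M.homSobB B β (1 - γ) (M.incl B v) + M.homSobB B β (-γ) g) * G := fun v g hv hg => by
    have h1 := hCY (w.sol v g)
    rw [w.sol_u_zero, w.sol_ut_zero, show 1 - γ - 1 = -γ by ring] at h1
    exact Y.ext.setLIntegral_inner_le hr hr' (w.continuous_sol_u v g) hF.1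
      (ENNReal.mul_ne_top ENNReal.coe_ne_top (ENNReal.add_ne_top.2 ⟨hv, hg⟩)) h1 E
  have h1 := hC₁ (-∫ s in E, opS w.D s (F s)) (CY * G) fun v hv => by
    have h2 := key 0 (M.incl B v) (by rw [map_zero, hzero]; simp) hv
    rw [map_zero, hzero, zero_add] at h2
    rw [inner_neg_right, enorm_neg,
      ← integral_inner (w.integrable_opS hF hF0).integrableOn]
    refine (enorm_integral_le_lintegral_enorm _).trans ?_
    refine le_trans (lintegral_mono fun s => le_of_eq ?_) (h2.trans_eq (by ring))
    rw [w.sol_u, map_zero, map_zero, zero_add, w.base.inner_opS]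
  have h3 := hC₂ (∫ s in E, opC w.D s (F s)) (CY * G) fun v hv => by
    rw [neg_sub] at hv ⊢
    have h2 := key v 0 hv (by rw [hzero]; simp)
    rw [hzero, add_zero] at h2
    rw [← integral_inner (w.integrable_opC hF hF0).integrableOn]
    refine (enorm_integral_le_lintegral_enorm _).trans ?_
    refine le_trans (lintegral_mono fun s => le_of_eq ?_) (h2.trans_eq (by ring))
    rw [w.sol_u, map_zero, add_zero, w.base.inner_opC]
  refine (add_le_add h1 h3).trans_eq ?_
  push_cast
  ring

end LinearEstimate

end AbstractStrichartz

end

/-! ### The inhomogeneous estimate -/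

noncomputable section
namespace AbstractStrichartz

section Inhomogeneous

variable {n : ℕ} {M : Exterior n} {B : BC} {β : Eu n → ℝ} {X Y : SpacePair M} {γ : ℝ}
  {q r r' : ℝ≥0∞}

/-- The inhomogeneous estimate for forcing terms of compact support in time. -/
theorem GlobalStrichartz.exists_eLpNorm_setIntegral_Iic_le (hX : GlobalStrichartz B β X γ q)
    (hY : GlobalStrichartz B β Y (1 - γ) r)
    (hβ : M.IsCutoff β) (hn : 0 < n) (hγ₀ : 0 ≤ γ) (hγ₁ : γ ≤ 1) (hγ : γ < n / 2)
    (hγ' : 1 - γ < n / 2) (hr : r.HolderConjugate r') (hq : 1 ≤ q) (hqr : r' < q)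
    (w : WaveBase M B) :
    ∃ C : ℝ≥0, ∀ (T : ℝ) (F : ℝ → M.L2), Integrable F → (∀ s ∉ Ioc 0 T, F s = 0) →
      eLpNorm (fun t => X.ext.N (∫ s in Iic t, opS w.D (t - s) (F s) : M.L2)) q volume ≤
        C * mixedNorm (dualNorm M.vol Y.ext.N) r' univ F := by
  have hrt : r' ≠ ⊤ := hqr.ne_top
  have hr0 : r' ≠ 0 := ENNReal.HolderConjugate.ne_zero r' r
  have hp : 0 < r'.toReal := ENNReal.toReal_pos hr0 hrt
  obtain ⟨CY, hCY⟩ := hY.exists_homSobB_setIntegral_le hβ hn hγ₀ hγ₁ hγ hγ' hr hrt w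
  obtain ⟨CX, hCX⟩ := hX
  obtain ⟨C', hC'⟩ := AbstractStrichartz.exists_eLpNorm_setIntegral_Iic_le hp hq
    (by rwa [ENNReal.ofReal_toReal hrt])
  -- The summand 1 keeps the constant positive, so that the right side is ∞ whenever the norm of F
  -- is.
  refine ⟨C' * (CX * CY) + 1, fun T F hF hF0 => ?_⟩
  set b := fun s => dualNorm M.vol Y.ext.N (F s) with hb
  -- With this measure ν(E)^{1/r'} is the mixed norm of F over E, the form in which the
  -- Christ–Kiselev lemma takes its hypothesis.
  set ν := (volume : Measure ℝ).withDensity fun s => b s ^ r'.toReal with hν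
  have hνE : ∀ E, MeasurableSet E →
      ν E ^ (1 / r'.toReal) = mixedNorm (dualNorm M.vol Y.ext.N) r' E F := fun E hE => by
    rw [hν, withDensity_apply _ hE, mixedNorm, eLpNorm_eq_lintegral_rpow_enorm_toReal hr0 hrt]
    simp only [enorm_eq_self, hb]
  rcases eq_or_ne (mixedNorm (dualNorm M.vol Y.ext.N) r' univ F) ⊤ with htop | htop
  · rw [htop, ENNReal.mul_top (by simp)]
    exact le_top
  have hfin : IsFiniteMeasure ν := ⟨by
    rw [lt_top_iff_ne_top]
    intro h
    rw [← hνE univ MeasurableSet.univ, h, ENNReal.top_rpow_of_pos (by positivity)] at htop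
    exact htop rfl⟩
  have hnull : NullSingletonClass ν :=
    ⟨fun x => withDensity_absolutelyContinuous _ _ (measure_singleton x)⟩
  have hsol : ∀ E : Set ℝ, ∃ v : M.H1 B, M.incl B v = -∫ s in E, opS w.D s (F s) :=
    w.exists_incl_eq_neg_setIntegral hF hF0
  refine (hC' (N := fun f : M.L2 => X.ext.N f) X.ext.norm_eq_zero_iff X.ext.norm_add_le
    X.ext.lowerSemicontinuous_norm ν (fun t s => opS w.D (t - s) (F s))
    (w.integrable_opS_sub hF hF0) (fun E _ => ?_) (CX * CY) fun E hE => ?_).trans ?_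
  · obtain ⟨v, hv⟩ := hsol E
    simp_rw [← w.sol_eq_setIntegral hF hF0 hv]
    exact w.continuous_sol_u _ _
  · obtain ⟨v, hv⟩ := hsol E
    simp_rw [← w.sol_eq_setIntegral hF hF0 hv]
    have h1 := hCX (w.sol v (∫ s in E, opC w.D s (F s)))
    rw [mixedNorm, Measure.restrict_univ, w.sol_u_zero, w.sol_ut_zero, hv] at h1
    refine h1.trans ?_
    rw [hνE E hE, mul_assoc]
    exact mul_le_mul_right (hCY T F hF hF0 E) _
  · rw [hνE univ MeasurableSet.univ, ← mul_assoc]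
    push_cast
    gcongr
    exact le_self_add

theorem setIntegral_Iic_indicator_Ioc (w : WaveBase M B) (F : ℝ → M.L2) {t T : ℝ} (ht : 0 ≤ t)
    (htT : t ≤ T) :
    ∫ s in Iic t, opS w.D (t - s) ((Ioc 0 T).indicator F s) =
      ∫ s in (0 : ℝ)..t, opS w.D (t - s) (F s) := by
  have h1 : (fun s => opS w.D (t - s) ((Ioc 0 T).indicator F s)) =
      (Ioc 0 T).indicator fun s => opS w.D (t - s) (F s) := by
    funext s
    by_cases hs : s ∈ Ioc 0 T
    · rw [indicator_of_mem hs, indicator_of_mem hs]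
    · rw [indicator_of_notMem hs, indicator_of_notMem hs, map_zero]
  rw [h1, setIntegral_indicator measurableSet_Ioc, intervalIntegral.integral_of_le ht]
  congr 2
  ext s
  simp only [mem_inter_iff, mem_Iic, mem_Ioc]
  exact ⟨fun h => ⟨h.2.1, h.1⟩, fun h => ⟨h.2, h.1, h.2.trans htT⟩⟩

theorem mixedNorm_indicator_le {N : (Eu n → ℂ) → ℝ≥0∞} {p : ℝ≥0∞} (F : ℝ → M.L2) (T : ℝ) :
    mixedNorm (dualNorm M.vol N) p univ ((Ioc 0 T).indicator F) ≤
      mixedNorm (dualNorm M.vol N) p (Ici 0) F := by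
  have h1 : (fun t => dualNorm M.vol N ((Ioc 0 T).indicator F t : M.L2)) =
      (Ioc 0 T).indicator fun t => dualNorm M.vol N (F t) := by
    funext s
    by_cases hs : s ∈ Ioc 0 T
    · rw [indicator_of_mem hs, indicator_of_mem hs]
    · rw [indicator_of_notMem hs, indicator_of_notMem hs, FunSpace.dualNorm_zero]
  rw [mixedNorm, mixedNorm, Measure.restrict_univ, h1,
    eLpNorm_indicator_eq_eLpNorm_restrict measurableSet_Ioc]
  exact eLpNorm_mono_measure _ (Measure.restrict_mono (fun s hs => hs.1.le) le_rfl)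

/-- Duhamel's formula splits off the homogeneous solution, defined on all of ℝ. As F is only locally
integrable, it is truncated to (0, k], which does not change the Duhamel term on [0, k]; the bounds
are uniform in k, and monotone convergence concludes. -/
theorem GlobalStrichartz.inhomogeneous (hX : GlobalStrichartz B β X γ q)
    (hY : GlobalStrichartz B β Y (1 - γ) r)
    (hβ : M.IsCutoff β) (hn : 0 < n) (hγ₀ : 0 ≤ γ) (hγ₁ : γ ≤ 1) (hγ : γ < n / 2)
    (hγ' : 1 - γ < n / 2) (hr : r.HolderConjugate r') (hq : 1 ≤ q) (hqr : r' < q) :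
    ∃ C : ℝ≥0, ∀ F : ℝ → M.L2, LocallyIntegrableOn F (Ici 0) → ∀ s : Solution M B (Ici 0) F,
      mixedNorm X.ext.N q (Ici 0) s.u ≤
        C * (M.homSobB B β γ (s.u 0) + M.homSobB B β (γ - 1) (s.ut 0) +
          mixedNorm (dualNorm M.vol Y.ext.N) r' (Ici 0) F) := by
  obtain ⟨w⟩ : Nonempty (WaveBase M B) := inferInstance
  obtain ⟨C, hC⟩ := hX.exists_eLpNorm_setIntegral_Iic_le hY hβ hn hγ₀ hγ₁ hγ hγ' hr hq hqr w
  obtain ⟨CX, hCX⟩ := hX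
  refine ⟨CX + C, fun F hF s => ?_⟩
  obtain ⟨⟨v, hv⟩, hs⟩ := w.duhamel hF s
  have huc : ContinuousOn s.u (Ici 0) := fun t ht => (s.hasDeriv t ht).continuousWithinAt
  -- The extension by the initial value is continuous on ℝ and so has a measurable X-norm.
  set y : ℝ → M.L2 := fun t => s.u (max t 0) with hy
  have hyc : Continuous y := huc.comp_continuous (by fun_prop) fun t => le_max_right t 0
  have hys : ∀ t, 0 ≤ t → y t = s.u t := fun t ht => by rw [hy]; simp only [max_eq_left ht]
  set h := w.sol v (s.ut 0) with hh
  have hhc : Continuous h.u := w.continuous_sol_u _ _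
  have hhN : eLpNorm (fun t => X.ext.N (h.u t)) q volume ≤
      CX * (M.homSobB B β γ (s.u 0) + M.homSobB B β (γ - 1) (s.ut 0)) := by
    have := hCX h
    rwa [mixedNorm, Measure.restrict_univ, hh, w.sol_u_zero, w.sol_ut_zero, hv] at this
  have hyd : ∀ t, 0 ≤ t → y t = h.u t + ∫ r in (0 : ℝ)..t, opS w.D (t - r) (F r) := fun t ht => by
    rw [hys t ht, hs t ht, hh, w.sol_u, hv]
  have hym := X.ext.measurable_norm_comp hyc
  have hhm := X.ext.measurable_norm_comp hhc
  have hdm := X.ext.measurable_norm_comp (hyc.sub hhc)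
  calc mixedNorm X.ext.N q (Ici 0) s.u
      = eLpNorm (fun t => X.ext.N (y t)) q (volume.restrict (Ici 0)) := by
        refine eLpNorm_congr_ae ?_
        filter_upwards [ae_restrict_mem measurableSet_Ici] with t ht
        rw [hys t ht]
    _ ≤ (CX + C : ℝ≥0) * (M.homSobB B β γ (s.u 0) + M.homSobB B β (γ - 1) (s.ut 0) +
          mixedNorm (dualNorm M.vol Y.ext.N) r' (Ici 0) F) := by
      refine eLpNorm_le_of_monotone (one_pos.trans_le hq).ne'
        (f := fun k : ℕ => (Iic (k : ℝ)).indicator fun t => X.ext.N (y t))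
        (fun k => (hym.indicator measurableSet_Iic).aemeasurable)
        (fun t i j hij => indicator_le_indicator_of_subset
          (Iic_subset_Iic.2 (by exact_mod_cast hij)) (fun _ => zero_le) t)
        (fun t => ?_) fun k => ?_
      · obtain ⟨k, hk⟩ := exists_nat_ge t
        exact le_iSup_of_le (f := fun k : ℕ => (Iic (k : ℝ)).indicator (fun t => X.ext.N (y t)) t)
          k (indicator_of_mem (s := Iic (k : ℝ)) hk fun t => X.ext.N (y t)).ge
      · have hFk : Integrable ((Ioc 0 (k : ℝ)).indicator F) :=
          ((hF.integrableOn_compact_subset Icc_subset_Ici_self isCompact_Icc).mono_set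
            Ioc_subset_Icc_self).integrable_indicator measurableSet_Ioc
        have hCk := hC k _ hFk fun s hs => indicator_of_notMem hs F
        set d : ℝ → ℝ≥0∞ := (Icc 0 (k : ℝ)).indicator fun t => X.ext.N ((y - h.u) t : M.L2) with hd
        have hdC : eLpNorm d q volume ≤ C * mixedNorm (dualNorm M.vol Y.ext.N) r' (Ici 0) F := by
          refine (eLpNorm_mono_enorm fun t => ?_).trans
            (hCk.trans (mul_le_mul_right (mixedNorm_indicator_le F k) _))
          rw [enorm_eq_self, enorm_eq_self]
          by_cases ht : t ∈ Icc 0 (k : ℝ)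
          · rw [hd, indicator_of_mem ht, setIntegral_Iic_indicator_Ioc w F ht.1 ht.2, Pi.sub_apply,
              hyd t ht.1, add_sub_cancel_left]
          · rw [hd, indicator_of_notMem ht]
            exact zero_le
        calc eLpNorm ((Iic (k : ℝ)).indicator fun t => X.ext.N (y t)) q (volume.restrict (Ici 0))
            ≤ eLpNorm ((fun t => X.ext.N (h.u t)) + d) q (volume.restrict (Ici 0)) := by
              refine eLpNorm_mono_enorm_ae ?_
              filter_upwards [ae_restrict_mem measurableSet_Ici] with t ht
              rw [enorm_eq_self, enorm_eq_self, Pi.add_apply]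
              by_cases htk : t ∈ Iic (k : ℝ)
              · rw [indicator_of_mem htk, hd, indicator_of_mem (show t ∈ Icc 0 (k : ℝ) from ⟨ht, htk⟩),
                  ← add_sub_cancel (h.u t) (y t)]
                exact X.ext.norm_add_le _ _
              · rw [indicator_of_notMem htk]
                exact zero_le
          _ ≤ eLpNorm ((fun t => X.ext.N (h.u t)) + d) q volume :=
              eLpNorm_mono_measure _ Measure.restrict_le_self
          _ ≤ eLpNorm (fun t => X.ext.N (h.u t)) q volume + eLpNorm d q volume :=
              eLpNorm_add_le hhm.aemeasurable.aestronglyMeasurable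
                (hdm.indicator measurableSet_Icc).aemeasurable.aestronglyMeasurable hq
          _ ≤ _ := by
              refine (add_le_add hhN hdC).trans ?_
              rw [ENNReal.coe_add, mul_add (CX + C : ℝ≥0∞)]
              exact add_le_add (mul_le_mul' le_self_add le_rfl) (mul_le_mul' le_add_self le_rfl)

end Inhomogeneous

end AbstractStrichartz

end

theorem corollary1p4 {n : ℕ} (hn : 2 ≤ n) (M : AbstractStrichartz.Exterior n)
    (B : AbstractStrichartz.BC) (hB : AbstractStrichartz.HypothesisB M B)
    (β : AbstractStrichartz.Eu n → ℝ) (hβ : M.IsCutoff β)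
    (X Y : AbstractStrichartz.SpacePair M) (γ : ℝ) (q r r' : ℝ≥0∞)
    (hγ₀ : 0 ≤ γ) (hγ₁ : γ ≤ 1) (hγ : γ < n / 2) (hγ' : 1 - γ < n / 2)
    (hr : r.HolderConjugate r') (hqr : r' < q)
    (hX : AbstractStrichartz.IsAdmissible B β X γ q)
    (hY : AbstractStrichartz.IsAdmissible B β Y (1 - γ) r)
    (hXglobal : AbstractStrichartz.GlobalStrichartz B β X γ q)
    (hYglobal : AbstractStrichartz.GlobalStrichartz B β Y (1 - γ) r) :
    ∃ C : ℝ≥0, ∀ F : ℝ → M.L2, LocallyIntegrableOn F (Ici 0) →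
      ∀ w : AbstractStrichartz.Solution M B (Ici 0) F,
        AbstractStrichartz.mixedNorm X.ext.N q (Ici 0) w.u ≤
          C * (M.homSobB B β γ (w.u 0) + M.homSobB B β (γ - 1) (w.ut 0) +
            AbstractStrichartz.mixedNorm
              (AbstractStrichartz.dualNorm M.vol Y.ext.N) r' (Ici 0) F) :=
  hXglobal.inhomogeneous hYglobal hβ (by omega) hγ₀ hγ₁ hγ hγ' hr
    (one_le_two.trans hX.two_le) hqr
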